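/- **Setting.** Let $T$ be a finite tree embedded in a disk $D^2$ so that exactly its leaves (vertices of degree one) lie on the boundary, and assume that every other (*interior*) vertex has degree at least $3$. The embedding is considered up to isotopy, i.e. it is recorded by the clockwise cyclic order of the edges at each vertex. The components of $D^2\setminus T$ are the *faces* of $T$; a *corner* is a pair $(v,F)$ of an interior vertex $v$ and a face $F$ whose boundary contains $v$. A path in $T$ is identified with its reverse and is determined by its endpoints; $[v,w]$ is the path from $v$ to $w$. A *segment* is a path with at least two vertices, with interior endpoints, in which any two consecutive edges are incident to a common face; an *arc* is such a path whose endpoints are distinct leaves. Thus, walking along a segment or an arc, at each vertex other than its endpoints it turns either left (the common face of the two edges at that vertex is on the left) or right, and it *contains* the corresponding corner. $\mathrm{Seg}(T)$ is the set of segments. **Oriented flip graph.** An arc $p$ divides the faces into two *regions*; $\mathrm{Reg}(p,F)$ is the one containing the face $F$. Arcs $p,q$ are *crossing* if there is a segment all of whose vertices lie on both $p$ and $q$, and no region of one of them is contained in a region of the other; otherwise they are *noncrossing*. A *boundary arc* is an arc all of whose vertices lie on a common face. The elements of $\overrightarrow{FG}(T)$ are the maximal sets of pairwise noncrossing non-boundary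 arcs (the facets of the reduced noncrossing complex). For such a set $\mathcal F$, an arc $p\in\mathcal F$ is *marked* at a corner $(v,F)$ if it contains $(v,F)$ and $\mathrm{Reg}(q,F)\subseteq\mathrm{Reg}(p,F)$ for all $q\in\mathcal F$ containing $(v,F)$. There is an oriented edge $\mathcal F\to\mathcal F'$ if $\mathcal F'=(\mathcal F\setminus\{p\})\cup\{q\}$ with $p\in\mathcal F$, $q\notin\mathcal F$, and there are two distinct corners at which $p$ is marked in $\mathcal F$ such that $q$ is marked in $\mathcal F'$ at the corners immediately clockwise from them (about the same vertices). Write $\mathcal F\le\mathcal F'$ if there is a directed path from $\mathcal F$ to $\mathcal F'$. **Biclosed sets.** If two paths $s,t$ share exactly one vertex, an endpoint of both, and their union is a path, this path is denoted $s\circ t$. A set $X\subseteq\mathrm{Seg}(T)$ is *closed* if $s,t\in X$ and $s\circ t\in\mathrm{Seg}(T)$ imply $s\circ t\in X$; $\overline X$ is the smallest closed set containing $X$; and $X$ is *biclosed* if $X$ and $\mathrm{Seg}(T)\setminus X$ are closed. $\mathrm{Bic}(T)$ is the set of biclosed sets, ordered by inclusion. For a segment or an arc $p=(v_0,\dots,v_l)$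 let $C_p$ be the set of segments $(v_i,\dots,v_j)$, $i<j$, such that $p$ (walked from $v_0$ to $v_l$) turns right at $v_i$ if $i>0$ and turns left at $v_j$ if $j<l$. For $X\in\mathrm{Bic}(T)$ put $\pi_\downarrow(X)=\{s\in X: C_s\subseteq X\}$, and write $X\equiv Y \bmod \Theta$ if $\pi_\downarrow(X)=\pi_\downarrow(Y)$. **The maps.** For $X\in\mathrm{Bic}(T)$ and a corner $(v,F)$ let $p_{(v,F)}$ be the arc containing $(v,F)$ such that for every interior vertex $u\ne v$ of the arc, the arc walked from $v$ towards $u$ turns left at $u$ if and only if $[v,u]\in X$. Let $\eta(X)$ be the set of the non-boundary arcs among the $p_{(v,F)}$, where $(v,F)$ runs over all corners. For $\mathcal F\in\overrightarrow{FG}(T)$ let $\phi(\mathcal F)=\overline{\bigcup_{p\in\mathcal F}C_p}$. **Lattice notions.** For elements $x\lessdot y$ of a finite lattice $L$ let $\mathrm{con}(x,y)$ be the finest lattice congruence identifying $x$ and $y$. $L$ is *congruence-uniform* if $j\mapsto\mathrm{con}(j_*,j)$ ($j_*$ the unique element covered by $j$) is a bijection from the join-irreducible elements of $L$ to the join-irreducible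 congruences of $L$, and $m\mapsto\mathrm{con}(m,m^*)$ ($m^*$ the unique element covering $m$) is a bijection from the meet-irreducible elements of $L$ to the join-irreducible congruences. An interval $[x,y]$ is a *polygon* if it is the union of two maximal chains of $[x,y]$ that meet only in $x$ and $y$. $L$ is *polygonal* if $[x,y\vee z]$ is a polygon whenever $y\neq z$ cover $x$, and $[y\wedge z,x]$ is a polygon whenever $y\ne z$ are covered by $x$. A *lattice map* is a map preserving binary joins and meets. **Theorem.** For every $X\in\mathrm{Bic}(T)$ and every corner $(v,F)$ the arc $p_{(v,F)}$ exists and is unique. $\mathrm{Bic}(T)$ is a lattice; $\overrightarrow{FG}(T)$ with $\le$ is a lattice whose covering relations are exactly the oriented edges $\mathcal F\to\mathcal F'$; and $\Theta$ is a lattice congruence on $\mathrm{Bic}(T)$. Moreover: 1. $\eta$ is a well-defined surjective lattice map $\mathrm{Bic}(T)\to\overrightarrow{FG}(T)$, and $\eta(X)=\eta(Y)$ if and only if $X\equiv Y\bmod\Theta$. 2. $\phi$ is a well-defined injective lattice map $\overrightarrow{FG}(T)\to\mathrm{Bic}(T)$ whose image is $\pi_\downarrow(\mathrm{Bic}(T))=\{\pi_\downarrow(X):X\in\mathrm{Bic}(T)\}$.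 3. $\mathrm{Bic}(T)$ and $\overrightarrow{FG}(T)$ are congruence-uniform and polygonal lattices. -/

import Mathlib

/-! ### Lattice notions: lattice congruences, congruence-uniformity, polygonality -/

/-- Lattice congruences ordered by refinement: `θ ≤ θ'` means that every pair identified by `θ`
is identified by `θ'`. -/
instance LatticeCon.instPartialOrderRefinement {L : Type*} [Lattice L] :
    PartialOrder (LatticeCon L) :=
  PartialOrder.lift (fun θ : LatticeCon L => θ.toSetoid) (by
    rintro ⟨s, _, _⟩ ⟨t, _, _⟩ h
    cases h
    rfl)

/-- The most refined lattice congruence identifying all pairs related by `R`. -/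
def LatticeCon.generate {L : Type*} [Lattice L] (R : L → L → Prop) : LatticeCon L where
  r x y := ∀ θ : LatticeCon L, (∀ a b, R a b → θ.r a b) → θ.r x y
  iseqv :=
    { refl := fun x θ _ => θ.iseqv.refl x
      symm := fun h θ hθ => θ.iseqv.symm (h θ hθ)
      trans := fun h h' θ hθ => θ.iseqv.trans (h θ hθ) (h' θ hθ) }
  inf := fun h h' θ hθ => θ.inf (h θ hθ) (h' θ hθ)
  sup := fun h h' θ hθ => θ.sup (h θ hθ) (h' θ hθ)

/-- Join-irreducibility of a lattice congruence in the lattice of all congruences (the join of two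
congruences being their least upper bound with respect to refinement). -/
def LatticeCon.IsJoinIrreducible {L : Type*} [Lattice L] (θ : LatticeCon L) : Prop :=
  ¬ IsMin θ ∧ ∀ α β : LatticeCon L, IsLUB {α, β} θ → α = θ ∨ β = θ

/-- A (finite) lattice is congruence-uniform if `j ↦ con(j_*, j)` is a bijection from the
join-irreducible elements of `L` to the join-irreducible congruences, and `m ↦ con(m, m^*)` is a
bijection from the meet-irreducible elements of `L` to the join-irreducible congruences.
Here `j_*` is the only element covered by `j`, and `m^*` is the only element covering `m`. -/
def IsCongruenceUniform (L : Type*) [Lattice L] : Prop :=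
  Set.BijOn (fun j : L => LatticeCon.generate (fun a b => a ⋖ b ∧ b = j))
      {j | SupIrred j} {θ : LatticeCon L | θ.IsJoinIrreducible} ∧
  Set.BijOn (fun m : L => LatticeCon.generate (fun a b => a ⋖ b ∧ a = m))
      {m | InfIrred m} {θ : LatticeCon L | θ.IsJoinIrreducible}

/-- `C` is a maximal chain of the interval `[x, y]`. -/
def IsMaxChainIcc {L : Type*} [Lattice L] (x y : L) (C : Set L) : Prop :=
  Maximal (fun S : Set L => S ⊆ Set.Icc x y ∧ IsChain (· ≤ ·) S) C

/-- The interval `[x, y]` is a polygon: it is the union of two maximal chains that meet only in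
`x` and `y`. -/
def IsPolygon {L : Type*} [Lattice L] (x y : L) : Prop :=
  ∃ C D : Set L, IsMaxChainIcc x y C ∧ IsMaxChainIcc x y D ∧
    C ∪ D = Set.Icc x y ∧ C ∩ D = {x, y}

/-- A (finite) lattice is polygonal if `[x, y ⊔ z]` is a polygon for all distinct `y`, `z`
covering `x`, and `[y ⊓ z, x]` is a polygon for all distinct `y`, `z` covered by `x`. -/
def IsPolygonal (L : Type*) [Lattice L] : Prop :=
  (∀ x y z : L, x ⋖ y → x ⋖ z → y ≠ z → IsPolygon x (y ⊔ z)) ∧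
  (∀ x y z : L, y ⋖ x → z ⋖ x → y ≠ z → IsPolygon (y ⊓ z) x)

/-! ### Trees embedded in a disk -/

/-- A tree embedded in a disk so that exactly its leaves lie on the boundary, up to isotopy: a tree
together with the clockwise cyclic order of the neighbours of each vertex (`cw v a` is the
neighbour of `v` that comes next after `a` in clockwise order; `cw v` is a single cycle). Every
vertex that is not a leaf has degree at least three. -/
structure PlaneTree (V : Type*) where
  graph : SimpleGraph V
  isTree : graph.IsTree
  cw : ∀ v : V, Equiv.Perm (graph.neighborSet v)
  cw_cyclic : ∀ (v : V) (a b : graph.neighborSet v), (cw v).SameCycle a b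
  three_le : ∀ v : V, (graph.neighborSet v).ncard ≠ 1 → 3 ≤ (graph.neighborSet v).ncard

namespace PlaneTree

/-- A leaf is a vertex of degree one. -/
def IsLeaf {V : Type*} (T : PlaneTree V) (v : V) : Prop :=
  (T.graph.neighborSet v).ncard = 1

/-- Walking from `x` to `u` and on to `y`, one turns left at `u`: the edge to `y` is the one right
after the edge to `x` in clockwise order around `u`, so that the corner between the two edges is on
the left-hand side. -/
def LeftTurn {V : Type*} (T : PlaneTree V) (x u y : V) : Prop :=
  ∃ h : T.graph.Adj u x, ((T.cw u ⟨x, h⟩ : T.graph.neighborSet u) : V) = y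

/-- Walking from `x` to `u` and on to `y`, one turns right at `u`, i.e. one turns left when the
path is walked backwards. -/
def RightTurn {V : Type*} (T : PlaneTree V) (x u y : V) : Prop :=
  T.LeftTurn y u x

/-- A face is represented by the sides of edges on its boundary: the dart `x → u` stands for
the left-hand side of the edge `xu` walked from `x` to `u`. The left-hand sides of `x → u` and
`u → y` belong to the same face if one turns left at the interior vertex `u`. (Nothing is glued
at a leaf, as a leaf lies on the boundary of the disk.) -/
def Face {V : Type*} (T : PlaneTree V) : Type _ :=
  Quot (fun d e : T.graph.Dart =>
    d.snd = e.fst ∧ ¬ T.IsLeaf d.snd ∧ T.LeftTurn d.fst d.snd e.snd)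

/-- The face to the left of a dart. -/
def leftFace {V : Type*} (T : PlaneTree V) (d : T.graph.Dart) : T.Face :=
  Quot.mk _ d

/-- The vertex `v` lies on (the boundary of) the face `F`. -/
def OnFace {V : Type*} (T : PlaneTree V) (v : V) (F : T.Face) : Prop :=
  ∃ d : T.graph.Dart, (d.fst = v ∨ d.snd = v) ∧ T.leftFace d = F

/-- A corner of the tree at an interior vertex `apex`: the angular sector between the neighbour
`side` and the neighbour following it in clockwise order. -/
structure Corner {V : Type*} (T : PlaneTree V) where
  apex : V
  side : V
  interior : ¬ T.IsLeaf apex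
  adj : T.graph.Adj apex side

/-- The neighbour of the apex bounding the corner on its clockwise side. -/
def Corner.other {V : Type*} {T : PlaneTree V} (c : T.Corner) : V :=
  ((T.cw c.apex ⟨c.side, c.adj⟩ : T.graph.neighborSet c.apex) : V)

/-- The face `F` of a corner `(v, F)`. -/
def Corner.face {V : Type*} {T : PlaneTree V} (c : T.Corner) : T.Face :=
  T.leftFace ⟨(c.side, c.apex), c.adj.symm⟩

/-- The corner immediately clockwise from a given corner. -/
def Corner.next {V : Type*} {T : PlaneTree V} (c : T.Corner) : T.Corner where
  apex := c.apex
  side := c.other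
  interior := c.interior
  adj := (T.cw c.apex ⟨c.side, c.adj⟩).2

/-! ### Acyclic paths, segments, arcs

A path is listed as a sequence of vertices; reversing the list gives the same path, and a path is
identified with its set of vertices. -/

/-- The vertex set of a list. -/
def vset {V : Type*} (l : List V) : Set V := {x | x ∈ l}

/-- `l` lists the successive vertices of an acyclic path of the tree. (In a tree such a path
automatically has no chords.) -/
def IsPath {V : Type*} (T : PlaneTree V) (l : List V) : Prop :=
  l.IsChain T.graph.Adj ∧ l.Nodup

/-- Any two successive edges of `l` are incident to a common face, i.e. they are neighbours in the
cyclic order around their common vertex. -/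
def IsTight {V : Type*} (T : PlaneTree V) (l : List V) : Prop :=
  ∀ x u y : V, [x, u, y] <:+: l → T.LeftTurn x u y ∨ T.RightTurn x u y

/-- The path `l`, walked in the order of the list, turns left at its vertex `u`. -/
def TurnsLeft {V : Type*} (T : PlaneTree V) (l : List V) (u : V) : Prop :=
  ∃ x y : V, [x, u, y] <:+: l ∧ T.LeftTurn x u y

/-- The path `l`, walked in the order of the list, turns right at its vertex `u`. -/
def TurnsRight {V : Type*} (T : PlaneTree V) (l : List V) (u : V) : Prop :=
  ∃ x y : V, [x, u, y] <:+: l ∧ T.RightTurn x u y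

/-- The set `Seg(T)` of segments: acyclic paths with at least two vertices whose endpoints are not
leaves and any two successive edges of which are incident to a common face. -/
def Seg {V : Type*} (T : PlaneTree V) : Set (Set V) :=
  {s | ∃ (u : V) (m : List V) (w : V), T.IsPath (u :: (m ++ [w])) ∧ T.IsTight (u :: (m ++ [w])) ∧
    ¬ T.IsLeaf u ∧ ¬ T.IsLeaf w ∧ s = vset (u :: (m ++ [w]))}

/-- Arcs: acyclic paths whose endpoints are distinct leaves and any two successive edges of which
are incident to a common face. -/
def IsArc {V : Type*} (T : PlaneTree V) (p : Set V) : Prop :=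
  ∃ (u : V) (m : List V) (w : V), T.IsPath (u :: (m ++ [w])) ∧ T.IsTight (u :: (m ++ [w])) ∧
    T.IsLeaf u ∧ T.IsLeaf w ∧ p = vset (u :: (m ++ [w]))

/-- A boundary arc: an arc all of whose vertices lie on a common face. -/
def IsBoundaryArc {V : Type*} (T : PlaneTree V) (p : Set V) : Prop :=
  T.IsArc p ∧ ∃ F : T.Face, ∀ v ∈ p, T.OnFace v F

/-- The path `p` traverses the corner `c`. -/
def ContainsCorner {V : Type*} (T : PlaneTree V) (p : Set V) (c : T.Corner) : Prop :=
  ∃ l : List V, T.IsPath l ∧ vset l = p ∧ [c.side, c.apex, c.other] <:+: l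

/-! ### Regions, the noncrossing complex, the oriented flip graph -/

/-- `Reg(p, F)`: the faces that can be reached from `F` by crossing edges of the tree that are not
edges of the path `p`, i.e. the faces in the same component of the complement of `p` as `F`. -/
def Reg {V : Type*} (T : PlaneTree V) (p : Set V) (F : T.Face) : Set T.Face :=
  {G | Relation.ReflTransGen (fun A B : T.Face => ∃ d : T.graph.Dart,
    ¬ (d.fst ∈ p ∧ d.snd ∈ p) ∧ A = T.leftFace d ∧ B = T.leftFace d.symm) F G}

/-- The arcs `p` and `q` cross: they share all vertices of some segment, and no region of one of
them is contained in a region of the other. -/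
def Crossing {V : Type*} (T : PlaneTree V) (p q : Set V) : Prop :=
  (∃ s ∈ T.Seg, s ⊆ p ∧ s ⊆ q) ∧
  ∀ F G : T.Face, ¬ T.Reg p F ⊆ T.Reg q G ∧ ¬ T.Reg q G ⊆ T.Reg p F

/-- The faces of the reduced noncrossing complex: sets of pairwise noncrossing arcs that contain no
boundary arc. -/
def IsReducedFace {V : Type*} (T : PlaneTree V) (A : Set (Set V)) : Prop :=
  (∀ p ∈ A, T.IsArc p ∧ ¬ T.IsBoundaryArc p) ∧ A.Pairwise (fun p q => ¬ T.Crossing p q)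

/-- The vertices of the flip graph: the facets of the reduced noncrossing complex. -/
def FG {V : Type*} (T : PlaneTree V) : Type _ :=
  {A : Set (Set V) // Maximal T.IsReducedFace A}

/-- The arc `p` of `A` is marked at the corner `c = (v, F)`: it is the largest arc of `A` containing
`c`, where arcs containing `c` are compared by inclusion of the regions `Reg(·, F)`. -/
def IsMarked {V : Type*} (T : PlaneTree V) (A : Set (Set V)) (p : Set V) (c : T.Corner) : Prop :=
  p ∈ A ∧ T.ContainsCorner p c ∧
    ∀ q ∈ A, T.ContainsCorner q c → T.Reg q c.face ⊆ T.Reg p c.face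

/-- The oriented edges `A → B` of the oriented flip graph: `B` arises from `A` by replacing one arc
`p` by another arc `q`, and there are two distinct corners at which `p` is marked in `A` such that
`q` is marked in `B` at the corners immediately clockwise from these two. -/
def Flip {V : Type*} (T : PlaneTree V) (A B : T.FG) : Prop :=
  ∃ p q : Set V, p ∈ A.1 ∧ q ∉ A.1 ∧ B.1 = (A.1 \ {p}) ∪ {q} ∧
    ∃ c d : T.Corner, c ≠ d ∧ T.IsMarked A.1 p c ∧ T.IsMarked A.1 p d ∧
      T.IsMarked B.1 q c.next ∧ T.IsMarked B.1 q d.next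

/-! ### Biclosed sets of segments and the maps between them and the oriented flip graph -/

/-- `r = s ∘ t`: the path `r` is the concatenation of the paths `s` and `t`, which share exactly
one vertex, an endpoint of both. -/
def IsComp {V : Type*} (T : PlaneTree V) (s t r : Set V) : Prop :=
  ∃ (a : List V) (v : V) (b : List V), T.IsPath (a ++ v :: b) ∧
    s = vset (a ++ [v]) ∧ t = vset (v :: b) ∧ r = vset (a ++ v :: b)

/-- A set of segments is closed if it contains `s ∘ t` whenever it contains `s` and `t` and `s ∘ t`
is a segment. -/
def IsClosedSet {V : Type*} (T : PlaneTree V) (X : Set (Set V)) : Prop :=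
  X ⊆ T.Seg ∧ ∀ s ∈ X, ∀ t ∈ X, ∀ r ∈ T.Seg, T.IsComp s t r → r ∈ X

/-- The smallest closed set of segments containing `X`. -/
def closureSet {V : Type*} (T : PlaneTree V) (X : Set (Set V)) : Set (Set V) :=
  ⋂₀ {Y | T.IsClosedSet Y ∧ X ⊆ Y}

/-- Biclosed sets of segments: both the set and its complement in `Seg(T)` are closed. -/
def Bic {V : Type*} (T : PlaneTree V) : Type _ :=
  {X : Set (Set V) // T.IsClosedSet X ∧ T.IsClosedSet (T.Seg \ X)}

/-- The set `C_p`, for a segment or an arc `p = (v_0, …, v_l)`: the segments `(v_i, …, v_j)`,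
`i < j`, such that `p` turns right at `v_i` unless `i = 0`, and turns left at `v_j` unless `j = l`.
(If `p` is an arc, then `v_0` and `v_l` are leaves, so only `0 < i` and `j < l` occur.) -/
def CSet {V : Type*} (T : PlaneTree V) (p : Set V) : Set (Set V) :=
  {t | t ∈ T.Seg ∧ ∃ (a : List V) (u : V) (m : List V) (w : V) (b : List V),
    T.IsPath (a ++ (u :: (m ++ [w])) ++ b) ∧ p = vset (a ++ (u :: (m ++ [w])) ++ b) ∧
    t = vset (u :: (m ++ [w])) ∧
    (a ≠ [] → T.TurnsRight (a ++ (u :: (m ++ [w])) ++ b) u) ∧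
    (b ≠ [] → T.TurnsLeft (a ++ (u :: (m ++ [w])) ++ b) w)}

/-- The map `π_↓`, sending `X` to the set of all `s ∈ X` with `C_s ⊆ X`. -/
def piDown {V : Type*} (T : PlaneTree V) (X : Set (Set V)) : Set (Set V) :=
  {s | s ∈ X ∧ T.CSet s ⊆ X}

/-- The condition characterising the arc `p_{(v,F)}` attached to a set `X` of segments and a corner
`c = (v, F)`: the arc `p` contains `c`, and for each interior vertex `u ≠ v` of `p`, walking along
`p` from `v` to `u`, it turns left at `u` if and only if `[v, u] ∈ X`. -/
def IsEtaArc {V : Type*} (T : PlaneTree V) (X : Set (Set V)) (c : T.Corner) (p : Set V) : Prop :=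
  T.IsArc p ∧ T.ContainsCorner p c ∧
    ∀ (a m b : List V) (u : V), T.IsPath (a ++ (c.apex :: (m ++ [u])) ++ b) →
      p = vset (a ++ (c.apex :: (m ++ [u])) ++ b) → ¬ T.IsLeaf u →
      (T.TurnsLeft (a ++ (c.apex :: (m ++ [u])) ++ b) u ↔ vset (c.apex :: (m ++ [u])) ∈ X)

/-- The value `η(X)`: the set of all arcs `p_{(v,F)}`, where boundary arcs are left out, as they are
not vertices of the reduced noncrossing complex. -/
def etaSet {V : Type*} (T : PlaneTree V) (X : Set (Set V)) : Set (Set V) :=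
  {p | ¬ T.IsBoundaryArc p ∧ ∃ c : T.Corner, T.IsEtaArc X c p}

/-- The value `φ(A)`: the closure of the union of the sets `C_p`, `p ∈ A`. -/
def phiSet {V : Type*} (T : PlaneTree V) (A : Set (Set V)) : Set (Set V) :=
  T.closureSet (⋃ p ∈ A, T.CSet p)

end PlaneTree

/-! Fix a path in the tree. A biclosed set X induces a total order on its vertices: for i < j, the
vertex v_i comes before v_j exactly if [v_i, v_j] is not in X. Closedness and coclosedness of X are
what makes this relation transitive (`Before.trans`). In these terms the arc attached to a corner at
v turns left at the vertices before v and right at those after v. It is therefore built greedily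
from the corner and is unique.

Write K_p for the set C_p formed in the mirror image, where left and right are exchanged. A
non-boundary arc p belongs to η(X) if and only if C_p ⊆ X and K_p ∩ X = ∅, that is, if all left
turns of p precede all its right turns (`mem_etaSet_iff`, `fits_iff`). This description, free of
corners and symmetric under complementation combined with mirroring, drives the whole argument.

Bic(T): the closure of a coclosed set is coclosed (`isCoclosed_closureSet`), so closures of unions
are joins, and complementation supplies meets. Each cover inserts one segment s. It is labelled by s
and by the choice, at each subdivision of s, of the part that is already present. For each label
there is a congruence remembering it (`shapeCon`) and a least biclosed set realising it
(`shapeJoinIrr`), whence congruence-uniformity. If two covers of X insert s and t, their join adds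
at most s, t and s ∘ t, whence polygonality.

Θ: a segment s lies in π_↓(X) exactly if the biclosed set C_s lies below X, so π_↓ respects meets.
The mirror projection of the complement is determined by π_↓(X) (`notMem_piDown_mirror_iff`), so
joins are respected as well.

The flip graph: two arcs cross exactly if C of one meets K of the other (`crossing_of_mem`,
`Crossing.exists_mem`). Geometrically, the arcs leave their common stretch on opposite sides at its
two ends. Hence η(X) is noncrossing, and conversely each arc of a noncrossing set A fits φ(A).
Together with φ(η(X)) = π_↓(X) and its mirror image this makes η(X) maximal and η ∘ φ the identity.
The facets thus form the quotient of Bic(T) by Θ, realised inside Bic(T) as the image of π_↓, and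
both lattice properties pass to quotients.

Flips: the arc of η(X) marked at a corner is the one attached to it (`isMarked_etaSet_iff`).
Inserting a segment s swaps two neighbours in the order of a path. In a cover of facets the only arc
with s in K_p is lost, the only arc with s in C_q is gained, and the marked corners at the ends of s
move one step clockwise. Conversely, a flip increases the facet, and two consecutive flips cannot
combine to a single one because their corners do not match. -/

namespace LatticeCon

/-! ### Joins, duals, images and inverse images of lattice congruences. -/

variable {L : Type*} [Lattice L]

theorem le_iff {α β : LatticeCon L} : α ≤ β ↔ ∀ x y, α.r x y → β.r x y :=
  ⟨fun h _ _ hxy => h hxy, fun h _ _ hxy => h _ _ hxy⟩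

theorem generate_le_iff {R : L → L → Prop} {θ : LatticeCon L} :
    generate R ≤ θ ↔ ∀ a b, R a b → θ.r a b :=
  ⟨fun h a b hab => le_iff.1 h a b fun _ hθ => hθ a b hab,
    fun h => le_iff.2 fun _ _ hxy => hxy θ h⟩

/-- The least congruence above a set of congruences. -/
def supSet (S : Set (LatticeCon L)) : LatticeCon L :=
  generate fun a b => ∃ α ∈ S, α.r a b

theorem isLUB_supSet (S : Set (LatticeCon L)) : IsLUB S (supSet S) := by
  constructor
  · intro α hα
    exact le_iff.2 fun x y hxy θ hθ => hθ x y ⟨α, hα, hxy⟩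
  · intro β hβ
    exact generate_le_iff.2 fun a b ⟨α, hα, hab⟩ => le_iff.1 (hβ hα) a b hab

/-- Reachability through two congruences is a congruence. -/
def union (α β : LatticeCon L) : LatticeCon L where
  r := Relation.ReflTransGen fun x y => α.r x y ∨ β.r x y
  iseqv :=
    { refl := fun _ => Relation.ReflTransGen.refl
      symm := fun h => by
        have : Std.Symm fun x y => α.r x y ∨ β.r x y :=
          ⟨fun x y h => h.imp (fun k => α.iseqv.symm k) (fun k => β.iseqv.symm k)⟩
        exact Std.Symm.symm _ _ h
      trans := fun h h' => h.trans h' }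
  inf := fun {w x y z} h h' => by
    have h1 := Relation.ReflTransGen.lift (r := fun x y => α.r x y ∨ β.r x y)
      (p := fun x y => α.r x y ∨ β.r x y) (fun t => t ⊓ y)
      (fun a b hab => Or.imp (fun k => α.inf k (α.iseqv.refl y))
        (fun k => β.inf k (β.iseqv.refl y)) hab) _ _ h
    have h2 := Relation.ReflTransGen.lift (r := fun x y => α.r x y ∨ β.r x y)
      (p := fun x y => α.r x y ∨ β.r x y) (fun t => x ⊓ t)
      (fun a b hab => Or.imp (fun k => α.inf (α.iseqv.refl x) k)
        (fun k => β.inf (β.iseqv.refl x) k) hab) _ _ h'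
    exact h1.trans h2
  sup := fun {w x y z} h h' => by
    have h1 := Relation.ReflTransGen.lift (r := fun x y => α.r x y ∨ β.r x y)
      (p := fun x y => α.r x y ∨ β.r x y) (fun t => t ⊔ y)
      (fun a b hab => Or.imp (fun k => α.sup k (α.iseqv.refl y))
        (fun k => β.sup k (β.iseqv.refl y)) hab) _ _ h
    have h2 := Relation.ReflTransGen.lift (r := fun x y => α.r x y ∨ β.r x y)
      (p := fun x y => α.r x y ∨ β.r x y) (fun t => x ⊔ t)
      (fun a b hab => Or.imp (fun k => α.sup (α.iseqv.refl x) k)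
        (fun k => β.sup (β.iseqv.refl x) k) hab) _ _ h'
    exact h1.trans h2

theorem left_le_union (α β : LatticeCon L) : α ≤ union α β :=
  le_iff.2 fun _ _ h => Relation.ReflTransGen.single (Or.inl h)

theorem right_le_union (α β : LatticeCon L) : β ≤ union α β :=
  le_iff.2 fun _ _ h => Relation.ReflTransGen.single (Or.inr h)

/-- A cover that is contracted by a join of two congruences is contracted by one of them. -/
theorem or_of_union {α β : LatticeCon L} {a j : L} (haj : a ⋖ j) (h : (union α β).r a j) :
    α.r a j ∨ β.r a j := by
  by_contra! hno
  -- The polynomial x ↦ (x ⊔ a) ⊓ j respects both congruences and takes only the values a and j. If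
  -- neither congruence identifies a with j, its value stays a along every chain of steps from a;
  -- but at x = j it is j.
  have key : ∀ x, (union α β).r a x → (x ⊔ a) ⊓ j = a := by
    intro x hx
    induction hx with
    | refl => simpa using haj.le
    | @tail b c _ hbc ih =>
      have hc : (c ⊔ a) ⊓ j = a ∨ (c ⊔ a) ⊓ j = j := by
        rcases haj.wcovBy.eq_or_eq (c := (c ⊔ a) ⊓ j) (le_inf le_sup_right haj.le) inf_le_right
          with h | h <;> simp [h]
      refine hc.resolve_right fun hc => ?_
      rcases hbc with hbc | hbc
      · have := α.inf (α.sup hbc (α.iseqv.refl a)) (α.iseqv.refl j)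
        rw [ih, hc] at this
        exact hno.1 this
      · have := β.inf (β.sup hbc (β.iseqv.refl a)) (β.iseqv.refl j)
        rw [ih, hc] at this
        exact hno.2 this
  have := key j h
  rw [sup_eq_left.2 haj.le, inf_idem] at this
  exact haj.ne this.symm

/-- Congruences of the dual lattice. -/
def ofDual (θ : LatticeCon Lᵒᵈ) : LatticeCon L where
  r x y := θ.r (OrderDual.toDual x) (OrderDual.toDual y)
  iseqv := ⟨fun _ => θ.iseqv.refl _, fun h => θ.iseqv.symm h, fun h h' => θ.iseqv.trans h h'⟩
  inf := fun h h' => θ.sup h h'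
  sup := fun h h' => θ.inf h h'

/-- Congruences, viewed in the dual lattice. -/
def toDual (θ : LatticeCon L) : LatticeCon Lᵒᵈ where
  r x y := θ.r (OrderDual.ofDual x) (OrderDual.ofDual y)
  iseqv := ⟨fun _ => θ.iseqv.refl _, fun h => θ.iseqv.symm h, fun h h' => θ.iseqv.trans h h'⟩
  inf := fun h h' => θ.sup h h'
  sup := fun h h' => θ.inf h h'

/-- The congruences of a lattice and its dual agree. -/
def dualIso : LatticeCon Lᵒᵈ ≃o LatticeCon L where
  toFun := ofDual
  invFun := toDual
  left_inv _ := rfl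
  right_inv _ := rfl
  map_rel_iff' := Iff.rfl

theorem isJoinIrreducible_map {M : Type*} [Lattice M] (e : LatticeCon L ≃o LatticeCon M)
    {θ : LatticeCon L} (h : θ.IsJoinIrreducible) : (e θ).IsJoinIrreducible := by
  refine ⟨fun hm => h.1 ?_, fun α β hl => ?_⟩
  · exact (e.isMin_apply).1 hm
  · have := h.2 (e.symm α) (e.symm β) (by
      have := (e.symm.isLUB_image' (s := {α, β}) (x := e θ)).2 hl
      simpa [Set.image_pair] using this)
    refine this.imp (fun h => ?_) (fun h => ?_) <;> rw [← h] <;> simp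

/-- The image of a congruence containing the kernel of a surjective homomorphism. -/
def push {M : Type*} [Lattice M] (f : LatticeHom L M) (hf : Function.Surjective f)
    (γ : LatticeCon L) (hγ : ∀ x y, f x = f y → γ.r x y) : LatticeCon M where
  r x y := ∃ a b, f a = x ∧ f b = y ∧ γ.r a b
  iseqv :=
    { refl := fun x => by
        obtain ⟨a, rfl⟩ := hf x
        exact ⟨a, a, rfl, rfl, γ.iseqv.refl a⟩
      symm := fun ⟨a, b, ha, hb, h⟩ => ⟨b, a, hb, ha, γ.iseqv.symm h⟩
      trans := fun ⟨a, b, ha, hb, h⟩ ⟨a', b', ha', hb', h'⟩ =>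
        ⟨a, b', ha, hb', γ.iseqv.trans h (γ.iseqv.trans (hγ b a' (hb.trans ha'.symm)) h')⟩ }
  inf := fun ⟨a, b, ha, hb, h⟩ ⟨a', b', ha', hb', h'⟩ =>
    ⟨a ⊓ a', b ⊓ b', by rw [map_inf, ha, ha'], by rw [map_inf, hb, hb'], γ.inf h h'⟩
  sup := fun ⟨a, b, ha, hb, h⟩ ⟨a', b', ha', hb', h'⟩ =>
    ⟨a ⊔ a', b ⊔ b', by rw [map_sup, ha, ha'], by rw [map_sup, hb, hb'], γ.sup h h'⟩

/-- The inverse image of a congruence. -/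
def pull {M : Type*} [Lattice M] (f : LatticeHom L M) (γ : LatticeCon M) : LatticeCon L where
  r x y := γ.r (f x) (f y)
  iseqv := ⟨fun x => γ.iseqv.refl _, fun h => γ.iseqv.symm h, fun h h' => γ.iseqv.trans h h'⟩
  inf := fun h h' => by simpa using γ.inf h h'
  sup := fun h h' => by simpa using γ.sup h h'

/-- The identity congruence. -/
def idCon : LatticeCon L where
  r x y := x = y
  iseqv := eq_equivalence
  inf := by rintro _ _ _ _ rfl rfl; rfl
  sup := by rintro _ _ _ _ rfl rfl; rfl

/-- The kernel of a lattice homomorphism. -/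
def kernel {M : Type*} [Lattice M] (f : LatticeHom L M) : LatticeCon L := pull f idCon

end LatticeCon

/-! ### Congruence-uniformity and polygonality of finite lattices, and their passage to quotients.
-/

section Finite

variable {L : Type*} [Lattice L]

/-- Distinct join-irreducible elements are separated by the congruences contracting them. -/
def SeparatesJoinIrreducibles (L : Type*) [Lattice L] : Prop :=
  ∀ j j' a a' : L, SupIrred j → SupIrred j' → a ⋖ j → a' ⋖ j' →
    (∀ θ : LatticeCon L, θ.r a j ↔ θ.r a' j') → j = j'

theorem SupIrred.le_of_lt [Finite L] {j a x : L} (hj : SupIrred j) (ha : a ⋖ j) (hx : x < j) :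
    x ≤ a := by
  rcases em (x ⊔ a = j) with h | h
  · rcases hj.2 h with h | h
    · exact absurd h hx.ne
    · exact absurd h ha.ne
  · rcases ha.wcovBy.eq_or_eq (c := x ⊔ a) le_sup_right (sup_le hx.le ha.le) with h' | h'
    · exact sup_eq_right.1 h'
    · exact absurd h' h

theorem exists_covBy_of_supIrred [Finite L] {j : L} (hj : SupIrred j) : ∃ a, a ⋖ j := by
  obtain ⟨b, hb⟩ := not_isMin_iff.1 hj.1
  obtain ⟨x, _, hx⟩ := exists_le_covBy_of_lt hb
  exact ⟨x, hx⟩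

theorem supIrred_of_le [Finite L] {j a : L} (ha : a < j) (h : ∀ x, x < j → x ≤ a) :
    SupIrred j := by
  refine ⟨fun hm => ha.not_ge (hm ha.le), fun b c hbc => ?_⟩
  by_contra! hno
  have hb : b < j := lt_of_le_of_ne (hbc ▸ le_sup_left) hno.1
  have hc : c < j := lt_of_le_of_ne (hbc ▸ le_sup_right) hno.2
  exact absurd (hbc ▸ sup_le (h b hb) (h c hc)) ha.not_ge

/-- A join-irreducible element covers only one element, so the generating relation consists of the
single pair (a, j). -/
theorem generate_supIrred [Finite L] {j a : L} (hj : SupIrred j) (ha : a ⋖ j)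
    {θ : LatticeCon L} :
    LatticeCon.generate (fun a b => a ⋖ b ∧ b = j) ≤ θ ↔ θ.r a j := by
  rw [LatticeCon.generate_le_iff]
  refine ⟨fun h => h a j ⟨ha, rfl⟩, ?_⟩
  rintro h a' b ⟨ha', rfl⟩
  have h1 := hj.le_of_lt ha ha'.lt
  have h2 := hj.le_of_lt ha' ha.lt
  rwa [le_antisymm h1 h2]

/-- A cover contracted by a congruence is perspective to a contracted join-irreducible. -/
theorem exists_supIrred_of_covBy [Finite L] {x z : L} (hxz : x ⋖ z) :
    ∃ j a, SupIrred j ∧ a ⋖ j ∧ ∀ θ : LatticeCon L, θ.r x z ↔ θ.r a j := by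
  -- A minimal element j below z but not below x is join-irreducible with lower cover x ⊓ j. Meeting
  -- with j and joining with x carry the covers x ⋖ z and x ⊓ j ⋖ j into each other, so the same
  -- congruences contract both.
  obtain ⟨j, hj⟩ := Set.Finite.exists_minimal (s := {j : L | j ≤ z ∧ ¬ j ≤ x}) (Set.toFinite _)
    ⟨z, le_rfl, hxz.lt.not_ge⟩
  have hlt : ∀ y, y < j → y ≤ x := fun y hy => by
    by_contra hyx
    exact hy.not_ge (hj.2 ⟨hy.le.trans hj.1.1, hyx⟩ hy.le)
  have hxj : x ⊓ j < j := lt_of_le_of_ne inf_le_right fun h => hj.1.2 (inf_eq_right.1 h)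
  have hirr : SupIrred j := supIrred_of_le hxj fun y hy => le_inf (hlt y hy) hy.le
  have hsup : x ⊔ j = z := by
    rcases hxz.wcovBy.eq_or_eq (c := x ⊔ j) le_sup_left (sup_le hxz.le hj.1.1) with h | h
    · exact absurd (sup_eq_left.1 h) hj.1.2
    · exact h
  refine ⟨j, x ⊓ j, hirr, ⟨hxj, fun y hy hyj => ?_⟩, fun θ => ⟨fun h => ?_, fun h => ?_⟩⟩
  · exact hy.not_ge (le_inf (hlt y hyj) hyj.le)
  · have := θ.inf h (θ.iseqv.refl j)
    rwa [inf_eq_right.2 hj.1.1] at this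
  · have := θ.sup (θ.iseqv.refl x) h
    rwa [sup_inf_self, hsup] at this

/-- Convexity of classes: joining with y and then meeting with z moves the identified pair to (y,
z). -/
theorem LatticeCon.r_of_le {θ : LatticeCon L} {x y z w : L} (h : θ.r x w) (hxy : x ≤ y)
    (hyz : y ≤ z) (hzw : z ≤ w) : θ.r y z := by
  have h1 := θ.sup h (θ.iseqv.refl y)
  rw [sup_eq_right.2 hxy, sup_eq_left.2 (hyz.trans hzw)] at h1
  have h2 := θ.inf h1 (θ.iseqv.refl z)
  rwa [inf_eq_left.2 hyz, inf_eq_right.2 hzw] at h2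

/-- A congruence of a finite lattice is determined by the covers it contracts: if x and y are
identified, convexity contracts every cover on a chain from x ⊓ y to x ⊔ y. -/
theorem LatticeCon.le_of_covBy [Finite L] {θ α : LatticeCon L}
    (h : ∀ x z : L, x ⋖ z → θ.r x z → α.r x z) : θ ≤ α := by
  have key : ∀ y x : L, x ≤ y → θ.r x y → α.r x y := by
    intro y x
    induction x using WellFoundedGT.induction with
    | ind x ih =>
      intro hxy hθ
      rcases hxy.eq_or_lt with rfl | hlt
      · exact α.iseqv.refl x
      obtain ⟨z, hxz, hzy⟩ := exists_covBy_le_of_lt hlt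
      exact α.iseqv.trans (h x z hxz (LatticeCon.r_of_le hθ le_rfl hxz.le hzy))
        (ih z hxz.lt hzy (LatticeCon.r_of_le hθ hxz.le hzy le_rfl))
  exact LatticeCon.le_iff.2 fun x y hxy =>
    (α.r_inf_sup_iff).1 (key _ _ inf_le_sup ((θ.r_inf_sup_iff).2 hxy))

/-- If α and β have this congruence as their join, then `union α β` contracts a ⋖ j. By
`or_of_union` one of them does so already, and it then contains the generated congruence. -/
theorem isJoinIrreducible_generate [Finite L] {j a : L} (hj : SupIrred j) (ha : a ⋖ j) :
    (LatticeCon.generate (fun a b => a ⋖ b ∧ b = j) : LatticeCon L).IsJoinIrreducible := by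
  constructor
  · intro hm
    have := (generate_supIrred hj ha).1 (hm (b := LatticeCon.idCon)
      (LatticeCon.le_iff.2 fun x y hxy => by cases hxy; exact Setoid.refl' _ _))
    exact ha.ne this
  · intro α β hl
    have h1 := hl.2 (show LatticeCon.union α β ∈ upperBounds {α, β} by
      rintro γ (rfl | rfl)
      · exact LatticeCon.left_le_union _ _
      · exact LatticeCon.right_le_union _ _)
    rcases LatticeCon.or_of_union ha ((generate_supIrred hj ha).1 h1) with h | h
    · exact Or.inl (le_antisymm (hl.1 (by simp)) ((generate_supIrred hj ha).2 h))
    · exact Or.inr (le_antisymm (hl.1 (by simp)) ((generate_supIrred hj ha).2 h))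

/-- Each cover contracted by θ is equivalent to one below a join-irreducible element, so θ is the
join of the congruences `con(j_*, j)` below it. Splitting off one member of this finite join at a
time, irreducibility of θ makes θ equal to some member; the empty join is excluded because it is
minimal. -/
theorem exists_generate_eq [Finite L] {θ : LatticeCon L} (hθ : θ.IsJoinIrreducible) :
    ∃ j : L, SupIrred j ∧ LatticeCon.generate (fun a b => a ⋖ b ∧ b = j) = θ := by
  by_contra! hno
  let con : L → LatticeCon L := fun j => LatticeCon.generate (fun a b => a ⋖ b ∧ b = j)
  have key : ∀ S : Set L, (∀ j ∈ S, SupIrred j) → LatticeCon.supSet (con '' S) ≠ θ := by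
    intro S
    induction S, Set.toFinite S using Set.Finite.induction_on with
    | empty =>
      intro _ h
      rw [← h] at hθ
      refine hθ.1 fun α _ => ?_
      exact (LatticeCon.isLUB_supSet _).2 (by simp)
    | @insert j S _ _ ih =>
      intro hS h
      rw [Set.image_insert_eq] at h
      have h1 := LatticeCon.isLUB_supSet (insert (con j) (con '' S))
      have h2 := LatticeCon.isLUB_supSet (con '' S)
      have h3 : IsLUB {con j, LatticeCon.supSet (con '' S)} θ := by
        rw [h] at h1
        refine ⟨?_, fun γ hγ => h1.2 ?_⟩
        · rintro γ (rfl | rfl)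
          · exact h1.1 (by simp)
          · exact h2.2 fun δ hδ => h1.1 (Set.mem_insert_of_mem _ hδ)
        · rintro δ (rfl | hδ)
          · exact hγ (by simp)
          · exact (h2.1 hδ).trans (hγ (by simp))
      rcases hθ.2 _ _ h3 with h4 | h4
      · exact hno j (hS j (by simp)) h4
      · exact ih (fun k hk => hS k (by simp [hk])) h4
  refine key {j | SupIrred j ∧ con j ≤ θ} (fun j hj => hj.1) (le_antisymm ?_ ?_)
  · refine (LatticeCon.isLUB_supSet _).2 ?_
    rintro _ ⟨j, hj, rfl⟩
    exact hj.2
  · refine LatticeCon.le_of_covBy fun x z hxz h => ?_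
    obtain ⟨j, a, hj, ha, hiff⟩ := exists_supIrred_of_covBy hxz
    rw [hiff]
    have h1 : con j ≤ θ := (generate_supIrred hj ha).2 ((hiff θ).1 h)
    have h2 := (LatticeCon.isLUB_supSet (con '' {j | SupIrred j ∧ con j ≤ θ})).1
      ⟨j, ⟨hj, h1⟩, rfl⟩
    exact (generate_supIrred hj ha).1 h2

theorem SeparatesJoinIrreducibles.bijOn [Finite L] (h : SeparatesJoinIrreducibles L) :
    Set.BijOn (fun j : L => LatticeCon.generate (fun a b => a ⋖ b ∧ b = j))
      {j | SupIrred j} {θ : LatticeCon L | θ.IsJoinIrreducible} := by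
  refine ⟨fun j hj => ?_, fun j hj j' hj' he => ?_, fun θ hθ => ?_⟩
  · obtain ⟨a, ha⟩ := exists_covBy_of_supIrred hj
    exact isJoinIrreducible_generate hj ha
  · obtain ⟨a, ha⟩ := exists_covBy_of_supIrred hj
    obtain ⟨a', ha'⟩ := exists_covBy_of_supIrred hj'
    refine h j j' a a' hj hj' ha ha' fun θ => ?_
    rw [← generate_supIrred hj ha, ← generate_supIrred hj' ha']
    exact iff_of_eq (congrArg (· ≤ θ) he)
  · obtain ⟨j, hj, h⟩ := exists_generate_eq hθ
    exact ⟨j, hj, h⟩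

/-- The half about meet-irreducible elements is the join half for the dual lattice, carried over by
`dualIso`. Covers are reversed there, which the symmetry of congruences absorbs. -/
theorem isCongruenceUniform_of_separates [Finite L] (h : SeparatesJoinIrreducibles L)
    (h' : SeparatesJoinIrreducibles Lᵒᵈ) : IsCongruenceUniform L := by
  refine ⟨h.bijOn, ?_⟩
  have hd := h'.bijOn
  have hgen : ∀ m : L, LatticeCon.dualIso
      (LatticeCon.generate (fun a b : Lᵒᵈ => a ⋖ b ∧ b = OrderDual.toDual m)) =
      LatticeCon.generate (fun a b : L => a ⋖ b ∧ a = m) := by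
    intro m
    refine le_antisymm ?_ ?_
    · rw [← OrderIso.le_symm_apply, LatticeCon.generate_le_iff]
      rintro a b ⟨hab, rfl⟩
      intro θ hθ
      exact θ.iseqv.symm (hθ _ (OrderDual.ofDual a) ⟨hab.ofDual, rfl⟩)
    · rw [LatticeCon.generate_le_iff]
      rintro a b ⟨hab, rfl⟩
      intro θ hθ
      exact θ.iseqv.symm (hθ (OrderDual.toDual b) (OrderDual.toDual a) ⟨hab.toDual, rfl⟩)
  refine ⟨fun m hm => ?_, fun m hm m' hm' he => ?_, fun θ hθ => ?_⟩
  · have := LatticeCon.isJoinIrreducible_map LatticeCon.dualIso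
      (hd.mapsTo (x := OrderDual.toDual m) (by simpa using hm))
    simpa [hgen] using this
  · refine OrderDual.toDual.injective (hd.injOn (by simpa using hm) (by simpa using hm') ?_)
    apply LatticeCon.dualIso.injective
    simpa [hgen] using he
  · obtain ⟨m, hm, h⟩ := hd.surjOn
      (LatticeCon.isJoinIrreducible_map (LatticeCon.dualIso (L := L)).symm hθ)
    refine ⟨OrderDual.ofDual m, by simpa using hm, ?_⟩
    dsimp only at h ⊢
    rw [← hgen, OrderDual.toDual_ofDual, h, OrderIso.apply_symm_apply]

/-- The fibres of a lattice homomorphism from a finite lattice have least elements. -/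
theorem exists_isLeast_fiber {M : Type*} [Lattice M] [Finite L] (f : LatticeHom L M)
    (hf : Function.Surjective f) (y : M) : ∃ x, IsLeast {x | f x = y} x := by
  obtain ⟨x, hx⟩ := Set.Finite.exists_minimal (Set.toFinite {x | f x = y}) (hf y)
  refine ⟨x, hx.1, fun z hz => ?_⟩
  have h : f (x ⊓ z) = y := by rw [map_inf, hx.1, hz, inf_idem]
  exact (hx.2 h inf_le_left).trans inf_le_right

/-- The cover below a join-irreducible m of the quotient lifts to the cover below the least preimage
of m. A congruence θ of L is tested downstairs through its join with the kernel. If that join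
contracts a lifted cover, then θ does, because the kernel does not. -/
theorem SeparatesJoinIrreducibles.map {M : Type*} [Lattice M] [Finite L]
    (h : SeparatesJoinIrreducibles L) (f : LatticeHom L M) (hf : Function.Surjective f) :
    SeparatesJoinIrreducibles M := by
  have : Finite M := Finite.of_surjective f hf
  have lift : ∀ m b : M, SupIrred m → b ⋖ m → ∃ j a : L, SupIrred j ∧ a ⋖ j ∧ f j = m ∧ f a = b := by
    intro m b hm hb
    obtain ⟨j, hj⟩ := exists_isLeast_fiber f hf m
    obtain ⟨a₀, ha₀⟩ := hf b
    have hfj : f j = m := hj.1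
    have hne : a₀ ⊓ j ≠ j := fun he => by
      have h1 : f (a₀ ⊓ j) = f j := by rw [he]
      rw [map_inf, ha₀, hfj, inf_eq_left.2 hb.le] at h1
      exact hb.ne h1
    have hlt : a₀ ⊓ j < j := lt_of_le_of_ne inf_le_right hne
    have hfx : ∀ x, x < j → f x ≤ b := fun x hx => by
      refine hm.le_of_lt hb (lt_of_le_of_ne ?_ fun he => ?_)
      · rw [← hfj]; exact OrderHomClass.mono f hx.le
      · exact hx.not_ge (hj.2 he)
    have hj' : SupIrred j := by
      refine ⟨fun hmin => hlt.not_ge (hmin hlt.le), fun x y hxy => ?_⟩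
      by_contra! hno
      have hx : x < j := lt_of_le_of_ne (hxy ▸ le_sup_left) hno.1
      have hy : y < j := lt_of_le_of_ne (hxy ▸ le_sup_right) hno.2
      have h1 := sup_le (hfx x hx) (hfx y hy)
      rw [← map_sup, hxy, hfj] at h1
      exact hb.lt.not_ge h1
    obtain ⟨a, ha⟩ := exists_covBy_of_supIrred hj'
    refine ⟨j, a, hj', ha, hfj, le_antisymm (hfx a ha.lt) ?_⟩
    have h1 := OrderHomClass.mono f (hj'.le_of_lt ha hlt)
    rwa [map_inf, ha₀, hfj, inf_eq_left.2 hb.le] at h1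
  intro m m' b b' hm hm' hb hb' hθ
  obtain ⟨j, a, hj, ha, rfl, rfl⟩ := lift m b hm hb
  obtain ⟨j', a', hj', ha', rfl, rfl⟩ := lift m' b' hm' hb'
  have half : ∀ (j j' a a' : L), a' ⋖ j' → f a' ≠ f j' →
      (∀ θ : LatticeCon M, θ.r (f a) (f j) → θ.r (f a') (f j')) →
      ∀ θ : LatticeCon L, θ.r a j → θ.r a' j' := by
    intro j j' a a' ha' hne hθ θ hr
    let γ := LatticeCon.union θ (LatticeCon.kernel f)
    have hγ : ∀ x y, f x = f y → γ.r x y := fun x y hxy =>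
      LatticeCon.le_iff.1 (LatticeCon.right_le_union θ (LatticeCon.kernel f)) x y hxy
    obtain ⟨u, w, hu, hw, huw⟩ := hθ (LatticeCon.push f hf γ hγ)
      ⟨a, j, rfl, rfl, LatticeCon.le_iff.1 (LatticeCon.left_le_union _ _) a j hr⟩
    have h1 : γ.r a' j' := γ.iseqv.trans (hγ _ _ hu.symm) (γ.iseqv.trans huw (hγ _ _ hw))
    exact (LatticeCon.or_of_union ha' h1).resolve_right hne
  rw [h j j' a a' hj hj' ha ha' fun θ => ⟨half j j' a a' ha' hb'.ne (fun θ => (hθ θ).1) θ,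
    half j' j a' a ha hb.ne (fun θ => (hθ θ).2) θ⟩]

/-- Upper polygonality in the form in which it is inherited by quotients. -/
def UpperPolygonal (L : Type*) [Lattice L] : Prop :=
  ∀ x y z : L, x ⋖ y → x ⋖ z → y ≠ z →
    (∀ w, x ≤ w → w ≤ y ⊔ z → w = x ∨ y ≤ w ∨ z ≤ w) ∧
    (∀ w w', w ≤ y ⊔ z → w' ≤ y ⊔ z → y ≤ w → y ≤ w' → ¬ z ≤ w → ¬ z ≤ w' → w ≤ w' ∨ w' ≤ w)

/-- The two sides are the elements above y but not z, and those above z but not y. By hypothesis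
both are chains, and nothing else lies strictly between x and y ⊔ z. -/
theorem isPolygon_of_upper {x y z : L} (hy : x ⋖ y) (hz : x ⋖ z) (hne : y ≠ z)
    (h1 : ∀ w, x ≤ w → w ≤ y ⊔ z → w = x ∨ y ≤ w ∨ z ≤ w)
    (h2 : ∀ w w', w ≤ y ⊔ z → w' ≤ y ⊔ z → y ≤ w → y ≤ w' → ¬ z ≤ w → ¬ z ≤ w' →
      w ≤ w' ∨ w' ≤ w)
    (h3 : ∀ w w', w ≤ y ⊔ z → w' ≤ y ⊔ z → z ≤ w → z ≤ w' → ¬ y ≤ w → ¬ y ≤ w' →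
      w ≤ w' ∨ w' ≤ w) : IsPolygon x (y ⊔ z) := by
  have hle : x ≤ y ⊔ z := hy.le.trans le_sup_left
  have hyz : ¬ y ≤ z := fun h => (hz.eq_or_eq hy.le h).elim hy.ne' hne
  have hzy : ¬ z ≤ y := fun h => (hy.eq_or_eq hz.le h).elim hz.ne' hne.symm
  have chain : ∀ y z : L, x ⋖ y → x ⋖ z → ¬ z ≤ y → (∀ w, x ≤ w → w ≤ y ⊔ z → w = x ∨ y ≤ w ∨ z ≤ w) →
      (∀ w w', w ≤ y ⊔ z → w' ≤ y ⊔ z → y ≤ w → y ≤ w' → ¬ z ≤ w → ¬ z ≤ w' →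
      w ≤ w' ∨ w' ≤ w) →
      IsMaxChainIcc x (y ⊔ z) ({x, y ⊔ z} ∪ {w | w ≤ y ⊔ z ∧ y ≤ w ∧ ¬ z ≤ w}) := by
    intro y z hy hz hzy h1 h2
    have hle : x ≤ y ⊔ z := hy.le.trans le_sup_left
    refine ⟨⟨?_, ?_⟩, ?_⟩
    · rintro w ((rfl | rfl) | ⟨h, h', _⟩)
      · exact ⟨le_rfl, hle⟩
      · exact ⟨hle, le_rfl⟩
      · exact ⟨hy.le.trans h', h⟩
    · rintro w hw w' hw' _
      rcases hw with (rfl | rfl) | ⟨a1, a2, a3⟩ <;> rcases hw' with (rfl | rfl) | ⟨b1, b2, b3⟩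
      · exact Or.inl le_rfl
      · exact Or.inl hle
      · exact Or.inl (hy.le.trans b2)
      · exact Or.inr hle
      · exact Or.inl le_rfl
      · exact Or.inr b1
      · exact Or.inr (hy.le.trans a2)
      · exact Or.inl a1
      · exact h2 w w' a1 b1 a2 b2 a3 b3
    · rintro S ⟨hS, hSc⟩ hsub w hw
      have hw' := hS hw
      have hyS : y ∈ S := hsub (Or.inr ⟨le_sup_left, le_rfl, hzy⟩)
      have hcomp := hSc.total hw hyS
      rcases h1 w hw'.1 hw'.2 with h | h | h
      · exact Or.inl (Or.inl h)
      · by_cases hzw : z ≤ w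
        · exact Or.inl (Or.inr (le_antisymm hw'.2 (sup_le h hzw)))
        · exact Or.inr ⟨hw'.2, h, hzw⟩
      · rcases hcomp with h' | h'
        · exact absurd (h.trans h') hzy
        · exact Or.inl (Or.inr (le_antisymm hw'.2 (sup_le h' h)))
  have hD := chain z y hz hy hyz (fun w ha hb => (h1 w ha (sup_comm y z ▸ hb)).imp id Or.symm)
    (fun w w' ha hb => h3 w w' (sup_comm y z ▸ ha) (sup_comm y z ▸ hb))
  rw [sup_comm z y] at hD
  refine ⟨_, _, chain y z hy hz hzy h1 h2, hD, ?_, ?_⟩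
  · ext w
    constructor
    · rintro (((rfl | rfl) | ⟨h, h', _⟩) | ((rfl | rfl) | ⟨h, h', _⟩))
      · exact ⟨le_rfl, hle⟩
      · exact ⟨hle, le_rfl⟩
      · exact ⟨hy.le.trans h', h⟩
      · exact ⟨le_rfl, hle⟩
      · exact ⟨hle, le_rfl⟩
      · exact ⟨hz.le.trans h', h⟩
    · rintro ⟨ha, hb⟩
      by_cases hyw : y ≤ w <;> by_cases hzw : z ≤ w
      · exact Or.inl (Or.inl (Or.inr (le_antisymm hb (sup_le hyw hzw))))
      · exact Or.inl (Or.inr ⟨hb, hyw, hzw⟩)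
      · exact Or.inr (Or.inr ⟨hb, hzw, hyw⟩)
      · rcases h1 w ha hb with h | h | h
        · exact Or.inl (Or.inl (Or.inl h))
        · exact absurd h hyw
        · exact absurd h hzw
  · ext w
    constructor
    · rintro ⟨(h | ⟨_, h, h'⟩), (k | ⟨_, k, k'⟩)⟩
      · exact h
      · exact h
      · exact k
      · exact absurd h k'
    · intro h
      exact ⟨Or.inl h, Or.inl h⟩

theorem IsPolygon.ofDual {x y : L} (h : IsPolygon (OrderDual.toDual x) (OrderDual.toDual y)) :
    IsPolygon y x := by
  obtain ⟨C, D, hC, hD, hu, hi⟩ := h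
  have key : ∀ S : Set Lᵒᵈ, IsMaxChainIcc (OrderDual.toDual x) (OrderDual.toDual y) S →
      IsMaxChainIcc y x (OrderDual.toDual ⁻¹' S) := by
    intro S hS
    refine ⟨⟨fun w hw => (hS.1.1 hw).symm, fun a ha b hb hab => (hS.1.2 ha hb hab).symm⟩, ?_⟩
    rintro S' ⟨h1, h2⟩ hle
    exact hS.2 (y := S') ⟨fun w hw => (h1 hw).symm, fun a ha b hb hab => (h2 ha hb hab).symm⟩ hle
  refine ⟨_, _, key C hC, key D hD, ?_, ?_⟩
  · rw [← Set.preimage_union, hu]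
    ext w
    exact and_comm
  · rw [← Set.preimage_inter, hi]
    ext w
    exact or_comm

theorem isPolygonal_of_upper (h : UpperPolygonal L) (h' : UpperPolygonal Lᵒᵈ) :
    IsPolygonal L := by
  have key : ∀ {M : Type _} [Lattice M], UpperPolygonal M → ∀ x y z : M, x ⋖ y → x ⋖ z → y ≠ z →
      IsPolygon x (y ⊔ z) := by
    intro M _ h x y z hy hz hne
    obtain ⟨h1, h2⟩ := h x y z hy hz hne
    refine isPolygon_of_upper hy hz hne h1 h2 ?_
    have h3 := (h x z y hz hy hne.symm).2
    rwa [sup_comm z y] at h3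
  exact ⟨key h, fun x y z hy hz hne => IsPolygon.ofDual
    (key h' (OrderDual.toDual x) (OrderDual.toDual y) (OrderDual.toDual z) hy.toDual hz.toDual hne)⟩

/-- Covers of x lift to covers of a maximal element X of its fibre, since anything strictly above X
leaves the fibre. Elements of an interval lift to (W ⊔ U) ⊓ (Y ⊔ Z), where W is any preimage, so the
lifts stay between U and Y ⊔ Z and the conditions upstairs apply. -/
theorem UpperPolygonal.map {M : Type*} [Lattice M] [Finite L]
    (h : UpperPolygonal L) (f : LatticeHom L M) (hf : Function.Surjective f) :
    UpperPolygonal M := by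
  intro x y z hy hz hne
  obtain ⟨X, hX⟩ := Set.Finite.exists_maximal (Set.toFinite {t | f t = x}) (hf x)
  have hfX : f X = x := hX.1
  have lift : ∀ y, x ⋖ y → ∃ Y, X ⋖ Y ∧ f Y = y := by
    intro y hy
    obtain ⟨Y₀, rfl⟩ := hf y
    have h0 : f (X ⊔ Y₀) = f Y₀ := by rw [map_sup, hfX, sup_eq_right.2 hy.le]
    have hlt : X < X ⊔ Y₀ := lt_of_le_of_ne le_sup_left fun he => by
      rw [← he, hfX] at h0
      exact hy.ne h0
    obtain ⟨Y, hXY, hY⟩ := exists_covBy_le_of_lt hlt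
    refine ⟨Y, hXY, ?_⟩
    have h1 : f Y ≤ f Y₀ := h0 ▸ OrderHomClass.mono f hY
    have h2 : x ≤ f Y := hfX ▸ OrderHomClass.mono f hXY.le
    rcases hy.eq_or_eq h2 h1 with h3 | h3
    · exact absurd (hX.2 h3 hXY.le) hXY.lt.not_ge
    · exact h3
  obtain ⟨Y, hY, rfl⟩ := lift y hy
  obtain ⟨Z, hZ, rfl⟩ := lift z hz
  obtain ⟨h1, h2⟩ := h X Y Z hY hZ (fun he => hne (he ▸ rfl))
  rw [← map_sup]
  have liftI : ∀ w U : _, U ≤ Y ⊔ Z → f U ≤ w → w ≤ f (Y ⊔ Z) → ∃ W, U ≤ W ∧ W ≤ Y ⊔ Z ∧ f W = w := by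
    intro w U hU h1 h2
    obtain ⟨W, rfl⟩ := hf w
    refine ⟨(W ⊔ U) ⊓ (Y ⊔ Z), le_inf le_sup_right hU, inf_le_right, ?_⟩
    rw [map_inf, map_sup f W U, sup_eq_left.2 h1, inf_eq_left.2 h2]
  refine ⟨fun w ha hb => ?_, fun w w' ha ha' hb hb' hc hc' => ?_⟩
  · obtain ⟨W, hW, hW', rfl⟩ := liftI w X (hY.le.trans le_sup_left) (hfX.le.trans ha) hb
    rcases h1 W hW hW' with rfl | h | h
    · exact Or.inl hfX
    · exact Or.inr (Or.inl (OrderHomClass.mono f h))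
    · exact Or.inr (Or.inr (OrderHomClass.mono f h))
  · obtain ⟨W, hW, hW1, rfl⟩ := liftI w Y le_sup_left hb ha
    obtain ⟨W', hW', hW1', rfl⟩ := liftI w' Y le_sup_left hb' ha'
    exact (h2 W W' hW1 hW1' hW hW' (fun k => hc (OrderHomClass.mono f k))
      (fun k => hc' (OrderHomClass.mono f k))).imp (fun k => OrderHomClass.mono f k)
        (fun k => OrderHomClass.mono f k)

end Finite

namespace PlaneTree

/-! ### Turns at a single vertex. -/

section Local

variable {V : Type*} {T : PlaneTree V}

theorem IsLeaf.eq_of_adj {u x y : V} (hu : T.IsLeaf u) (hx : T.graph.Adj u x)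
    (hy : T.graph.Adj u y) : x = y := by
  obtain ⟨a, ha⟩ := Set.ncard_eq_one.1 hu
  have h1 : x ∈ T.graph.neighborSet u := hx
  have h2 : y ∈ T.graph.neighborSet u := hy
  rw [ha] at h1 h2
  exact h1.trans h2.symm

theorem not_isLeaf_of_adj {u x y : V} (hx : T.graph.Adj u x) (hy : T.graph.Adj u y)
    (hxy : x ≠ y) : ¬ T.IsLeaf u :=
  fun hu => hxy (hu.eq_of_adj hx hy)

theorem LeftTurn.adj_left {x u y : V} (h : T.LeftTurn x u y) : T.graph.Adj u x := h.1

theorem LeftTurn.adj_right {x u y : V} (h : T.LeftTurn x u y) : T.graph.Adj u y := by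
  obtain ⟨h, rfl⟩ := h
  exact (T.cw u ⟨x, h⟩).2

theorem LeftTurn.right_unique {x u y y' : V} (h : T.LeftTurn x u y) (h' : T.LeftTurn x u y') :
    y = y' := by
  obtain ⟨h, rfl⟩ := h
  obtain ⟨h', rfl⟩ := h'
  rfl

theorem LeftTurn.left_unique {x x' u y : V} (h : T.LeftTurn x u y) (h' : T.LeftTurn x' u y) :
    x = x' := by
  obtain ⟨h, h1⟩ := h
  obtain ⟨h', h2⟩ := h'
  have := (T.cw u).injective (Subtype.ext (h1.trans h2.symm))
  exact congrArg Subtype.val this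

theorem exists_leftTurn {x u : V} (h : T.graph.Adj u x) : ∃ y, T.LeftTurn x u y :=
  ⟨_, h, rfl⟩

theorem exists_leftTurn' {y u : V} (h : T.graph.Adj u y) : ∃ x, T.LeftTurn x u y :=
  ⟨((T.cw u).symm ⟨y, h⟩ : T.graph.neighborSet u), ((T.cw u).symm ⟨y, h⟩).2, by simp⟩

/-- A set of neighbours that is closed under clockwise steps contains all neighbours. -/
theorem forall_adj_of_leftTurn [Finite V] {u : V} {Q : V → Prop} {x : V} (hx : T.graph.Adj u x)
    (h0 : Q x) (hs : ∀ a b, Q a → T.LeftTurn a u b → Q b) {y : V} (hy : T.graph.Adj u y) : Q y := by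
  obtain ⟨k, hk⟩ := (T.cw_cyclic u ⟨x, hx⟩ ⟨y, hy⟩).exists_nat_pow_eq
  have key : ∀ k : ℕ, Q (((T.cw u ^ k) ⟨x, hx⟩ : T.graph.neighborSet u) : V) := by
    intro k
    induction k with
    | zero => exact h0
    | succ k ih =>
      refine hs _ _ ih ⟨((T.cw u ^ k) ⟨x, hx⟩).2, ?_⟩
      rw [pow_succ', Equiv.Perm.mul_apply]
  have := key k
  rwa [hk] at this

/-- The degree condition enters here. If x and y followed each other, {x, y} would be stable under
the rotation at u and hence contain all neighbours, but there are at least three. -/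
theorem LeftTurn.not_rev [Finite V] {x u y : V} (hu : ¬ T.IsLeaf u) (h : T.LeftTurn x u y) :
    ¬ T.LeftTurn y u x := by
  intro h'
  have hsub : T.graph.neighborSet u ⊆ {x, y} := fun z hz =>
    forall_adj_of_leftTurn (Q := fun z => z ∈ ({x, y} : Set V)) h.adj_left (by simp) (by
      rintro a b (rfl | rfl) hab
      · exact Or.inr (hab.right_unique h)
      · exact Or.inl (hab.right_unique h')) hz
  have h3 := T.three_le u hu
  have h2 := (Set.ncard_le_ncard hsub).trans (Set.ncard_insert_le x {y})
  rw [Set.ncard_singleton] at h2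
  omega

theorem LeftTurn.ne [Finite V] {x u y : V} (hu : ¬ T.IsLeaf u) (h : T.LeftTurn x u y) : x ≠ y := by
  rintro rfl
  exact h.not_rev hu h

end Local

/-! ### Paths parametrised by intervals of integers -/

section Paths

variable {V : Type*}

/-- The vertices `v i, …, v j`. -/
def stretch (v : ℤ → V) (i j : ℤ) : Set V := v '' Set.Icc i j

/-- A path walked backwards. -/
def rev (v : ℤ → V) : ℤ → V := fun i => v (-i)

theorem mem_stretch {v : ℤ → V} {i j : ℤ} {x : V} :
    x ∈ stretch v i j ↔ ∃ k, i ≤ k ∧ k ≤ j ∧ v k = x := by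
  simp [stretch, and_assoc]

theorem stretch_congr {v w : ℤ → V} {i j : ℤ} (h : ∀ k, i ≤ k → k ≤ j → v k = w k) :
    stretch v i j = stretch w i j :=
  Set.image_congr fun k hk => h k hk.1 hk.2

/-- Paths are functions on all of ℤ of which only an interval matters. Reversal is then i ↦ -i,
reparametrisation is a shift, and a path can grow at either end without renumbering. -/
theorem stretch_congr_shift {v w : ℤ → V} {i j a b : ℤ} (d : ℤ)
    (h : ∀ k, i ≤ k → k ≤ j → v k = w (k + d)) (ha : a = i + d) (hb : b = j + d) :
    stretch v i j = stretch w a b := by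
  subst ha hb
  ext x
  simp only [mem_stretch]
  constructor
  · rintro ⟨k, h1, h2, rfl⟩
    exact ⟨k + d, by omega, by omega, (h k h1 h2).symm⟩
  · rintro ⟨k, h1, h2, rfl⟩
    exact ⟨k - d, by omega, by omega, by rw [h _ (by omega) (by omega)]; congr 1; omega⟩

theorem stretch_congr_flip {v w : ℤ → V} {i j a b : ℤ} (d : ℤ)
    (h : ∀ k, i ≤ k → k ≤ j → v k = w (d - k)) (ha : a = d - j) (hb : b = d - i) :
    stretch v i j = stretch w a b := by
  subst ha hb
  ext x
  simp only [mem_stretch]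
  constructor
  · rintro ⟨k, h1, h2, rfl⟩
    exact ⟨d - k, by omega, by omega, (h k h1 h2).symm⟩
  · rintro ⟨k, h1, h2, rfl⟩
    exact ⟨d - k, by omega, by omega, by rw [h _ (by omega) (by omega)]; congr 1; omega⟩

theorem stretch_rev (v : ℤ → V) (i j : ℤ) : stretch (rev v) i j = stretch v (-j) (-i) :=
  stretch_congr_flip 0 (fun k _ _ => by simp [rev]) (by omega) (by omega)

theorem stretch_subset {v : ℤ → V} {i j a b : ℤ} (h : i ≤ a) (h' : b ≤ j) :
    stretch v a b ⊆ stretch v i j :=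
  Set.image_mono (Set.Icc_subset_Icc h h')

variable (T : PlaneTree V)

/-- The path `v` turns left at `v i`. -/
def TurnL (v : ℤ → V) (i : ℤ) : Prop := T.LeftTurn (v (i - 1)) (v i) (v (i + 1))

/-- The path `v` turns right at `v i`. -/
def TurnR (v : ℤ → V) (i : ℤ) : Prop := T.LeftTurn (v (i + 1)) (v i) (v (i - 1))

/-- `v m, …, v n` are the successive vertices of an acyclic path. -/
structure Line (v : ℤ → V) (m n : ℤ) : Prop where
  le : m ≤ n
  adj : ∀ i, m ≤ i → i < n → T.graph.Adj (v i) (v (i + 1))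
  inj : ∀ i j, m ≤ i → i ≤ n → m ≤ j → j ≤ n → v i = v j → i = j

/-- `v m, …, v n` are the successive vertices of an acyclic path in which any two successive edges
are incident to a common face. -/
structure Geo (v : ℤ → V) (m n : ℤ) : Prop extends T.Line v m n where
  turn : ∀ i, m < i → i < n → T.TurnL v i ∨ T.TurnR v i

variable {T}

theorem turnL_rev {v : ℤ → V} {i : ℤ} : T.TurnL (rev v) i ↔ T.TurnR v (-i) := by
  simp only [TurnL, TurnR, rev]
  rw [show -(i - 1) = -i + 1 by ring, show -(i + 1) = -i - 1 by ring]

theorem turnR_rev {v : ℤ → V} {i : ℤ} : T.TurnR (rev v) i ↔ T.TurnL v (-i) := by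
  simp only [TurnL, TurnR, rev]
  rw [show -(i - 1) = -i + 1 by ring, show -(i + 1) = -i - 1 by ring]

theorem turnL_congr {v w : ℤ → V} {i : ℤ} (h1 : v (i - 1) = w (i - 1)) (h2 : v i = w i)
    (h3 : v (i + 1) = w (i + 1)) : T.TurnL v i ↔ T.TurnL w i := by
  simp only [TurnL, h1, h2, h3]

theorem turnR_congr {v w : ℤ → V} {i : ℤ} (h1 : v (i - 1) = w (i - 1)) (h2 : v i = w i)
    (h3 : v (i + 1) = w (i + 1)) : T.TurnR v i ↔ T.TurnR w i := by
  simp only [TurnR, h1, h2, h3]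

namespace Line

variable {v w : ℤ → V} {m n a b : ℤ}

theorem sub (h : T.Line v m n) {i j : ℤ} (hi : m ≤ i) (hij : i ≤ j) (hj : j ≤ n) :
    T.Line v i j :=
  ⟨hij, fun k h1 h2 => h.adj k (hi.trans h1) (h2.trans_le hj), fun k l h1 h2 h3 h4 =>
    h.inj k l (hi.trans h1) (h2.trans hj) (hi.trans h3) (h4.trans hj)⟩

theorem adj' (h : T.Line v m n) {i : ℤ} (h1 : m < i) (h2 : i ≤ n) :
    T.graph.Adj (v i) (v (i - 1)) := by
  have := (h.adj (i - 1) (by omega) (by omega)).symm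
  rwa [sub_add_cancel] at this

theorem rev (h : T.Line v m n) : T.Line (rev v) (-n) (-m) := by
  refine ⟨neg_le_neg h.le, fun i h1 h2 => ?_, fun i j h1 h2 h3 h4 he => ?_⟩
  · have := h.adj' (i := -i) (by omega) (by omega)
    simpa [PlaneTree.rev, neg_add, ← sub_eq_add_neg, add_comm] using this
  · have := h.inj (-i) (-j) (by omega) (by omega) (by omega) (by omega) he
    omega

theorem shift (h : T.Line v m n) (d : ℤ) : T.Line (fun i => v (i + d)) (m - d) (n - d) := by
  refine ⟨by linarith [h.le], fun i h1 h2 => ?_, fun i j h1 h2 h3 h4 he => ?_⟩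
  · have := h.adj (i + d) (by omega) (by omega)
    rwa [add_right_comm] at this
  · have := h.inj (i + d) (j + d) (by omega) (by omega) (by omega) (by omega) he
    omega

theorem not_isLeaf (h : T.Line v m n) {i : ℤ} (h1 : m < i) (h2 : i < n) : ¬ T.IsLeaf (v i) := by
  refine not_isLeaf_of_adj (h.adj' h1 h2.le) (h.adj i h1.le h2) fun he => ?_
  have := h.inj _ _ (by omega) (by omega) (by omega) (by omega) he
  omega

theorem exists_walk (h : T.Line v m n) (k : ℕ) (hk : m + k ≤ n) {x y : V} (hx : x = v m)
    (hy : y = v (m + k)) : ∃ W : T.graph.Walk x y,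
      W.support = (List.range (k + 1)).map fun t : ℕ => v (m + t) := by
  subst hx
  induction k generalizing y with
  | zero =>
    simp only [Nat.cast_zero, add_zero] at hy
    subst hy
    exact ⟨SimpleGraph.Walk.nil, by simp⟩
  | succ k ih =>
    obtain ⟨W, hW⟩ := ih (by push_cast at hk; omega) rfl
    have hadj : T.graph.Adj (v (m + k)) y := by
      rw [hy]
      have := h.adj (m + k) (by omega) (by push_cast at hk; omega)
      convert this using 2
      push_cast
      ring
    refine ⟨W.concat hadj, ?_⟩
    rw [SimpleGraph.Walk.support_concat, hW, List.range_succ (n := k + 1), List.map_append, hy]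
    simp

/-- In a tree, two paths with the same endpoints agree. -/
theorem unique (hv : T.Line v m n) (hw : T.Line w a b) (h0 : v m = w a) (h1 : v n = w b) :
    n - m = b - a ∧ ∀ t, 0 ≤ t → t ≤ n - m → v (m + t) = w (a + t) := by
  have isPath : ∀ {v : ℤ → V} {m n : ℤ} (hv : T.Line v m n) {x y : V}, x = v m → y = v n →
      ∃ W : T.graph.Walk x y, W.IsPath ∧
        W.support = (List.range ((n - m).toNat + 1)).map fun t : ℕ => v (m + t) := by
    intro v m n hv x y hx hy
    have hle := hv.le
    have hk : m + ((n - m).toNat : ℤ) = n := by omega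
    obtain ⟨W, hW⟩ := hv.exists_walk (n - m).toNat (by omega) hx (y := y) (by rw [hk, hy])
    refine ⟨W, ?_, hW⟩
    rw [SimpleGraph.Walk.isPath_def, hW]
    refine List.Nodup.map_on ?_ List.nodup_range
    intro s hs t ht he
    simp only [List.mem_range] at hs ht
    have := hv.inj _ _ (by omega) (by omega) (by omega) (by omega) he
    omega
  obtain ⟨W, hW, hWs⟩ := isPath hv rfl rfl
  obtain ⟨W', hW', hWs'⟩ := isPath hw h0 h1
  have he := (T.isTree.isAcyclic.subsingleton_path _ _).elim
    (⟨W, hW⟩ : T.graph.Path _ _) ⟨W', hW'⟩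
  have he' : W = W' := congrArg Subtype.val he
  rw [← he', hWs] at hWs'
  have hlen := congrArg List.length hWs'
  simp only [List.length_map, List.length_range] at hlen
  have hle := hv.le
  have hle' := hw.le
  refine ⟨by omega, fun t h2 h3 => ?_⟩
  obtain ⟨t, rfl⟩ := Int.eq_ofNat_of_zero_le h2
  have h4 := congrArg (fun l : List V => l[t]?) hWs'
  simp only [List.getElem?_map] at h4 h3 ⊢
  rw [List.getElem?_range (by omega), List.getElem?_range (by omega)] at h4
  simpa using h4

theorem ncard_stretch (h : T.Line v m n) : ((stretch v m n).ncard : ℤ) = n - m + 1 := by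
  rw [stretch, Set.InjOn.ncard_image fun i hi j hj he => h.inj i j hi.1 hi.2 hj.1 hj.2 he]
  rw [← Finset.coe_Icc, Set.ncard_coe_finset, Int.card_Icc]
  have := h.le
  omega

/-- A path with a given vertex set is unique up to reversal. -/
theorem eq_or_rev (hv : T.Line v m n) (hw : T.Line w a b) (h : stretch v m n = stretch w a b) :
    n - m = b - a ∧ ((∀ k, m ≤ k → k ≤ n → v k = w (k + (a - m))) ∨
      ∀ k, m ≤ k → k ≤ n → v k = w (b + m - k)) := by
  have hc : n - m = b - a := by
    have h1 := hv.ncard_stretch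
    have h2 := hw.ncard_stretch
    rw [h] at h1
    omega
  refine ⟨hc, ?_⟩
  have hle := hv.le
  have hm : v m ∈ stretch w a b := h ▸ mem_stretch.2 ⟨m, le_rfl, hle, rfl⟩
  have hn : v n ∈ stretch w a b := h ▸ mem_stretch.2 ⟨n, hle, le_rfl, rfl⟩
  obtain ⟨c, hc1, hc2, hc3⟩ := mem_stretch.1 hm
  obtain ⟨d, hd1, hd2, hd3⟩ := mem_stretch.1 hn
  rcases le_total c d with hcd | hcd
  · left
    obtain ⟨h1, h2⟩ := hv.unique (hw.sub hc1 hcd hd2) hc3.symm hd3.symm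
    intro k h3 h4
    have := h2 (k - m) (by omega) (by omega)
    rw [show m + (k - m) = k by ring] at this
    rw [this]
    congr 1
    omega
  · right
    obtain ⟨h1, h2⟩ := hv.unique (hw.sub hd1 hcd hc2).rev (by simp [PlaneTree.rev, hc3])
      (by simp [PlaneTree.rev, hd3])
    intro k h3 h4
    have := h2 (k - m) (by omega) (by omega)
    rw [show m + (k - m) = k by ring] at this
    rw [this, PlaneTree.rev]
    congr 1
    omega

/-- A subdivision of a path given by one parametrisation is given by any other one. -/
theorem split (hv : T.Line v m n) (hw : T.Line w a b) (h : stretch v m n = stretch w a b) {j : ℤ}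
    (h1 : a < j) (h2 : j < b) : ∃ i, m < i ∧ i < n ∧
      ((stretch w a j = stretch v m i ∧ stretch w j b = stretch v i n) ∨
        (stretch w a j = stretch v i n ∧ stretch w j b = stretch v m i)) := by
  obtain ⟨hc, h3 | h3⟩ := hv.eq_or_rev hw h
  · refine ⟨j - (a - m), by omega, by omega, Or.inl ⟨?_, ?_⟩⟩
    · exact (stretch_congr_shift (a - m) (fun k _ _ => h3 k (by omega) (by omega))
        (by omega) (by omega)).symm
    · exact (stretch_congr_shift (a - m) (fun k _ _ => h3 k (by omega) (by omega))
        (by omega) (by omega)).symm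
  · refine ⟨b + m - j, by omega, by omega, Or.inr ⟨?_, ?_⟩⟩
    · exact (stretch_congr_flip (b + m) (fun k _ _ => h3 k (by omega) (by omega))
        (by omega) (by omega)).symm
    · exact (stretch_congr_flip (b + m) (fun k _ _ => h3 k (by omega) (by omega))
        (by omega) (by omega)).symm

/-- If y were v i, then the path from v i to v n and the single edge from y to v n would have the
same ends, which forces i = n - 1. -/
theorem ne_of_adj (h : T.Line v m n) (hmn : m < n) {y : V} (hy : T.graph.Adj (v n) y)
    (hne : y ≠ v (n - 1)) {i : ℤ} (h1 : m ≤ i) (h2 : i ≤ n) : v i ≠ y := by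
  intro he
  rcases h2.eq_or_lt with rfl | h3
  · exact hy.ne he
  have hl : T.Line (fun t : ℤ => if t ≤ 0 then y else v n) 0 1 := by
    refine ⟨by norm_num, fun k h4 h5 => ?_, fun k l h4 h5 h6 h7 he => ?_⟩
    · obtain rfl : k = 0 := by omega
      simpa using hy.symm
    · by_contra hkl
      have hny := hy.ne
      rcases (show (k = 0 ∧ l = 1) ∨ (k = 1 ∧ l = 0) by omega) with ⟨rfl, rfl⟩ | ⟨rfl, rfl⟩
      · exact hny (by simpa using he.symm)
      · exact hny (by simpa using he)
  have := ((h.sub h1 h2 le_rfl).unique hl (by simpa using he) (by simp)).1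
  apply hne
  rw [← he]
  congr 1
  omega

theorem snoc (h : T.Line v m n) (hmn : m < n) {y : V} (hy : T.graph.Adj (v n) y)
    (hne : y ≠ v (n - 1)) : T.Line (Function.update v (n + 1) y) m (n + 1) := by
  have hup : ∀ i, i ≤ n → Function.update v (n + 1) y i = v i := fun i hi =>
    Function.update_of_ne (by omega) _ _
  refine ⟨by omega, fun i h1 h2 => ?_, fun i j h1 h2 h3 h4 he => ?_⟩
  · rcases (show i ≤ n by omega).eq_or_lt with rfl | h3
    · rw [hup i le_rfl, Function.update_self]
      exact hy
    · rw [hup i h3.le, hup (i + 1) h3]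
      exact h.adj i h1 h3
  · rcases (show i < n + 1 ∨ i = n + 1 by omega) with h5 | rfl <;>
      rcases (show j < n + 1 ∨ j = n + 1 by omega) with h6 | rfl
    · rw [hup i (by omega), hup j (by omega)] at he
      exact h.inj i j h1 (by omega) h3 (by omega) he
    · rw [hup i (by omega), Function.update_self] at he
      exact absurd he (h.ne_of_adj hmn hy hne h1 (by omega))
    · rw [hup j (by omega), Function.update_self] at he
      exact absurd he.symm (h.ne_of_adj hmn hy hne h3 (by omega))
    · rfl

theorem lt_card [Finite V] (h : T.Line v m n) : n - m < Nat.card V := by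
  have h1 := h.ncard_stretch
  have h2 := Set.ncard_le_card (stretch v m n)
  omega

end Line

namespace Geo

variable {v w : ℤ → V} {m n a b : ℤ}

theorem sub (h : T.Geo v m n) {i j : ℤ} (hi : m ≤ i) (hij : i ≤ j) (hj : j ≤ n) :
    T.Geo v i j :=
  ⟨h.toLine.sub hi hij hj, fun k h1 h2 => h.turn k (by omega) (by omega)⟩

theorem rev (h : T.Geo v m n) : T.Geo (rev v) (-n) (-m) :=
  ⟨h.toLine.rev, fun i h1 h2 => by
    rw [turnL_rev, turnR_rev]
    exact (h.turn (-i) (by omega) (by omega)).symm⟩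

theorem shift (h : T.Geo v m n) (d : ℤ) : T.Geo (fun i => v (i + d)) (m - d) (n - d) :=
  ⟨h.toLine.shift d, fun i h1 h2 => by
    have := h.turn (i + d) (by omega) (by omega)
    simpa only [TurnL, TurnR, add_sub_right_comm, add_right_comm] using this⟩

theorem not_turnR [Finite V] (h : T.Geo v m n) {i : ℤ} (h1 : m < i) (h2 : i < n)
    (hl : T.TurnL v i) : ¬ T.TurnR v i :=
  LeftTurn.not_rev (h.not_isLeaf h1 h2) hl

theorem not_turnL_iff [Finite V] (h : T.Geo v m n) {i : ℤ} (h1 : m < i) (h2 : i < n) :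
    ¬ T.TurnL v i ↔ T.TurnR v i :=
  ⟨fun h3 => (h.turn i h1 h2).resolve_left h3, fun h3 h4 => h.not_turnR h1 h2 h4 h3⟩

theorem not_turnR_iff [Finite V] (h : T.Geo v m n) {i : ℤ} (h1 : m < i) (h2 : i < n) :
    ¬ T.TurnR v i ↔ T.TurnL v i := by
  rw [← h.not_turnL_iff h1 h2, not_not]

/-- A path can be extended to a leaf, with prescribed turns. -/
theorem exists_extension [Finite V] (P : V → Prop) (hv : T.Geo v m n) (hmn : m < n) :
    ∃ w n', n ≤ n' ∧ T.Geo w m n' ∧ (∀ i, i ≤ n → w i = v i) ∧ T.IsLeaf (w n') ∧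
      ∀ i, n ≤ i → i < n' → (T.TurnL w i ↔ P (w i)) := by
  -- Here k bounds the number of vertices still available. At k = 0 the path would have more
  -- vertices than the tree.
  suffices key : ∀ (k : ℕ) (v : ℤ → V) (n : ℤ), T.Geo v m n → m < n → Nat.card V ≤ k + (n - m) →
      ∃ w n', n ≤ n' ∧ T.Geo w m n' ∧ (∀ i, i ≤ n → w i = v i) ∧ T.IsLeaf (w n') ∧
      ∀ i, n ≤ i → i < n' → (T.TurnL w i ↔ P (w i)) from
    key (Nat.card V) v n hv hmn (by omega)
  clear hv hmn
  intro k
  induction k with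
  | zero =>
    intro v n hv _ hk
    have := hv.lt_card
    push_cast at hk
    omega
  | succ k ih =>
    intro v n hv hmn hk
    by_cases hleaf : T.IsLeaf (v n)
    · exact ⟨v, n, le_rfl, hv, fun _ _ => rfl, hleaf, fun i h1 h2 => by omega⟩
    have hadj := hv.adj' hmn le_rfl
    -- The next vertex is the clockwise successor of the previous one for a left turn and its
    -- predecessor for a right turn. At an interior vertex neither of them is the previous vertex
    -- itself.
    obtain ⟨y, hy, hne, hturn⟩ : ∃ y, T.graph.Adj (v n) y ∧ y ≠ v (n - 1) ∧
        ((P (v n) ∧ T.LeftTurn (v (n - 1)) (v n) y) ∨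
          (¬ P (v n) ∧ T.LeftTurn y (v n) (v (n - 1)))) := by
      by_cases hP : P (v n)
      · obtain ⟨y, hy⟩ := exists_leftTurn hadj
        exact ⟨y, hy.adj_right, (hy.ne hleaf).symm, Or.inl ⟨hP, hy⟩⟩
      · obtain ⟨y, hy⟩ := exists_leftTurn' hadj
        exact ⟨y, hy.adj_left, hy.ne hleaf, Or.inr ⟨hP, hy⟩⟩
    have hup : ∀ i, i ≤ n → Function.update v (n + 1) y i = v i := fun i hi =>
      Function.update_of_ne (by omega) _ _
    have hL : T.TurnL (Function.update v (n + 1) y) n ↔ T.LeftTurn (v (n - 1)) (v n) y := by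
      rw [TurnL, hup n le_rfl, hup _ (by omega), Function.update_self]
    have hR : T.TurnR (Function.update v (n + 1) y) n ↔ T.LeftTurn y (v n) (v (n - 1)) := by
      rw [TurnR, hup n le_rfl, hup (n - 1) (by omega), Function.update_self]
    have hgeo : T.Geo (Function.update v (n + 1) y) m (n + 1) := by
      refine ⟨hv.toLine.snoc hmn hy hne, fun i h1 h2 => ?_⟩
      rcases (show i ≤ n by omega).eq_or_lt with rfl | h3
      · rw [hL, hR]
        exact hturn.imp And.right And.right
      · rw [turnL_congr (hup _ (by omega)) (hup _ (by omega)) (hup _ (by omega)),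
          turnR_congr (hup _ (by omega)) (hup _ (by omega)) (hup _ (by omega))]
        exact hv.turn i h1 h3
    obtain ⟨w, n', h1, h2, h3, h4, h5⟩ := ih _ (n + 1) hgeo (by omega) (by push_cast at hk; omega)
    refine ⟨w, n', by omega, h2, fun i hi => (h3 i (by omega)).trans (hup i hi), h4, ?_⟩
    intro i hi hi'
    rcases hi.eq_or_lt with rfl | hi
    · rw [turnL_congr (h3 _ (by omega)) (h3 _ (by omega)) (h3 _ (by omega)), hL, h3 _ (by omega),
        hup _ le_rfl]
      rcases hturn with ⟨hP, h⟩ | ⟨hP, h⟩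
      · exact ⟨fun _ => hP, fun _ => h⟩
      · exact ⟨fun h' => absurd h (h'.not_rev hleaf), fun h' => absurd h' hP⟩
    · exact h5 i hi hi'

/-- A path can be extended to an arc, with prescribed turns. -/
theorem exists_arc [Finite V] (P Q : V → Prop) (hv : T.Geo v m n) (hmn : m < n) :
    ∃ w m' n', m' ≤ m ∧ n ≤ n' ∧ T.Geo w m' n' ∧ (∀ i, m ≤ i → i ≤ n → w i = v i) ∧
      T.IsLeaf (w m') ∧ T.IsLeaf (w n') ∧ (∀ i, n ≤ i → i < n' → (T.TurnL w i ↔ P (w i))) ∧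
      ∀ i, m' < i → i ≤ m → (T.TurnR w i ↔ Q (w i)) := by
  obtain ⟨w, n', h1, h2, h3, h4, h5⟩ := hv.exists_extension P hmn
  obtain ⟨u, m', k1, k2, k3, k4, k5⟩ := h2.rev.exists_extension Q (by omega)
  have hu : ∀ i, m ≤ i → PlaneTree.rev u i = w i := fun i hi => by
    rw [PlaneTree.rev, k3 _ (by omega), PlaneTree.rev, neg_neg]
  refine ⟨PlaneTree.rev u, -m', n', by omega, h1, ?_, ?_, ?_, ?_, ?_, ?_⟩
  · simpa using k2.rev
  · intro i hi hi'
    rw [hu i hi, h3 i hi']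
  · simpa [PlaneTree.rev] using k4
  · rw [hu n' (by omega)]
    exact h4
  · intro i hi hi'
    rw [turnL_congr (hu _ (by omega)) (hu _ (by omega)) (hu _ (by omega)), hu i (by omega)]
    exact h5 i hi hi'
  · intro i hi hi'
    rw [turnR_rev]
    exact k5 (-i) (by omega) (by omega)

/-- Two arcs with a common edge agree up to the point where they end or turn in different
directions. -/
theorem exists_divergence [Finite V] (hv : T.Geo v m n) (hw : T.Geo w a b) (hn : T.IsLeaf (v n))
    (hb : T.IsLeaf (w b)) {k : ℤ} (h1 : m ≤ k) (h2 : k < n) (h3 : a ≤ k) (h4 : k < b)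
    (h5 : v k = w k) (h6 : v (k + 1) = w (k + 1)) :
    ∃ y, k < y ∧ y ≤ n ∧ y ≤ b ∧ (∀ i, k ≤ i → i ≤ y → v i = w i) ∧
      ((y = n ∧ y = b) ∨ (y < n ∧ y < b ∧ v (y + 1) ≠ w (y + 1) ∧
        ((T.TurnL v y ∧ T.TurnR w y) ∨ (T.TurnR v y ∧ T.TurnL w y)))) := by
  obtain ⟨y, ⟨hy1, hy2, hy3, hy4⟩, hmax⟩ := Int.exists_greatest_of_bdd
    (P := fun y => k < y ∧ y ≤ n ∧ y ≤ b ∧ ∀ i, k ≤ i → i ≤ y → v i = w i)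
    ⟨n, fun z hz => hz.2.1⟩ ⟨k + 1, by omega, by omega, by omega, fun i hi hi' => by
      rcases (show i = k ∨ i = k + 1 by omega) with rfl | rfl
      · exact h5
      · exact h6⟩
  refine ⟨y, hy1, hy2, hy3, hy4, ?_⟩
  have hvw := hy4 y hy1.le le_rfl
  rcases hy2.eq_or_lt with hyn | hyn <;> rcases hy3.eq_or_lt with hyb | hyb
  · exact Or.inl ⟨hyn, hyb⟩
  · exact absurd (hvw ▸ hyn ▸ hn) (hw.not_isLeaf (by omega) hyb)
  · exact absurd (hvw.symm ▸ hyb ▸ hb) (hv.not_isLeaf (by omega) hyn)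
  · have hne : v (y + 1) ≠ w (y + 1) := fun he => by
      have := hmax (y + 1) ⟨by omega, by omega, by omega, fun i hi hi' => by
        rcases (show i ≤ y ∨ i = y + 1 by omega) with h | rfl
        · exact hy4 i hi h
        · exact he⟩
      omega
    refine Or.inr ⟨hyn, hyb, hne, ?_⟩
    have hpre := hy4 (y - 1) (by omega) (by omega)
    rcases hv.turn y (by omega) hyn with hv' | hv' <;> rcases hw.turn y (by omega) hyb with hw' | hw'
    · rw [TurnL, hpre, hvw] at hv'
      exact absurd (hv'.right_unique hw') hne
    · exact Or.inl ⟨hv', hw'⟩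
    · exact Or.inr ⟨hv', hw'⟩
    · rw [TurnR, hpre, hvw] at hv'
      exact absurd (hv'.left_unique hw') hne

end Geo

end Paths

end PlaneTree

namespace PlaneTree

/-! ### Translation between vertex lists and paths indexed by integers. -/

section Lists

variable {V : Type*}

/-- The list `v m, …, v n`. -/
def sl (v : ℤ → V) (m n : ℤ) : List V := (List.range (n + 1 - m).toNat).map fun t : ℕ => v (m + t)

theorem length_sl (v : ℤ → V) (m n : ℤ) : (sl v m n).length = (n + 1 - m).toNat := by
  simp [sl]

theorem getElem_sl (v : ℤ → V) (m n : ℤ) (t : ℕ) (h : t < (sl v m n).length) :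
    (sl v m n)[t] = v (m + t) := by
  simp [sl]

theorem vset_sl (v : ℤ → V) (m n : ℤ) : vset (sl v m n) = stretch v m n := by
  ext x
  simp only [vset, sl, List.mem_map, List.mem_range, Set.mem_ofPred_eq, mem_stretch]
  constructor
  · rintro ⟨t, ht, rfl⟩
    exact ⟨m + t, by omega, by omega, rfl⟩
  · rintro ⟨k, h1, h2, rfl⟩
    exact ⟨(k - m).toNat, by omega, by congr 1; omega⟩

theorem sl_append (v : ℤ → V) {m j n : ℤ} (h1 : m ≤ j) (h2 : j ≤ n + 1) :
    sl v m n = sl v m (j - 1) ++ sl v j n := by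
  refine List.ext_getElem ?_ fun t ht ht' => ?_
  · simp only [List.length_append, length_sl]
    omega
  · rw [getElem_sl, List.getElem_append]
    split_ifs with h
    · rw [getElem_sl]
    · rw [getElem_sl]
      congr 1
      rw [length_sl] at h ⊢
      omega

theorem sl_self (v : ℤ → V) (m : ℤ) : sl v m m = [v m] := by
  simp [sl]

theorem sl_cons (v : ℤ → V) {m n : ℤ} (h : m ≤ n) : sl v m n = v m :: sl v (m + 1) n := by
  rw [sl_append v (j := m + 1) (by omega) (by omega), add_sub_cancel_right, sl_self]
  rfl

theorem sl_snoc (v : ℤ → V) {m n : ℤ} (h : m ≤ n) : sl v m n = sl v m (n - 1) ++ [v n] := by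
  rw [sl_append v (j := n) (by omega) (by omega), sl_self]

theorem sl_ends (v : ℤ → V) {m n : ℤ} (h : m < n) :
    sl v m n = v m :: (sl v (m + 1) (n - 1) ++ [v n]) := by
  rw [sl_cons v h.le, sl_snoc v (by omega)]

theorem eq_sl_of_append {v : ℤ → V} {m n : ℤ} {l l' : List V} (h : l ++ l' = sl v m n)
    (hmn : m ≤ n + 1) :
    m + l.length ≤ n + 1 ∧ l = sl v m (m + l.length - 1) ∧ l' = sl v (m + l.length) n := by
  have hlen := congrArg List.length h
  rw [List.length_append, length_sl] at hlen
  have hle : m + l.length ≤ n + 1 := by omega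
  rw [sl_append v (j := m + l.length) (by omega) hle] at h
  exact ⟨hle, List.append_inj h (by rw [length_sl]; omega)⟩

theorem exists_eq_sl (l : List V) (h : l ≠ []) : ∃ v : ℤ → V, l = sl v 0 (l.length - 1) := by
  refine ⟨fun i => l.getD i.toNat (l.head h), ?_⟩
  refine List.ext_getElem ?_ fun t ht ht' => ?_
  · rw [length_sl]
    omega
  · rw [getElem_sl]
    simp [ht]

theorem sl_congr_shift {v w : ℤ → V} {m n a b : ℤ} (d : ℤ) (h : ∀ k, m ≤ k → k ≤ n → v k = w (k + d))
    (ha : a = m + d) (hb : b = n + d) : sl v m n = sl w a b := by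
  subst ha hb
  refine List.ext_getElem ?_ fun t ht ht' => ?_
  · simp only [length_sl]
    omega
  · rw [length_sl] at ht
    rw [getElem_sl, getElem_sl, h _ (by omega) (by omega)]
    congr 1
    omega

/-- The position of a consecutive part of a listed path. -/
theorem eq_stretch_of_append {v : ℤ → V} {m n : ℤ} {a mid b : List V} {u w : V}
    (h : a ++ (u :: (mid ++ [w])) ++ b = sl v m n) (hmn : m ≤ n + 1) :
    ∃ i j, m ≤ i ∧ i < j ∧ j ≤ n ∧ u = v i ∧ w = v j ∧ vset (u :: (mid ++ [w])) = stretch v i j ∧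
      (a ≠ [] ↔ m < i) ∧ (b ≠ [] ↔ j < n) := by
  obtain ⟨h1, h2, h3⟩ := eq_sl_of_append h hmn
  obtain ⟨h4, h5, h6⟩ := eq_sl_of_append h2 (by omega)
  simp only [List.length_append, List.length_cons, List.length_nil] at h1 h3 h4 h6
  push_cast at h1 h3 h4 h6
  refine ⟨m + a.length, m + a.length + mid.length + 1, by omega, by omega, by omega, ?_, ?_, ?_,
    ?_, ?_⟩
  · rw [sl_cons v (by omega)] at h6
    exact (List.cons.inj h6).1
  · rw [sl_ends v (by omega)] at h6
    have h7 := (List.cons.inj h6).2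
    have h8 := congrArg List.getLast? h7
    simp only [List.getLast?_append, List.getLast?_singleton, Option.some_or] at h8
    rw [Option.some.inj h8]
    congr 1
    omega
  · rw [h6, vset_sl]
    congr 1
    omega
  · rw [← List.length_pos_iff]
    omega
  · have hb := congrArg List.length h3
    rw [length_sl] at hb
    rw [← List.length_pos_iff]
    omega

variable {T : PlaneTree V}

theorem isPath_sl {v : ℤ → V} {m n : ℤ} (h : m ≤ n) : T.IsPath (sl v m n) ↔ T.Line v m n := by
  rw [IsPath, List.isChain_iff_getElem, List.nodup_iff_injective_getElem]
  constructor
  · rintro ⟨h1, h2⟩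
    refine ⟨h, fun i h3 h4 => ?_, fun i j h3 h4 h5 h6 he => ?_⟩
    · have := h1 (i - m).toNat (by rw [length_sl]; omega)
      rw [getElem_sl, getElem_sl] at this
      convert this using 2 <;> omega
    · have := @h2 ⟨(i - m).toNat, by rw [length_sl]; omega⟩ ⟨(j - m).toNat, by rw [length_sl]; omega⟩
        (by
          simp only [getElem_sl]
          convert he using 2 <;> omega)
      simp only [Fin.mk.injEq] at this
      omega
  · intro hl
    refine ⟨fun t ht => ?_, fun s t he => ?_⟩
    · rw [length_sl] at ht
      rw [getElem_sl, getElem_sl]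
      have := hl.adj (m + t) (by omega) (by omega)
      convert this using 2
      push_cast
      ring
    · have hs := s.2
      have ht := t.2
      simp only [length_sl] at hs ht
      simp only [getElem_sl] at he
      have := hl.inj _ _ (by omega) (by omega) (by omega) (by omega) he
      exact Fin.ext (by omega)

theorem triple_infix_sl {v : ℤ → V} {m n : ℤ} {x u y : V} :
    [x, u, y] <:+: sl v m n ↔ ∃ i, m < i ∧ i < n ∧ x = v (i - 1) ∧ u = v i ∧ y = v (i + 1) := by
  constructor
  · rintro ⟨s, t, h⟩
    have hmn : m ≤ n + 1 := by
      have := congrArg List.length h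
      simp [length_sl] at this
      omega
    obtain ⟨h1, h2, h3⟩ := eq_sl_of_append h hmn
    obtain ⟨h4, h5, h6⟩ := eq_sl_of_append h2 (by omega)
    simp only [List.length_append, List.length_cons, List.length_nil] at h1 h3 h4 h6
    push_cast at h1 h3 h4 h6
    rw [sl_cons v (by omega), sl_cons v (by omega), sl_cons v (by omega)] at h6
    simp only [List.cons.injEq] at h6
    refine ⟨m + s.length + 1, by omega, by omega, ?_, h6.2.1, h6.2.2.1⟩
    rw [h6.1]
    congr 1
    omega
  · rintro ⟨i, h1, h2, rfl, rfl, rfl⟩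
    refine ⟨sl v m (i - 2), sl v (i + 2) n, ?_⟩
    rw [sl_append v (j := i - 1) (m := m) (n := n) (by omega) (by omega),
      sl_cons v (m := i - 1) (by omega), sl_cons v (m := i - 1 + 1) (by omega),
      sl_cons v (m := i - 1 + 1 + 1) (by omega)]
    simp only [List.append_assoc, List.cons_append, List.nil_append]
    rw [show i - 1 + 1 = i by ring, show i - 1 - 1 = i - 2 by ring, show i + 1 + 1 = i + 2 by ring]

theorem isTight_sl {v : ℤ → V} {m n : ℤ} :
    T.IsTight (sl v m n) ↔ ∀ i, m < i → i < n → T.TurnL v i ∨ T.TurnR v i := by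
  constructor
  · intro h i h1 h2
    exact h _ _ _ (triple_infix_sl.2 ⟨i, h1, h2, rfl, rfl, rfl⟩)
  · intro h x u y hi
    obtain ⟨i, h1, h2, rfl, rfl, rfl⟩ := triple_infix_sl.1 hi
    exact h i h1 h2

theorem turnsLeft_sl {v : ℤ → V} {m n i : ℤ} (hv : T.Line v m n) (h1 : m ≤ i) (h2 : i ≤ n) :
    T.TurnsLeft (sl v m n) (v i) ↔ m < i ∧ i < n ∧ T.TurnL v i := by
  constructor
  · rintro ⟨x, y, h, hl⟩
    obtain ⟨j, h3, h4, rfl, h6, rfl⟩ := triple_infix_sl.1 h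
    obtain rfl := hv.inj _ _ h1 h2 h3.le h4.le h6
    exact ⟨h3, h4, hl⟩
  · rintro ⟨h3, h4, hl⟩
    exact ⟨_, _, triple_infix_sl.2 ⟨i, h3, h4, rfl, rfl, rfl⟩, hl⟩

theorem turnsRight_sl {v : ℤ → V} {m n i : ℤ} (hv : T.Line v m n) (h1 : m ≤ i) (h2 : i ≤ n) :
    T.TurnsRight (sl v m n) (v i) ↔ m < i ∧ i < n ∧ T.TurnR v i := by
  constructor
  · rintro ⟨x, y, h, hl⟩
    obtain ⟨j, h3, h4, rfl, h6, rfl⟩ := triple_infix_sl.1 h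
    obtain rfl := hv.inj _ _ h1 h2 h3.le h4.le h6
    exact ⟨h3, h4, hl⟩
  · rintro ⟨h3, h4, hl⟩
    exact ⟨_, _, triple_infix_sl.2 ⟨i, h3, h4, rfl, rfl, rfl⟩, hl⟩

/-- A list of the successive vertices of a path is determined up to reversal. -/
theorem IsPath.eq_sl {l : List V} (hl : T.IsPath l) {v : ℤ → V} {m n : ℤ} (hv : T.Line v m n)
    (h : vset l = stretch v m n) : l = sl v m n ∨ l = sl (rev v) (-n) (-m) := by
  have hne : l ≠ [] := by
    rintro rfl
    have : v m ∈ vset ([] : List V) := h ▸ mem_stretch.2 ⟨m, le_rfl, hv.le, rfl⟩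
    simp [vset] at this
  obtain ⟨w, hw⟩ := exists_eq_sl l hne
  have hpos := List.length_pos_iff.2 hne
  have hw' : T.Line w 0 (l.length - 1) := (isPath_sl (by omega)).1 (hw ▸ hl)
  rw [hw, vset_sl] at h
  obtain ⟨h1, h2 | h2⟩ := hw'.eq_or_rev hv h
  · left
    rw [hw]
    exact sl_congr_shift (m - 0) h2 (by omega) (by omega)
  · right
    rw [hw]
    refine sl_congr_shift (-n) (fun k h3 h4 => ?_) (by omega) (by omega)
    rw [h2 k h3 h4, rev]
    congr 1
    omega

theorem exists_eq_sl_of_ends (u w : V) (mid : List V) :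
    ∃ (v : ℤ → V) (n : ℤ), 0 < n ∧ u :: (mid ++ [w]) = sl v 0 n ∧ v 0 = u ∧ v n = w := by
  obtain ⟨v, hv⟩ := exists_eq_sl (u :: (mid ++ [w])) (by simp)
  have hn : ((u :: (mid ++ [w])).length : ℤ) - 1 = mid.length + 1 := by simp
  rw [hn] at hv
  refine ⟨v, mid.length + 1, by omega, hv, ?_⟩
  rw [sl_ends v (by omega)] at hv
  refine ⟨(List.cons.inj hv).1.symm, ?_⟩
  have h8 := congrArg List.getLast? (List.cons.inj hv).2
  simpa using h8.symm

theorem mem_seg_iff {s : Set V} : s ∈ T.Seg ↔ ∃ (v : ℤ → V) (m n : ℤ), m < n ∧ T.Geo v m n ∧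
    ¬ T.IsLeaf (v m) ∧ ¬ T.IsLeaf (v n) ∧ s = stretch v m n := by
  constructor
  · rintro ⟨u, mid, w, h1, h2, h3, h4, rfl⟩
    obtain ⟨v, n, hn, he, rfl, rfl⟩ := exists_eq_sl_of_ends u w mid
    rw [he] at h1 h2 ⊢
    exact ⟨v, 0, n, hn, ⟨(isPath_sl hn.le).1 h1, isTight_sl.1 h2⟩, h3, h4, vset_sl v 0 n⟩
  · rintro ⟨v, m, n, hmn, hv, h3, h4, rfl⟩
    refine ⟨v m, sl v (m + 1) (n - 1), v n, ?_⟩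
    rw [← sl_ends v hmn]
    exact ⟨(isPath_sl hmn.le).2 hv.toLine, isTight_sl.2 hv.turn, h3, h4, (vset_sl v m n).symm⟩

theorem isArc_iff {s : Set V} : T.IsArc s ↔ ∃ (v : ℤ → V) (m n : ℤ), m < n ∧ T.Geo v m n ∧
    T.IsLeaf (v m) ∧ T.IsLeaf (v n) ∧ s = stretch v m n := by
  constructor
  · rintro ⟨u, mid, w, h1, h2, h3, h4, rfl⟩
    obtain ⟨v, n, hn, he, rfl, rfl⟩ := exists_eq_sl_of_ends u w mid
    rw [he] at h1 h2 ⊢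
    exact ⟨v, 0, n, hn, ⟨(isPath_sl hn.le).1 h1, isTight_sl.1 h2⟩, h3, h4, vset_sl v 0 n⟩
  · rintro ⟨v, m, n, hmn, hv, h3, h4, rfl⟩
    refine ⟨v m, sl v (m + 1) (n - 1), v n, ?_⟩
    rw [← sl_ends v hmn]
    exact ⟨(isPath_sl hmn.le).2 hv.toLine, isTight_sl.2 hv.turn, h3, h4, (vset_sl v m n).symm⟩

theorem not_isLeaf_of_mem_seg {s : Set V} (hs : s ∈ T.Seg) {x : V} (hx : x ∈ s) :
    ¬ T.IsLeaf x := by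
  obtain ⟨v, m, n, _, hv, h1, h2, rfl⟩ := mem_seg_iff.1 hs
  obtain ⟨k, h3, h4, rfl⟩ := mem_stretch.1 hx
  rcases h3.eq_or_lt with rfl | h3
  · exact h1
  rcases h4.eq_or_lt with rfl | h4
  · exact h2
  exact hv.not_isLeaf h3 h4

theorem Geo.mem_seg {v : ℤ → V} {m n i j : ℤ} (hv : T.Geo v m n) (hi : m ≤ i) (hij : i < j)
    (hj : j ≤ n) (h1 : ¬ T.IsLeaf (v i)) (h2 : ¬ T.IsLeaf (v j)) : stretch v i j ∈ T.Seg :=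
  mem_seg_iff.2 ⟨v, i, j, hij, hv.sub hi hij.le hj, h1, h2, rfl⟩

theorem left_mem_stretch (v : ℤ → V) {i j : ℤ} (h : i ≤ j) : v i ∈ stretch v i j :=
  mem_stretch.2 ⟨i, le_rfl, h, rfl⟩

theorem right_mem_stretch (v : ℤ → V) {i j : ℤ} (h : i ≤ j) : v j ∈ stretch v i j :=
  mem_stretch.2 ⟨j, h, le_rfl, rfl⟩

/-- The position of the members of `C_p` in a parametrisation of `p`. -/
theorem mem_cSet_iff {v : ℤ → V} {m n : ℤ} (hv : T.Geo v m n) {t : Set V} :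
    t ∈ T.CSet (stretch v m n) ↔ ∃ i j, m ≤ i ∧ i < j ∧ j ≤ n ∧ ¬ T.IsLeaf (v i) ∧
      ¬ T.IsLeaf (v j) ∧ t = stretch v i j ∧ (i = m ∨ T.TurnR v i) ∧ (j = n ∨ T.TurnL v j) := by
  have hle := hv.le
  constructor
  · rintro ⟨ht, a, u, mid, w, b, h1, h2, rfl, h3, h4⟩
    have key : ∀ (v : ℤ → V) (m n : ℤ), T.Geo v m n →
        a ++ (u :: (mid ++ [w])) ++ b = sl v m n → ∃ i j, m ≤ i ∧ i < j ∧ j ≤ n ∧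
        ¬ T.IsLeaf (v i) ∧ ¬ T.IsLeaf (v j) ∧ vset (u :: (mid ++ [w])) = stretch v i j ∧
        (i = m ∨ T.TurnR v i) ∧ (j = n ∨ T.TurnL v j) := by
      intro v m n hv he
      have hle := hv.le
      obtain ⟨i, j, k1, k2, k3, rfl, rfl, k6, k7, k8⟩ := eq_stretch_of_append he (by omega)
      rw [k6] at ht
      refine ⟨i, j, k1, k2, k3, not_isLeaf_of_mem_seg ht (left_mem_stretch v k2.le),
        not_isLeaf_of_mem_seg ht (right_mem_stretch v k2.le), k6, ?_, ?_⟩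
      · rcases k1.eq_or_lt with rfl | k1
        · exact Or.inl rfl
        · have := h3 (k7.2 k1)
          rw [he, turnsRight_sl hv.toLine (by omega) (by omega)] at this
          exact Or.inr this.2.2
      · rcases k3.eq_or_lt with rfl | k3
        · exact Or.inl rfl
        · have := h4 (k8.2 k3)
          rw [he, turnsLeft_sl hv.toLine (by omega) (by omega)] at this
          exact Or.inr this.2.2
    rcases h1.eq_sl hv.toLine h2.symm with he | he
    · exact key v m n hv he
    · obtain ⟨i, j, k1, k2, k3, k4, k5, k6, k7, k8⟩ := key _ _ _ hv.rev he
      refine ⟨-j, -i, by omega, by omega, by omega, k5, k4, ?_, ?_, ?_⟩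
      · rw [k6, stretch_rev]
      · rw [turnL_rev] at k8
        exact k8.imp (fun h => by omega) id
      · rw [turnR_rev] at k7
        exact k7.imp (fun h => by omega) id
  · rintro ⟨i, j, h1, h2, h3, h4, h5, rfl, h6, h7⟩
    refine ⟨hv.mem_seg h1 h2 h3 h4 h5, sl v m (i - 1), v i, sl v (i + 1) (j - 1), v j,
      sl v (j + 1) n, ?_⟩
    rw [← sl_ends v h2]
    have he : sl v m (i - 1) ++ sl v i j ++ sl v (j + 1) n = sl v m n := by
      rw [sl_append v (m := m) (n := n) (j := j + 1) (by omega) (by omega), add_sub_cancel_right,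
        sl_append v (m := m) (n := j) (j := i) (by omega) (by omega)]
    rw [he]
    refine ⟨(isPath_sl hle).2 hv.toLine, (vset_sl v m n).symm, (vset_sl v i j).symm, ?_, ?_⟩
    · intro hne
      rw [← List.length_pos_iff, length_sl] at hne
      exact (turnsRight_sl hv.toLine h1 (by omega)).2 ⟨by omega, by omega,
        h6.resolve_left (by omega)⟩
    · intro hne
      rw [← List.length_pos_iff, length_sl] at hne
      exact (turnsLeft_sl hv.toLine (by omega) h3).2 ⟨by omega, by omega,
        h7.resolve_left (by omega)⟩

theorem IsComp.exists_split {s t : Set V} {v : ℤ → V} {m n : ℤ} (hv : T.Line v m n)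
    (h : T.IsComp s t (stretch v m n)) : ∃ j, m ≤ j ∧ j ≤ n ∧
      ((s = stretch v m j ∧ t = stretch v j n) ∨ (s = stretch v j n ∧ t = stretch v m j)) := by
  obtain ⟨a, u, b, h1, rfl, rfl, h2⟩ := h
  have hle := hv.le
  have key : ∀ (v : ℤ → V) (m n : ℤ), m ≤ n → a ++ u :: b = sl v m n → ∃ j, m ≤ j ∧ j ≤ n ∧
      vset (a ++ [u]) = stretch v m j ∧ vset (u :: b) = stretch v j n := by
    intro v m n hle he
    obtain ⟨h3, h4, h5⟩ := eq_sl_of_append he (by omega)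
    have hlen := congrArg List.length h5
    rw [length_sl, List.length_cons] at hlen
    refine ⟨m + a.length, by omega, by omega, ?_, ?_⟩
    · rw [sl_cons v (by omega)] at h5
      have hl : a ++ [u] = sl v m (m + a.length) := by
        rw [sl_snoc v (by omega), (List.cons.inj h5).1, ← h4]
      rw [hl, vset_sl]
    · rw [h5, vset_sl]
  rcases h1.eq_sl hv h2.symm with he | he
  · obtain ⟨j, k1, k2, k3, k4⟩ := key v m n hle he
    exact ⟨j, k1, k2, Or.inl ⟨k3, k4⟩⟩
  · obtain ⟨j, k1, k2, k3, k4⟩ := key _ _ _ (by omega) he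
    rw [stretch_rev, neg_neg] at k3 k4
    exact ⟨-j, by omega, by omega, Or.inr ⟨k3, k4⟩⟩

theorem Line.isComp {v : ℤ → V} {m j n : ℤ} (hv : T.Line v m n) (h1 : m ≤ j) (h2 : j ≤ n) :
    T.IsComp (stretch v m j) (stretch v j n) (stretch v m n) := by
  refine ⟨sl v m (j - 1), v j, sl v (j + 1) n, ?_⟩
  rw [← sl_cons v h2, ← sl_snoc v h1, ← sl_append v h1 (by omega)]
  exact ⟨(isPath_sl hv.le).2 hv, (vset_sl _ _ _).symm, (vset_sl _ _ _).symm, (vset_sl _ _ _).symm⟩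

theorem Corner.leftTurn (c : T.Corner) : T.LeftTurn c.side c.apex c.other := ⟨c.adj, rfl⟩

theorem containsCorner_iff {v : ℤ → V} {m n : ℤ} (hv : T.Line v m n) {c : T.Corner} :
    T.ContainsCorner (stretch v m n) c ↔ ∃ i, m < i ∧ i < n ∧ v i = c.apex ∧
      ((v (i - 1) = c.side ∧ v (i + 1) = c.other) ∨
        (v (i + 1) = c.side ∧ v (i - 1) = c.other)) := by
  constructor
  · rintro ⟨l, h1, h2, h3⟩
    rcases h1.eq_sl hv h2 with rfl | rfl
    · obtain ⟨i, k1, k2, k3, k4, k5⟩ := triple_infix_sl.1 h3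
      exact ⟨i, k1, k2, k4.symm, Or.inl ⟨k3.symm, k5.symm⟩⟩
    · obtain ⟨i, k1, k2, k3, k4, k5⟩ := triple_infix_sl.1 h3
      refine ⟨-i, by omega, by omega, k4.symm, Or.inr ⟨?_, ?_⟩⟩
      · rw [k3, rev]
        congr 1
        omega
      · rw [k5, rev]
        congr 1
        omega
  · rintro ⟨i, h1, h2, h3, ⟨h4, h5⟩ | ⟨h4, h5⟩⟩
    · exact ⟨sl v m n, (isPath_sl hv.le).2 hv, vset_sl v m n,
        triple_infix_sl.2 ⟨i, h1, h2, h4.symm, h3.symm, h5.symm⟩⟩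
    · refine ⟨sl (rev v) (-n) (-m), (isPath_sl (by linarith [hv.le])).2 hv.rev, ?_,
        triple_infix_sl.2 ⟨-i, by omega, by omega, ?_, ?_, ?_⟩⟩
      · rw [vset_sl, stretch_rev, neg_neg, neg_neg]
      · rw [← h4, rev]
        congr 1
        omega
      · rw [← h3, rev, neg_neg]
      · rw [← h5, rev]
        congr 1
        omega

/-- A path through a corner has a parametrisation turning left at the corner. -/
theorem ContainsCorner.exists_param {v : ℤ → V} {m n : ℤ} (hv : T.Geo v m n) {c : T.Corner}
    (h : T.ContainsCorner (stretch v m n) c) : ∃ (w : ℤ → V) (a b k : ℤ), T.Geo w a b ∧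
      stretch w a b = stretch v m n ∧ a < k ∧ k < b ∧ w (k - 1) = c.side ∧ w k = c.apex ∧
      w (k + 1) = c.other ∧ ((w a = v m ∧ w b = v n) ∨ (w a = v n ∧ w b = v m)) := by
  obtain ⟨i, h1, h2, h3, ⟨h4, h5⟩ | ⟨h4, h5⟩⟩ := (containsCorner_iff hv.toLine).1 h
  · exact ⟨v, m, n, i, hv, rfl, h1, h2, h4, h3, h5, Or.inl ⟨rfl, rfl⟩⟩
  · refine ⟨rev v, -n, -m, -i, hv.rev, by rw [stretch_rev, neg_neg, neg_neg], by omega, by omega,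
      ?_, ?_, ?_, Or.inr ⟨by simp [rev], by simp [rev]⟩⟩
    · rw [← h4, rev]
      congr 1
      omega
    · rw [← h3, rev, neg_neg]
    · rw [← h5, rev]
      congr 1
      omega

/-- The turning rule characterising `p_{(v,F)}` in terms of a parametrisation. -/
def EtaRule (T : PlaneTree V) (X : Set (Set V)) (v : ℤ → V) (m n k : ℤ) : Prop :=
  ∀ j, m < j → j < n → (k < j → (T.TurnL v j ↔ stretch v k j ∈ X)) ∧
    (j < k → (T.TurnR v j ↔ stretch v j k ∈ X))

/-- The rule is stated for walks starting at the apex. For j < k this walk runs against the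
parametrisation, so a left turn of the walk is a right turn of v, which explains the two halves of
`EtaRule`. -/
theorem isEtaArc_iff {X : Set (Set V)} {v : ℤ → V} {m n k : ℤ} (hv : T.Geo v m n)
    (hm : T.IsLeaf (v m)) (hn : T.IsLeaf (v n)) {c : T.Corner} (h1 : m < k) (h2 : k < n)
    (hk : v k = c.apex) (hc : T.ContainsCorner (stretch v m n) c) :
    T.IsEtaArc X c (stretch v m n) ↔ T.EtaRule X v m n k := by
  have hle := hv.le
  constructor
  · rintro ⟨_, _, h⟩ j h3 h4
    have key : ∀ (v : ℤ → V) (m n j k : ℤ), T.Geo v m n → (∀ (a mid b : List V) (u : V),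
        T.IsPath (a ++ c.apex :: (mid ++ [u]) ++ b) → stretch v m n =
        vset (a ++ c.apex :: (mid ++ [u]) ++ b) → ¬T.IsLeaf u →
        (T.TurnsLeft (a ++ c.apex :: (mid ++ [u]) ++ b) u ↔ vset (c.apex :: (mid ++ [u])) ∈ X)) →
        v k = c.apex → m < j → j < n → m < k → k < j → (T.TurnL v j ↔ stretch v k j ∈ X) := by
      intro v m n j k hv h hk h3 h4 h5 h6
      have := h (sl v m (k - 1)) (sl v (k + 1) (j - 1)) (sl v (j + 1) n) (v j)
      rw [← hk, ← sl_ends v h6] at this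
      have he : sl v m (k - 1) ++ sl v k j ++ sl v (j + 1) n = sl v m n := by
        rw [sl_append v (m := m) (n := n) (j := j + 1) (by omega) (by omega), add_sub_cancel_right,
          sl_append v (m := m) (n := j) (j := k) (by omega) (by omega)]
      rw [he, vset_sl, vset_sl, turnsLeft_sl hv.toLine h3.le h4.le] at this
      rw [← this ((isPath_sl hv.le).2 hv.toLine) rfl (hv.not_isLeaf h3 h4)]
      simp [h3, h4]
    refine ⟨fun h5 => key v m n j k hv h hk h3 h4 h1 h5, fun h5 => ?_⟩
    have := key (rev v) (-n) (-m) (-j) (-k) hv.rev (by rwa [stretch_rev, neg_neg, neg_neg])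
      (by rw [rev, neg_neg, hk]) (by omega) (by omega) (by omega) (by omega)
    rwa [turnL_rev, stretch_rev, neg_neg, neg_neg] at this
  · intro h
    refine ⟨isArc_iff.2 ⟨v, m, n, by omega, hv, hm, hn, rfl⟩, hc, ?_⟩
    intro a mid b u k1 k2 k3
    have key : ∀ (v : ℤ → V) (m n : ℤ), T.Geo v m n → a ++ (c.apex :: (mid ++ [u])) ++ b = sl v m n →
        T.IsLeaf (v m) → T.IsLeaf (v n) → ∃ i j, m ≤ i ∧ i < j ∧ m < j ∧ j < n ∧ v i = c.apex ∧
        vset (c.apex :: (mid ++ [u])) = stretch v i j ∧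
        (T.TurnsLeft (a ++ c.apex :: (mid ++ [u]) ++ b) u ↔ T.TurnL v j) := by
      intro v m n hv he hm hn
      obtain ⟨i, j, e1, e2, e3, e4, rfl, e6, _, _⟩ :=
        eq_stretch_of_append he (by linarith [hv.le])
      have hjn : j < n := lt_of_le_of_ne e3 (by rintro rfl; exact k3 hn)
      refine ⟨i, j, e1, e2, by omega, hjn, e4.symm, e6, ?_⟩
      rw [he, turnsLeft_sl hv.toLine (by omega) e3]
      exact ⟨fun h => h.2.2, fun h => ⟨by omega, hjn, h⟩⟩
    rcases k1.eq_sl hv.toLine k2.symm with he | he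
    · obtain ⟨i, j, e1, e2, e3, e4, e5, e6, e7⟩ := key v m n hv he hm hn
      obtain rfl := hv.inj k i h1.le h2.le e1 (by omega) (hk.trans e5.symm)
      rw [e6, e7]
      exact (h j e3 e4).1 e2
    · obtain ⟨i, j, e1, e2, e3, e4, e5, e6, e7⟩ := key (rev v) (-n) (-m) hv.rev he
        (by simpa [rev] using hn) (by simpa [rev] using hm)
      obtain rfl : k = -i := hv.inj k (-i) h1.le h2.le (by omega) (by omega) (hk.trans e5.symm)
      rw [e6, e7, turnL_rev, stretch_rev]
      exact (h (-j) (by omega) (by omega)).2 (by omega)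

theorem IsEtaArc.exists_param {X : Set (Set V)} {c : T.Corner} {p : Set V}
    (h : T.IsEtaArc X c p) : ∃ (v : ℤ → V) (m n k : ℤ), T.Geo v m n ∧ T.IsLeaf (v m) ∧
      T.IsLeaf (v n) ∧ m < k ∧ k < n ∧ v (k - 1) = c.side ∧ v k = c.apex ∧
      v (k + 1) = c.other ∧ p = stretch v m n ∧ T.EtaRule X v m n k := by
  obtain ⟨v, m, n, _, hv, hm, hn, rfl⟩ := isArc_iff.1 h.1
  obtain ⟨w, a, b, k, hw, he, h1, h2, h3, h4, h5, h6⟩ := h.2.1.exists_param hv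
  have hl : T.IsLeaf (w a) ∧ T.IsLeaf (w b) := by
    rcases h6 with ⟨h6, h7⟩ | ⟨h6, h7⟩
    · exact ⟨h6 ▸ hm, h7 ▸ hn⟩
    · exact ⟨h6 ▸ hn, h7 ▸ hm⟩
  refine ⟨w, a, b, k, hw, hl.1, hl.2, h1, h2, h3, h4, h5, he.symm, ?_⟩
  rw [← he] at h
  exact (isEtaArc_iff hw hl.1 hl.2 h1 h2 h4 h.2.1).1 h

end Lists

/-! ### Closed sets of segments -/

section Closed

variable {V : Type*} {T : PlaneTree V}

/-- Segments have at least two vertices, so compositions with a one-vertex factor never occur and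
only proper subdivisions i < j < k count. -/
theorem isClosedSet_iff {X : Set (Set V)} : T.IsClosedSet X ↔ X ⊆ T.Seg ∧
    ∀ (v : ℤ → V) (i j k : ℤ), T.Geo v i k → i < j → j < k → stretch v i j ∈ X →
      stretch v j k ∈ X → stretch v i k ∈ X := by
  refine and_congr_right fun hX => ⟨fun h v i j k hv h1 h2 h3 h4 => ?_, fun h s hs t ht r hr hc => ?_⟩
  · refine h _ h3 _ h4 _ ?_ (hv.toLine.isComp h1.le h2.le)
    exact hv.mem_seg le_rfl (by omega) le_rfl
      (not_isLeaf_of_mem_seg (hX h3) (left_mem_stretch v h1.le))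
      (not_isLeaf_of_mem_seg (hX h4) (right_mem_stretch v h2.le))
  · obtain ⟨v, m, n, hmn, hv, h1, h2, rfl⟩ := mem_seg_iff.1 hr
    have hne : ∀ (x : V), ({x} : Set V) ∉ X := fun x hx => by
      obtain ⟨w, a, b, hab, hw, _, _, he⟩ := mem_seg_iff.1 (hX hx)
      have h1 : w a ∈ ({x} : Set V) := he ▸ left_mem_stretch w hab.le
      have h2 : w b ∈ ({x} : Set V) := he ▸ right_mem_stretch w hab.le
      have := hw.inj a b le_rfl hab.le hab.le le_rfl (h1.trans h2.symm)
      omega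
    have hself : ∀ i, stretch v i i = {v i} := fun i => by simp [stretch]
    obtain ⟨j, h3, h4, h5⟩ := hc.exists_split hv.toLine
    have hj : m < j ∧ j < n := by
      constructor
      · refine lt_of_le_of_ne h3 ?_
        rintro rfl
        rcases h5 with ⟨rfl, rfl⟩ | ⟨rfl, rfl⟩
        · exact hne _ (hself m ▸ hs)
        · exact hne _ (hself m ▸ ht)
      · refine lt_of_le_of_ne h4 ?_
        rintro rfl
        rcases h5 with ⟨rfl, rfl⟩ | ⟨rfl, rfl⟩
        · exact hne _ (hself j ▸ ht)
        · exact hne _ (hself j ▸ hs)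
    rcases h5 with ⟨rfl, rfl⟩ | ⟨rfl, rfl⟩
    · exact h v m j n hv hj.1 hj.2 hs ht
    · exact h v m j n hv hj.1 hj.2 ht hs

/-- A set of segments is coclosed if each composite segment in it has a part in it. -/
def IsCoclosed (T : PlaneTree V) (X : Set (Set V)) : Prop :=
  ∀ (v : ℤ → V) (i j k : ℤ), T.Geo v i k → i < j → j < k → stretch v i k ∈ X →
    stretch v i j ∈ X ∨ stretch v j k ∈ X

theorem isClosedSet_diff_iff {X : Set (Set V)} (hX : X ⊆ T.Seg) :
    T.IsClosedSet (T.Seg \ X) ↔ T.IsCoclosed X := by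
  rw [isClosedSet_iff]
  constructor
  · rintro ⟨_, h⟩ v i j k hv h1 h2 h3
    by_contra! hno
    have hl := not_isLeaf_of_mem_seg (hX h3) (left_mem_stretch v (h1.trans h2).le)
    have hr := not_isLeaf_of_mem_seg (hX h3) (right_mem_stretch v (h1.trans h2).le)
    have hj := hv.not_isLeaf h1 h2
    exact (h v i j k hv h1 h2 ⟨hv.mem_seg le_rfl h1 h2.le hl hj, hno.1⟩
      ⟨hv.mem_seg h1.le h2 le_rfl hj hr, hno.2⟩).2 h3
  · intro h
    refine ⟨Set.sdiff_subset, fun v i j k hv h1 h2 h3 h4 => ⟨?_, fun h5 => ?_⟩⟩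
    · exact hv.mem_seg le_rfl (by omega) le_rfl
        (not_isLeaf_of_mem_seg h3.1 (left_mem_stretch v h1.le))
        (not_isLeaf_of_mem_seg h4.1 (right_mem_stretch v h2.le))
    · exact (h v i j k hv h1 h2 h5).elim h3.2 h4.2

end Closed

/-! ### Mirror images -/

section Mirror

variable {V : Type*}

/-- The mirror image of a plane tree. -/
def mirror [Finite V] (T : PlaneTree V) : PlaneTree V where
  graph := T.graph
  isTree := T.isTree
  cw v := (T.cw v)⁻¹
  cw_cyclic v a b := (T.cw_cyclic v a b).inv
  three_le := T.three_le

variable [Finite V] {T : PlaneTree V}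

theorem leftTurn_mirror {x u y : V} : T.mirror.LeftTurn x u y ↔ T.LeftTurn y u x := by
  constructor
  · rintro ⟨h, rfl⟩
    refine ⟨((T.cw u)⁻¹ ⟨x, h⟩).2, ?_⟩
    change (((T.cw u) ((T.cw u)⁻¹ ⟨x, h⟩) : T.graph.neighborSet u) : V) = x
    simp
  · rintro ⟨h, rfl⟩
    refine ⟨((T.cw u) ⟨y, h⟩).2, ?_⟩
    change (((T.cw u)⁻¹ ((T.cw u) ⟨y, h⟩) : T.graph.neighborSet u) : V) = y
    simp

theorem turnL_mirror {v : ℤ → V} {i : ℤ} : T.mirror.TurnL v i ↔ T.TurnR v i := leftTurn_mirror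

theorem turnR_mirror {v : ℤ → V} {i : ℤ} : T.mirror.TurnR v i ↔ T.TurnL v i := leftTurn_mirror

theorem line_mirror {v : ℤ → V} {m n : ℤ} : T.mirror.Line v m n ↔ T.Line v m n :=
  ⟨fun h => ⟨h.le, h.adj, h.inj⟩, fun h => ⟨h.le, h.adj, h.inj⟩⟩

theorem geo_mirror {v : ℤ → V} {m n : ℤ} : T.mirror.Geo v m n ↔ T.Geo v m n :=
  ⟨fun h => ⟨line_mirror.1 h.toLine, fun i h1 h2 => by
      have := h.turn i h1 h2
      rw [turnL_mirror, turnR_mirror] at this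
      exact this.symm⟩,
    fun h => ⟨line_mirror.2 h.toLine, fun i h1 h2 => by
      rw [turnL_mirror, turnR_mirror]
      exact (h.turn i h1 h2).symm⟩⟩

theorem isLeaf_mirror {x : V} : T.mirror.IsLeaf x ↔ T.IsLeaf x := Iff.rfl

theorem seg_mirror : T.mirror.Seg = T.Seg := by
  ext s
  simp only [mem_seg_iff, geo_mirror, isLeaf_mirror]

theorem isArc_mirror {p : Set V} : T.mirror.IsArc p ↔ T.IsArc p := by
  simp only [isArc_iff, geo_mirror, isLeaf_mirror]

theorem isClosedSet_mirror {X : Set (Set V)} : T.mirror.IsClosedSet X ↔ T.IsClosedSet X := by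
  simp only [isClosedSet_iff, geo_mirror, seg_mirror]

theorem mirror_mirror : T.mirror.mirror = T := by
  cases T
  simp only [mirror]
  congr 1

/-- The segments of `p` bounded by a left turn and a right turn of `p`. -/
theorem mem_cSet_mirror_iff {v : ℤ → V} {m n : ℤ} (hv : T.Geo v m n) {t : Set V} :
    t ∈ T.mirror.CSet (stretch v m n) ↔ ∃ i j, m ≤ i ∧ i < j ∧ j ≤ n ∧ ¬ T.IsLeaf (v i) ∧
      ¬ T.IsLeaf (v j) ∧ t = stretch v i j ∧ (i = m ∨ T.TurnL v i) ∧ (j = n ∨ T.TurnR v j) := by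
  simp only [mem_cSet_iff (geo_mirror.2 hv), turnL_mirror, turnR_mirror, isLeaf_mirror]

end Mirror

end PlaneTree

namespace PlaneTree

/-! ### Biclosed sets -/

section Biclosed

variable {V : Type*} {T : PlaneTree V}

theorem Line.subset_of_stretch {v : ℤ → V} {m n i j a b : ℤ} (hv : T.Line v m n) (hi : m ≤ i)
    (hij : i ≤ j) (hj : j ≤ n) (ha : m ≤ a) (hb : b ≤ n) (h : stretch v i j ⊆ stretch v a b) :
    a ≤ i ∧ j ≤ b := by
  obtain ⟨k, h1, h2, h3⟩ := mem_stretch.1 (h (left_mem_stretch v hij))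
  obtain ⟨l, h4, h5, h6⟩ := mem_stretch.1 (h (right_mem_stretch v hij))
  obtain rfl := hv.inj k i (by omega) (by omega) (by omega) (by omega) h3
  obtain rfl := hv.inj l j (by omega) (by omega) (by omega) (by omega) h6
  exact ⟨h1, h5⟩

theorem Line.stretch_inj {v : ℤ → V} {m n i j a b : ℤ} (hv : T.Line v m n) (hi : m ≤ i)
    (hij : i ≤ j) (hj : j ≤ n) (ha : m ≤ a) (hab : a ≤ b) (hb : b ≤ n)
    (h : stretch v i j = stretch v a b) : i = a ∧ j = b := by
  have h1 := hv.subset_of_stretch hi hij hj ha hb h.subset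
  have h2 := hv.subset_of_stretch ha hab hb hi hj h.superset
  omega

theorem stretch_union (v : ℤ → V) {i j k : ℤ} (h1 : i ≤ j) (h2 : j ≤ k) :
    stretch v i j ∪ stretch v j k = stretch v i k := by
  rw [stretch, stretch, stretch, ← Set.image_union, Set.Icc_union_Icc_eq_Icc h1 h2]

theorem isClosedSet_seg : T.IsClosedSet T.Seg :=
  ⟨le_rfl, fun _ _ _ _ _ hr _ => hr⟩

theorem subset_closureSet (X : Set (Set V)) : X ⊆ T.closureSet X :=
  fun _ hs _ hY => hY.2 hs

theorem closureSet_subset {X Y : Set (Set V)} (hY : T.IsClosedSet Y) (h : X ⊆ Y) :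
    T.closureSet X ⊆ Y :=
  fun _ hs => hs Y ⟨hY, h⟩

theorem isClosedSet_closureSet {X : Set (Set V)} (h : X ⊆ T.Seg) :
    T.IsClosedSet (T.closureSet X) :=
  ⟨closureSet_subset isClosedSet_seg h, fun s hs t ht r hr hc Y hY =>
    hY.1.2 s (hs Y hY) t (ht Y hY) r hr hc⟩

theorem IsClosedSet.comp {X : Set (Set V)} (hX : T.IsClosedSet X) {v : ℤ → V} {m n i j k : ℤ}
    (hv : T.Geo v m n) (hi : m ≤ i) (hij : i < j) (hjk : j < k) (hk : k ≤ n)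
    (h1 : stretch v i j ∈ X) (h2 : stretch v j k ∈ X) : stretch v i k ∈ X :=
  (isClosedSet_iff.1 hX).2 v i j k (hv.sub hi (by omega) hk) hij hjk h1 h2

theorem IsCoclosed.split {X : Set (Set V)} (hX : T.IsCoclosed X) {v : ℤ → V} {m n i j k : ℤ}
    (hv : T.Geo v m n) (hi : m ≤ i) (hij : i < j) (hjk : j < k) (hk : k ≤ n)
    (h : stretch v i k ∈ X) : stretch v i j ∈ X ∨ stretch v j k ∈ X :=
  hX v i j k (hv.sub hi (by omega) hk) hij hjk h

/-- The closure of a coclosed set of segments is coclosed. -/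
theorem isCoclosed_closureSet {X : Set (Set V)} (hX : X ⊆ T.Seg) (hc : T.IsCoclosed X) :
    T.IsCoclosed (T.closureSet X) := by
  let Z := T.closureSet X
  have hZ : T.IsClosedSet Z := isClosedSet_closureSet hX
  -- Closure induction on the members of Z all of whose subdivisions have a part in Z. If [i, j] ∘
  -- [j, k] is cut at l < j, then the cut of [i, j] leaves either [i, l] in Z, or [l, j], which
  -- composes with [j, k] to [l, k]. Cuts beyond j are symmetric.
  have key : Z ⊆ {r | r ∈ Z ∧ ∀ (v : ℤ → V) (i j k : ℤ), T.Geo v i k → i < j → j < k →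
      r = stretch v i k → stretch v i j ∈ Z ∨ stretch v j k ∈ Z} := by
    refine closureSet_subset (isClosedSet_iff.2 ⟨fun r hr => hZ.1 hr.1, ?_⟩) fun r hr =>
      ⟨subset_closureSet X hr, ?_⟩
    · intro v i j k hv hij hjk h1 h2
      refine ⟨hZ.comp hv le_rfl hij hjk le_rfl h1.1 h2.1, fun w a b c hw hab hbc he => ?_⟩
      obtain ⟨l, hil, hlk, hl⟩ := hv.toLine.split hw.toLine he hab hbc
      have : stretch v i l ∈ Z ∨ stretch v l k ∈ Z := by
        rcases lt_trichotomy l j with h | rfl | h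
        · rcases h1.2 v i l j (hv.sub le_rfl hij.le hjk.le) hil h rfl with h3 | h3
          · exact Or.inl h3
          · exact Or.inr (hZ.comp hv hil.le h hjk le_rfl h3 h2.1)
        · exact Or.inl h1.1
        · rcases h2.2 v j l k (hv.sub hij.le hjk.le le_rfl) h hlk rfl with h3 | h3
          · exact Or.inl (hZ.comp hv le_rfl hij h hlk.le h1.1 h3)
          · exact Or.inr h3
      rcases hl with ⟨h3, h4⟩ | ⟨h3, h4⟩
      · rwa [h3, h4]
      · rwa [h3, h4, or_comm]
    · rintro v i j k hv hij hjk rfl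
      exact (hc v i j k hv hij hjk hr).imp (fun h => subset_closureSet X h)
        fun h => subset_closureSet X h
  intro v i j k hv hij hjk h
  exact (key h).2 v i j k hv hij hjk rfl

theorem IsCoclosed.union {X Y : Set (Set V)} (hX : T.IsCoclosed X) (hY : T.IsCoclosed Y) :
    T.IsCoclosed (X ∪ Y) := by
  rintro v i j k hv hij hjk (h | h)
  · exact (hX v i j k hv hij hjk h).imp Or.inl Or.inl
  · exact (hY v i j k hv hij hjk h).imp Or.inr Or.inr

/-- The parts `v i, …, v j` of a path with `P i` and `Q j`. -/
def window (v : ℤ → V) (m n : ℤ) (P Q : ℤ → Prop) : Set (Set V) :=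
  {t | ∃ i j, m ≤ i ∧ i < j ∧ j ≤ n ∧ P i ∧ Q j ∧ t = stretch v i j}

/-- Cutting [i, j] at k leaves [k, j] in the window if P k holds, and [i, k] if Q k holds. -/
theorem isCoclosed_window {v : ℤ → V} {m n : ℤ} {P Q : ℤ → Prop} (hv : T.Line v m n)
    (h : ∀ k, m < k → k < n → P k ∨ Q k) : T.IsCoclosed (window v m n P Q) := by
  rintro w a b c hw hab hbc ⟨i, j, h1, h2, h3, h4, h5, he⟩
  obtain ⟨k, h6, h7, h8⟩ := (hv.sub h1 h2.le h3).split hw.toLine he.symm hab hbc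
  have : stretch v i k ∈ window v m n P Q ∨ stretch v k j ∈ window v m n P Q := by
    rcases h k (by omega) (by omega) with hk | hk
    · exact Or.inr ⟨k, j, by omega, h7, h3, hk, h5, rfl⟩
    · exact Or.inl ⟨i, k, h1, h6, by omega, h4, hk, rfl⟩
  rcases h8 with ⟨h8, h9⟩ | ⟨h8, h9⟩
  · rwa [h8, h9]
  · rwa [h8, h9, or_comm]

/-- Closedness holds vacuously. Two members that can be composed share exactly one index, which is
the right end of one and the left end of the other, so both Q and P would hold there. -/
theorem isClosedSet_window {v : ℤ → V} {m n : ℤ} {P Q : ℤ → Prop} (hv : T.Line v m n)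
    (hs : window v m n P Q ⊆ T.Seg) (h : ∀ k, m < k → k < n → P k → ¬ Q k) :
    T.IsClosedSet (window v m n P Q) := by
  refine isClosedSet_iff.2 ⟨hs, ?_⟩
  rintro w a b c hw hab hbc ⟨i, j, h1, h2, h3, h4, h5, he⟩ ⟨k, l, h6, h7, h8, h9, h10, he'⟩
  have huniq : ∀ e, i ≤ e → e ≤ j → k ≤ e → e ≤ l → v e = w b := by
    intro e e1 e2 e3 e4
    have hx : v e ∈ stretch w a b := he ▸ mem_stretch.2 ⟨e, e1, e2, rfl⟩
    have hy : v e ∈ stretch w b c := he' ▸ mem_stretch.2 ⟨e, e3, e4, rfl⟩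
    obtain ⟨x, hx1, hx2, hx3⟩ := mem_stretch.1 hx
    obtain ⟨y, hy1, hy2, hy3⟩ := mem_stretch.1 hy
    have := hw.inj x y hx1 (by omega) (by omega) hy2 (hx3.trans hy3.symm)
    rw [← hx3]
    congr 1
    omega
  obtain ⟨e, e1, e2, e3⟩ := mem_stretch.1 (he ▸ right_mem_stretch w hab.le : w b ∈ stretch v i j)
  obtain ⟨f, f1, f2, f3⟩ := mem_stretch.1 (he' ▸ left_mem_stretch w hbc.le : w b ∈ stretch v k l)
  obtain rfl := hv.inj e f (by omega) (by omega) (by omega) (by omega) (e3.trans f3.symm)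
  have hall : ∀ x, i ≤ x → x ≤ j → k ≤ x → x ≤ l → x = e := fun x x1 x2 x3 x4 =>
    hv.inj x e (by omega) (by omega) (by omega) (by omega) ((huniq x x1 x2 x3 x4).trans e3.symm)
  rcases (show (e = j ∧ e = k) ∨ (e = i ∧ e = l) by
      have g1 := hall (e + 1)
      have g2 := hall (e - 1)
      omega) with ⟨rfl, rfl⟩ | ⟨rfl, rfl⟩
  · exact absurd h5 (h e (by omega) (by omega) h9)
  · exact absurd h10 (h e (by omega) (by omega) h4)

namespace Bic

theorem subset (X : T.Bic) : X.1 ⊆ T.Seg := X.2.1.1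

theorem isClosedSet (X : T.Bic) : T.IsClosedSet X.1 := X.2.1

theorem isCoclosed (X : T.Bic) : T.IsCoclosed X.1 := (isClosedSet_diff_iff X.subset).1 X.2.2

/-- A closed and coclosed set as an element of `Bic(T)`. -/
def mk' (X : Set (Set V)) (h : T.IsClosedSet X) (h' : T.IsCoclosed X) : T.Bic :=
  ⟨X, h, (isClosedSet_diff_iff h.1).2 h'⟩

/-- The complement of a biclosed set. -/
def compl (X : T.Bic) : T.Bic :=
  ⟨T.Seg \ X.1, X.2.2, by rw [Set.sdiff_sdiff_cancel_left X.subset]; exact X.2.1⟩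

theorem compl_val (X : T.Bic) : X.compl.1 = T.Seg \ X.1 := rfl

theorem mem_compl {X : T.Bic} {s : Set V} (hs : s ∈ T.Seg) : s ∈ X.compl.1 ↔ s ∉ X.1 :=
  ⟨fun h => h.2, fun h => ⟨hs, h⟩⟩

theorem compl_compl (X : T.Bic) : X.compl.compl = X :=
  Subtype.ext (Set.sdiff_sdiff_cancel_left X.subset)

end Bic

scoped instance instPartialOrderBic : PartialOrder T.Bic :=
  PartialOrder.lift Subtype.val Subtype.val_injective

namespace Bic

theorem le_iff {X Y : T.Bic} : X ≤ Y ↔ X.1 ⊆ Y.1 := Iff.rfl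

theorem compl_le_compl {X Y : T.Bic} (h : X ≤ Y) : Y.compl ≤ X.compl :=
  Set.sdiff_subset_sdiff_right h

/-- The closure of a coclosed set of segments. -/
def closure (X : Set (Set V)) (h : X ⊆ T.Seg) (h' : T.IsCoclosed X) : T.Bic :=
  mk' (T.closureSet X) (isClosedSet_closureSet h) (isCoclosed_closureSet h h')

/-- The join of two biclosed sets. -/
def join (X Y : T.Bic) : T.Bic :=
  closure (X.1 ∪ Y.1) (Set.union_subset X.subset Y.subset) (X.isCoclosed.union Y.isCoclosed)

theorem join_le {X Y Z : T.Bic} (h : X ≤ Z) (h' : Y ≤ Z) : join X Y ≤ Z :=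
  closureSet_subset Z.isClosedSet (Set.union_subset h h')

theorem le_join_left (X Y : T.Bic) : X ≤ join X Y :=
  Set.subset_union_left.trans (subset_closureSet _)

theorem le_join_right (X Y : T.Bic) : Y ≤ join X Y :=
  Set.subset_union_right.trans (subset_closureSet _)

end Bic

scoped instance instLatticeBic : Lattice T.Bic where
  sup := Bic.join
  le_sup_left := Bic.le_join_left
  le_sup_right := Bic.le_join_right
  sup_le _ _ _ := Bic.join_le
  inf X Y := (Bic.join X.compl Y.compl).compl
  inf_le_left X Y := by
    have := Bic.compl_le_compl (Bic.le_join_left X.compl Y.compl)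
    rwa [Bic.compl_compl] at this
  inf_le_right X Y := by
    have := Bic.compl_le_compl (Bic.le_join_right X.compl Y.compl)
    rwa [Bic.compl_compl] at this
  le_inf X Y Z h h' := by
    have := Bic.compl_le_compl (Bic.join_le (Bic.compl_le_compl h) (Bic.compl_le_compl h'))
    rwa [Bic.compl_compl] at this

namespace Bic

/-- Complementation as an anti-automorphism. -/
def complIso : T.Bic ≃o T.Bicᵒᵈ where
  toFun X := OrderDual.toDual X.compl
  invFun X := (OrderDual.ofDual X).compl
  left_inv X := compl_compl X
  right_inv X := congrArg OrderDual.toDual (compl_compl (OrderDual.ofDual X))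
  map_rel_iff' {X Y} := by
    constructor
    · intro h
      have h' : Y.compl ≤ X.compl := h
      have := compl_le_compl h'
      rwa [compl_compl, compl_compl] at this
    · intro h
      exact (compl_le_compl h : Y.compl ≤ X.compl)

variable [Finite V]

instance : Finite T.Bic := inferInstanceAs (Finite {X : Set (Set V) // _})

/-- Inclusion of biclosed sets is refined by adding single segments. -/
theorem exists_insert {X Y : T.Bic} (h : X < Y) :
    ∃ s, s ∈ Y.1 ∧ s ∉ X.1 ∧ ∃ Z : T.Bic, Z.1 = insert s X.1 := by
  have hne : ∃ s, s ∈ Y.1 ∧ s ∉ X.1 := by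
    by_contra! hno
    exact h.not_ge hno
  -- A shortest segment of Y outside X qualifies: at each subdivision Y contains a part, and this
  -- part, being shorter, already lies in X.
  have hcand : ∃ r, r ∈ Y.1 ∧ r ∉ X.1 ∧ T.IsCoclosed (insert r X.1) := by
    obtain ⟨r, hr, hmin⟩ := Set.exists_min_image {s | s ∈ Y.1 ∧ s ∉ X.1} Set.ncard
      (Set.toFinite _) hne
    refine ⟨r, hr.1, hr.2, ?_⟩
    rintro v i j k hv hij hjk (rfl | h')
    · have hc := hv.toLine.ncard_stretch
      have short : ∀ t ∈ Y.1, t.ncard < (stretch v i k).ncard → t ∈ X.1 := fun t ht hlt => by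
        by_contra hX
        exact hlt.not_ge (hmin t ⟨ht, hX⟩)
      have c1 := (hv.toLine.sub le_rfl hij.le hjk.le).ncard_stretch
      have c2 := (hv.toLine.sub hij.le hjk.le le_rfl).ncard_stretch
      exact (Y.isCoclosed v i j k hv hij hjk hr.1).imp
        (fun h => Or.inr (short _ h (by omega))) fun h => Or.inr (short _ h (by omega))
    · exact (X.isCoclosed v i j k hv hij hjk h').imp Or.inr Or.inr
  -- Taking a longest candidate makes X ∪ {r} closed as well: a composite of r with a member of X
  -- that is missing from X would give a longer candidate.
  obtain ⟨r, ⟨hrY, hrX, hrc⟩, hmax⟩ := Set.exists_max_image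
    {r | r ∈ Y.1 ∧ r ∉ X.1 ∧ T.IsCoclosed (insert r X.1)} Set.ncard (Set.toFinite _) hcand
  have hsub : insert r X.1 ⊆ Y.1 := Set.insert_subset hrY h.le
  -- Induction on the length of the appended segment [b, c]. Cuts of [a, c] before b are handled by
  -- coclosedness of X ∪ {r}, cuts after b by coclosedness of X and the induction hypothesis.
  have ext : ∀ (k : ℕ) (v : ℤ → V) (a b c : ℤ), T.Geo v a c → a < b → b < c → c - b ≤ k →
      stretch v a b = r → stretch v b c ∈ X.1 → stretch v a c ∈ X.1 := by
    intro k
    induction k with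
    | zero => intro v a b c _ _ _ _; omega
    | succ k ih =>
      intro v a b c hv hab hbc hk h1 h2
      by_contra hX
      have hY : stretch v a c ∈ Y.1 :=
        Y.isClosedSet.comp hv le_rfl hab hbc le_rfl (h1 ▸ hrY) (h.le h2)
      have hco : T.IsCoclosed (insert (stretch v a c) X.1) := by
        rintro w i j l hw hij hjl (he | h')
        · obtain ⟨x, hax, hxc, hx⟩ := hv.toLine.split hw.toLine he.symm hij hjl
          have : stretch v a x ∈ X.1 ∨ stretch v x c ∈ X.1 := by
            rcases lt_trichotomy x b with hxb | rfl | hxb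
            · have hne1 : stretch v a x ≠ r := fun he => by
                have := hv.toLine.stretch_inj le_rfl hax.le hxc.le le_rfl hab.le hbc.le
                  (he.trans h1.symm)
                omega
              have hne2 : stretch v x b ≠ r := fun he => by
                have := hv.toLine.stretch_inj hax.le hxb.le hbc.le le_rfl hab.le hbc.le
                  (he.trans h1.symm)
                omega
              rcases hrc.split hv le_rfl hax hxb hbc.le (Or.inl h1) with h3 | h3
              · exact Or.inl (h3.resolve_left hne1)
              · exact Or.inr (X.isClosedSet.comp hv hax.le hxb hbc le_rfl
                  (h3.resolve_left hne2) h2)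
            · exact Or.inr h2
            · rcases X.isCoclosed.split hv hab.le hxb hxc le_rfl h2 with h3 | h3
              · exact Or.inl (ih v a b x (hv.sub le_rfl hax.le hxc.le) hab hxb
                  (by push_cast at hk; omega) h1 h3)
              · exact Or.inr h3
          rcases hx with ⟨h3, h4⟩ | ⟨h3, h4⟩
          · rw [h3, h4]
            exact this.imp Or.inr Or.inr
          · rw [h3, h4]
            exact this.symm.imp Or.inr Or.inr
        · exact (X.isCoclosed w i j l hw hij hjl h').imp Or.inr Or.inr
      have := hmax _ ⟨hY, hX, hco⟩
      have c1 := hv.toLine.ncard_stretch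
      have c2 := (hv.toLine.sub le_rfl hab.le hbc.le).ncard_stretch
      rw [h1] at c2
      omega
  refine ⟨r, hrY, hrX, mk' (insert r X.1) (isClosedSet_iff.2 ⟨hsub.trans Y.subset, ?_⟩) hrc, rfl⟩
  rintro v a b c hv hab hbc (h1 | h1) (h2 | h2)
  · have := hv.toLine.stretch_inj le_rfl hab.le hbc.le hab.le hbc.le le_rfl (h1.trans h2.symm)
    omega
  · exact Or.inr (ext (c - b).toNat v a b c hv hab hbc (by omega) h1 h2)
  · right
    have := ext (b - a).toNat (rev v) (-c) (-b) (-a) hv.rev (by omega) (by omega) (by omega)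
      (by rw [stretch_rev, neg_neg, neg_neg]; exact h2)
      (by rw [stretch_rev, neg_neg, neg_neg]; exact h1)
    rwa [stretch_rev, neg_neg, neg_neg] at this
  · exact Or.inr (X.isClosedSet.comp hv le_rfl hab hbc le_rfl h1 h2)

/-- Inclusion of biclosed sets is refined by removing single segments. -/
theorem exists_remove {X Y : T.Bic} (h : X < Y) :
    ∃ s, s ∈ Y.1 ∧ s ∉ X.1 ∧ ∃ Z : T.Bic, X ≤ Z ∧ s ∉ Z.1 ∧ Y.1 = insert s Z.1 := by
  have hlt : Y.compl < X.compl := by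
    refine lt_of_le_of_ne (compl_le_compl h.le) fun he => h.ne ?_
    rw [← compl_compl X, ← compl_compl Y, he]
  obtain ⟨s, h1, h2, Z, hZ⟩ := exists_insert hlt
  have hs : s ∈ T.Seg := h1.1
  have hsY : s ∈ Y.1 := by
    by_contra hc
    exact h2 ⟨hs, hc⟩
  have hZv : Z.compl.1 = Y.1 \ {s} := by
    ext t
    rw [compl_val, hZ, compl_val]
    simp only [Set.mem_sdiff, Set.mem_insert_iff, Set.mem_singleton_iff]
    constructor
    · rintro ⟨k1, k2⟩
      push Not at k2
      exact ⟨k2.2 k1, k2.1⟩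
    · rintro ⟨k1, k2⟩
      exact ⟨Y.subset k1, fun hc => hc.elim k2 fun hc => hc.2 k1⟩
  refine ⟨s, hsY, h1.2, Z.compl, ?_, ?_, ?_⟩
  · intro t ht
    rw [hZv]
    exact ⟨h.le ht, fun hc => h1.2 ((Set.mem_singleton_iff.1 hc) ▸ ht)⟩
  · rw [hZv]
    simp
  · rw [hZv, Set.insert_sdiff_singleton, Set.insert_eq_of_mem hsY]

theorem exists_of_covBy {X Y : T.Bic} (h : X ⋖ Y) : ∃ s, s ∉ X.1 ∧ Y.1 = insert s X.1 := by
  obtain ⟨s, h1, h2, Z, hZ⟩ := exists_insert h.lt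
  have hXZ : X < Z := by
    refine lt_of_le_of_ne (le_iff.2 (hZ ▸ Set.subset_insert s X.1)) ?_
    rintro rfl
    exact h2 (hZ ▸ Set.mem_insert s _)
  have hZY : Z ≤ Y := le_iff.2 (hZ ▸ Set.insert_subset h1 h.le)
  rcases h.eq_or_eq hXZ.le hZY with he | he
  · exact absurd he hXZ.ne'
  · exact ⟨s, h2, he ▸ hZ⟩

/-! ### Congruence-uniformity of `Bic(T)` -/

/-- The behaviour of a biclosed set at the subdivisions of a segment is prescribed by `A`. -/
def Shape (v : ℤ → V) (m n : ℤ) (A : ℤ → Prop) (X : T.Bic) : Prop :=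
  ∀ x, m < x → x < n → (stretch v m x ∈ X.1 ↔ A x) ∧ (stretch v x n ∈ X.1 ↔ ¬ A x)

/-- The biclosed sets `X`, `Y` agree on the segments of length at most that of `s`, except that
they may differ at `s` if they have the shape `A` there. -/
def ShapeRel (v : ℤ → V) (m n : ℤ) (A : ℤ → Prop) (X Y : T.Bic) : Prop :=
  (∀ t, t.ncard ≤ (stretch v m n).ncard → t ≠ stretch v m n → (t ∈ X.1 ↔ t ∈ Y.1)) ∧
    ((stretch v m n ∈ X.1 ↔ stretch v m n ∈ Y.1) ∨ Shape v m n A X)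

omit [Finite V] in
theorem ncard_lt {v : ℤ → V} {m n i j : ℤ} (hv : T.Line v m n) (hi : m ≤ i) (hij : i ≤ j)
    (hj : j ≤ n) (h : j - i < n - m) : (stretch v i j).ncard < (stretch v m n).ncard := by
  have h1 := hv.ncard_stretch
  have h2 := (hv.sub hi hij hj).ncard_stretch
  omega

variable {v : ℤ → V} {m n : ℤ} {A : ℤ → Prop} {X Y Z : T.Bic}

omit [Finite V] in
theorem Shape.congr (hv : T.Line v m n) (h : Shape v m n A X)
    (he : ∀ t, t.ncard ≤ (stretch v m n).ncard → t ≠ stretch v m n → (t ∈ X.1 ↔ t ∈ Y.1)) :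
    Shape v m n A Y := by
  intro x h1 h2
  have c1 := ncard_lt hv le_rfl h1.le h2.le (by omega)
  have c2 := ncard_lt hv h1.le h2.le le_rfl (by omega)
  rw [← he _ c1.le (fun h => by rw [h] at c1; omega), ← he _ c2.le (fun h => by rw [h] at c2; omega)]
  exact h x h1 h2

omit [Finite V] in
theorem ShapeRel.symm (hv : T.Line v m n) (h : ShapeRel v m n A X Y) : ShapeRel v m n A Y X :=
  ⟨fun t h1 h2 => (h.1 t h1 h2).symm, h.2.imp Iff.symm fun k => k.congr hv h.1⟩

omit [Finite V] in
theorem ShapeRel.trans (hv : T.Line v m n) (h : ShapeRel v m n A X Y) (h' : ShapeRel v m n A Y Z) :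
    ShapeRel v m n A X Z := by
  refine ⟨fun t h1 h2 => (h.1 t h1 h2).trans (h'.1 t h1 h2), ?_⟩
  rcases h.2 with k | k
  · exact h'.2.imp k.trans fun k' => k'.congr hv (h.symm hv).1
  · exact Or.inr k

omit [Finite V] in
/-- Short segments of a closure only depend on short segments. -/
theorem mem_closureSet_of_short {X Y : Set (Set V)} (hX : X ⊆ T.Seg) (hY : Y ⊆ T.Seg)
    {S : Set (Set V)} (hS : ∀ (v : ℤ → V) (i j k : ℤ), T.Geo v i k → i < j → j < k →
      stretch v i k ∈ S → stretch v i j ∈ S ∧ stretch v j k ∈ S)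
    (h : ∀ t ∈ S, t ∈ X → t ∈ Y) {t : Set V} (ht : t ∈ S) (hc : t ∈ T.closureSet X) :
    t ∈ T.closureSet Y := by
  have hZ := isClosedSet_closureSet hX
  have hZ' := isClosedSet_closureSet hY
  have key : T.closureSet X ⊆ {t | t ∈ T.closureSet X ∧ (t ∈ S → t ∈ T.closureSet Y)} := by
    refine closureSet_subset (isClosedSet_iff.2 ⟨fun r hr => hZ.1 hr.1, ?_⟩) fun r hr =>
      ⟨subset_closureSet X hr, fun hs => subset_closureSet Y (h r hs hr)⟩
    intro v i j k hv hij hjk h1 h2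
    refine ⟨hZ.comp hv le_rfl hij hjk le_rfl h1.1 h2.1, fun hs => ?_⟩
    obtain ⟨k1, k2⟩ := hS v i j k hv hij hjk hs
    exact hZ'.comp hv le_rfl hij hjk le_rfl (h1.2 k1) (h2.2 k2)
  exact (key hc).2 ht

-- The segments of a join up to the length of s depend only on the segments of that length in the
-- two factors. If the joins differ at s, then X and Y have shape A. The join missing s contains at
-- most one part of each subdivision of s, so the part prescribed by A remains the only one.
omit [Finite V] in
theorem ShapeRel.sup_right (hv : T.Geo v m n) (h : ShapeRel v m n A X Y) (Z : T.Bic) :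
    ShapeRel v m n A (X ⊔ Z) (Y ⊔ Z) := by
  have short : ∀ X Y : T.Bic, ShapeRel v m n A X Y → ∀ t, t.ncard ≤ (stretch v m n).ncard →
      t ≠ stretch v m n → t ∈ (X ⊔ Z).1 → t ∈ (Y ⊔ Z).1 := by
    intro X Y h t h1 h2 h3
    refine mem_closureSet_of_short (Set.union_subset X.subset Z.subset)
      (Set.union_subset Y.subset Z.subset)
      (S := {t | t.ncard ≤ (stretch v m n).ncard ∧ t ≠ stretch v m n}) ?_ ?_ ⟨h1, h2⟩ h3
    · rintro w i j k hw hij hjk ⟨k1, _⟩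
      have c1 := (ncard_lt hw.toLine le_rfl hij.le hjk.le (by omega)).trans_le k1
      have c2 := (ncard_lt hw.toLine hij.le hjk.le le_rfl (by omega)).trans_le k1
      exact ⟨⟨c1.le, fun he => by rw [he] at c1; omega⟩, ⟨c2.le, fun he => by rw [he] at c2; omega⟩⟩
    · rintro t ⟨k1, k2⟩ (k3 | k3)
      · exact Or.inl ((h.1 t k1 k2).1 k3)
      · exact Or.inr k3
  have hshort : ∀ t, t.ncard ≤ (stretch v m n).ncard → t ≠ stretch v m n →
      (t ∈ (X ⊔ Z).1 ↔ t ∈ (Y ⊔ Z).1) := fun t h1 h2 =>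
    ⟨short X Y h t h1 h2, short Y X (h.symm hv.toLine) t h1 h2⟩
  have full : ∀ X Y : T.Bic, ShapeRel v m n A X Y → stretch v m n ∈ (X ⊔ Z).1 →
      stretch v m n ∉ (Y ⊔ Z).1 → Shape v m n A (X ⊔ Z) := by
    intro X Y h h1 h2
    rcases h.2 with h3 | h3
    · refine absurd ?_ h2
      refine mem_closureSet_of_short (Set.union_subset X.subset Z.subset)
        (Set.union_subset Y.subset Z.subset)
        (S := {t | t.ncard ≤ (stretch v m n).ncard}) ?_ ?_
        (show (stretch v m n).ncard ≤ _ from le_rfl) h1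
      · rintro w i j k hw hij hjk k1
        exact ⟨(ncard_lt hw.toLine le_rfl hij.le hjk.le (by omega)).le.trans k1,
          (ncard_lt hw.toLine hij.le hjk.le le_rfl (by omega)).le.trans k1⟩
      · rintro t k1 (k3 | k3)
        · by_cases he : t = stretch v m n
          · subst he
            exact Or.inl (h3.1 k3)
          · exact Or.inl ((h.1 t k1 he).1 k3)
        · exact Or.inr k3
    · have h4 : Shape v m n A Y := h3.congr hv.toLine h.1
      intro x hx1 hx2
      have c1 := ncard_lt hv.toLine le_rfl hx1.le hx2.le (by omega)
      have c2 := ncard_lt hv.toLine hx1.le hx2.le le_rfl (by omega)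
      have n1 : stretch v m x ≠ stretch v m n := fun he => by rw [he] at c1; omega
      have n2 : stretch v x n ≠ stretch v m n := fun he => by rw [he] at c2; omega
      have hno : ¬ (stretch v m x ∈ (Y ⊔ Z).1 ∧ stretch v x n ∈ (Y ⊔ Z).1) := fun hc =>
        h2 ((Y ⊔ Z).isClosedSet.comp hv le_rfl hx1 hx2 le_rfl hc.1 hc.2)
      have s1 := short X Y h _ c1.le n1
      have s2 := short X Y h _ c2.le n2
      have t1 := (h3 x hx1 hx2)
      have t2 := (h4 x hx1 hx2)
      by_cases hA : A x
      · have u1 := le_sup_left (a := X) (b := Z) (t1.1.2 hA)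
        exact ⟨iff_of_true u1 hA, iff_of_false (fun hc => hno ⟨s1 u1, s2 hc⟩) (not_not.2 hA)⟩
      · have u1 := le_sup_left (a := X) (b := Z) (t1.2.2 hA)
        exact ⟨iff_of_false (fun hc => hno ⟨s1 hc, s2 u1⟩) hA, iff_of_true u1 hA⟩
  refine ⟨hshort, ?_⟩
  by_cases h1 : stretch v m n ∈ (X ⊔ Z).1 <;> by_cases h2 : stretch v m n ∈ (Y ⊔ Z).1
  · exact Or.inl (iff_of_true h1 h2)
  · exact Or.inr (full X Y h h1 h2)
  · refine Or.inr ((full Y X (h.symm hv.toLine) h2 h1).congr hv.toLine fun t k1 k2 =>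
      (hshort t k1 k2).symm)
  · exact Or.inl (iff_of_false h1 h2)

-- Complementation exchanges the present and the absent part of each subdivision, so A is negated.
-- This reduces compatibility with meets to compatibility with joins.
omit [Finite V] in
theorem ShapeRel.compl (hv : T.Geo v m n) (hs : stretch v m n ∈ T.Seg)
    (h : ShapeRel v m n A X Y) : ShapeRel v m n (fun x => ¬ A x) X.compl Y.compl := by
  have hm := not_isLeaf_of_mem_seg hs (left_mem_stretch v hv.le)
  have hn := not_isLeaf_of_mem_seg hs (right_mem_stretch v hv.le)
  refine ⟨fun t h1 h2 => and_congr_right fun _ => not_congr (h.1 t h1 h2), ?_⟩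
  refine h.2.imp (fun k => and_congr_right fun _ => not_congr k) fun k x h1 h2 => ?_
  have hx := hv.not_isLeaf h1 h2
  rw [mem_compl (hv.mem_seg le_rfl h1 h2.le hm hx), mem_compl (hv.mem_seg h1.le h2 le_rfl hx hn)]
  exact ⟨not_congr (k x h1 h2).1, not_congr (k x h1 h2).2⟩

omit [Finite V] in
theorem ShapeRel.sup (hv : T.Geo v m n) {X Y X' Y' : T.Bic} (h : ShapeRel v m n A X Y)
    (h' : ShapeRel v m n A X' Y') : ShapeRel v m n A (X ⊔ X') (Y ⊔ Y') := by
  have h1 := h.sup_right hv X'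
  have h2 := h'.sup_right hv Y
  rw [sup_comm X' Y, sup_comm Y' Y] at h2
  exact h1.trans hv.toLine h2

/-- The congruence contracting the covers labelled by a segment with a given shape. -/
def shapeCon (hv : T.Geo v m n) (hs : stretch v m n ∈ T.Seg) (A : ℤ → Prop) :
    LatticeCon T.Bic where
  r := ShapeRel v m n A
  iseqv := ⟨fun _ => ⟨fun _ _ _ => Iff.rfl, Or.inl Iff.rfl⟩, fun h => h.symm hv.toLine,
    fun h h' => h.trans hv.toLine h'⟩
  sup h h' := h.sup hv h'
  inf {W X Y Z} h h' := by
    have h1 := ((h.compl hv hs).sup hv (h'.compl hv hs)).compl hv hs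
    simp only [not_not] at h1
    exact h1

-- At each subdivision of the inserted segment, Z contains not both parts, being closed without it,
-- and at least one, because Y is coclosed. So a cover always determines a shape.
omit [Finite V] in
theorem shape_of_insert (hv : T.Geo v m n) {A : ℤ → Prop} {Y Z : T.Bic}
    (hZ : stretch v m n ∉ Z.1) (hY : Y.1 = insert (stretch v m n) Z.1)
    (hA : ∀ x, m < x → x < n → (stretch v m x ∈ Z.1 ↔ A x)) : Shape v m n A Z := by
  intro x h1 h2
  refine ⟨hA x h1 h2, ?_⟩
  rw [← hA x h1 h2]
  refine ⟨fun h h' => hZ (Z.isClosedSet.comp hv le_rfl h1 h2 le_rfl h' h), fun h => ?_⟩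
  have hY' : stretch v m n ∈ Y.1 := hY ▸ Set.mem_insert _ _
  have := Y.isCoclosed.split hv le_rfl h1 h2 le_rfl hY'
  rw [hY] at this
  rcases this with (k | k) | (k | k)
  · have := hv.toLine.stretch_inj le_rfl h1.le h2.le le_rfl hv.le le_rfl k
    omega
  · exact absurd k h
  · have := hv.toLine.stretch_inj h1.le h2.le le_rfl le_rfl hv.le le_rfl k
    omega
  · exact k

/-- The least biclosed set with a given shape at a segment. -/
def shapeJoinIrr (hv : T.Geo v m n) (hs : stretch v m n ∈ T.Seg) (A : ℤ → Prop) : T.Bic :=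
  mk' (window v m n (fun i => i = m ∨ ¬ A i) (fun j => j = n ∨ A j))
    (isClosedSet_window hv.toLine (by
      rintro t ⟨i, j, h1, h2, h3, -, -, rfl⟩
      exact hv.mem_seg h1 h2 h3
        (not_isLeaf_of_mem_seg hs (mem_stretch.2 ⟨i, h1, by omega, rfl⟩))
        (not_isLeaf_of_mem_seg hs (mem_stretch.2 ⟨j, by omega, h3, rfl⟩))) (by
      intro k h1 h2 h3 h4
      exact (h3.resolve_left (by omega)) (h4.resolve_left (by omega))))
    (isCoclosed_window hv.toLine fun k _ _ => by
      by_cases h : A k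
      · exact Or.inr (Or.inr h)
      · exact Or.inl (Or.inr h))

-- For a member [i, j] of the window with both ends inside, Z contains [m, j] but not [m, i], so
-- coclosedness puts [i, j] into Z.
omit [Finite V] in
theorem shapeJoinIrr_le (hv : T.Geo v m n) (hs : stretch v m n ∈ T.Seg) {A : ℤ → Prop}
    {Y Z : T.Bic} (hY : Y.1 = insert (stretch v m n) Z.1) (hA : Shape v m n A Z) :
    shapeJoinIrr hv hs A ≤ Y := by
  rintro t ⟨i, j, h1, h2, h3, h4, h5, rfl⟩
  rw [hY]
  rcases h1.eq_or_lt with rfl | h1 <;> rcases h3.eq_or_lt with rfl | h3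
  · exact Or.inl rfl
  · exact Or.inr ((hA j h2 h3).1.2 (h5.resolve_left h3.ne))
  · exact Or.inr ((hA i h1 h2).2.2 (h4.resolve_left h1.ne'))
  · have hi := h4.resolve_left h1.ne'
    have hj := h5.resolve_left h3.ne
    have := (hA j (by omega) h3).1.2 hj
    right
    refine (Z.isCoclosed.split hv le_rfl h1 h2 h3.le this).resolve_left fun hc => ?_
    exact hi ((hA i h1 (by omega)).1.1 hc)

/-- The congruences contracting the cover below Y determine the inserted segment and its shape, by
`shapeCon`. These in turn determine Y, which must be the corresponding `shapeJoinIrr`. -/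
theorem separatesJoinIrreducibles : SeparatesJoinIrreducibles T.Bic := by
  -- The congruence attached to the longer of the two segments is used, since `ShapeRel` controls
  -- only segments up to that length.
  have key : ∀ (Y Y' Z Z' : T.Bic) (s s' : Set V), SupIrred Y → SupIrred Y' → Z ⋖ Y → Z' ⋖ Y' →
      s ∉ Z.1 → Y.1 = insert s Z.1 → s' ∉ Z'.1 → Y'.1 = insert s' Z'.1 → s'.ncard ≤ s.ncard →
      (∀ θ : LatticeCon T.Bic, θ.r Z Y ↔ θ.r Z' Y') → Y = Y' := by
    intro Y Y' Z Z' s s' hY hY' hZY hZY' hs hYs hs' hYs' hle hθ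
    have hseg : s ∈ T.Seg := Y.subset (hYs ▸ Set.mem_insert _ _)
    obtain ⟨v, m, n, hmn, hv, _, _, rfl⟩ := mem_seg_iff.1 hseg
    have hshape : Shape v m n (fun x => stretch v m x ∈ Z.1) Z :=
      shape_of_insert hv hs hYs fun _ _ _ => Iff.rfl
    have h1 : (shapeCon hv hseg fun x => stretch v m x ∈ Z.1).r Z Y := by
      refine ⟨fun t _ ht => ?_, Or.inr hshape⟩
      rw [hYs]
      exact ⟨Or.inr, fun h => h.resolve_left ht⟩
    have h2 : ShapeRel v m n (fun x => stretch v m x ∈ Z.1) Z' Y' := (hθ _).1 h1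
    have hmem : s' ∈ Y'.1 := hYs' ▸ Set.mem_insert _ _
    obtain rfl : s' = stretch v m n := by
      by_contra hne
      exact hs' ((h2.1 s' hle hne).2 hmem)
    have h3 : Shape v m n (fun x => stretch v m x ∈ Z.1) Z' :=
      h2.2.resolve_left fun h => hs' (h.2 hmem)
    -- Everything strictly below the join-irreducible Y lies below its lower cover Z, which misses
    -- the segment.
    have huniq : ∀ Y Z : T.Bic, SupIrred Y → Z ⋖ Y → stretch v m n ∉ Z.1 → 
        ∀ J : T.Bic, J ≤ Y → stretch v m n ∈ J.1 → J = Y := by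
      intro Y Z hY hZ hs J hJ hJs
      by_contra hne
      exact hs (hY.le_of_lt hZ (lt_of_le_of_ne hJ hne) hJs)
    have hJ : stretch v m n ∈ (shapeJoinIrr hv hseg fun x => stretch v m x ∈ Z.1).1 :=
      ⟨m, n, le_rfl, hmn, le_rfl, Or.inl rfl, Or.inl rfl, rfl⟩
    rw [← huniq Y Z hY hZY hs _ (shapeJoinIrr_le hv hseg hYs hshape) hJ,
      ← huniq Y' Z' hY' hZY' hs' _ (shapeJoinIrr_le hv hseg hYs' h3) hJ]
  intro Y Y' Z Z' hY hY' hZY hZY' hθ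
  obtain ⟨s, hs, hYs⟩ := exists_of_covBy hZY
  obtain ⟨s', hs', hYs'⟩ := exists_of_covBy hZY'
  rcases le_total s'.ncard s.ncard with h | h
  · exact key Y Y' Z Z' s s' hY hY' hZY hZY' hs hYs hs' hYs' h hθ
  · exact (key Y' Y Z' Z s' s hY' hY hZY' hZY hs' hYs' hs hYs h fun θ => (hθ θ).symm).symm

/-- Complementation as a lattice homomorphism to the dual. -/
def complHom : LatticeHom T.Bic T.Bicᵒᵈ where
  toFun := complIso
  map_sup' := map_sup complIso
  map_inf' := map_inf complIso

omit [Finite V] in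
theorem complHom_surjective : Function.Surjective (complHom (T := T)) := complIso.surjective

/-! ### Polygonality of `Bic(T)` -/

/-- `u` is the concatenation of `s` and `t`. -/
def Concat (T : PlaneTree V) (s t u : Set V) : Prop :=
  ∃ (v : ℤ → V) (i j k : ℤ), T.Geo v i k ∧ i < j ∧ j < k ∧ u = stretch v i k ∧
    s = stretch v i j ∧ t = stretch v j k

omit [Finite V] in
theorem Concat.symm {s t u : Set V} (h : Concat T s t u) : Concat T t s u := by
  obtain ⟨v, i, j, k, h1, h2, h3, rfl, rfl, rfl⟩ := h
  exact ⟨rev v, -k, -j, -i, h1.rev, by omega, by omega, by simp [stretch_rev],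
    by simp [stretch_rev], by simp [stretch_rev]⟩

omit [Finite V] in
theorem Concat.eq_union {s t u : Set V} (h : Concat T s t u) : u = s ∪ t := by
  obtain ⟨v, i, j, k, h1, h2, h3, rfl, rfl, rfl⟩ := h
  rw [stretch_union v h2.le h3.le]

omit [Finite V] in
theorem Concat.exists_split {s t : Set V} {v : ℤ → V} {i j : ℤ} (hv : T.Geo v i j)
    (h : Concat T s t (stretch v i j)) : ∃ l, i < l ∧ l < j ∧
      ((s = stretch v i l ∧ t = stretch v l j) ∨ (t = stretch v i l ∧ s = stretch v l j)) := by
  obtain ⟨w, a, b, c, h1, h2, h3, he, rfl, rfl⟩ := h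
  obtain ⟨l, h4, h5, h6⟩ := hv.toLine.split h1.toLine he h2 h3
  exact ⟨l, h4, h5, h6.imp id fun h => h.symm⟩

omit [Finite V] in
/-- The join of two biclosed sets that cover a third one. -/
theorem sup_subset_of_insert {X Y Z : T.Bic} {s t : Set V} (hY : Y.1 = insert s X.1)
    (hZ : Z.1 = insert t X.1) :
    ∀ u ∈ (Y ⊔ Z).1, u ∈ X.1 ∨ u = s ∨ u = t ∨ Concat T s t u := by
  have hsub : Y.1 ∪ Z.1 ⊆ T.Seg := Set.union_subset Y.subset Z.subset
  have hYc := Y.isClosedSet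
  have hZc := Z.isClosedSet
  rw [hY] at hYc
  rw [hZ] at hZc
  -- The segment [l, k] lies in X ∪ {t} by closedness and differs from t because it is longer, so it
  -- lies in X. Prefixing s then stays in X ∪ {s}.
  have aux : ∀ (s t : Set V), T.IsClosedSet (insert s X.1) → T.IsClosedSet (insert t X.1) →
      ∀ (v : ℤ → V) (i l j k : ℤ), T.Geo v i k → i < l → l < j → j < k → stretch v i l = s →
      stretch v l j = t → stretch v j k ∈ X.1 → stretch v i k ∈ insert s X.1 := by
    intro s t hs ht v i l j k hv h1 h2 h3 h4 h5 h6
    have h7 := ht.comp hv h1.le h2 h3 le_rfl (Or.inl h5) (Or.inr h6)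
    have h8 : stretch v l k ∈ X.1 := h7.resolve_left fun he => by
      have := hv.toLine.stretch_inj h1.le (by omega) le_rfl h1.le h2.le h3.le (he.trans h5.symm)
      omega
    exact hs.comp hv le_rfl h1 (by omega) le_rfl (Or.inl h4) (Or.inr h8)
  -- A piece following a concatenation of s and t occupies new positions on the path. It can
  -- therefore be neither s, nor t, nor another concatenation of them, and only members of X are
  -- left, to which `aux` applies.
  have aux' : ∀ (v : ℤ → V) (i j k : ℤ), T.Geo v i k → i < j → j < k →
      Concat T s t (stretch v i j) → (stretch v j k ∈ X.1 ∨ stretch v j k = s ∨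
        stretch v j k = t ∨ Concat T s t (stretch v j k)) →
      stretch v i k ∈ X.1 ∨ stretch v i k = s ∨ stretch v i k = t := by
    intro v i j k hv hij hjk h1 h2
    obtain ⟨l, hl1, hl2, hl⟩ := h1.exists_split (hv.sub le_rfl hij.le hjk.le)
    have hcontra : ∀ (x : Set V) (a b : ℤ), j ≤ a → a < b → b ≤ k → x = stretch v a b →
        (x = s ∨ x = t) → False := by
      intro x a b ha hab hb hx hst
      have : stretch v a b = stretch v i l ∨ stretch v a b = stretch v l j := by
        rw [← hx]
        rcases hl with ⟨e1, e2⟩ | ⟨e1, e2⟩ <;> rw [← e1, ← e2]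
        · exact hst
        · exact hst.symm
      rcases this with h | h
      · have := hv.toLine.stretch_inj (by omega) hab.le hb le_rfl hl1.le (by omega) h
        omega
      · have := hv.toLine.stretch_inj (by omega) hab.le hb hl1.le hl2.le hjk.le h
        omega
    rcases h2 with h2 | h2 | h2 | h2
    · rcases hl with ⟨e1, e2⟩ | ⟨e1, e2⟩
      · exact (aux s t hYc hZc v i l j k hv hl1 hl2 hjk e1.symm e2.symm h2).elim
          (fun h => Or.inr (Or.inl h)) Or.inl
      · exact (aux t s hZc hYc v i l j k hv hl1 hl2 hjk e1.symm e2.symm h2).elim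
          (fun h => Or.inr (Or.inr h)) Or.inl
    · exact (hcontra _ j k le_rfl hjk le_rfl rfl (Or.inl h2)).elim
    · exact (hcontra _ j k le_rfl hjk le_rfl rfl (Or.inr h2)).elim
    · obtain ⟨x, hx1, hx2, hx⟩ := h2.exists_split (hv.sub hij.le hjk.le le_rfl)
      rcases hx with ⟨e1, _⟩ | ⟨e1, _⟩
      · exact (hcontra _ j x le_rfl hx1 hx2.le e1 (Or.inl rfl)).elim
      · exact (hcontra _ j x le_rfl hx1 hx2.le e1 (Or.inr rfl)).elim
  have hclosed : T.IsClosedSet {u | u ∈ T.Seg ∧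
      (u ∈ X.1 ∨ u = s ∨ u = t ∨ Concat T s t u)} := by
    refine isClosedSet_iff.2 ⟨fun u hu => hu.1, ?_⟩
    intro v i j k hv hij hjk h1 h2
    refine ⟨isClosedSet_seg.comp hv le_rfl hij hjk le_rfl h1.1 h2.1, ?_⟩
    have inY : ∀ u, (u ∈ X.1 ∨ u = s) → u ∈ insert s X.1 := fun u h => h.symm
    have inZ : ∀ u, (u ∈ X.1 ∨ u = t) → u ∈ insert t X.1 := fun u h => h.symm
    have cY : stretch v i j ∈ insert s X.1 → stretch v j k ∈ insert s X.1 →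
        stretch v i k ∈ X.1 ∨ stretch v i k = s ∨ stretch v i k = t ∨
        Concat T s t (stretch v i k) := fun a b =>
      (hYc.comp hv le_rfl hij hjk le_rfl a b).elim (fun h => Or.inr (Or.inl h)) Or.inl
    have cZ : stretch v i j ∈ insert t X.1 → stretch v j k ∈ insert t X.1 →
        stretch v i k ∈ X.1 ∨ stretch v i k = s ∨ stretch v i k = t ∨
        Concat T s t (stretch v i k) := fun a b =>
      (hZc.comp hv le_rfl hij hjk le_rfl a b).elim (fun h => Or.inr (Or.inr (Or.inl h))) Or.inl
    rcases h1.2 with a | a | a | a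
    · rcases h2.2 with b | b | b | b
      · exact cY (Or.inr a) (Or.inr b)
      · exact cY (Or.inr a) (Or.inl b)
      · exact cZ (Or.inr a) (Or.inl b)
      · have := aux' (rev v) (-k) (-j) (-i) hv.rev (by omega) (by omega)
          (by simpa [stretch_rev] using b) (by simpa [stretch_rev] using h1.2)
        simp only [stretch_rev, neg_neg] at this
        exact this.imp id fun h => h.imp id Or.inl
    · rcases h2.2 with b | b | b | b
      · exact cY (Or.inl a) (Or.inr b)
      · exact cY (Or.inl a) (Or.inl b)
      · exact Or.inr (Or.inr (Or.inr ⟨v, i, j, k, hv, hij, hjk, rfl, a.symm, b.symm⟩))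
      · have := aux' (rev v) (-k) (-j) (-i) hv.rev (by omega) (by omega)
          (by simpa [stretch_rev] using b) (by simpa [stretch_rev] using h1.2)
        simp only [stretch_rev, neg_neg] at this
        exact this.imp id fun h => h.imp id Or.inl
    · rcases h2.2 with b | b | b | b
      · exact cZ (Or.inl a) (Or.inr b)
      · exact Or.inr (Or.inr (Or.inr
          (Concat.symm ⟨v, i, j, k, hv, hij, hjk, rfl, a.symm, b.symm⟩)))
      · exact cZ (Or.inl a) (Or.inl b)
      · have := aux' (rev v) (-k) (-j) (-i) hv.rev (by omega) (by omega)
          (by simpa [stretch_rev] using b) (by simpa [stretch_rev] using h1.2)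
        simp only [stretch_rev, neg_neg] at this
        exact this.imp id fun h => h.imp id Or.inl
    · exact (aux' v i j k hv hij hjk a h2.2).imp id fun h => h.imp id Or.inl
  intro u hu
  have h0 : Y.1 ∪ Z.1 ⊆ {u | u ∈ T.Seg ∧ (u ∈ X.1 ∨ u = s ∨ u = t ∨ Concat T s t u)} := by
    intro u hu
    refine ⟨hsub hu, ?_⟩
    rw [hY, hZ] at hu
    rcases hu with (h | h) | (h | h)
    · exact Or.inr (Or.inl h)
    · exact Or.inl h
    · exact Or.inr (Or.inr (Or.inl h))
    · exact Or.inl h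
  exact (closureSet_subset hclosed h0 hu).2

/-- The join adds to X at most s, t and their concatenations, and a concatenation in either order
has vertex set s ∪ t. Any W above X in the interval and different from X contains s or t, by
coclosedness. Those above Y but not above Z are Y with or without s ∪ t, hence comparable. -/
theorem upperPolygonal : UpperPolygonal T.Bic := by
  intro X Y Z hXY hXZ hne
  obtain ⟨s, hs, hY⟩ := exists_of_covBy hXY
  obtain ⟨t, ht, hZ⟩ := exists_of_covBy hXZ
  have hsup := sup_subset_of_insert hY hZ
  have hYle : ∀ W : T.Bic, X ≤ W → s ∈ W.1 → Y ≤ W := fun W h h' =>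
    le_iff.2 (hY ▸ Set.insert_subset h' h)
  have hZle : ∀ W : T.Bic, X ≤ W → t ∈ W.1 → Z ≤ W := fun W h h' =>
    le_iff.2 (hZ ▸ Set.insert_subset h' h)
  have hsplit : ∀ (W : T.Bic) u, u ∈ W.1 → Concat T s t u → s ∈ W.1 ∨ t ∈ W.1 := by
    rintro W _ hu ⟨v, i, j, k, hv, hij, hjk, rfl, rfl, rfl⟩
    exact W.isCoclosed v i j k hv hij hjk hu
  constructor
  · intro W hXW hW
    by_cases hWX : W ≤ X
    · exact Or.inl (le_antisymm hWX hXW)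
    · obtain ⟨u, hu, huX⟩ := Set.not_subset.1 hWX
      right
      rcases hsup u (hW hu) with h | rfl | rfl | h
      · exact absurd h huX
      · exact Or.inl (hYle W hXW hu)
      · exact Or.inr (hZle W hXW hu)
      · exact (hsplit W u hu h).imp (hYle W hXW) (hZle W hXW)
  · intro W W' hW hW' hYW hYW' hZW hZW'
    have mem : ∀ W : T.Bic, W ≤ Y ⊔ Z → Y ≤ W → ¬ Z ≤ W → ∀ u ∈ W.1, u ∈ Y.1 ∨ u = s ∪ t := by
      intro W hW hYW hZW u hu
      have hXW := hXY.le.trans hYW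
      rcases hsup u (hW hu) with h | rfl | rfl | h
      · exact Or.inl (hXY.le h)
      · exact Or.inl (hY ▸ Set.mem_insert _ _)
      · exact absurd (hZle W hXW hu) hZW
      · exact Or.inr h.eq_union
    by_cases hst : s ∪ t ∈ W'.1
    · left
      intro u hu
      rcases mem W hW hYW hZW u hu with h | rfl
      · exact hYW' h
      · exact hst
    · right
      intro u hu
      rcases mem W' hW' hYW' hZW' u hu with h | rfl
      · exact hYW h
      · exact absurd hu hst

end Bic

end Biclosed

end PlaneTree

namespace PlaneTree

/-! ### Boundary arcs -/

section Boundary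

variable {V : Type*} {T : PlaneTree V}

/-- The left-hand side of `e` follows that of `d` along a common face. -/
def FaceStep (T : PlaneTree V) (d e : T.graph.Dart) : Prop :=
  d.snd = e.fst ∧ ¬ T.IsLeaf d.snd ∧ T.LeftTurn d.fst d.snd e.snd

theorem FaceStep.right_unique {d e e' : T.graph.Dart} (h : T.FaceStep d e)
    (h' : T.FaceStep d e') : e = e' :=
  SimpleGraph.Dart.ext _ _ (Prod.ext (h.1.symm.trans h'.1) (h.2.2.right_unique h'.2.2))

theorem FaceStep.left_unique {d d' e : T.graph.Dart} (h : T.FaceStep d e)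
    (h' : T.FaceStep d' e) : d = d' := by
  have h1 : d.snd = d'.snd := h.1.trans h'.1.symm
  have h2 := h.2.2
  rw [h1] at h2
  exact SimpleGraph.Dart.ext _ _ (Prod.ext (h2.left_unique h'.2.2) h1)

/-- `FaceStep` is deterministic in both directions, so the generated equivalence reduces to
reachability one way or the other. -/
theorem reflTransGen_of_leftFace_eq {d e : T.graph.Dart} (h : T.leftFace d = T.leftFace e) :
    Relation.ReflTransGen T.FaceStep d e ∨ Relation.ReflTransGen T.FaceStep e d := by
  have h' : Relation.EqvGen T.FaceStep d e := Quot.eqvGen_exact h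
  clear h
  induction h' with
  | rel x y h => exact Or.inl (Relation.ReflTransGen.single h)
  | refl x => exact Or.inl Relation.ReflTransGen.refl
  | symm x y _ ih => exact ih.symm
  | trans x y z _ _ ih1 ih2 =>
    rcases ih1 with h1 | h1 <;> rcases ih2 with h2 | h2
    · exact Or.inl (h1.trans h2)
    · have := Relation.ReflTransGen.total_of_right_unique (r := Function.swap T.FaceStep)
        (fun a b c h h' => FaceStep.left_unique h h')
        (Relation.reflTransGen_swap.2 h1) (Relation.reflTransGen_swap.2 h2)
      rcases this with h | h
      · exact Or.inr (Relation.reflTransGen_swap.1 h)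
      · exact Or.inl (Relation.reflTransGen_swap.1 h)
    · exact Relation.ReflTransGen.total_of_right_unique
        (fun a b c h h' => FaceStep.right_unique h h') h1 h2
    · exact Or.inr (h2.trans h1)

variable [Finite V]

/-- Walking along a face never backtracks, since a left turn at an interior vertex leads to another
neighbour; in a tree such a walk is a path. -/
theorem exists_line_of_reflTransGen {d e : T.graph.Dart}
    (h : Relation.ReflTransGen T.FaceStep d e) : ∃ (x : ℤ → V) (n : ℤ), 1 ≤ n ∧ T.Line x 0 n ∧
      (∀ i, 0 < i → i < n → T.TurnL x i) ∧ x 0 = d.fst ∧ x 1 = d.snd ∧ x (n - 1) = e.fst ∧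
      x n = e.snd := by
  induction h with
  | refl =>
    have hne := d.adj.ne
    refine ⟨fun i => if i ≤ 0 then d.fst else d.snd, 1, le_rfl, ⟨by omega, ?_, ?_⟩, ?_, by simp,
      by simp, by simp, by simp⟩
    · intro i h1 h2
      obtain rfl : i = 0 := by omega
      simp
    · intro i j h1 h2 h3 h4 he
      by_contra hij
      rcases (show (i = 0 ∧ j = 1) ∨ (i = 1 ∧ j = 0) by omega) with ⟨rfl, rfl⟩ | ⟨rfl, rfl⟩
      · exact hne he
      · exact hne (by simpa using he.symm)
    · intro i h1 h2
      omega
  | @tail f e _ hstep ih =>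
    obtain ⟨x, n, hn, hx, hturn, h0, h1, h2, h3⟩ := ih
    obtain ⟨k1, k2, k3⟩ := hstep
    have hup : ∀ i, i ≤ n → Function.update x (n + 1) e.snd i = x i := fun i hi =>
      Function.update_of_ne (by omega) _ _
    refine ⟨Function.update x (n + 1) e.snd, n + 1, by omega, hx.snoc (by omega) ?_ ?_, ?_, ?_, ?_,
      ?_, ?_⟩
    · rw [h3]
      exact k3.adj_right
    · rw [h2]
      exact (k3.ne k2).symm
    · intro i hi hi'
      rcases (show i < n ∨ i = n by omega) with hi' | rfl
      · rw [turnL_congr (hup _ (by omega)) (hup _ (by omega)) (hup _ (by omega))]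
        exact hturn i hi hi'
      · rw [TurnL, hup _ le_rfl, hup (i - 1) (by omega), Function.update_self, h2, h3]
        exact k3
    · rw [hup _ (by omega), h0]
    · rw [hup _ (by omega), h1]
    · rw [add_sub_cancel_right, hup _ le_rfl, h3, k1]
    · rw [Function.update_self]

/-- Two vertices on a common face are joined by a path with left turns only. -/
theorem OnFace.exists_line {u w : V} {F : T.Face} (hu : T.OnFace u F) (hw : T.OnFace w F) :
    ∃ (x : ℤ → V) (n a b : ℤ), T.Line x 0 n ∧ (∀ i, 0 < i → i < n → T.TurnL x i) ∧
      0 ≤ a ∧ a ≤ n ∧ 0 ≤ b ∧ b ≤ n ∧ x a = u ∧ x b = w := by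
  obtain ⟨d, hd, rfl⟩ := hu
  obtain ⟨e, he, hF⟩ := hw
  have key : ∀ (d e : T.graph.Dart) (u w : V), (d.fst = u ∨ d.snd = u) → (e.fst = w ∨ e.snd = w) →
      Relation.ReflTransGen T.FaceStep d e →
      ∃ (x : ℤ → V) (n a b : ℤ), T.Line x 0 n ∧ (∀ i, 0 < i → i < n → T.TurnL x i) ∧
      0 ≤ a ∧ a ≤ n ∧ 0 ≤ b ∧ b ≤ n ∧ x a = u ∧ x b = w := by
    intro d e u w hd he h
    obtain ⟨x, n, hn, hx, hturn, h0, h1, h2, h3⟩ := exists_line_of_reflTransGen h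
    have ha : ∃ a, 0 ≤ a ∧ a ≤ n ∧ x a = u := by
      rcases hd with rfl | rfl
      · exact ⟨0, by omega, by omega, h0⟩
      · exact ⟨1, by omega, by omega, h1⟩
    have hb : ∃ b, 0 ≤ b ∧ b ≤ n ∧ x b = w := by
      rcases he with rfl | rfl
      · exact ⟨n - 1, by omega, by omega, h2⟩
      · exact ⟨n, by omega, by omega, h3⟩
    obtain ⟨a, ha⟩ := ha
    obtain ⟨b, hb⟩ := hb
    exact ⟨x, n, a, b, hx, hturn, ha.1, ha.2.1, hb.1, hb.2.1, ha.2.2, hb.2.2⟩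
  rcases reflTransGen_of_leftFace_eq hF with h | h
  · obtain ⟨x, n, a, b, k1, k2, k3, k4, k5, k6, k7, k8⟩ := key e d w u he hd h
    exact ⟨x, n, b, a, k1, k2, k5, k6, k3, k4, k8, k7⟩
  · exact key d e u w hd he h

/-- Boundary arcs turn always left or always right. -/
theorem isBoundaryArc_iff {v : ℤ → V} {m n : ℤ} (hmn : m < n) (hv : T.Geo v m n)
    (hm : T.IsLeaf (v m)) (hn : T.IsLeaf (v n)) : T.IsBoundaryArc (stretch v m n) ↔
      (∀ i, m < i → i < n → T.TurnL v i) ∨ ∀ i, m < i → i < n → T.TurnR v i := by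
  constructor
  · rintro ⟨_, F, hF⟩
    obtain ⟨x, N, a, b, hx, hturn, ha, ha', hb, hb', hxa, hxb⟩ :=
      (hF _ (left_mem_stretch v hmn.le)).exists_line (hF _ (right_mem_stretch v hmn.le))
    rcases le_total a b with hab | hab
    · left
      obtain ⟨h1, h2⟩ := hv.toLine.unique (hx.sub ha hab hb') hxa.symm hxb.symm
      have h3 : ∀ k, m ≤ k → k ≤ n → v k = x (k + (a - m)) := fun k k1 k2 => by
        have := h2 (k - m) (by omega) (by omega)
        rw [show m + (k - m) = k by ring] at this
        rw [this]
        congr 1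
        ring
      intro i h4 h5
      have := hturn (i + (a - m)) (by omega) (by omega)
      rw [TurnL] at this ⊢
      rw [h3 i h4.le h5.le, h3 (i - 1) (by omega) (by omega), h3 (i + 1) (by omega) (by omega)]
      convert this using 2 <;> ring
    · right
      obtain ⟨h1, h2⟩ := hv.toLine.unique (hx.sub hb hab ha').rev
        (by rw [PlaneTree.rev, neg_neg, hxa]) (by rw [PlaneTree.rev, neg_neg, hxb])
      have h3 : ∀ k, m ≤ k → k ≤ n → v k = x (a + m - k) := fun k k1 k2 => by
        have := h2 (k - m) (by omega) (by omega)
        rw [show m + (k - m) = k by ring] at this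
        rw [this, PlaneTree.rev]
        congr 1
        ring
      intro i h4 h5
      have := hturn (a + m - i) (by omega) (by omega)
      rw [TurnL] at this
      rw [TurnR]
      rw [h3 i h4.le h5.le, h3 (i - 1) (by omega) (by omega), h3 (i + 1) (by omega) (by omega)]
      convert this using 2 <;> ring
  · have key : ∀ (v : ℤ → V) (m n : ℤ), m < n → T.Geo v m n →
        (∀ i, m < i → i < n → T.TurnL v i) → ∃ F, ∀ x ∈ stretch v m n, T.OnFace x F := by
      intro v m n hmn hv hL
      refine ⟨T.leftFace ⟨(v m, v (m + 1)), hv.adj m le_rfl hmn⟩, ?_⟩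
      have hface : ∀ k : ℕ, ∀ h : m + k < n, T.leftFace ⟨(v m, v (m + 1)), hv.adj m le_rfl hmn⟩ =
          T.leftFace ⟨(v (m + k), v (m + k + 1)), hv.adj _ (by omega) h⟩ := by
        intro k
        induction k with
        | zero =>
          intro h
          congr 3 <;> simp
        | succ k ih =>
          intro h
          have h' : m + k < n := by
            push_cast at h
            omega
          rw [ih h']
          refine Quot.sound ⟨?_, ?_, ?_⟩
          · show v (m + k + 1) = v (m + (k + 1 : ℕ))
            congr 1
            push_cast
            ring
          · exact hv.not_isLeaf (by omega) (by push_cast at h; omega)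
          · have := hL (m + k + 1) (by omega) (by push_cast at h; omega)
            rw [TurnL] at this
            convert this using 1
            · show v (m + k) = _
              congr 1
              ring
            · show v (m + (k + 1 : ℕ) + 1) = _
              congr 1
              push_cast
              ring
      intro x hx
      obtain ⟨i, h1, h2, rfl⟩ := mem_stretch.1 hx
      rcases h2.eq_or_lt with rfl | h2
      · refine ⟨_, Or.inr ?_, (hface (i - 1 - m).toNat (by omega)).symm⟩
        show v (m + (i - 1 - m).toNat + 1) = v i
        congr 1
        omega
      · refine ⟨_, Or.inl ?_, (hface (i - m).toNat (by omega)).symm⟩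
        show v (m + (i - m).toNat) = v i
        congr 1
        omega
    refine fun h => ⟨isArc_iff.2 ⟨v, m, n, hmn, hv, hm, hn, rfl⟩, ?_⟩
    rcases h with h | h
    · exact key v m n hmn hv h
    · have := key (rev v) (-n) (-m) (by omega) hv.rev fun i h1 h2 => by
        rw [turnL_rev]
        exact h (-i) (by omega) (by omega)
      rwa [stretch_rev, neg_neg, neg_neg] at this

theorem not_isBoundaryArc_iff {v : ℤ → V} {m n : ℤ} (hmn : m < n) (hv : T.Geo v m n)
    (hm : T.IsLeaf (v m)) (hn : T.IsLeaf (v n)) : ¬ T.IsBoundaryArc (stretch v m n) ↔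
      (∃ i, m < i ∧ i < n ∧ T.TurnL v i) ∧ ∃ i, m < i ∧ i < n ∧ T.TurnR v i := by
  rw [isBoundaryArc_iff hmn hv hm hn, not_or, and_comm]
  push Not
  refine and_congr ⟨?_, ?_⟩ ⟨?_, ?_⟩
  · rintro ⟨i, h1, h2, h3⟩
    exact ⟨i, h1, h2, (hv.not_turnR_iff h1 h2).1 h3⟩
  · rintro ⟨i, h1, h2, h3⟩
    exact ⟨i, h1, h2, (hv.not_turnR_iff h1 h2).2 h3⟩
  · rintro ⟨i, h1, h2, h3⟩
    exact ⟨i, h1, h2, (hv.not_turnL_iff h1 h2).1 h3⟩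
  · rintro ⟨i, h1, h2, h3⟩
    exact ⟨i, h1, h2, (hv.not_turnL_iff h1 h2).2 h3⟩

theorem isBoundaryArc_mirror {p : Set V} (hp : T.IsArc p) :
    T.mirror.IsBoundaryArc p ↔ T.IsBoundaryArc p := by
  obtain ⟨v, m, n, hmn, hv, hm, hn, rfl⟩ := isArc_iff.1 hp
  rw [isBoundaryArc_iff hmn hv hm hn, isBoundaryArc_iff hmn (geo_mirror.2 hv) hm hn]
  simp only [turnL_mirror, turnR_mirror]
  exact or_comm

end Boundary

/-! ### The sets `C_p` and the projection `π_↓` -/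

section Projection

variable {V : Type*} {T : PlaneTree V} {v : ℤ → V} {m n : ℤ}

theorem cSet_subset_seg (p : Set V) : T.CSet p ⊆ T.Seg := fun _ h => h.1

/-- Members start at right turns and stop at left turns. Every inner vertex turns one way and none
turns both ways, so both window criteria apply and C_p is coclosed and closed. -/
theorem cSet_eq_window (hv : T.Geo v m n) : T.CSet (stretch v m n) = window v m n
    (fun i => ¬ T.IsLeaf (v i) ∧ (i = m ∨ T.TurnR v i))
    (fun j => ¬ T.IsLeaf (v j) ∧ (j = n ∨ T.TurnL v j)) := by
  ext t
  rw [mem_cSet_iff hv]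
  constructor
  · rintro ⟨i, j, h1, h2, h3, h4, h5, h6, h7, h8⟩
    exact ⟨i, j, h1, h2, h3, ⟨h4, h7⟩, ⟨h5, h8⟩, h6⟩
  · rintro ⟨i, j, h1, h2, h3, ⟨h4, h7⟩, ⟨h5, h8⟩, h6⟩
    exact ⟨i, j, h1, h2, h3, h4, h5, h6, h7, h8⟩

theorem isCoclosed_cSet (hv : T.Geo v m n) : T.IsCoclosed (T.CSet (stretch v m n)) := by
  rw [cSet_eq_window hv]
  refine isCoclosed_window hv.toLine fun k h1 h2 => ?_
  have h3 := hv.not_isLeaf h1 h2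
  exact (hv.turn k h1 h2).symm.imp (fun h => ⟨h3, Or.inr h⟩) fun h => ⟨h3, Or.inr h⟩

theorem self_mem_cSet {s : Set V} (hs : s ∈ T.Seg) : s ∈ T.CSet s := by
  obtain ⟨v, m, n, hmn, hv, hm, hn, rfl⟩ := mem_seg_iff.1 hs
  exact (mem_cSet_iff hv).2 ⟨m, n, le_rfl, hmn, le_rfl, hm, hn, rfl, Or.inl rfl, Or.inl rfl⟩

theorem cSet_subset_cSet (hv : T.Geo v m n) {t : Set V} (ht : t ∈ T.CSet (stretch v m n)) :
    T.CSet t ⊆ T.CSet (stretch v m n) := by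
  obtain ⟨i, j, h1, h2, h3, h4, h5, rfl, h6, h7⟩ := (mem_cSet_iff hv).1 ht
  intro u hu
  obtain ⟨a, b, k1, k2, k3, k4, k5, rfl, k6, k7⟩ := (mem_cSet_iff (hv.sub h1 h2.le h3)).1 hu
  refine (mem_cSet_iff hv).2 ⟨a, b, by omega, k2, by omega, k4, k5, rfl, ?_, ?_⟩
  · rcases k6 with rfl | k6
    · exact h6
    · exact Or.inr k6
  · rcases k7 with rfl | k7
    · exact h7
    · exact Or.inr k7

variable [Finite V]

theorem isClosedSet_cSet (hv : T.Geo v m n) : T.IsClosedSet (T.CSet (stretch v m n)) := by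
  have hsub := cSet_subset_seg (T := T) (stretch v m n)
  rw [cSet_eq_window hv] at hsub ⊢
  refine isClosedSet_window hv.toLine hsub fun k h1 h2 h3 h4 => ?_
  exact hv.not_turnR h1 h2 (h4.2.resolve_left h2.ne) (h3.2.resolve_left h1.ne')

/-- The sets `C_s` as biclosed sets. -/
def cBic {s : Set V} (hs : s ∈ T.Seg) : T.Bic :=
  Bic.mk' (T.CSet s) (by
    obtain ⟨v, m, n, _, hv, _, _, rfl⟩ := mem_seg_iff.1 hs
    exact isClosedSet_cSet hv) (by
    obtain ⟨v, m, n, _, hv, _, _, rfl⟩ := mem_seg_iff.1 hs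
    exact isCoclosed_cSet hv)

omit [Finite V] in
theorem mem_piDown_iff {X : Set (Set V)} {s : Set V} (hs : s ∈ T.Seg) :
    s ∈ T.piDown X ↔ T.CSet s ⊆ X :=
  ⟨fun h => h.2, fun h => ⟨h (self_mem_cSet hs), h⟩⟩

omit [Finite V] in
theorem cSet_subset_piDown {X : Set (Set V)} (hv : T.Geo v m n)
    (h : T.CSet (stretch v m n) ⊆ X) : T.CSet (stretch v m n) ⊆ T.piDown X :=
  fun _ ht => ⟨h ht, (cSet_subset_cSet hv ht).trans h⟩

namespace Bic

-- A member of C_s for s = [i, j] ∘ [j, k] that straddles j is composed of a member of C of each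
-- factor: no turn is demanded at j, which is an end of both.
omit [Finite V] in
theorem isClosedSet_piDown (X : T.Bic) : T.IsClosedSet (T.piDown X.1) := by
  refine isClosedSet_iff.2 ⟨fun s hs => X.subset hs.1, ?_⟩
  intro v i j k hv hij hjk h1 h2
  refine ⟨X.isClosedSet.comp hv le_rfl hij hjk le_rfl h1.1 h2.1, fun t ht => ?_⟩
  obtain ⟨a, b, k1, k2, k3, k4, k5, rfl, k6, k7⟩ := (mem_cSet_iff hv).1 ht
  have hj := hv.not_isLeaf hij hjk
  have left : ∀ b, b ≤ j → a < b → ¬ T.IsLeaf (v b) → (b = j ∨ T.TurnL v b) →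
      stretch v a b ∈ X.1 := fun b e1 e2 e3 e4 =>
    h1.2 ((mem_cSet_iff (hv.sub le_rfl hij.le hjk.le)).2 ⟨a, b, k1, e2, e1, k4, e3, rfl, k6, e4⟩)
  have right : ∀ a, j ≤ a → a < b → ¬ T.IsLeaf (v a) → (a = j ∨ T.TurnR v a) →
      stretch v a b ∈ X.1 := fun a e1 e2 e3 e4 =>
    h2.2 ((mem_cSet_iff (hv.sub hij.le hjk.le le_rfl)).2 ⟨a, b, e1, e2, k3, e3, k5, rfl, e4, k7⟩)
  rcases le_total b j with hb | hb
  · exact left b hb k2 k5 (k7.imp (fun h => by omega) id)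
  rcases le_total j a with ha | ha
  · exact right a ha k2 k4 (k6.imp (fun h => by omega) id)
  rcases hb.eq_or_lt with rfl | hb
  · exact left j le_rfl k2 hj (Or.inl rfl)
  rcases ha.eq_or_lt with rfl | ha
  · exact right a le_rfl k2 hj (Or.inl rfl)
  exact X.isClosedSet.comp hv k1 ha hb k3 (left j le_rfl ha hj (Or.inl rfl))
    (right j le_rfl hb hj (Or.inl rfl))

-- The turn at the cut decides which part stays: a left turn puts the initial part into C_s, a right
-- turn the final part.
omit [Finite V] in
theorem isCoclosed_piDown (X : T.Bic) : T.IsCoclosed (T.piDown X.1) := by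
  intro v i j k hv hij hjk h
  have hs := X.subset h.1
  have hj := hv.not_isLeaf hij hjk
  have hi := not_isLeaf_of_mem_seg hs (left_mem_stretch v hv.le)
  have hk := not_isLeaf_of_mem_seg hs (right_mem_stretch v hv.le)
  rcases hv.turn j hij hjk with hL | hR
  · left
    have h1 : stretch v i j ∈ T.CSet (stretch v i k) := (mem_cSet_iff hv).2
      ⟨i, j, le_rfl, hij, hjk.le, hi, hj, rfl, Or.inl rfl, Or.inr hL⟩
    exact ⟨h.2 h1, (cSet_subset_cSet hv h1).trans h.2⟩
  · right
    have h1 : stretch v j k ∈ T.CSet (stretch v i k) := (mem_cSet_iff hv).2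
      ⟨j, k, hij.le, hjk, le_rfl, hj, hk, rfl, Or.inr hR, Or.inl rfl⟩
    exact ⟨h.2 h1, (cSet_subset_cSet hv h1).trans h.2⟩

/-- The projection `π_↓` on biclosed sets. -/
def down (X : T.Bic) : T.Bic := mk' (T.piDown X.1) X.isClosedSet_piDown X.isCoclosed_piDown

omit [Finite V] in
theorem down_val (X : T.Bic) : X.down.1 = T.piDown X.1 := rfl

omit [Finite V] in
theorem down_le (X : T.Bic) : X.down ≤ X := fun _ h => h.1

omit [Finite V] in
theorem down_mono {X Y : T.Bic} (h : X ≤ Y) : X.down ≤ Y.down :=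
  fun _ hs => ⟨h hs.1, hs.2.trans h⟩

omit [Finite V] in
theorem down_down (X : T.Bic) : X.down.down = X.down := by
  refine le_antisymm X.down.down_le fun s hs => ⟨hs, fun t ht => ?_⟩
  obtain ⟨v, m, n, _, hv, _, _, rfl⟩ := mem_seg_iff.1 (X.subset hs.1)
  exact cSet_subset_piDown hv hs.2 ht

/-- Since C_s is itself biclosed, membership in π_↓(X) is a statement about elements of Bic(T) below
X; this makes π_↓ compatible with meets. -/
theorem cBic_le_iff {X : T.Bic} {s : Set V} (hs : s ∈ T.Seg) : cBic hs ≤ X ↔ s ∈ X.down.1 :=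
  (mem_piDown_iff hs).symm

theorem mem_down_inf {X Y : T.Bic} {s : Set V} (hx : s ∈ X.down.1) (hy : s ∈ Y.down.1) :
    s ∈ (X ⊓ Y).down.1 := by
  have hs := X.subset hx.1
  rw [← cBic_le_iff hs] at hx hy ⊢
  exact le_inf hx hy

theorem down_inf (X Y : T.Bic) : (X.down ⊓ Y.down).down = (X ⊓ Y).down := by
  refine le_antisymm (down_mono (inf_le_inf X.down_le Y.down_le)) fun s hs => ?_
  refine mem_down_inf ?_ ?_
  · rw [down_down]
    exact down_mono inf_le_left hs
  · rw [down_down]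
    exact down_mono inf_le_right hs

theorem down_inf_of_down_eq {X Y : T.Bic} (hX : X.down = X) (hY : Y.down = Y) :
    (X ⊓ Y).down = X ⊓ Y := by
  refine le_antisymm (down_le _) fun s hs => mem_down_inf ?_ ?_
  · rw [hX]
    exact (inf_le_left : X ⊓ Y ≤ X) hs
  · rw [hY]
    exact (inf_le_right : X ⊓ Y ≤ Y) hs

omit [Finite V] in
theorem down_sup_of_down_eq {X Y : T.Bic} (hX : X.down = X) (hY : Y.down = Y) :
    (X ⊔ Y).down = X ⊔ Y := by
  refine le_antisymm (down_le _) (sup_le ?_ ?_)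
  · conv_lhs => rw [← hX]
    exact down_mono le_sup_left
  · conv_lhs => rw [← hY]
    exact down_mono le_sup_right

theorem isClosedSet_of_mirror {S : Set (Set V)}
    (h : T.mirror.IsClosedSet S ∧ T.mirror.IsClosedSet (T.mirror.Seg \ S)) :
    S ⊆ T.Seg ∧ T.IsClosedSet (T.Seg \ S) ∧ T.IsClosedSet (T.Seg \ (T.Seg \ S)) := by
  rw [isClosedSet_mirror, isClosedSet_mirror, seg_mirror] at h
  refine ⟨h.1.1, h.2, ?_⟩
  rw [Set.sdiff_sdiff_cancel_left h.1.1]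
  exact h.1

/-- Biclosed sets correspond to complements of biclosed sets of the mirror image. -/
def mirrorIso : T.Bic ≃o T.mirror.Bicᵒᵈ where
  toFun X := OrderDual.toDual ⟨T.Seg \ X.1, by
    rw [isClosedSet_mirror, isClosedSet_mirror, seg_mirror]
    exact X.compl.2⟩
  invFun X := ⟨T.Seg \ (OrderDual.ofDual X).1, (isClosedSet_of_mirror (OrderDual.ofDual X).2).2⟩
  left_inv X := compl_compl X
  right_inv X := Subtype.ext (Set.sdiff_sdiff_cancel_left
    (isClosedSet_of_mirror (OrderDual.ofDual X).2).1)
  map_rel_iff' {X Y} := complIso.map_rel_iff' (a := X) (b := Y)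

/-- The complement of a biclosed set, as a biclosed set of the mirror image. -/
def mir (X : T.Bic) : T.mirror.Bic := OrderDual.ofDual (mirrorIso X)

theorem mir_val (X : T.Bic) : X.mir.1 = T.Seg \ X.1 := rfl

theorem mir_sup (X Y : T.Bic) : (X ⊔ Y).mir = X.mir ⊓ Y.mir :=
  congrArg OrderDual.ofDual (map_sup mirrorIso X Y)

/-- The complement of `π^↑(X)` is determined by `π_↓(X)`. -/
theorem notMem_piDown_mirror_iff (X : T.Bic) {s : Set V} (hs : s ∈ T.Seg) :
    s ∉ T.mirror.piDown X.mir.1 ↔ ∃ t ∈ T.mirror.CSet s, t ∈ T.piDown X.1 := by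
  rw [mem_piDown_iff (by rwa [seg_mirror]), mir_val, Set.not_subset]
  constructor
  · intro h
    have h' : ∃ t, t ∈ T.mirror.CSet s ∧ t ∈ X.1 := by
      obtain ⟨t, h1, h2⟩ := h
      have h3 := cSet_subset_seg _ h1
      rw [seg_mirror] at h3
      exact ⟨t, h1, by_contra fun h4 => h2 ⟨h3, h4⟩⟩
    -- A shortest member t of K_s ∩ X lies in π_↓(X). At a left turn of t the final part lies in
    -- K_s, hence not in X, so the initial part lies in X. At a right turn the initial part is not
    -- in X and the final part is. Coclosedness then settles the parts between a right and a left
    -- turn.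
    obtain ⟨t, ⟨h1, h2⟩, hmin⟩ := Set.exists_min_image {t | t ∈ T.mirror.CSet s ∧ t ∈ X.1}
      Set.ncard (Set.toFinite _) h'
    refine ⟨t, h1, h2, ?_⟩
    obtain ⟨v, m, n, _, hv, _, _, rfl⟩ := mem_seg_iff.1 hs
    obtain ⟨i, j, k1, k2, k3, k4, k5, rfl, k6, k7⟩ := (mem_cSet_mirror_iff hv).1 h1
    have hv' := hv.sub k1 k2.le k3
    have hL : ∀ k, i < k → k < j → T.TurnL v k → stretch v i k ∈ X.1 := by
      intro k e1 e2 e3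
      refine (X.isCoclosed v i k j hv' e1 e2 h2).resolve_right fun hc => ?_
      have := hmin _ ⟨(mem_cSet_mirror_iff hv).2 ⟨k, j, by omega, e2, k3, hv'.not_isLeaf e1 e2, k5,
        rfl, Or.inr e3, k7⟩, hc⟩
      have := ncard_lt hv'.toLine e1.le e2.le le_rfl (by omega)
      omega
    have hR' : ∀ k, i < k → k < j → T.TurnR v k → stretch v i k ∉ X.1 := by
      intro k e1 e2 e3 hc
      have := hmin _ ⟨(mem_cSet_mirror_iff hv).2 ⟨i, k, by omega, e1, by omega, k4,
        hv'.not_isLeaf e1 e2, rfl, k6, Or.inr e3⟩, hc⟩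
      have := ncard_lt hv'.toLine le_rfl e1.le e2.le (by omega)
      omega
    have hR : ∀ k, i < k → k < j → T.TurnR v k → stretch v k j ∈ X.1 := fun k e1 e2 e3 =>
      (X.isCoclosed v i k j hv' e1 e2 h2).resolve_left (hR' k e1 e2 e3)
    intro u hu
    obtain ⟨a, b, e1, e2, e3, e4, e5, rfl, e6, e7⟩ := (mem_cSet_iff hv').1 hu
    rcases e1.eq_or_lt with rfl | e1 <;> rcases e3.eq_or_lt with rfl | e3
    · exact h2
    · exact hL b e2 e3 (e7.resolve_left e3.ne)
    · exact hR a e1 e2 (e6.resolve_left e1.ne')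
    · exact (X.isCoclosed.split hv' le_rfl e1 e2 e3.le
        (hL b (by omega) e3 (e7.resolve_left e3.ne))).resolve_left
        (hR' a e1 (by omega) (e6.resolve_left e1.ne'))
  · rintro ⟨t, h1, h2⟩
    exact ⟨t, h1, fun h => h.2 h2.1⟩

theorem mir_down_le {X Y : T.Bic} (h : X.down ≤ Y.down) : Y.mir.down ≤ X.mir.down := by
  intro s hs
  have hseg : s ∈ T.Seg := by
    have := Y.mir.down.subset hs
    rwa [seg_mirror] at this
  by_contra hno
  obtain ⟨t, h1, h2⟩ := (notMem_piDown_mirror_iff X hseg).1 hno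
  exact (notMem_piDown_mirror_iff Y hseg).2 ⟨t, h1, h h2⟩ hs

theorem down_val_mir_mir (X : T.Bic) : X.mir.mir.down.1 = X.down.1 := by
  rw [down_val, down_val, mir_val, mir_val, seg_mirror, mirror_mirror,
    Set.sdiff_sdiff_cancel_left X.subset]

theorem mir_down_le_iff {X Y : T.Bic} : Y.mir.down ≤ X.mir.down ↔ X.down ≤ Y.down := by
  refine ⟨fun h => ?_, mir_down_le⟩
  have h1 : X.mir.mir.down.1 ⊆ Y.mir.mir.down.1 := mir_down_le h
  rwa [down_val_mir_mir, down_val_mir_mir] at h1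

theorem down_eq_iff_mir {X Y : T.Bic} : X.down = Y.down ↔ X.mir.down = Y.mir.down := by
  rw [le_antisymm_iff, le_antisymm_iff, mir_down_le_iff, mir_down_le_iff, and_comm]

/-- The congruence `Θ`. -/
def theta (T : PlaneTree V) : LatticeCon T.Bic where
  r X Y := X.down = Y.down
  iseqv := ⟨fun _ => rfl, fun h => h.symm, fun h h' => h.trans h'⟩
  inf {W X Y Z} h h' := by
    rw [← down_inf W Y, ← down_inf X Z, h, h']
  -- Joins become meets of complements in the mirror image, and the projection there is determined
  -- by π_↓.
  sup {W X Y Z} h h' := by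
    rw [down_eq_iff_mir] at h h' ⊢
    rw [mir_sup, mir_sup, ← down_inf W.mir Y.mir, ← down_inf X.mir Z.mir, h, h']

theorem down_sup (X Y : T.Bic) : (X ⊔ Y).down = X.down ⊔ Y.down := by
  have h := (theta T).sup (w := X) (x := X.down) (y := Y) (z := Y.down)
    (X.down_down).symm (Y.down_down).symm
  exact Eq.trans h (down_sup_of_down_eq X.down_down Y.down_down)

end Bic

end Projection

end PlaneTree

namespace PlaneTree

/-! ### The arcs attached to a biclosed set -/

section Eta

variable {V : Type*} {T : PlaneTree V}

theorem Line.stretch_eq_of_ends {v w : ℤ → V} {m n a b : ℤ} (hv : T.Line v m n)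
    (hw : T.Line w a b) (h0 : v m = w a) (h1 : v n = w b) : stretch v m n = stretch w a b := by
  obtain ⟨h2, h3⟩ := hv.unique hw h0 h1
  refine stretch_congr_shift (a - m) (fun k k1 k2 => ?_) (by ring) (by omega)
  have := h3 (k - m) (by omega) (by omega)
  rwa [show m + (k - m) = k by ring, show a + (k - m) = k + (a - m) by ring] at this

/-- The order on the vertices of a path that is encoded by a biclosed set. -/
def Before (X : Set (Set V)) (v : ℤ → V) (i j : ℤ) : Prop :=
  (i < j ∧ stretch v i j ∉ X) ∨ (j < i ∧ stretch v j i ∈ X)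

variable {v : ℤ → V} {m n k : ℤ}

theorem Before.ne {X : Set (Set V)} {i j : ℤ} (h : Before X v i j) : i ≠ j := by
  rcases h with h | h <;> omega

theorem Before.asymm {X : Set (Set V)} {i j : ℤ} (h : Before X v i j) : ¬ Before X v j i := by
  rintro (h' | h') <;> rcases h with h | h
  · omega
  · exact h'.2 h.2
  · exact h.2 h'.2
  · omega

theorem Before.total {X : Set (Set V)} {i j : ℤ} (h : i ≠ j) : Before X v i j ∨ Before X v j i := by
  rcases lt_or_gt_of_ne h with h | h
  · by_cases hs : stretch v i j ∈ X
    · exact Or.inr (Or.inr ⟨h, hs⟩)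
    · exact Or.inl (Or.inl ⟨h, hs⟩)
  · by_cases hs : stretch v j i ∈ X
    · exact Or.inl (Or.inr ⟨h, hs⟩)
    · exact Or.inr (Or.inl ⟨h, hs⟩)

theorem Before.not_iff {X : Set (Set V)} {i j : ℤ} (h : i ≠ j) :
    ¬ Before X v i j ↔ Before X v j i :=
  ⟨fun h' => (Before.total h).resolve_left h', fun h' => h'.asymm⟩

theorem before_iff_of_lt {X : Set (Set V)} {i j : ℤ} (h : i < j) :
    Before X v i j ↔ stretch v i j ∉ X :=
  ⟨fun h' => h'.elim (fun h' => h'.2) fun h' => by omega, fun h' => Or.inl ⟨h, h'⟩⟩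

theorem before_iff_of_gt {X : Set (Set V)} {i j : ℤ} (h : j < i) :
    Before X v i j ↔ stretch v j i ∈ X :=
  ⟨fun h' => h'.elim (fun h' => by omega) fun h' => h'.2, fun h' => Or.inr ⟨h, h'⟩⟩

/-- X restricts to the inversion set of a permutation of the vertices of the path. For each relative
position of i, j, k either closedness or coclosedness of X is what is needed. -/
theorem Before.trans (X : T.Bic) (hv : T.Geo v m n) {i j k : ℤ} (hi : m ≤ i) (hi' : i ≤ n)
    (hj : m ≤ j) (hj' : j ≤ n) (hk : m ≤ k) (hk' : k ≤ n) (h1 : Before X.1 v i j)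
    (h2 : Before X.1 v j k) : Before X.1 v i k := by
  have hik : i ≠ k := by
    rintro rfl
    exact h1.asymm h2
  have clo : ∀ a b c, m ≤ a → a < b → b < c → c ≤ n → stretch v a b ∈ X.1 → stretch v b c ∈ X.1 →
      stretch v a c ∈ X.1 := fun a b c e1 e2 e3 e4 => X.isClosedSet.comp hv e1 e2 e3 e4
  have coc : ∀ a b c, m ≤ a → a < b → b < c → c ≤ n → stretch v a c ∈ X.1 →
      stretch v a b ∈ X.1 ∨ stretch v b c ∈ X.1 :=
    fun a b c e1 e2 e3 e4 => X.isCoclosed.split hv e1 e2 e3 e4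
  rcases h1 with ⟨h1, s1⟩ | ⟨h1, s1⟩ <;> rcases h2 with ⟨h2, s2⟩ | ⟨h2, s2⟩
  · exact Or.inl ⟨by omega, fun h => (coc i j k hi h1 h2 hk' h).elim s1 s2⟩
  · rcases lt_or_gt_of_ne hik with h3 | h3
    · exact Or.inl ⟨h3, fun h => s1 (clo i k j hi h3 h2 hj' h s2)⟩
    · exact Or.inr ⟨h3, (coc k i j hk h3 h1 hj' s2).resolve_right s1⟩
  · rcases lt_or_gt_of_ne hik with h3 | h3
    · exact Or.inl ⟨h3, fun h => s2 (clo j i k hj h1 h3 hk' s1 h)⟩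
    · exact Or.inr ⟨h3, (coc j k i hj h2 h3 hi' s1).resolve_left s2⟩
  · exact Or.inr ⟨by omega, clo k j i hk h2 h1 hi' s2 s1⟩

/-- Transitivity is assumed on U only, because `Before` is transitive only for indices on the path.
-/
theorem exists_last_of_trans {α : Type*} {r : α → α → Prop} {U : Set α} (S : Finset α)
    (htot : ∀ a b : α, a ≠ b → r a b ∨ r b a)
    (htr : ∀ a b c, a ∈ U → b ∈ U → c ∈ U → r a b → r b c → r a c)
    (hS : S.Nonempty) (hU : ∀ a ∈ S, a ∈ U) : ∃ k ∈ S, ∀ j ∈ S, j ≠ k → r j k := by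
  classical
  induction hS using Finset.Nonempty.cons_induction with
  | singleton a => exact ⟨a, by simp, by simp⟩
  | cons a S ha hS ih =>
    obtain ⟨k, hk, h⟩ := ih fun b hb => hU b (Finset.mem_cons_of_mem hb)
    have hak : a ≠ k := fun h => ha (h ▸ hk)
    have hkU := hU k (Finset.mem_cons_of_mem hk)
    have haU := hU a (Finset.mem_cons_self a S)
    rcases htot a k hak with h' | h'
    · refine ⟨k, Finset.mem_cons_of_mem hk, fun j hj hjk => ?_⟩
      rcases Finset.mem_cons.1 hj with rfl | hj
      · exact h'
      · exact h j hj hjk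
    · refine ⟨a, Finset.mem_cons_self a S, fun j hj hjk => ?_⟩
      have hj' := (Finset.mem_cons.1 hj).resolve_left hjk
      by_cases hjk : j = k
      · exact hjk ▸ h'
      · exact htr j k a (hU j hj) hkU haU (h j hj' hjk) h'

theorem exists_last (X : T.Bic) (hv : T.Geo v m n) (P : ℤ → Prop)
    (h : ∃ i, m < i ∧ i < n ∧ P i) : ∃ k, m < k ∧ k < n ∧ P k ∧
      ∀ j, m < j → j < n → P j → j ≠ k → Before X.1 v j k := by
  classical
  obtain ⟨k, hk, hk'⟩ := exists_last_of_trans (r := Before X.1 v) (U := Set.Icc m n)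
    ((Finset.Ioo m n).filter P) (fun a b hab => Before.total hab)
    (fun a b c ha hb hc => Before.trans X hv ha.1 ha.2 hb.1 hb.2 hc.1 hc.2)
    (by obtain ⟨i, h1, h2, h3⟩ := h; exact ⟨i, by simp [h1, h2, h3]⟩)
    (fun a ha => by
      have := (Finset.mem_Ioo.1 (Finset.mem_filter.1 ha).1)
      exact ⟨this.1.le, this.2.le⟩)
  simp only [Finset.mem_filter, Finset.mem_Ioo] at hk hk'
  exact ⟨k, hk.1.1, hk.1.2, hk.2, fun j h1 h2 h3 h4 => hk' j ⟨⟨h1, h2⟩, h3⟩ h4⟩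

theorem exists_first (X : T.Bic) (hv : T.Geo v m n) (P : ℤ → Prop)
    (h : ∃ i, m < i ∧ i < n ∧ P i) : ∃ k, m < k ∧ k < n ∧ P k ∧
      ∀ j, m < j → j < n → P j → j ≠ k → Before X.1 v k j := by
  classical
  obtain ⟨k, hk, hk'⟩ := exists_last_of_trans (r := fun a b => Before X.1 v b a)
    (U := Set.Icc m n) ((Finset.Ioo m n).filter P) (fun a b hab => Before.total hab.symm)
    (fun a b c ha hb hc h1 h2 => Before.trans X hv hc.1 hc.2 hb.1 hb.2 ha.1 ha.2 h2 h1)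
    (by obtain ⟨i, h1, h2, h3⟩ := h; exact ⟨i, by simp [h1, h2, h3]⟩)
    (fun a ha => by
      have := (Finset.mem_Ioo.1 (Finset.mem_filter.1 ha).1)
      exact ⟨this.1.le, this.2.le⟩)
  simp only [Finset.mem_filter, Finset.mem_Ioo] at hk hk'
  exact ⟨k, hk.1.1, hk.1.2, hk.2, fun j h1 h2 h3 h4 => hk' j ⟨⟨h1, h2⟩, h3⟩ h4⟩

theorem etaRule_rev {X : Set (Set V)} :
    T.EtaRule X (rev v) (-n) (-m) (-k) ↔ T.EtaRule X v m n k := by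
  constructor
  · intro h j h1 h2
    have := h (-j) (by omega) (by omega)
    simp only [turnL_rev, turnR_rev, stretch_rev, neg_neg, neg_lt_neg_iff] at this
    exact ⟨this.2, this.1⟩
  · intro h j h1 h2
    have := h (-j) (by omega) (by omega)
    simp only [turnL_rev, turnR_rev, stretch_rev, neg_neg]
    exact ⟨fun hj => this.2 (by omega), fun hj => this.1 (by omega)⟩

theorem etaRule_congr {X : Set (Set V)} {w : ℤ → V} (hw : ∀ i, m ≤ i → i ≤ n → w i = v i)
    (h1 : m < k) (h2 : k < n) (h : T.EtaRule X v m n k) : T.EtaRule X w m n k := by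
  intro j j1 j2
  rw [turnL_congr (hw _ (by omega) (by omega)) (hw _ (by omega) (by omega))
    (hw _ (by omega) (by omega)), turnR_congr (hw _ (by omega) (by omega))
    (hw _ (by omega) (by omega)) (hw _ (by omega) (by omega)),
    stretch_congr (i := k) (j := j) fun i e1 e2 => hw i (by omega) (by omega),
    stretch_congr (i := j) (j := k) fun i e1 e2 => hw i (by omega) (by omega)]
  exact h j j1 j2

theorem etaRule_shift {X : Set (Set V)} (d : ℤ) (h : T.EtaRule X v m n k) :
    T.EtaRule X (fun i => v (i + d)) (m - d) (n - d) (k - d) := by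
  intro j h1 h2
  have := h (j + d) (by omega) (by omega)
  have hL : T.TurnL (fun i => v (i + d)) j ↔ T.TurnL v (j + d) := by
    simp only [TurnL, show j - 1 + d = j + d - 1 by ring, show j + 1 + d = j + d + 1 by ring]
  have hR : T.TurnR (fun i => v (i + d)) j ↔ T.TurnR v (j + d) := by
    simp only [TurnR, show j - 1 + d = j + d - 1 by ring, show j + 1 + d = j + d + 1 by ring]
  rw [hL, hR, stretch_congr_shift (v := fun i => v (i + d)) (w := v) (a := k) (b := j + d) d
    (fun _ _ _ => rfl) (by ring) (by ring), stretch_congr_shift (v := fun i => v (i + d)) (w := v)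
    (a := j + d) (b := k) d (fun _ _ _ => rfl) (by ring) (by ring)]
  exact ⟨fun hj => this.1 (by omega), fun hj => this.2 (by omega)⟩

theorem exists_corner (hv : T.Geo v m n) (h1 : m < k) (h2 : k < n) :
    ∃ c : T.Corner, c.apex = v k ∧ T.ContainsCorner (stretch v m n) c ∧
      (T.TurnL v k → c.side = v (k - 1)) ∧ (¬ T.TurnL v k → c.side = v (k + 1)) := by
  by_cases h : T.TurnL v k
  · refine ⟨⟨v k, v (k - 1), hv.not_isLeaf h1 h2, h.adj_left⟩, rfl, ?_, fun _ => rfl,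
      fun h' => absurd h h'⟩
    exact (containsCorner_iff hv.toLine).2 ⟨k, h1, h2, rfl, Or.inl ⟨rfl,
      h.right_unique ⟨h.adj_left, rfl⟩⟩⟩
  · have h' := (hv.turn k h1 h2).resolve_left h
    refine ⟨⟨v k, v (k + 1), hv.not_isLeaf h1 h2, h'.adj_left⟩, rfl, ?_, fun h'' => absurd h'' h,
      fun _ => rfl⟩
    exact (containsCorner_iff hv.toLine).2 ⟨k, h1, h2, rfl, Or.inr ⟨rfl,
      h'.right_unique ⟨h'.adj_left, rfl⟩⟩⟩

variable [Finite V]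

/-- In terms of the order, the two halves of the rule merge into one: left turns occur exactly at
the vertices preceding v k. -/
theorem etaRule_iff {X : Set (Set V)} (hv : T.Geo v m n) : T.EtaRule X v m n k ↔
    ∀ j, m < j → j < n → j ≠ k → (T.TurnL v j ↔ Before X v j k) := by
  constructor
  · intro h j h1 h2 hj
    rcases lt_or_gt_of_ne hj with hj | hj
    · rw [before_iff_of_lt hj, ← (h j h1 h2).2 hj, hv.not_turnR_iff h1 h2]
    · rw [before_iff_of_gt hj, (h j h1 h2).1 hj]
  · intro h j h1 h2
    refine ⟨fun hj => ?_, fun hj => ?_⟩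
    · rw [h j h1 h2 hj.ne', before_iff_of_gt hj]
    · rw [← hv.not_turnL_iff h1 h2, h j h1 h2 hj.ne, before_iff_of_lt hj, not_not]

theorem EtaRule.turnR_iff {X : Set (Set V)} (h : T.EtaRule X v m n k) (hv : T.Geo v m n) {j : ℤ}
    (h1 : m < j) (h2 : j < n) (hj : j ≠ k) : T.TurnR v j ↔ Before X v k j := by
  rw [← hv.not_turnL_iff h1 h2, (etaRule_iff hv).1 h j h1 h2 hj, Before.not_iff hj]

/-- The arc `p` belongs to `η(X)`, unless it is a boundary arc. -/
def Fits (T : PlaneTree V) (X : Set (Set V)) (p : Set V) : Prop :=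
  T.CSet p ⊆ X ∧ ∀ t ∈ T.mirror.CSet p, t ∉ X

/-- A left turn and a right turn bound a member of C_p if the right turn has the smaller index, and
a member of K_p otherwise. All members arise so, as the ends of an arc are leaves. -/
theorem fits_iff {X : Set (Set V)} (hv : T.Geo v m n) (hm : T.IsLeaf (v m)) (hn : T.IsLeaf (v n)) :
    T.Fits X (stretch v m n) ↔ ∀ i j, m < i → i < n → m < j → j < n → T.TurnL v i → T.TurnR v j →
      Before X v i j := by
  constructor
  · rintro ⟨h1, h2⟩ i j hi hi' hj hj' hL hR
    have hij : i ≠ j := by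
      rintro rfl
      exact hv.not_turnR hi hi' hL hR
    rcases lt_or_gt_of_ne hij with hij | hij
    · refine (before_iff_of_lt hij).2 (h2 _ ((mem_cSet_mirror_iff hv).2 ⟨i, j, hi.le, hij, hj'.le,
        hv.not_isLeaf hi hi', hv.not_isLeaf hj hj', rfl, Or.inr hL, Or.inr hR⟩))
    · refine (before_iff_of_gt hij).2 (h1 ((mem_cSet_iff hv).2 ⟨j, i, hj.le, hij, hi'.le,
        hv.not_isLeaf hj hj', hv.not_isLeaf hi hi', rfl, Or.inr hR, Or.inr hL⟩))
  · intro h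
    have hne : ∀ i, m ≤ i → i ≤ n → ¬ T.IsLeaf (v i) → m < i ∧ i < n := fun i h1 h2 h3 =>
      ⟨h1.lt_of_ne (by rintro rfl; exact h3 hm), h2.lt_of_ne (by rintro rfl; exact h3 hn)⟩
    constructor
    · intro t ht
      obtain ⟨i, j, h1, h2, h3, h4, h5, rfl, h6, h7⟩ := (mem_cSet_iff hv).1 ht
      have hi := hne i h1 (by omega) h4
      have hj := hne j (by omega) h3 h5
      exact (before_iff_of_gt h2).1 (h j i hj.1 hj.2 hi.1 hi.2 (h7.resolve_left hj.2.ne)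
        (h6.resolve_left hi.1.ne'))
    · intro t ht
      obtain ⟨i, j, h1, h2, h3, h4, h5, rfl, h6, h7⟩ := (mem_cSet_mirror_iff hv).1 ht
      have hi := hne i h1 (by omega) h4
      have hj := hne j (by omega) h3 h5
      exact (before_iff_of_lt h2).1 (h i j hi.1 hi.2 hj.1 hj.2 (h6.resolve_left hi.1.ne')
        (h7.resolve_left hj.2.ne))

/-- The vertex v k separates the turns: other left turns precede it and other right turns follow it,
so transitivity applies. -/
theorem EtaRule.fits {X : T.Bic} (h : T.EtaRule X.1 v m n k) (hv : T.Geo v m n)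
    (hm : T.IsLeaf (v m)) (hn : T.IsLeaf (v n)) (h1 : m < k) (h2 : k < n) :
    T.Fits X.1 (stretch v m n) := by
  rw [fits_iff hv hm hn]
  intro i j hi hi' hj hj' hL hR
  have hij : i ≠ j := by
    rintro rfl
    exact hv.not_turnR hi hi' hL hR
  by_cases hik : i = k
  · subst hik
    exact (h.turnR_iff hv hj hj' hij.symm).1 hR
  have h3 := ((etaRule_iff hv).1 h i hi hi' hik).1 hL
  by_cases hjk : j = k
  · subst hjk
    exact h3
  exact Before.trans X hv hi.le hi'.le h1.le h2.le hj.le hj'.le h3 ((h.turnR_iff hv hj hj' hjk).1 hR)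

/-- Right turns come after the left turn k, so a vertex preceding the last left turn must itself
turn left. -/
theorem Fits.etaRule_last {X : Set (Set V)} (h : T.Fits X (stretch v m n)) (hv : T.Geo v m n)
    (hm : T.IsLeaf (v m)) (hn : T.IsLeaf (v n)) (h1 : m < k) (h2 : k < n) (hk : T.TurnL v k)
    (hlast : ∀ j, m < j → j < n → T.TurnL v j → j ≠ k → Before X v j k) :
    T.EtaRule X v m n k := by
  refine (etaRule_iff hv).2 fun j j1 j2 hj => ⟨fun hL => hlast j j1 j2 hL hj, fun hb => ?_⟩
  by_contra hL
  exact hb.asymm ((fits_iff hv hm hn).1 h k j h1 h2 j1 j2 hk ((hv.not_turnL_iff j1 j2).1 hL))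

theorem Fits.etaRule_first {X : Set (Set V)} (h : T.Fits X (stretch v m n)) (hv : T.Geo v m n)
    (hm : T.IsLeaf (v m)) (hn : T.IsLeaf (v n)) (h1 : m < k) (h2 : k < n) (hk : T.TurnR v k)
    (hfirst : ∀ j, m < j → j < n → T.TurnR v j → j ≠ k → Before X v k j) :
    T.EtaRule X v m n k := by
  refine (etaRule_iff hv).2 fun j j1 j2 hj =>
    ⟨fun hL => (fits_iff hv hm hn).1 h j k j1 j2 h1 h2 hL hk, fun hb => ?_⟩
  by_contra hL
  exact hb.asymm (hfirst j j1 j2 ((hv.not_turnL_iff j1 j2).1 hL) hj)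

/-- This removes corners from the description of η. A non-boundary arc has left turns, and if it
fits X it is attached to the corner at the last of them. -/
theorem mem_etaSet_iff {X : T.Bic} {p : Set V} :
    p ∈ T.etaSet X.1 ↔ T.IsArc p ∧ ¬ T.IsBoundaryArc p ∧ T.Fits X.1 p := by
  constructor
  · rintro ⟨hb, c, hc⟩
    refine ⟨hc.1, hb, ?_⟩
    obtain ⟨v, m, n, k, hv, hm, hn, h1, h2, h3, h4, h5, rfl, h6⟩ := hc.exists_param
    exact h6.fits hv hm hn h1 h2
  · rintro ⟨ha, hb, hf⟩
    refine ⟨hb, ?_⟩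
    obtain ⟨v, m, n, hmn, hv, hm, hn, rfl⟩ := isArc_iff.1 ha
    obtain ⟨k, h1, h2, h3, h4⟩ :=
      exists_last X hv _ ((not_isBoundaryArc_iff hmn hv hm hn).1 hb).1
    obtain ⟨c, hc, hc', -, -⟩ := exists_corner hv h1 h2
    exact ⟨c, (isEtaArc_iff hv hm hn h1 h2 hc.symm hc').2 (hf.etaRule_last hv hm hn h1 h2 h3 h4)⟩

/-- A path obeying the rule defining `η` extends to an arc obeying it. -/
theorem exists_arc_etaRule {X : Set (Set V)} (hv : T.Geo v m n) (h1 : m < k) (h2 : k < n)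
    (h : T.EtaRule X v m n k) : ∃ w m' n', m' ≤ m ∧ n ≤ n' ∧ T.Geo w m' n' ∧
      (∀ i, m ≤ i → i ≤ n → w i = v i) ∧ T.IsLeaf (w m') ∧ T.IsLeaf (w n') ∧
      T.EtaRule X w m' n' k := by
  -- The turns have to be prescribed before the extension is known. The path from v k to u is unique
  -- in a tree, so its membership in X is a property of the vertex u alone.
  let P : V → Prop := fun u => ∃ (x : ℤ → V) (a b : ℤ), T.Line x a b ∧ x a = v k ∧ x b = u ∧
    stretch x a b ∈ X
  obtain ⟨w, m', n', hm', hn', hw, hwv, hwm, hwn, hP, hQ⟩ := hv.exists_arc P P (by omega)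
  refine ⟨w, m', n', hm', hn', hw, hwv, hwm, hwn, fun j j1 j2 => ⟨fun hj => ?_, fun hj => ?_⟩⟩
  · rcases lt_or_ge j n with hjn | hjn
    · exact ((etaRule_congr hwv h1 h2 h) j (by omega) hjn).1 hj
    rw [hP j hjn j2]
    have hl := hw.toLine.sub (i := k) (j := j) (by omega) hj.le (by omega)
    have hk := hwv k h1.le h2.le
    constructor
    · rintro ⟨x, a, b, hx, hxa, hxb, hs⟩
      rwa [hl.stretch_eq_of_ends hx (hk.trans hxa.symm) hxb.symm]
    · exact fun hs => ⟨w, k, j, hl, hk, rfl, hs⟩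
  · rcases lt_or_ge m j with hjm | hjm
    · exact ((etaRule_congr hwv h1 h2 h) j hjm (by omega)).2 hj
    rw [hQ j j1 hjm]
    have hl := (hw.toLine.sub (i := j) (j := k) (by omega) hj.le (by omega)).rev
    have hs : stretch w j k = stretch (rev w) (-k) (-j) := by rw [stretch_rev, neg_neg, neg_neg]
    have hk : rev w (-k) = v k := by rw [← hwv k h1.le h2.le]; simp [rev]
    have hj : rev w (-j) = w j := by simp [rev]
    rw [hs]
    constructor
    · rintro ⟨x, a, b, hx, hxa, hxb, hs⟩
      rwa [hl.stretch_eq_of_ends hx (hk.trans hxa.symm) (hj.trans hxb.symm)]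
    · exact fun hs => ⟨_, _, _, hl, hk, hj, hs⟩

theorem Corner.exists_geo (c : T.Corner) : ∃ v : ℤ → V, T.Geo v (-1) 1 ∧ v (-1) = c.side ∧
    v 0 = c.apex ∧ v 1 = c.other := by
  have hL := c.leftTurn
  have hne := hL.ne c.interior
  have a1 := hL.adj_left
  have a2 := hL.adj_right
  refine ⟨fun i => if i = 0 then c.apex else if i = 1 then c.other else c.side,
    ⟨⟨by omega, ?_, ?_⟩, ?_⟩, by simp, by simp, by simp⟩
  · intro i h1 h2
    rcases (show i = -1 ∨ i = 0 by omega) with rfl | rfl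
    · simpa using a1.symm
    · simpa using a2
  · intro i j h1 h2 h3 h4
    rcases (show i = -1 ∨ i = 0 ∨ i = 1 by omega) with rfl | rfl | rfl <;>
    rcases (show j = -1 ∨ j = 0 ∨ j = 1 by omega) with rfl | rfl | rfl <;>
    simp [hne, hne.symm, a1.ne, a1.ne.symm, a2.ne, a2.ne.symm]
  · intro i h1 h2
    obtain rfl : i = 0 := by omega
    left
    simpa [TurnL] using hL

/-- At a vertex where two such arcs part, they still share the path from v k, and its membership in
X prescribes the same turn for both. -/
theorem EtaRule.agree {X : Set (Set V)} {w : ℤ → V} {a b : ℤ} (hv : T.Geo v m n)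
    (hw : T.Geo w a b) (hn : T.IsLeaf (v n)) (hb : T.IsLeaf (w b)) (h1 : m < k) (h2 : k < n)
    (h3 : a < k) (h4 : k < b) (h5 : v k = w k) (h6 : v (k + 1) = w (k + 1))
    (h : T.EtaRule X v m n k) (h' : T.EtaRule X w a b k) :
    n = b ∧ ∀ i, k ≤ i → i ≤ n → v i = w i := by
  obtain ⟨y, y1, y2, y3, y4, y5⟩ := hv.exists_divergence hw hn hb h1.le h2 h3.le h4 h5 h6
  rcases y5 with ⟨rfl, rfl⟩ | ⟨k1, k2, -, k3⟩
  · exact ⟨rfl, y4⟩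
  · exfalso
    have e1 := (h y (by omega) k1).1 y1
    have e2 := (h' y (by omega) k2).1 y1
    rw [stretch_congr y4, ← e2] at e1
    rcases k3 with ⟨l1, l2⟩ | ⟨l1, l2⟩
    · exact hw.not_turnR (by omega) k2 (e1.1 l1) l2
    · exact hv.not_turnR (by omega) k1 (e1.2 l2) l1

/-- On the three vertices of the corner the rule is vacuous; following it at each further vertex
produces the arc. Uniqueness compares two arcs in both directions from the corner. Biclosedness
plays no role. -/
theorem existsUnique_isEtaArc (X : Set (Set V)) (c : T.Corner) : ∃! p : Set V, T.IsEtaArc X c p := by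
  obtain ⟨v, hv, v1, v2, v3⟩ := c.exists_geo
  obtain ⟨w, m, n, hm, hn, hw, hwv, hwm, hwn, hE⟩ := exists_arc_etaRule (X := X) (k := 0) hv
    (by omega) (by omega) (fun j _ _ => ⟨fun _ => by omega, fun _ => by omega⟩)
  have w1 : w (-1) = c.side := (hwv _ (by omega) (by omega)).trans v1
  have w2 : w 0 = c.apex := (hwv _ (by omega) (by omega)).trans v2
  have w3 : w 1 = c.other := (hwv _ (by omega) (by omega)).trans v3
  refine ⟨stretch w m n, (isEtaArc_iff hw hwm hwn (k := 0) (by omega) (by omega) w2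
    ((containsCorner_iff hw.toLine).2 ⟨0, by omega, by omega, w2, Or.inl ⟨by simpa using w1,
      by simpa using w3⟩⟩)).2 hE, ?_⟩
  intro q hq
  obtain ⟨x, a, b, k, hx, ha, hb, hak, hkb, x1, x2, x3, rfl, hE'⟩ := hq.exists_param
  have hx' := hx.shift k
  have hE'' := etaRule_shift k hE'
  rw [sub_self] at hE''
  have r1 := EtaRule.agree hx' hw (by simpa using hb) hwn (by omega) (by omega) (by omega)
    (by omega) (by simpa [w2] using x2) (by simp only [zero_add, w3]; rw [add_comm]; exact x3) hE'' hE
  have r2 := EtaRule.agree (k := 0) hx'.rev hw.rev (by simpa [PlaneTree.rev] using ha)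
    (by simpa [PlaneTree.rev] using hwm) (by omega) (by omega) (by omega) (by omega)
    (by simpa [PlaneTree.rev, w2] using x2)
    (by simp only [PlaneTree.rev, zero_add, w1]; rw [show -1 + k = k - 1 by ring]; exact x1)
    (by simpa using etaRule_rev.2 hE'') (by simpa using etaRule_rev.2 hE)
  have e1 : stretch (fun i => x (i + k)) (a - k) (b - k) = stretch x a b :=
    stretch_congr_shift k (fun _ _ _ => rfl) (by ring) (by ring)
  obtain ⟨rb, ra⟩ := r1
  obtain ⟨rb', ra'⟩ := r2
  have hma : m = a - k := by omega
  rw [← e1, ← rb, ← hma]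
  refine stretch_congr fun i i1 i2 => ?_
  rcases le_total 0 i with hi | hi
  · exact ra i hi i2
  · have := ra' (-i) (by omega) (by omega)
    simpa [PlaneTree.rev] using this

end Eta

end PlaneTree

namespace PlaneTree

/-! ### The maps `η` and `φ` -/

section Maps

variable {V : Type*} {T : PlaneTree V} {v : ℤ → V} {m n k : ℤ}

theorem isCoclosed_biUnion {ι : Type*} {A : Set ι} {f : ι → Set (Set V)}
    (h : ∀ i ∈ A, T.IsCoclosed (f i)) : T.IsCoclosed (⋃ i ∈ A, f i) := by
  intro v a b c hv hab hbc hs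
  simp only [Set.mem_iUnion] at hs ⊢
  obtain ⟨i, hi, hs⟩ := hs
  exact (h i hi v a b c hv hab hbc hs).imp (fun h => ⟨i, hi, h⟩) fun h => ⟨i, hi, h⟩

theorem IsArc.isCoclosed_cSet {p : Set V} (hp : T.IsArc p) : T.IsCoclosed (T.CSet p) := by
  obtain ⟨v, m, n, _, hv, _, _, rfl⟩ := isArc_iff.1 hp
  exact PlaneTree.isCoclosed_cSet hv

theorem biUnion_cSet_subset_seg (A : Set (Set V)) : ⋃ p ∈ A, T.CSet p ⊆ T.Seg :=
  Set.iUnion₂_subset fun p _ => cSet_subset_seg p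

/-- The map `φ` on sets of arcs. -/
def phiBic (A : Set (Set V)) (hA : ∀ p ∈ A, T.IsArc p) : T.Bic :=
  Bic.closure (⋃ p ∈ A, T.CSet p) (biUnion_cSet_subset_seg A)
    (isCoclosed_biUnion fun p hp => (hA p hp).isCoclosed_cSet)

theorem phiSet_mono {A B : Set (Set V)} (h : A ⊆ B) : T.phiSet A ⊆ T.phiSet B :=
  closureSet_subset (isClosedSet_closureSet (biUnion_cSet_subset_seg B))
    ((Set.biUnion_subset_biUnion_left h).trans (subset_closureSet _))

theorem cSet_subset_phiSet {A : Set (Set V)} {p : Set V} (hp : p ∈ A) :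
    T.CSet p ⊆ T.phiSet A :=
  (Set.subset_biUnion_of_mem (u := fun p => T.CSet p) hp).trans (subset_closureSet _)

variable [Finite V]

theorem isCoclosed_mirror {X : Set (Set V)} : T.mirror.IsCoclosed X ↔ T.IsCoclosed X :=
  forall₄_congr fun v i j k => by rw [geo_mirror]

/-- K_p is coclosed, so its complement is a closed set containing all C_q and therefore their
closure. -/
theorem notMem_phiSet {A : Set (Set V)} {p : Set V} (hp : T.IsArc p)
    (h : ∀ q ∈ A, ∀ t ∈ T.CSet q, t ∉ T.mirror.CSet p) {t : Set V} (ht : t ∈ T.mirror.CSet p) :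
    t ∉ T.phiSet A := by
  have hsub : T.mirror.CSet p ⊆ T.Seg := by
    have := cSet_subset_seg (T := T.mirror) p
    rwa [seg_mirror] at this
  have hc : T.IsClosedSet (T.Seg \ T.mirror.CSet p) := (isClosedSet_diff_iff hsub).2
    (isCoclosed_mirror.1 (isArc_mirror.2 hp).isCoclosed_cSet)
  intro h'
  exact (closureSet_subset hc (Set.iUnion₂_subset fun q hq s hs =>
    ⟨cSet_subset_seg _ hs, h q hq s hs⟩) h').2 ht

theorem fits_phiSet {A : Set (Set V)} {p : Set V} (hpA : p ∈ A) (hp : T.IsArc p)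
    (h : ∀ q ∈ A, ∀ t ∈ T.CSet q, t ∉ T.mirror.CSet p) : T.Fits (T.phiSet A) p :=
  ⟨cSet_subset_phiSet hpA, fun _ ht => notMem_phiSet hp h ht⟩

theorem IsArc.disjoint_cSet_mirror {p : Set V} (hp : T.IsArc p) :
    ∀ t ∈ T.CSet p, t ∉ T.mirror.CSet p := by
  obtain ⟨v, m, n, hmn, hv, hm, hn, rfl⟩ := isArc_iff.1 hp
  intro t ht ht'
  obtain ⟨i, j, h1, h2, h3, h4, h5, rfl, h6, h7⟩ := (mem_cSet_iff hv).1 ht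
  obtain ⟨i', j', k1, k2, k3, k4, k5, k8, k6, k7⟩ := (mem_cSet_mirror_iff hv).1 ht'
  obtain ⟨rfl, rfl⟩ := hv.toLine.stretch_inj h1 h2.le h3 k1 k2.le k3 k8
  have hi : i ≠ m := by
    rintro rfl
    exact h4 hm
  exact hv.not_turnR (h1.lt_of_ne hi.symm) (by omega) (k6.resolve_left hi) (h6.resolve_left hi)

/-- If C_p lies in X, it lies in π_↓(X). If K_p misses X, it lies in the mirror projection of the
complement. Both projections are determined by π_↓(X). -/
theorem fits_down_iff {X Y : T.Bic} (h : X.down = Y.down) {p : Set V} (hp : T.IsArc p) :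
    T.Fits X.1 p → T.Fits Y.1 p := by
  obtain ⟨v, m, n, hmn, hv, hm, hn, rfl⟩ := isArc_iff.1 hp
  rintro ⟨h1, h2⟩
  constructor
  · have h3 : T.CSet (stretch v m n) ⊆ X.down.1 := cSet_subset_piDown hv h1
    rw [h] at h3
    exact h3.trans Y.down_le
  · have h3 : T.mirror.CSet (stretch v m n) ⊆ X.mir.down.1 :=
      cSet_subset_piDown (geo_mirror.2 hv) fun t ht => by
        have := cSet_subset_seg _ ht
        rw [seg_mirror] at this
        exact ⟨this, h2 t ht⟩
    rw [Bic.down_eq_iff_mir.1 h] at h3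
    exact fun t ht => (Y.mir.down_le (h3 ht)).2

theorem etaSet_eq_of_down_eq {X Y : T.Bic} (h : X.down = Y.down) :
    T.etaSet X.1 = T.etaSet Y.1 := by
  ext p
  rw [mem_etaSet_iff, mem_etaSet_iff]
  exact and_congr_right fun ha => and_congr_right fun _ =>
    ⟨fits_down_iff h ha, fits_down_iff h.symm ha⟩

theorem etaSet_mirror (X : T.Bic) : T.mirror.etaSet X.mir.1 = T.etaSet X.1 := by
  ext p
  rw [mem_etaSet_iff, mem_etaSet_iff, isArc_mirror]
  refine and_congr_right fun ha => ?_
  rw [isBoundaryArc_mirror ha, Fits, Fits, mirror_mirror]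
  refine and_congr_right fun _ => ?_
  have hsub : T.mirror.CSet p ⊆ T.Seg := by
    have := cSet_subset_seg (T := T.mirror) p
    rwa [seg_mirror] at this
  constructor
  · rintro ⟨h1, h2⟩
    exact ⟨fun t ht => by_contra fun h => h2 t ht ⟨cSet_subset_seg _ ht, h⟩, fun t ht => (h1 ht).2⟩
  · rintro ⟨h1, h2⟩
    exact ⟨fun t ht => ⟨hsub ht, h2 t ht⟩, fun t ht h => h.2 (h1 ht)⟩

theorem phiSet_etaSet_subset (X : T.Bic) : T.phiSet (T.etaSet X.1) ⊆ T.piDown X.1 := by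
  refine closureSet_subset X.isClosedSet_piDown (Set.iUnion₂_subset fun p hp => ?_)
  rw [mem_etaSet_iff] at hp
  obtain ⟨v, m, n, _, hv, _, _, rfl⟩ := isArc_iff.1 hp.1
  exact cSet_subset_piDown hv hp.2.2.1

/-- A segment satisfying the rule defining `η` extends to an arc obeying this rule that starts in a
prescribed direction. -/
theorem exists_arc_through (X : Set (Set V)) (hv : T.Geo v m n) (hmn : m < n)
    (hm : ¬ T.IsLeaf (v m)) (hn : ¬ T.IsLeaf (v n))
    (h : ∀ u, m < u → u < n → (T.TurnL v u ↔ stretch v m u ∈ X)) {y : V}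
    (hy : T.LeftTurn y (v m) (v (m + 1)) ∨ T.LeftTurn (v (m + 1)) (v m) y) :
    ∃ x a b, a < m ∧ n < b ∧ T.Geo x a b ∧ (∀ i, m ≤ i → i ≤ n → x i = v i) ∧ x (m - 1) = y ∧
      T.IsLeaf (x a) ∧ T.IsLeaf (x b) ∧ T.EtaRule X x a b m ∧
      (T.TurnL x n ↔ stretch v m n ∈ X) := by
  have hne : y ≠ v (m + 1) := hy.elim (fun hy => hy.ne hm) fun hy => (hy.ne hm).symm
  have hadj : T.graph.Adj (v m) y := hy.elim (fun hy => hy.adj_left) fun hy => hy.adj_right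
  have hl := (hv.toLine.rev.snoc (by omega) (y := y) (by simpa [rev] using hadj)
    (by simpa [rev, add_comm] using hne)).rev
  set w := rev (Function.update (rev v) (-m + 1) y) with hw
  have hwv : ∀ i, m ≤ i → w i = v i := by
    intro i hi
    simp only [hw, rev]
    rw [Function.update_of_ne (by omega)]
    simp [rev]
  have hwm : w (m - 1) = y := by
    simp only [hw, rev]
    rw [show -(m - 1) = -m + 1 by ring, Function.update_self]
  rw [neg_neg, show -(-m + 1) = m - 1 by ring] at hl
  have hg : T.Geo w (m - 1) n := ⟨hl, fun i h1 h2 => by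
    rcases (show m ≤ i by omega).eq_or_lt with rfl | hi
    · rw [TurnL, TurnR, hwm, hwv m le_rfl, hwv (m + 1) (by omega)]
      exact hy
    · rw [turnL_congr (hwv _ (by omega)) (hwv _ (by omega)) (hwv _ (by omega)),
        turnR_congr (hwv _ (by omega)) (hwv _ (by omega)) (hwv _ (by omega))]
      exact hv.turn i hi h2⟩
  obtain ⟨x, a, b, ha, hb, hx, hxw, hxa, hxb, hE⟩ := exists_arc_etaRule (X := X) (k := m) hg
    (by omega) hmn (fun j j1 j2 => ⟨fun hj => by
      rw [turnL_congr (hwv _ (by omega)) (hwv _ (by omega)) (hwv _ (by omega)), h j hj j2,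
        stretch_congr fun i i1 _ => hwv i i1], fun hj => by omega⟩)
  have hxv : ∀ i, m ≤ i → i ≤ n → x i = v i := fun i i1 i2 =>
    (hxw i (by omega) i2).trans (hwv i i1)
  have hbn : n < b := hb.lt_of_ne (by
    rintro rfl
    rw [hxv n (by omega) le_rfl] at hxb
    exact hn hxb)
  refine ⟨x, a, b, by omega, hbn, hx, hxv, (hxw _ le_rfl (by omega)).trans hwm, hxa, hxb, hE, ?_⟩
  rw [(hE n (by omega) hbn).1 hmn, stretch_congr hxv]

/-- A segment of `X` satisfying the rule defining `η` belongs to `C_p` for an arc `p` of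
`η(X)`. -/
theorem exists_mem_etaSet (X : T.Bic) (hv : T.Geo v m n) (hmn : m < n) (hm : ¬ T.IsLeaf (v m))
    (hn : ¬ T.IsLeaf (v n)) (hs : stretch v m n ∈ X.1)
    (h : ∀ u, m < u → u < n → (T.TurnL v u ↔ stretch v m u ∈ X.1)) :
    ∃ p ∈ T.etaSet X.1, stretch v m n ∈ T.CSet p := by
  -- Starting from y makes the arc turn right at v m. At v n it turns left by the rule, because the
  -- segment lies in X; so the segment belongs to C_p.
  obtain ⟨y, hy⟩ := exists_leftTurn (hv.adj m le_rfl hmn)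
  obtain ⟨x, a, b, ha, hb, hx, hxv, hxy, hxa, hxb, hE, hL⟩ :=
    exists_arc_through X.1 hv hmn hm hn h (Or.inr hy)
  have hR : T.TurnR x m := by
    rw [TurnR, hxy, hxv m le_rfl (by omega), hxv (m + 1) (by omega) (by omega)]
    exact hy
  have hL := hL.2 hs
  refine ⟨stretch x a b, mem_etaSet_iff.2 ⟨isArc_iff.2 ⟨x, a, b, by omega, hx, hxa, hxb, rfl⟩, ?_,
    hE.fits hx hxa hxb (by omega) (by omega)⟩, ?_⟩
  · exact (not_isBoundaryArc_iff (by omega) hx hxa hxb).2 ⟨⟨n, by omega, hb, hL⟩, m, by omega,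
      by omega, hR⟩
  · refine (mem_cSet_iff hx).2 ⟨m, n, by omega, hmn, by omega, ?_, ?_, (stretch_congr hxv).symm,
      Or.inr hR, Or.inr hL⟩
    · rwa [hxv m le_rfl (by omega)]
    · rwa [hxv n (by omega) le_rfl]

/-- Induction on the length of s. If s has right turns u with [v m, v u] in X, cutting at the first
of them in the order of X gives two shorter members of π_↓(X). If there are none, s obeys the rule
defining η from its starting point and lies in C_p for some p in η(X). -/
theorem piDown_subset_phiSet (X : T.Bic) {s : Set V} (hs : s ∈ T.piDown X.1) :
    s ∈ T.phiSet (T.etaSet X.1) := by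
  induction hN : s.ncard using Nat.strong_induction_on generalizing s with
  | _ N ih =>
  subst hN
  obtain ⟨v, m, n, hmn, hv, hm, hn, rfl⟩ := mem_seg_iff.1 (X.subset hs.1)
  have hC : ∀ i j, m ≤ i → i < j → j ≤ n → (i = m ∨ T.TurnR v i) → (j = n ∨ T.TurnL v j) →
      stretch v i j ∈ X.1 := by
    intro i j h1 h2 h3 h4 h5
    have nl : ∀ u, m ≤ u → u ≤ n → ¬ T.IsLeaf (v u) := fun u u1 u2 =>
      not_isLeaf_of_mem_seg (X.subset hs.1) (mem_stretch.2 ⟨u, u1, u2, rfl⟩)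
    exact hs.2 ((mem_cSet_iff hv).2 ⟨i, j, h1, h2, h3, nl i h1 (by omega), nl j (by omega) h3, rfl,
      h4, h5⟩)
  by_cases hR : ∃ u, m < u ∧ u < n ∧ (T.TurnR v u ∧ stretch v m u ∈ X.1)
  · obtain ⟨u, h1, h2, ⟨h3, h4⟩, h5⟩ := exists_first X hv _ hR
    have hu := hv.not_isLeaf h1 h2
    have s1 : stretch v m u ∈ T.piDown X.1 := by
      refine ⟨h4, fun t ht => ?_⟩
      obtain ⟨i, j, e1, e2, e3, e4, e5, rfl, e6, e7⟩ :=
        (mem_cSet_iff (hv.sub le_rfl h1.le h2.le)).1 ht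
      rcases e7 with rfl | e7
      · rcases e1.eq_or_lt with rfl | hmi
        · exact h4
        · have e6 := e6.resolve_left hmi.ne'
          -- If [m, i] lies in X, then i competes with u, so u precedes i and [i, u] lies in X.
          -- Otherwise coclosedness applied to [m, u] gives [i, u].
          by_cases hi : stretch v m i ∈ X.1
          · exact (before_iff_of_gt e2).1 (h5 i hmi (by omega) ⟨e6, hi⟩ e2.ne)
          · exact (X.isCoclosed.split hv le_rfl hmi e2 h2.le h4).resolve_left hi
      · exact hC i j e1 e2 (by omega) e6 (Or.inr e7)
    have s2 : stretch v u n ∈ T.piDown X.1 := by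
      refine ⟨hC u n h1.le h2 le_rfl (Or.inr h3) (Or.inl rfl), fun t ht => ?_⟩
      obtain ⟨i, j, e1, e2, e3, e4, e5, rfl, e6, e7⟩ :=
        (mem_cSet_iff (hv.sub h1.le h2.le le_rfl)).1 ht
      refine hC i j (by omega) e2 e3 (Or.inr ?_) e7
      rcases e6 with rfl | e6
      · exact h3
      · exact e6
    exact (isClosedSet_closureSet (biUnion_cSet_subset_seg _)).comp hv le_rfl h1 h2 le_rfl
      (ih _ (Bic.ncard_lt hv.toLine le_rfl h1.le h2.le (by omega)) s1 rfl)
      (ih _ (Bic.ncard_lt hv.toLine h1.le h2.le le_rfl (by omega)) s2 rfl)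
  · obtain ⟨p, hp, hsp⟩ := exists_mem_etaSet X hv hmn hm hn hs.1 fun u h1 h2 => ⟨fun hL =>
      hC m u le_rfl h1 h2.le (Or.inl rfl) (Or.inr hL), fun h => by
        by_contra hL
        exact hR ⟨u, h1, h2, (hv.not_turnL_iff h1 h2).1 hL, h⟩⟩
    exact cSet_subset_phiSet hp hsp

theorem phiSet_etaSet (X : T.Bic) : T.phiSet (T.etaSet X.1) = T.piDown X.1 :=
  (phiSet_etaSet_subset X).antisymm fun _ => piDown_subset_phiSet X

theorem down_le_of_etaSet_subset {X Y : T.Bic} (h : T.etaSet X.1 ⊆ T.etaSet Y.1) :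
    X.down ≤ Y.down := by
  change T.piDown X.1 ⊆ T.piDown Y.1
  rw [← phiSet_etaSet, ← phiSet_etaSet]
  exact phiSet_mono h

/-- Monotonicity of φ and φ ∘ η = π_↓ give one inequality. In the mirror image the sets of arcs are
the same but the order is reversed, which gives the other. -/
theorem down_eq_of_etaSet_subset {X Y : T.Bic} (h : T.etaSet X.1 ⊆ T.etaSet Y.1) :
    X.down = Y.down := by
  refine (down_le_of_etaSet_subset h).antisymm (Bic.mir_down_le_iff.1 (down_le_of_etaSet_subset ?_))
  rwa [etaSet_mirror, etaSet_mirror]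

end Maps

end PlaneTree

namespace PlaneTree

/-! ### The sides of an arc -/

section Gates

variable {V : Type*} {T : PlaneTree V}

/-- `x` and `y` are joined by an edge of the tree that is not an edge of `p`. -/
def Off (T : PlaneTree V) (p : Set V) (x y : V) : Prop :=
  T.graph.Adj x y ∧ ¬ (x ∈ p ∧ y ∈ p)

theorem Off.symm {p : Set V} {x y : V} (h : T.Off p x y) : T.Off p y x :=
  ⟨h.1.symm, fun h' => h.2 ⟨h'.2, h'.1⟩⟩

/-- `g` is the projection of the tree onto the path `v m, …, v n`. -/
structure Gate (T : PlaneTree V) (v : ℤ → V) (m n : ℤ) (g : V → ℤ) : Prop where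
  apply : ∀ i, m ≤ i → i ≤ n → g (v i) = i
  left_le : ∀ x, m ≤ g x
  le_right : ∀ x, g x ≤ n
  reach : ∀ x, Relation.ReflTransGen (T.Off (stretch v m n)) x (v (g x))
  off : ∀ x y, T.Off (stretch v m n) x y → g x = g y

variable {v w : ℤ → V} {m n a b : ℤ}

/-- Edges of a tree are bridges. A connection off the path, followed by the path back from v j to v
(i + 1), would join the ends of the edge v i v (i + 1) without using it. -/
theorem Line.not_reach (hv : T.Line v m n) {i j : ℤ} (hi : m ≤ i) (hij : i < j) (hj : j ≤ n) :
    ¬ Relation.ReflTransGen (T.Off (stretch v m n)) (v i) (v j) := by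
  intro h
  have hb := SimpleGraph.isAcyclic_iff_forall_adj_isBridge.1 T.isTree.2 (hv.adj i hi (by omega))
  rw [SimpleGraph.isBridge_iff] at hb
  refine hb ?_
  have h1 : (T.graph.deleteEdges {s(v i, v (i + 1))}).Reachable (v i) (v j) := by
    rw [SimpleGraph.reachable_iff_reflTransGen]
    refine Relation.ReflTransGen.mono (fun x y hxy => ?_) _ _ h
    rw [SimpleGraph.deleteEdges_adj]
    refine ⟨hxy.1, fun he => hxy.2 ?_⟩
    have hmi : v i ∈ stretch v m n := mem_stretch.2 ⟨i, hi, by omega, rfl⟩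
    have hmi' : v (i + 1) ∈ stretch v m n := mem_stretch.2 ⟨i + 1, by omega, by omega, rfl⟩
    rw [Set.mem_singleton_iff, Sym2.eq_iff] at he
    rcases he with ⟨rfl, rfl⟩ | ⟨rfl, rfl⟩
    · exact ⟨hmi, hmi'⟩
    · exact ⟨hmi', hmi⟩
  have h2 : ∀ k : ℕ, i + 1 + k ≤ j →
      (T.graph.deleteEdges {s(v i, v (i + 1))}).Reachable (v (i + 1)) (v (i + 1 + k)) := by
    intro k
    induction k with
    | zero => intro _; simp
    | succ k ih =>
      intro hk
      push_cast at hk ⊢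
      refine (ih (by omega)).trans (SimpleGraph.Adj.reachable ?_)
      rw [SimpleGraph.deleteEdges_adj, ← add_assoc]
      refine ⟨hv.adj _ (by omega) (by omega), fun he => ?_⟩
      rw [Set.mem_singleton_iff, Sym2.eq_iff] at he
      rcases he with ⟨e1, e2⟩ | ⟨e1, e2⟩
      · have := hv.inj _ _ (by omega) (by omega) (by omega) (by omega) e1
        omega
      · have := hv.inj _ _ (by omega) (by omega) (by omega) (by omega) e2
        omega
  have h3 := h2 (j - i - 1).toNat (by omega)
  rw [show i + 1 + ((j - i - 1).toNat : ℤ) = j by omega] at h3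
  exact h1.trans h3.symm

/-- A walk from x to v m, stopped at its first vertex on the path, yields a projection; by
`Line.not_reach` there is no other candidate. -/
theorem Line.exists_gate (hv : T.Line v m n) : ∃ g, T.Gate v m n g := by
  have htot : ∀ x, ∃ i, m ≤ i ∧ i ≤ n ∧ Relation.ReflTransGen (T.Off (stretch v m n)) x (v i) := by
    intro x
    have h := (SimpleGraph.reachable_iff_reflTransGen _ _).1 (T.isTree.1.preconnected x (v m))
    induction h using Relation.ReflTransGen.head_induction_on with
    | refl => exact ⟨m, le_rfl, hv.le, Relation.ReflTransGen.refl⟩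
    | @head x y hxy _ ih =>
      by_cases hp : x ∈ stretch v m n
      · obtain ⟨i, h1, h2, rfl⟩ := mem_stretch.1 hp
        exact ⟨i, h1, h2, Relation.ReflTransGen.refl⟩
      · obtain ⟨i, h1, h2, h3⟩ := ih
        exact ⟨i, h1, h2, h3.head ⟨hxy, fun h => hp h.1⟩⟩
  have hsymm : ∀ x y, Relation.ReflTransGen (T.Off (stretch v m n)) x y →
      Relation.ReflTransGen (T.Off (stretch v m n)) y x := fun x y h => by
    have : Std.Symm (T.Off (stretch v m n)) := ⟨fun _ _ h => h.symm⟩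
    exact Relation.ReflTransGen.stdSymm.symm _ _ h
  have huniq : ∀ i j, m ≤ i → i ≤ n → m ≤ j → j ≤ n →
      Relation.ReflTransGen (T.Off (stretch v m n)) (v i) (v j) → i = j := by
    intro i j h1 h2 h3 h4 h
    rcases lt_trichotomy i j with hij | hij | hij
    · exact absurd h (hv.not_reach h1 hij h4)
    · exact hij
    · exact absurd (hsymm _ _ h) (hv.not_reach h3 hij h2)
  choose g hg1 hg2 hg3 using htot
  refine ⟨g, fun i h1 h2 => (huniq i _ h1 h2 (hg1 _) (hg2 _) (hg3 _)).symm, hg1, hg2, hg3,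
    fun x y hxy => huniq _ _ (hg1 _) (hg2 _) (hg1 _) (hg2 _) ?_⟩
  exact (hsymm _ _ (hg3 x)).trans ((hg3 y).head hxy)

theorem Line.of_adj {x y : V} (h : T.graph.Adj x y) :
    T.Line (fun i : ℤ => if i ≤ 0 then x else y) 0 1 := by
  have hne := h.ne
  refine ⟨by omega, fun i h1 h2 => ?_, fun i j h1 h2 h3 h4 he => ?_⟩
  · obtain rfl : i = 0 := by omega
    simpa using h
  · rcases (show i = 0 ∨ i = 1 by omega) with rfl | rfl <;>
    rcases (show j = 0 ∨ j = 1 by omega) with rfl | rfl <;> simp_all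

theorem Line.adj_index (hv : T.Line v m n) {i j : ℤ} (h1 : m ≤ i) (h2 : i ≤ n) (h3 : m ≤ j)
    (h4 : j ≤ n) (h : T.graph.Adj (v i) (v j)) : j = i + 1 ∨ i = j + 1 := by
  rcases lt_trichotomy i j with hij | hij | hij
  · have := ((hv.sub h1 hij.le h4).unique (Line.of_adj h) (by simp) (by simp)).1
    omega
  · subst hij
    exact absurd rfl h.ne
  · have := ((hv.sub h3 hij.le h2).unique (Line.of_adj h.symm) (by simp) (by simp)).1
    omega

namespace Gate

variable {g h : V → ℤ}

theorem rev (hg : T.Gate v m n g) : T.Gate (rev v) (-n) (-m) (fun x => -g x) := by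
  have hs : stretch (PlaneTree.rev v) (-n) (-m) = stretch v m n := by
    rw [stretch_rev, neg_neg, neg_neg]
  refine ⟨fun i h1 h2 => ?_, fun x => ?_, fun x => ?_, fun x => ?_, fun x y hxy => ?_⟩
  · simp only [PlaneTree.rev]
    rw [hg.apply (-i) (by omega) (by omega), neg_neg]
  · have := hg.le_right x
    omega
  · have := hg.left_le x
    omega
  · rw [hs]
    simpa [PlaneTree.rev] using hg.reach x
  · rw [hs] at hxy
    rw [hg.off x y hxy]

/-- Induction along the path from a vertex to its projection. -/
theorem induction (hg : T.Gate v m n g) {i : ℤ} {Q : V → Prop} (h0 : Q (v i))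
    (hs : ∀ x y, T.Off (stretch v m n) x y → g y = i → Q y → Q x) {x : V} (hx : g x = i) : Q x := by
  have hr := hg.reach x
  rw [hx] at hr
  induction hr using Relation.ReflTransGen.head_induction_on with
  | refl => exact h0
  | @head x y hxy _ ih =>
    have hy := (hg.off x y hxy).symm.trans hx
    exact hs x y hxy hy (ih hy)

theorem eq_apply (hg : T.Gate v m n g) {x : V} (hx : x ∈ stretch v m n) : x = v (g x) := by
  obtain ⟨i, h1, h2, rfl⟩ := mem_stretch.1 hx
  rw [hg.apply i h1 h2]

/-- A function constant along edges off the path is determined by its values on the path, so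
projections can be identified without being computed. -/
theorem eq_of_off (hg : T.Gate v m n g) {f : V → ℤ} (h1 : ∀ i, m ≤ i → i ≤ n → f (v i) = i)
    (h2 : ∀ x y, T.Off (stretch v m n) x y → f x = f y) (z : V) : f z = g z := by
  rw [← h1 (g z) (hg.left_le z) (hg.le_right z)]
  exact hg.induction (Q := fun x => f x = f (v (g z))) rfl
    (fun x y hxy _ hy => (h2 x y hxy).trans hy) rfl

theorem clamp_off (hv : T.Line v m n) (hg : T.Gate v m n g) {x y : ℤ} (hx : m ≤ x) (hxy : x ≤ y)
    (hy : y ≤ n) {s t : V} (h : T.Off (stretch v x y) s t) :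
    max x (min y (g s)) = max x (min y (g t)) := by
  by_cases hst : s ∈ stretch v m n ∧ t ∈ stretch v m n
  · obtain ⟨⟨i, h1, h2, rfl⟩, ⟨j, h3, h4, rfl⟩⟩ := hst.imp mem_stretch.1 mem_stretch.1
    have h5 := hv.adj_index h1 h2 h3 h4 h.1
    rw [hg.apply i h1 h2, hg.apply j h3 h4]
    have h6 : ¬ ((x ≤ i ∧ i ≤ y) ∧ x ≤ j ∧ j ≤ y) := fun h' => h.2
      ⟨mem_stretch.2 ⟨i, h'.1.1, h'.1.2, rfl⟩, mem_stretch.2 ⟨j, h'.2.1, h'.2.2, rfl⟩⟩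
    omega
  · rw [hg.off s t ⟨h.1, hst⟩]

/-- Projections onto paths sharing the vertices with indices `x, …, y`. -/
theorem clamp_eq (hv : T.Line v m n) (hg : T.Gate v m n g) (hw : T.Line w a b)
    (hh : T.Gate w a b h) {x y : ℤ} (hx : m ≤ x) (hx' : a ≤ x) (hxy : x ≤ y) (hy : y ≤ n)
    (hy' : y ≤ b) (heq : ∀ i, x ≤ i → i ≤ y → v i = w i) (z : V) :
    max x (min y (g z)) = max x (min y (h z)) := by
  -- Either projection, clamped to the indices x, …, y, is the projection k onto the common part.
  obtain ⟨k, hk⟩ := (hv.sub hx hxy hy).exists_gate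
  have e1 := hk.eq_of_off (f := fun z => max x (min y (g z)))
    (fun i h1 h2 => by rw [hg.apply i (by omega) (by omega)]; omega)
    (fun s t hst => hg.clamp_off hv hx hxy hy hst) z
  have e2 := hk.eq_of_off (f := fun z => max x (min y (h z)))
    (fun i h1 h2 => by rw [heq i h1 h2, hh.apply i (by omega) (by omega)]; omega)
    (fun s t hst => hh.clamp_off hw hx' hxy hy' (by rwa [stretch_congr heq] at hst)) z
  exact e1.trans e2.symm

theorem le_of_adj (hw : T.Line w a b) (hh : T.Gate w a b h) {y : ℤ} {z z' : V}
    (hadj : T.graph.Adj z z') (hz : h z' ≤ y) (hne : z' ≠ w y) : h z ≤ y := by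
  by_cases hq : z ∈ stretch w a b ∧ z' ∈ stretch w a b
  · obtain ⟨⟨s, h1, h2, rfl⟩, ⟨t, h3, h4, rfl⟩⟩ := hq.imp mem_stretch.1 mem_stretch.1
    have h5 := hw.adj_index h1 h2 h3 h4 hadj
    rw [hh.apply _ h3 h4] at hz
    rw [hh.apply _ h1 h2]
    have : t ≠ y := by
      rintro rfl
      exact hne rfl
    omega
  · rw [hh.off _ _ ⟨hadj, hq⟩]
    exact hz

theorem not_mem_of_ne (hw : T.Line w a b) {y : ℤ} {z : V} (h1 : a ≤ y) (h2 : y ≤ b)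
    (hz : T.graph.Adj (w y) z) (hl : a < y → z ≠ w (y - 1)) (hr : y < b → z ≠ w (y + 1)) :
    z ∉ stretch w a b := by
  intro h
  obtain ⟨i, k1, k2, rfl⟩ := mem_stretch.1 h
  rcases hw.adj_index h1 h2 k1 k2 hz with rfl | rfl
  · exact hr (by omega) rfl
  · exact hl (by omega) (by ring_nf)

/-- After two paths have parted, the part of the tree beyond one of them projects to the last
common vertex on the other. -/
theorem le_of_parted (hv : T.Line v m n) (hg : T.Gate v m n g) (hw : T.Line w a b)
    (hh : T.Gate w a b h) {y : ℤ} (hy : m ≤ y) (hy' : a < y) (hn : y < n) (hb : y < b)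
    (h0 : v y = w y) (h1 : v (y + 1) ≠ w (y - 1)) (h2 : v (y + 1) ≠ w (y + 1)) {z : V}
    (hz : y < g z) : h z ≤ y := by
  have hne : ∀ i, y < i → i ≤ n → v i ≠ w y := by
    intro i h1 h2 he
    rw [← h0] at he
    have := hv.inj i y (by omega) h2 hy hn.le he
    omega
  have key : ∀ k : ℕ, y + 1 + k ≤ n → h (v (y + 1 + k)) ≤ y := by
    intro k
    induction k with
    | zero =>
      intro _
      have hadj := hv.adj y hy hn
      have hoff : v (y + 1) ∉ stretch w a b := not_mem_of_ne hw hy'.le hb.le (h0 ▸ hadj)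
        (fun _ => h1) fun _ => h2
      simp only [Nat.cast_zero, add_zero]
      rw [hh.off (v (y + 1)) (v y) ⟨hadj.symm, fun h => hoff h.1⟩, h0,
        hh.apply y hy'.le hb.le]
    | succ k ih =>
      intro hk
      push_cast at hk ⊢
      rw [← add_assoc]
      exact hh.le_of_adj hw (hv.adj _ (by omega) (by omega)).symm (ih (by omega))
        (hne _ (by omega) (by omega))
  have h3 := key (g z - (y + 1)).toNat (by have := hg.le_right z; omega)
  rw [show y + 1 + ((g z - (y + 1)).toNat : ℤ) = g z by omega] at h3
  refine hg.induction (Q := fun x => h x ≤ y) h3 (fun s t hst ht hle => ?_) rfl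
  refine hh.le_of_adj hw hst.1 hle ?_
  rintro rfl
  rw [← h0, hg.apply y hy hn.le] at ht
  omega

end Gate

end Gates

end PlaneTree

namespace PlaneTree

/-! ### The regions of an arc are its left and right sides. -/

section Sides

variable {V : Type*} {T : PlaneTree V} {v w : ℤ → V} {m n a b : ℤ} {g h : V → ℤ}

/-- `v m, …, v n` are the vertices of an arc, and `g` is the projection onto it. -/
structure GatedArc (T : PlaneTree V) (v : ℤ → V) (m n : ℤ) (g : V → ℤ) : Prop extends
    T.Geo v m n, T.Gate v m n g where
  lt : m < n
  leaf_left : T.IsLeaf (v m)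
  leaf_right : T.IsLeaf (v n)

theorem Geo.exists_gatedArc (hv : T.Geo v m n) (hmn : m < n) (hm : T.IsLeaf (v m))
    (hn : T.IsLeaf (v n)) : ∃ g, T.GatedArc v m n g :=
  let ⟨g, hg⟩ := hv.toLine.exists_gate
  ⟨g, ⟨hv, hg, hmn, hm, hn⟩⟩

/-- The left-hand side of the dart `d` lies to the left of the path `v` with projection `g`. -/
def LeftOf (T : PlaneTree V) (v : ℤ → V) (g : V → ℤ) (d : T.graph.Dart) : Prop :=
  g d.fst < g d.snd ∨ (g d.fst = g d.snd ∧ T.TurnR v (g d.fst))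

/-- The face `F` lies to the left of the path `v` with projection `g`. -/
def OnLeft (T : PlaneTree V) (v : ℤ → V) (g : V → ℤ) (F : T.Face) : Prop :=
  ∃ d, T.leftFace d = F ∧ T.LeftOf v g d

theorem mem_reg_trans {p : Set V} {F G H : T.Face} (h : G ∈ T.Reg p F) (h' : H ∈ T.Reg p G) :
    H ∈ T.Reg p F := Relation.ReflTransGen.trans h h'

theorem mem_reg_symm {p : Set V} {F G : T.Face} (h : G ∈ T.Reg p F) : F ∈ T.Reg p G := by
  have : Std.Symm (fun A B : T.Face => ∃ d : T.graph.Dart,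
      ¬ (d.fst ∈ p ∧ d.snd ∈ p) ∧ A = T.leftFace d ∧ B = T.leftFace d.symm) :=
    ⟨fun A B ⟨d, h1, h2, h3⟩ => ⟨d.symm, fun h => h1 ⟨h.2, h.1⟩, h3, by rw [h2, d.symm_symm]⟩⟩
  exact Relation.ReflTransGen.stdSymm.symm _ _ h

theorem mem_reg_self (p : Set V) (F : T.Face) : F ∈ T.Reg p F := Relation.ReflTransGen.refl

/-- The face to the left of the dart `x → y`. -/
def faceOf (T : PlaneTree V) {x y : V} (h : T.graph.Adj x y) : T.Face := T.leftFace ⟨(x, y), h⟩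

theorem faceOf_eq {x u y : V} (hu : ¬ T.IsLeaf u) (h : T.LeftTurn x u y) (h1 : T.graph.Adj x u)
    (h2 : T.graph.Adj u y) : T.faceOf h1 = T.faceOf h2 :=
  Quot.sound ⟨rfl, hu, h⟩

theorem faceOf_cross {p : Set V} {x y : V} (h : T.graph.Adj x y) (hp : ¬ (x ∈ p ∧ y ∈ p)) :
    T.faceOf h.symm ∈ T.Reg p (T.faceOf h) :=
  Relation.ReflTransGen.single ⟨⟨(x, y), h⟩, hp, rfl, rfl⟩

theorem GatedArc.rev (hv : T.GatedArc v m n g) :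
    T.GatedArc (PlaneTree.rev v) (-n) (-m) (fun x => -g x) :=
  ⟨hv.toGeo.rev, hv.toGate.rev, by have := hv.lt; omega,
    by simpa [PlaneTree.rev] using hv.leaf_right, by simpa [PlaneTree.rev] using hv.leaf_left⟩

/-- The end of an arc is a leaf whose only neighbour lies on the arc, so no branch of the tree hangs
there. -/
theorem GatedArc.eq_left (hv : T.GatedArc v m n g) {x : V} (hx : g x = m) : x = v m := by
  refine hv.toGate.induction (Q := fun x => x = v m) rfl (fun x y hxy _ hy => ?_) hx
  exfalso
  subst hy
  have := hv.leaf_left.eq_of_adj hxy.1.symm (hv.adj m le_rfl hv.lt)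
  subst this
  exact hxy.2 ⟨mem_stretch.2 ⟨m + 1, by omega, by have := hv.lt; omega, rfl⟩,
    left_mem_stretch v hv.le⟩

theorem GatedArc.left_lt (hv : T.GatedArc v m n g) {x y : V} (hxy : T.graph.Adj x y)
    (hg : g x = g y) : m < g x := by
  refine (hv.left_le x).lt_of_ne fun he => hxy.ne ?_
  rw [hv.eq_left he.symm, hv.eq_left (x := y) (by omega)]

theorem GatedArc.lt_right (hv : T.GatedArc v m n g) {x y : V} (hxy : T.graph.Adj x y)
    (hg : g x = g y) : g x < n := by
  have := hv.rev.left_lt hxy (by simpa using hg)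
  omega

variable [Finite V]

/-- Branches hang only at inner vertices of the arc and all lie opposite to the corner it contains
there, that is, on the left at a right turn. Reversal exchanges the two kinds of turns. -/
theorem GatedArc.leftOf_rev (hv : T.GatedArc v m n g) (d : T.graph.Dart) :
    T.LeftOf (PlaneTree.rev v) (fun x => -g x) d ↔ ¬ T.LeftOf v g d := by
  simp only [LeftOf, turnR_rev, neg_neg]
  rcases lt_trichotomy (g d.fst) (g d.snd) with h | h | h
  · simp only [h, true_or, not_true, iff_false]
    omega
  · have h1 := hv.left_lt d.adj h
    have h2 := hv.lt_right d.adj h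
    rw [← hv.not_turnR_iff h1 h2]
    simp only [h]
    simp
  · have h1 : -g d.fst < -g d.snd := by omega
    simp only [h1, true_or, true_iff]
    omega

/-- Only steps at an inner vertex v i of the arc matter. At a right turn the rotation leads from v
(i - 1) through all branches to v (i + 1) and then directly back; at a left turn it is the other way
round. No step changes sides. -/
theorem GatedArc.leftOf_step (hv : T.GatedArc v m n g) {d e : T.graph.Dart}
    (hde : T.FaceStep d e) : T.LeftOf v g d ↔ T.LeftOf v g e := by
  obtain ⟨⟨x, u⟩, hxu⟩ := d
  obtain ⟨⟨u', y⟩, huy⟩ := e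
  obtain ⟨h1, hu, hL⟩ := hde
  dsimp only at h1 hu hL
  subst h1
  simp only [LeftOf]
  have hxu : T.graph.Adj x u := hxu
  have huy : T.graph.Adj u y := huy
  by_cases hp : u ∈ stretch v m n
  · obtain ⟨i, hi, hi', rfl⟩ := mem_stretch.1 hp
    have h1 : m < i := hi.lt_of_ne (by rintro rfl; exact hu hv.leaf_left)
    have h2 : i < n := hi'.lt_of_ne (by rintro rfl; exact hu hv.leaf_right)
    have gi := hv.apply i hi hi'
    have gl := hv.apply (i - 1) (by omega) (by omega)
    have gr := hv.apply (i + 1) (by omega) (by omega)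
    have hturn := hv.turn i h1 h2
    have off : ∀ z, T.graph.Adj (v i) z → z = v (i - 1) ∨ z = v (i + 1) ∨ g z = i := by
      intro z hz
      by_cases hzp : z ∈ stretch v m n
      · obtain ⟨j, j1, j2, rfl⟩ := mem_stretch.1 hzp
        rcases hv.adj_index hi hi' j1 j2 hz with rfl | rfl
        · exact Or.inr (Or.inl rfl)
        · left
          ring_nf
      · right; right
        rw [← hv.off (v i) z ⟨hz, fun h => hzp h.2⟩, gi]
    have hne := hL.ne hu
    have key : T.TurnR v i → (x = v (i + 1) ↔ y = v (i - 1)) := fun hR =>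
      ⟨fun hx => (hx ▸ hL).right_unique hR, fun hy => (hy ▸ hL).left_unique hR⟩
    have key' : T.TurnL v i → (x = v (i - 1) ↔ y = v (i + 1)) := fun hR =>
      ⟨fun hx => (hx ▸ hL).right_unique hR, fun hy => (hy ▸ hL).left_unique hR⟩
    have hLR : ¬ T.TurnR v i → T.TurnL v i := (hv.not_turnR_iff h1 h2).1
    have hRL : T.TurnR v i → ¬ T.TurnL v i := fun hR hL => hv.not_turnR h1 h2 hL hR
    have hvne : v (i - 1) ≠ v (i + 1) := fun he => by
      have := hv.inj _ _ (by omega) (by omega) (by omega) (by omega) he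
      omega
    have gne : ∀ z, T.graph.Adj (v i) z → g z = i → z ≠ v (i - 1) ∧ z ≠ v (i + 1) := by
      intro z hz hgz
      constructor <;> rintro rfl <;> omega
    rw [gi]
    by_cases hR : T.TurnR v i
    · have k := key hR
      rcases off x hxu.symm with rfl | rfl | hx
      · have hy : y ≠ v (i - 1) := hne.symm
        rcases off y huy with rfl | rfl | hy'
        · exact absurd rfl hy
        · simp [gl, gr]
        · simp [gl, hy', hR]
      · obtain rfl := k.1 rfl
        rw [gl, gr]
        constructor <;> intro h <;> omega
      · rcases off y huy with rfl | rfl | hy'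
        · exact absurd (k.2 rfl) (gne x hxu.symm hx).2
        · simp [gr, hx, hR]
        · simp [hx, hy', hR]
    · have k := key' (hLR hR)
      rcases off x hxu.symm with rfl | rfl | hx
      · obtain rfl := k.1 rfl
        simp [gl, gr]
      · rcases off y huy with rfl | rfl | hy'
        · rw [gl, gr]
          constructor <;> intro h <;> omega
        · exact absurd rfl hne
        · rw [gr, hy']
          simp [hR]
      · rcases off y huy with rfl | rfl | hy'
        · rw [gl, hx]
          simp [hR]
        · exact absurd (k.2 rfl) (gne x hxu.symm hx).1
        · simp [hx, hy']
  · rw [hv.off x u ⟨hxu, fun h => hp h.2⟩, hv.off u y ⟨huy, fun h => hp h.1⟩]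

theorem GatedArc.leftOf_congr (hv : T.GatedArc v m n g) {d e : T.graph.Dart}
    (h : T.leftFace d = T.leftFace e) : T.LeftOf v g d ↔ T.LeftOf v g e := by
  have h' : Relation.EqvGen T.FaceStep d e := Quot.eqvGen_exact h
  clear h
  induction h' with
  | rel x y h => exact hv.leftOf_step h
  | refl x => exact Iff.rfl
  | symm x y _ ih => exact ih.symm
  | trans x y z _ _ ih1 ih2 => exact ih1.trans ih2

theorem GatedArc.onLeft_leftFace (hv : T.GatedArc v m n g) {d : T.graph.Dart} :
    T.OnLeft v g (T.leftFace d) ↔ T.LeftOf v g d :=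
  ⟨fun ⟨_, he, h⟩ => (hv.leftOf_congr he).1 h, fun h => ⟨d, rfl, h⟩⟩

theorem GatedArc.onLeft_of_mem_reg (hv : T.GatedArc v m n g) {F G : T.Face}
    (h : G ∈ T.Reg (stretch v m n) F) : T.OnLeft v g F ↔ T.OnLeft v g G := by
  have h' : Relation.ReflTransGen (fun A B : T.Face => ∃ d : T.graph.Dart,
    ¬ (d.fst ∈ stretch v m n ∧ d.snd ∈ stretch v m n) ∧ A = T.leftFace d ∧
      B = T.leftFace d.symm) F G := h
  clear h
  induction h' with
  | refl => exact Iff.rfl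
  | tail _ hd ih =>
    obtain ⟨d, h1, rfl, rfl⟩ := hd
    refine ih.trans ?_
    rw [hv.onLeft_leftFace, hv.onLeft_leftFace]
    have := hv.off _ _ ⟨d.adj, h1⟩
    simp [LeftOf, this]

/-- No edge at a vertex off p belongs to p, so rotation around it may cross all of them. -/
theorem faceOf_around {p : Set V} {x y z : V} (hx : x ∉ p) (hy : T.graph.Adj y x)
    (hz : T.graph.Adj z x) : T.faceOf hz ∈ T.Reg p (T.faceOf hy) := by
  by_cases hl : T.IsLeaf x
  · obtain rfl := hl.eq_of_adj hy.symm hz.symm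
    exact mem_reg_self _ _
  · obtain ⟨_, h⟩ := forall_adj_of_leftTurn (u := x) (x := y)
      (Q := fun z => ∃ hz : T.graph.Adj z x, T.faceOf hz ∈ T.Reg p (T.faceOf hy)) hy.symm
      ⟨hy, mem_reg_self _ _⟩ (fun c d ⟨hc, h⟩ hcd => ⟨hcd.adj_right.symm, mem_reg_trans h (by
        rw [faceOf_eq hl hcd hc hcd.adj_right]
        exact faceOf_cross _ fun h => hx h.1)⟩) hz.symm
    exact h

/-- At a right turn, clockwise rotation from v (i - 1) crosses only edges off the arc until v (i +
1) is reached. -/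
theorem GatedArc.faceOf_around (hv : T.GatedArc v m n g) {i : ℤ} (h1 : m < i) (h2 : i < n)
    (hR : T.TurnR v i) {z : V} (hz : T.graph.Adj z (v i)) (hne : z ≠ v (i + 1))
    (ha : T.graph.Adj (v (i - 1)) (v i)) :
    T.faceOf hz ∈ T.Reg (stretch v m n) (T.faceOf ha) := by
  have hl := hv.not_isLeaf h1 h2
  have := forall_adj_of_leftTurn (u := v i) (x := v (i - 1))
      (Q := fun z => z = v (i + 1) ∨ ∃ hz : T.graph.Adj z (v i),
        T.faceOf hz ∈ T.Reg (stretch v m n) (T.faceOf ha)) ha.symm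
      (Or.inr ⟨ha, mem_reg_self _ _⟩) (fun c d hc hcd => ?_) hz.symm
  · obtain ⟨_, h⟩ := this.resolve_left hne
    exact h
  · rcases hc with rfl | ⟨hc, h⟩
    · obtain rfl := hcd.right_unique hR
      exact Or.inr ⟨ha, mem_reg_self _ _⟩
    · by_cases hd : d = v (i + 1)
      · exact Or.inl hd
      by_cases hd' : d = v (i - 1)
      · subst hd'
        exact Or.inr ⟨ha, mem_reg_self _ _⟩
      refine Or.inr ⟨hcd.adj_right.symm, mem_reg_trans h ?_⟩
      rw [faceOf_eq hl hcd hc hcd.adj_right]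
      refine faceOf_cross _ fun h => ?_
      exact Gate.not_mem_of_ne hv.toLine h1.le h2.le hcd.adj_right (fun _ => hd') (fun _ => hd) h.2

theorem GatedArc.faceOf_forward (hv : T.GatedArc v m n g) (k : ℕ) (hk : m + k < n) :
    T.faceOf (hv.adj (m + k) (by omega) hk) ∈
      T.Reg (stretch v m n) (T.faceOf (hv.adj m le_rfl hv.lt)) := by
  induction k with
  | zero =>
    have : ∀ i (hi : m ≤ i) (hi' : i < n), i = m → T.faceOf (hv.adj i hi hi') ∈
        T.Reg (stretch v m n) (T.faceOf (hv.adj m le_rfl hv.lt)) := by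
      rintro i hi hi' rfl
      exact mem_reg_self _ _
    exact this _ (by simp) (by simpa using hk) (by simp)
  | succ k ih =>
    push_cast at hk
    refine mem_reg_trans (ih (by omega)) ?_
    have hstep : ∀ i j (hi : m ≤ i) (hj : j < n) (hi' : i < n) (hj' : m ≤ j), j = i + 1 →
        T.faceOf (hv.adj j hj' hj) ∈ T.Reg (stretch v m n) (T.faceOf (hv.adj i hi hi')) := by
      rintro i j hi hj hi' hj' rfl
      have hl := hv.not_isLeaf (i := i + 1) (by omega) hj
      have hadj : T.graph.Adj (v (i + 1 - 1)) (v (i + 1)) := by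
        rw [add_sub_cancel_right]
        exact hv.adj i hi hi'
      have he : T.faceOf (hv.adj i hi hi') = T.faceOf hadj := by
        have : ∀ k (hk : T.graph.Adj (v k) (v (i + 1))), k = i →
            T.faceOf (hv.adj i hi hi') = T.faceOf hk := by
          rintro k hk rfl
          rfl
        exact this _ _ (by ring)
      rw [he]
      rcases hv.turn (i + 1) (by omega) hj with hL | hR
      · rw [faceOf_eq hl hL hadj (hv.adj _ hj' hj)]
        exact mem_reg_self _ _
      · obtain ⟨z, hz⟩ := exists_leftTurn' (hv.adj (i + 1) hj' hj)
        rw [← faceOf_eq hl hz hz.adj_left.symm]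
        exact hv.faceOf_around (by omega) hj hR _ (hz.ne hl) _
    exact hstep _ _ (by omega) (by push_cast; omega) (by omega) (by omega) (by push_cast; ring)

theorem GatedArc.faceOf_forward' (hv : T.GatedArc v m n g) {i : ℤ} (hi : m ≤ i) (hi' : i < n) :
    T.faceOf (hv.adj i hi hi') ∈
      T.Reg (stretch v m n) (T.faceOf (hv.adj m le_rfl hv.lt)) := by
  obtain ⟨k, rfl⟩ := Int.le.dest hi
  exact hv.faceOf_forward k hi'

/-- Darts off the arc are connected to darts pointing at the arc. -/
theorem GatedArc.exists_dart (hv : T.GatedArc v m n g) {i : ℤ} {x : V} (hx : g x = i)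
    (hxp : x ∉ stretch v m n) : ∃ y, y ∉ stretch v m n ∧ ∃ hy : T.graph.Adj y (v i),
      ∀ z (hz : T.graph.Adj z x), T.faceOf hz ∈ T.Reg (stretch v m n) (T.faceOf hy) := by
  have hi : i ≤ n := hx ▸ hv.le_right x
  have hi' : m ≤ i := hx ▸ hv.left_le x
  revert hxp
  refine hv.toGate.induction (Q := fun x => x ∉ stretch v m n → ∃ y, y ∉ stretch v m n ∧
    ∃ hy : T.graph.Adj y (v i), ∀ z (hz : T.graph.Adj z x),
      T.faceOf hz ∈ T.Reg (stretch v m n) (T.faceOf hy)) ?_ ?_ hx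
  · exact fun h => absurd (mem_stretch.2 ⟨i, hi', hi, rfl⟩) h
  · intro x y hxy hy ih hxp
    by_cases hyp : y ∈ stretch v m n
    · have := hv.eq_apply hyp
      rw [hy] at this
      subst this
      refine ⟨x, hxp, hxy.1, fun z hz => ?_⟩
      exact mem_reg_trans (faceOf_cross hxy.1 hxy.2) (PlaneTree.faceOf_around hxp _ _)
    · obtain ⟨y', h1, h2, h3⟩ := ih hyp
      refine ⟨y', h1, h2, fun z hz => mem_reg_trans (h3 x hxy.1) ?_⟩
      exact mem_reg_trans (faceOf_cross hxy.1 hxy.2) (PlaneTree.faceOf_around hxp _ _)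

/-- The face left of the first edge is a base point: it is carried along the arc, around the right
turn at which the branch of d hangs, and into this branch. -/
theorem GatedArc.mem_reg_of_leftOf (hv : T.GatedArc v m n g) {d : T.graph.Dart}
    (hd : T.LeftOf v g d) :
    T.leftFace d ∈ T.Reg (stretch v m n) (T.faceOf (hv.adj m le_rfl hv.lt)) := by
  obtain ⟨⟨x, y⟩, hxy⟩ := d
  have hxy : T.graph.Adj x y := hxy
  change T.faceOf hxy ∈ _
  rcases hd with hd | ⟨hd, hR⟩
  · dsimp only at hd
    have hp : x ∈ stretch v m n ∧ y ∈ stretch v m n := by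
      by_contra hp
      have := hv.off x y ⟨hxy, hp⟩
      omega
    obtain ⟨⟨i, h1, h2, rfl⟩, ⟨j, h3, h4, rfl⟩⟩ := hp.imp mem_stretch.1 mem_stretch.1
    rw [hv.apply i h1 h2, hv.apply j h3 h4] at hd
    obtain rfl : j = i + 1 := by
      have := hv.adj_index h1 h2 h3 h4 hxy
      omega
    exact hv.faceOf_forward' h1 (by omega)
  · dsimp only at hd hR
    have h1 := hv.left_lt hxy hd
    have h2 := hv.lt_right hxy hd
    generalize hgx : g x = i at *
    have hadj := (hv.adj' h1 h2.le).symm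
    have hstart : T.faceOf hadj ∈ T.Reg (stretch v m n) (T.faceOf (hv.adj m le_rfl hv.lt)) := by
      have : ∀ k (hk : T.graph.Adj (v (i - 1)) (v k)), k = i - 1 + 1 →
          T.faceOf (hv.adj (i - 1) (by omega) (by omega)) = T.faceOf hk := by
        rintro k hk rfl
        rfl
      rw [← this i hadj (by ring)]
      exact hv.faceOf_forward' (by omega) (by omega)
    have hself : v (i + 1) ∈ stretch v m n := mem_stretch.2 ⟨i + 1, by omega, by omega, rfl⟩
    refine mem_reg_trans hstart ?_
    by_cases hy : y ∈ stretch v m n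
    · have hyi := hv.eq_apply hy
      rw [← hd] at hyi
      subst hyi
      refine hv.faceOf_around h1 h2 hR _ ?_ _
      rintro rfl
      rw [hv.apply _ (by omega) (by omega)] at hgx
      omega
    · obtain ⟨y', k1, k2, k3⟩ := hv.exists_dart hd.symm hy
      refine mem_reg_trans (hv.faceOf_around h1 h2 hR k2 ?_ hadj) (k3 x hxy)
      rintro rfl
      exact k1 hself

omit [Finite V] in
theorem exists_leftFace (F : T.Face) : ∃ d, T.leftFace d = F := Quot.exists_rep F

/-- The two regions of an arc are its two sides. -/
theorem GatedArc.mem_reg_iff (hv : T.GatedArc v m n g) {F G : T.Face} :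
    G ∈ T.Reg (stretch v m n) F ↔ (T.OnLeft v g F ↔ T.OnLeft v g G) := by
  refine ⟨hv.onLeft_of_mem_reg, fun h => ?_⟩
  obtain ⟨d, rfl⟩ := exists_leftFace F
  obtain ⟨e, rfl⟩ := exists_leftFace G
  rw [hv.onLeft_leftFace, hv.onLeft_leftFace] at h
  by_cases hd : T.LeftOf v g d
  · exact mem_reg_trans (mem_reg_symm (hv.mem_reg_of_leftOf hd)) (hv.mem_reg_of_leftOf (h.1 hd))
  -- Connectedness of the right side is that of the left side of the reversed arc.
  · have he : ¬ T.LeftOf v g e := fun h' => hd (h.2 h')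
    rw [← hv.leftOf_rev] at hd he
    have h1 := hv.rev.mem_reg_of_leftOf hd
    have h2 := hv.rev.mem_reg_of_leftOf he
    rw [stretch_rev, neg_neg, neg_neg] at h1 h2
    exact mem_reg_trans (mem_reg_symm h1) h2

end Sides

end PlaneTree

namespace PlaneTree

/-! ### Comparing the sides of two arcs -/

section Compare

variable {V : Type*} {T : PlaneTree V} {v w : ℤ → V} {m n a b : ℤ} {g h : V → ℤ}

/-- Two paths sharing the vertex with index `y` either both end there or part there in such a way
that `v` turns right and `w` turns left. -/
def PartsAfter (T : PlaneTree V) (v : ℤ → V) (n : ℤ) (w : ℤ → V) (b y : ℤ) : Prop :=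
  (y = n ∧ y = b) ∨ (y < n ∧ y < b ∧ v (y + 1) ≠ w (y + 1) ∧ T.TurnR v y ∧ T.TurnL w y)

/-- Two paths sharing the vertex with index `x` either both start there or meet there in such a way
that `v` turns right and `w` turns left. -/
def PartsBefore (T : PlaneTree V) (v : ℤ → V) (m : ℤ) (w : ℤ → V) (a x : ℤ) : Prop :=
  (x = m ∧ x = a) ∨ (m < x ∧ a < x ∧ v (x - 1) ≠ w (x - 1) ∧ T.TurnR v x ∧ T.TurnL w x)

theorem Geo.exists_align (hw : T.Geo w a b) (hab : a < b) (ha : T.IsLeaf (w a))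
    (hb : T.IsLeaf (w b)) {u : ℤ → V} {x y i j : ℤ} (hu : T.Line u x y) (hi : a ≤ i) (hij : i ≤ j)
    (hj : j ≤ b) (hx : u x = w i) (hy : u y = w j) : ∃ w' a' b' h', T.GatedArc w' a' b' h' ∧
      stretch w' a' b' = stretch w a b ∧ a' ≤ x ∧ y ≤ b' ∧ ∀ k, x ≤ k → k ≤ y → w' k = u k := by
  obtain ⟨h1, h2⟩ := hu.unique (hw.toLine.sub hi hij hj) hx hy
  obtain ⟨h', hh'⟩ := (hw.shift (i - x)).exists_gatedArc (by omega) (by simpa using ha)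
    (by simpa using hb)
  refine ⟨_, _, _, h', hh', stretch_congr_shift (i - x) (fun _ _ _ => rfl) (by ring) (by ring),
    by omega, by omega, fun k k1 k2 => ?_⟩
  have := h2 (k - x) (by omega) (by omega)
  rw [show x + (k - x) = k by ring] at this
  rw [this]
  ring_nf

/-- An arc containing the ends of a path can be parametrised compatibly with this path. -/
theorem IsArc.exists_align {q : Set V} (hq : T.IsArc q) {u : ℤ → V} {x y : ℤ}
    (hu : T.Line u x y) (hx : u x ∈ q) (hy : u y ∈ q) :
    ∃ w a b h, T.GatedArc w a b h ∧ stretch w a b = q ∧ a ≤ x ∧ y ≤ b ∧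
      ∀ k, x ≤ k → k ≤ y → w k = u k := by
  obtain ⟨w, a, b, hab, hw, ha, hb, rfl⟩ := isArc_iff.1 hq
  obtain ⟨i, i1, i2, hi⟩ := mem_stretch.1 hx
  obtain ⟨j, j1, j2, hj⟩ := mem_stretch.1 hy
  rcases le_total i j with hij | hij
  · exact hw.exists_align hab ha hb hu i1 hij j2 hi.symm hj.symm
  · obtain ⟨w', a', b', h', h1, h2, h3⟩ := hw.rev.exists_align (i := -i) (j := -j) (by omega)
      (by simpa [PlaneTree.rev] using hb) (by simpa [PlaneTree.rev] using ha) hu (by omega)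
      (by omega) (by omega) (by simpa [PlaneTree.rev] using hi.symm)
      (by simpa [PlaneTree.rev] using hj.symm)
    refine ⟨w', a', b', h', h1, ?_, h3⟩
    rw [h2, stretch_rev, neg_neg, neg_neg]

variable [Finite V]

/-- Divergence is applied forwards from a common edge and, after reversal, backwards. At each end of
the resulting common stretch the arcs both end or turn in opposite directions. -/
theorem GatedArc.exists_common (hv : T.GatedArc v m n g) (hw : T.GatedArc w a b h) {k : ℤ}
    (h1 : m ≤ k) (h2 : k < n) (h3 : a ≤ k) (h4 : k < b) (h5 : v k = w k)
    (h6 : v (k + 1) = w (k + 1)) : ∃ x y, x ≤ k ∧ k < y ∧ m ≤ x ∧ a ≤ x ∧ y ≤ n ∧ y ≤ b ∧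
      (∀ i, x ≤ i → i ≤ y → v i = w i) ∧
      (T.PartsAfter v n w b y ∨ T.PartsAfter w b v n y) ∧
      (T.PartsBefore v m w a x ∨ T.PartsBefore w a v m x) := by
  obtain ⟨y, y1, y2, y3, y4, y5⟩ := hv.exists_divergence hw.toGeo hv.leaf_right hw.leaf_right
    h1 h2 h3 h4 h5 h6
  obtain ⟨x, x1, x2, x3, x4, x5⟩ := hv.toGeo.rev.exists_divergence hw.toGeo.rev
    (k := -(k + 1)) hv.rev.leaf_right hw.rev.leaf_right (by omega) (by omega) (by omega) (by omega)
    (by simpa [PlaneTree.rev] using h6) (by simpa [PlaneTree.rev, add_comm] using h5)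
  refine ⟨-x, y, by omega, y1, by omega, by omega, y2, y3, fun i i1 i2 => ?_, ?_, ?_⟩
  · rcases le_total k i with hi | hi
    · exact y4 i hi i2
    · rcases hi.eq_or_lt with rfl | hi
      · exact h5
      · simpa [PlaneTree.rev] using x4 (-i) (by omega) (by omega)
  · rcases y5 with h | ⟨e1, e2, e3, ⟨e4, e5⟩ | ⟨e4, e5⟩⟩
    · exact Or.inl (Or.inl h)
    · exact Or.inr (Or.inr ⟨e2, e1, e3.symm, e5, e4⟩)
    · exact Or.inl (Or.inr ⟨e1, e2, e3, e4, e5⟩)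
  · have hne : PlaneTree.rev v (x + 1) ≠ PlaneTree.rev w (x + 1) → v (-x - 1) ≠ w (-x - 1) := by
      simp only [PlaneTree.rev, show -(x + 1) = -x - 1 by ring]
      exact id
    simp only [turnL_rev, turnR_rev] at x5
    rcases x5 with h | ⟨e1, e2, e3, ⟨e4, e5⟩ | ⟨e4, e5⟩⟩
    · exact Or.inl (Or.inl (by omega))
    · exact Or.inl (Or.inr ⟨by omega, by omega, hne e3, e4, e5⟩)
    · exact Or.inr (Or.inr ⟨by omega, by omega, (hne e3).symm, e5, e4⟩)

omit [Finite V] in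
/-- The vertices that project to a vertex of `w` after the paths have parted project to the last
common vertex on `v`. -/
theorem GatedArc.eq_of_parted (hv : T.GatedArc v m n g) (hw : T.GatedArc w a b h) {x y : ℤ}
    (hx : m ≤ x) (hx' : a ≤ x) (hxy : x < y) (hy : y < n) (hy' : y < b)
    (heq : ∀ i, x ≤ i → i ≤ y → v i = w i) (hne : v (y + 1) ≠ w (y + 1)) {z : V}
    (hz : y < h z) : g z = y := by
  have hc := hv.toGate.clamp_eq hv.toLine hw.toLine hw.toGate hx hx' hxy.le hy.le hy'.le heq z
  have h1 : w (y + 1) ≠ v (y - 1) := fun he => by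
    rw [heq (y - 1) (by omega) (by omega)] at he
    have := hw.inj _ _ (by omega) (by omega) (by omega) (by omega) he
    omega
  have := hw.toGate.le_of_parted hw.toLine hv.toLine hv.toGate (by omega) (by omega) hy' hy
    (heq y (by omega) (by omega)).symm h1 hne.symm hz
  omega

/-- Where w parts from v, it does so to the left. A dart to the left of w either projects into the
common stretch, where both arcs have the same sides, or it lies beyond an end of it; then it hangs
from v at a right turn, hence on the left. -/
theorem GatedArc.leftOf_of_common (hv : T.GatedArc v m n g) (hw : T.GatedArc w a b h) {x y : ℤ}
    (hx : m ≤ x) (hx' : a ≤ x) (hxy : x < y) (hy : y ≤ n) (hy' : y ≤ b)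
    (heq : ∀ i, x ≤ i → i ≤ y → v i = w i) (hr : T.PartsAfter v n w b y)
    (hl : T.PartsBefore v m w a x) {d : T.graph.Dart} (hd : T.LeftOf w h d) :
    T.LeftOf v g d := by
  have hc := hv.toGate.clamp_eq hv.toLine hw.toLine hw.toGate hx hx' hxy.le hy hy' heq
  have hhi : ∀ z, y < h z → g z = y := by
    intro z hz
    have := hw.le_right z
    rcases hr with hr | hr
    · omega
    · exact hv.eq_of_parted hw hx hx' hxy hr.1 hr.2.1 heq hr.2.2.1 hz
  have hlo : ∀ z, h z < x → g z = x := by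
    intro z hz
    have := hw.left_le z
    rcases hl with hl | hl
    · omega
    · have := hv.rev.eq_of_parted hw.rev (x := -y) (y := -x) (z := z) (by omega) (by omega)
        (by omega) (by omega) (by omega) (fun i i1 i2 => heq (-i) (by omega) (by omega)) (by
          simp only [PlaneTree.rev, show -(-x + 1) = x - 1 by ring]
          exact hl.2.2.1) (by omega)
      omega
  obtain ⟨⟨s, t⟩, hst⟩ := d
  have hst : T.graph.Adj s t := hst
  simp only [LeftOf] at hd ⊢
  rcases hd with hd | ⟨hd, hR⟩
  · have hp : s ∈ stretch w a b ∧ t ∈ stretch w a b := by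
      by_contra hp
      have := hw.off s t ⟨hst, hp⟩
      omega
    obtain ⟨⟨i, h1, h2, rfl⟩, ⟨j, h3, h4, rfl⟩⟩ := hp.imp mem_stretch.1 mem_stretch.1
    have hi := hw.apply i h1 h2
    have hj := hw.apply j h3 h4
    rw [hi, hj] at hd
    obtain rfl : j = i + 1 := by
      have := hw.adj_index h1 h2 h3 h4 hst
      omega
    rcases le_or_gt y i with hyi | hyi
    · have hr := hr.resolve_left (by omega)
      have e1 : g (w i) = y := by
        rcases hyi.eq_or_lt with rfl | hyi
        · rw [← heq y (by omega) le_rfl, hv.apply _ (by omega) (by omega)]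
        · exact hhi _ (by omega)
      have e2 : g (w (i + 1)) = y := hhi _ (by omega)
      rw [e1, e2]
      exact Or.inr ⟨rfl, hr.2.2.2.1⟩
    rcases le_or_gt (i + 1) x with hxi | hxi
    · have hl := hl.resolve_left (by omega)
      have e1 : g (w (i + 1)) = x := by
        rcases hxi.eq_or_lt with h | hxi
        · rw [h, ← heq x le_rfl (by omega), hv.apply _ (by omega) (by omega)]
        · exact hlo _ (by omega)
      have e2 : g (w i) = x := hlo _ (by omega)
      rw [e1, e2]
      exact Or.inr ⟨rfl, hl.2.2.2.1⟩
    · rw [← heq i (by omega) (by omega), ← heq (i + 1) (by omega) (by omega),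
        hv.apply _ (by omega) (by omega), hv.apply _ (by omega) (by omega)]
      exact Or.inl (by omega)
  · have h1 := hw.left_lt hst hd
    have h2 := hw.lt_right hst hd
    have c1 := hc s
    have c2 := hc t
    rcases lt_trichotomy y (h s) with hy1 | hy1 | hy1
    · have hr := hr.resolve_left (by omega)
      rw [hhi s hy1, hhi t (by omega)]
      exact Or.inr ⟨rfl, hr.2.2.2.1⟩
    · have hr := hr.resolve_left (by omega)
      rw [← hy1] at hR h1 h2
      exact absurd hR (hw.not_turnR h1 h2 hr.2.2.2.2)
    rcases lt_trichotomy (h s) x with hx1 | hx1 | hx1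
    · have hl := hl.resolve_left (by omega)
      rw [hlo s hx1, hlo t (by omega)]
      exact Or.inr ⟨rfl, hl.2.2.2.1⟩
    · have hl := hl.resolve_left (by omega)
      rw [hx1] at hR h1 h2
      exact absurd hR (hw.not_turnR h1 h2 hl.2.2.2.2)
    · have e1 : g s = h s := by omega
      have e2 : g t = h s := by omega
      rw [e1, e2]
      refine Or.inr ⟨rfl, ?_⟩
      rwa [turnR_congr (heq _ (by omega) (by omega)) (heq _ (by omega) (by omega))
        (heq _ (by omega) (by omega))]

omit [Finite V] in
theorem GatedArc.leftOf_parted (hv : T.GatedArc v m n g) {y : ℤ} {z : V} (h1 : m ≤ y) (h2 : y ≤ n)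
    (hz : T.graph.Adj (v y) z) (hne : z ∉ stretch v m n) :
    (T.LeftOf v g ⟨(v y, z), hz⟩ ↔ T.TurnR v y) ∧
      (T.LeftOf v g ⟨(z, v y), hz.symm⟩ ↔ T.TurnR v y) := by
  have e1 := hv.off (v y) z ⟨hz, fun h => hne h.2⟩
  have e2 := hv.apply y h1 h2
  have e3 : g z = y := by omega
  constructor <;> simp [LeftOf, e2, e3]

omit [Finite V] in
theorem GatedArc.leftOf_succ (hv : T.GatedArc v m n g) {y : ℤ} (h1 : m ≤ y) (h2 : y < n) :
    T.LeftOf v g ⟨(v y, v (y + 1)), hv.adj y h1 h2⟩ ∧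
      ¬ T.LeftOf v g ⟨(v (y + 1), v y), (hv.adj y h1 h2).symm⟩ := by
  have e1 := hv.apply y h1 h2.le
  have e2 := hv.apply (y + 1) (by omega) (by omega)
  constructor <;> simp [LeftOf, e1, e2]

omit [Finite V] in
theorem GatedArc.leftOf_pred (hv : T.GatedArc v m n g) {y : ℤ} (h1 : m < y) (h2 : y ≤ n) :
    T.LeftOf v g ⟨(v (y - 1), v y), (hv.adj' h1 h2).symm⟩ ∧
      ¬ T.LeftOf v g ⟨(v y, v (y - 1)), hv.adj' h1 h2⟩ := by
  have e1 := hv.apply y h1.le h2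
  have e2 := hv.apply (y - 1) (by omega) (by omega)
  constructor <;> simp [LeftOf, e1, e2]
  omega

/-- The arcs turn oppositely at both ends of t. The edge of p after t lies to the left of q and the
one before t to the right of q. The faces on both sides of these two edges realise all four
combinations of sides of p and q, so no region contains another. -/
theorem crossing_of_mem {p q t : Set V} (hp : T.IsArc p) (hq : T.IsArc q) (h1 : t ∈ T.CSet p)
    (h2 : t ∈ T.mirror.CSet q) : T.Crossing p q := by
  obtain ⟨v, m, n, hmn, hv, hm, hn, rfl⟩ := isArc_iff.1 hp
  obtain ⟨g, hv⟩ := hv.exists_gatedArc hmn hm hn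
  have ht := h1.1
  obtain ⟨x, y, x1, hxy, y1, hx, hy, rfl, xR, yL⟩ := (mem_cSet_iff hv.toGeo).1 h1
  have hmx : m < x := x1.lt_of_ne (by rintro rfl; exact hx hm)
  have hyn : y < n := y1.lt_of_ne (by rintro rfl; exact hy hn)
  have xR := xR.resolve_left hmx.ne'
  have yL := yL.resolve_left hyn.ne
  have hsub : stretch v x y ⊆ q := by
    obtain ⟨w, a, b, _, hw, _, _, rfl⟩ := isArc_iff.1 hq
    obtain ⟨i, j, i1, _, j1, _, _, he, _, _⟩ := (mem_cSet_mirror_iff hw).1 h2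
    rw [he]
    exact stretch_subset i1 j1
  obtain ⟨w, a, b, h, hw, rfl, hax, hyb, heq⟩ := hq.exists_align (hv.toLine.sub x1 hxy.le y1)
    (hsub (left_mem_stretch v hxy.le)) (hsub (right_mem_stretch v hxy.le))
  have hst : stretch v x y = stretch w x y := stretch_congr fun k k1 k2 => (heq k k1 k2).symm
  have hbnd : a < x ∧ y < b ∧ T.TurnL w x ∧ T.TurnR w y := by
    obtain ⟨i, j, i1, hij, j1, hi, hj, he, iL, jR⟩ := (mem_cSet_mirror_iff hw.toGeo).1 h2
    rw [hst] at he
    obtain ⟨rfl, rfl⟩ := hw.toLine.stretch_inj hax hxy.le hyb i1 hij.le j1 he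
    have h1 : x ≠ a := by rintro rfl; exact hi hw.leaf_left
    have h2 : y ≠ b := by rintro rfl; exact hj hw.leaf_right
    exact ⟨by omega, by omega, iL.resolve_left h1, jR.resolve_left h2⟩
  obtain ⟨hax, hyb, xL, yR⟩ := hbnd
  have hadjy := hv.adj y (by omega) hyn
  have hadjx := hv.adj' hmx (by omega)
  have offy : v (y + 1) ∉ stretch w a b := by
    refine Gate.not_mem_of_ne hw.toLine (by omega) hyb.le (by rw [heq y hxy.le le_rfl]; exact hadjy)
      (fun _ he => ?_) fun _ he => ?_
    · rw [heq _ (by omega) (by omega)] at he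
      have := hv.inj _ _ (by omega) (by omega) (by omega) (by omega) he
      omega
    · refine (show T.LeftTurn (v (y - 1)) (v y) (v (y + 1)) from yL).not_rev hy ?_
      rw [he, ← heq (y - 1) (by omega) (by omega), ← heq y (by omega) (by omega)]
      exact yR
  have offx : v (x - 1) ∉ stretch w a b := by
    refine Gate.not_mem_of_ne hw.toLine (by omega) (by omega)
      (by rw [heq x le_rfl hxy.le]; exact hadjx) (fun _ he => ?_) fun _ he => ?_
    · refine (show T.LeftTurn (v (x + 1)) (v x) (v (x - 1)) from xR).not_rev hx ?_
      rw [he, ← heq (x + 1) (by omega) (by omega), ← heq x (by omega) (by omega)]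
      exact xL
    · rw [heq _ (by omega) (by omega)] at he
      have := hv.inj _ _ (by omega) (by omega) (by omega) (by omega) he
      omega
  have ey := hw.leftOf_parted (y := y) (z := v (y + 1)) (by omega) (by omega)
    (by rw [heq y hxy.le le_rfl]; exact hadjy) offy
  have ex := hw.leftOf_parted (y := x) (z := v (x - 1)) (by omega) (by omega)
    (by rw [heq x le_rfl hxy.le]; exact hadjx) offx
  have nR : ¬ T.TurnR w x := hw.not_turnR hax (by omega) xL
  simp only [heq y hxy.le le_rfl, yR, iff_true] at ey
  simp only [heq x le_rfl hxy.le, nR, iff_false] at ex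
  have vy := hv.leftOf_succ (y := y) (by omega) hyn
  have vx := hv.leftOf_pred hmx (show x ≤ n by omega)
  have all : ∀ P Q : Prop, ∃ F, (T.OnLeft v g F ↔ P) ∧ (T.OnLeft w h F ↔ Q) := by
    intro P Q
    by_cases hP : P <;> by_cases hQ : Q <;> simp only [hP, hQ, iff_true, iff_false]
    · exact ⟨T.leftFace _, hv.onLeft_leftFace.2 vy.1, hw.onLeft_leftFace.2 ey.1⟩
    · exact ⟨T.leftFace _, hv.onLeft_leftFace.2 vx.1, mt hw.onLeft_leftFace.1 ex.2⟩
    · exact ⟨T.leftFace _, mt hv.onLeft_leftFace.1 vy.2, hw.onLeft_leftFace.2 ey.2⟩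
    · exact ⟨T.leftFace _, mt hv.onLeft_leftFace.1 vx.2, mt hw.onLeft_leftFace.1 ex.1⟩
  refine ⟨⟨_, ht, stretch_subset x1 y1, hsub⟩, fun F G => ⟨fun hFG => ?_, fun hGF => ?_⟩⟩
  · obtain ⟨H, e1, e2⟩ := all (T.OnLeft v g F) (¬ T.OnLeft w h G)
    have := hw.mem_reg_iff.1 (hFG (hv.mem_reg_iff.2 e1.symm))
    tauto
  · obtain ⟨H, e1, e2⟩ := all (¬ T.OnLeft v g F) (T.OnLeft w h G)
    have := hv.mem_reg_iff.1 (hGF (hw.mem_reg_iff.2 e2.symm))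
    tauto

theorem GatedArc.reg_subset (hv : T.GatedArc v m n g) (hw : T.GatedArc w a b h)
    (hle : ∀ d, T.LeftOf w h d → T.LeftOf v g d) {d : T.graph.Dart} (hd : T.LeftOf w h d) :
    T.Reg (stretch w a b) (T.leftFace d) ⊆ T.Reg (stretch v m n) (T.leftFace d) := by
  intro G hG
  obtain ⟨e, rfl⟩ := exists_leftFace G
  rw [hw.mem_reg_iff, hw.onLeft_leftFace, hw.onLeft_leftFace] at hG
  rw [hv.mem_reg_iff, hv.onLeft_leftFace, hv.onLeft_leftFace]
  exact ⟨fun _ => hle e (hG.1 hd), fun _ => hle d hd⟩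

/-- On the maximal common stretch around the shared segment, if one arc could play the right-turning
role at both ends, the regions would be nested by `leftOf_of_common`. So the roles switch, and the
stretch lies in C of one arc and in K of the other. -/
theorem Crossing.exists_mem {p q : Set V} (hp : T.IsArc p) (hq : T.IsArc q)
    (hpq : T.Crossing p q) : ∃ t, (t ∈ T.CSet p ∧ t ∈ T.mirror.CSet q) ∨
      (t ∈ T.mirror.CSet p ∧ t ∈ T.CSet q) := by
  obtain ⟨⟨s, hs, hsp, hsq⟩, hno⟩ := hpq
  obtain ⟨u, x, y, hxy, hu, -, -, rfl⟩ := mem_seg_iff.1 hs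
  obtain ⟨v, m, n, g, hv, rfl, v1, v2, v3⟩ := hp.exists_align hu.toLine
    (hsp (left_mem_stretch u hxy.le)) (hsp (right_mem_stretch u hxy.le))
  obtain ⟨w, a, b, h, hw, rfl, w1, w2, w3⟩ := hq.exists_align hu.toLine
    (hsq (left_mem_stretch u hxy.le)) (hsq (right_mem_stretch u hxy.le))
  have heq : ∀ k, x ≤ k → k ≤ y → v k = w k := fun k k1 k2 => (v3 k k1 k2).trans (w3 k k1 k2).symm
  obtain ⟨x', y', hx, hy, e1, e2, e3, e4, e5, hr, hl⟩ := hv.exists_common hw v1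
    (by omega) w1 (by omega) (heq x le_rfl hxy.le) (heq (x + 1) (by omega) (by omega))
  have c1 : T.PartsAfter v n w b y' → ¬ T.PartsBefore v m w a x' := fun hr hl => by
    have hd := (hw.leftOf_succ le_rfl hw.lt).1
    have := hv.reg_subset hw (fun d => hv.leftOf_of_common hw e1 e2 (by omega) e3 e4 e5 hr hl) hd
    exact (hno _ _).2 this
  have c2 : T.PartsAfter w b v n y' → ¬ T.PartsBefore w a v m x' := fun hr hl => by
    have hd := (hv.leftOf_succ le_rfl hv.lt).1
    have := hw.reg_subset hv (fun d => hw.leftOf_of_common hv e2 e1 (by omega) e4 e3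
      (fun i i1 i2 => (e5 i i1 i2).symm) hr hl) hd
    exact (hno _ _).1 this
  have hst : stretch v x' y' = stretch w x' y' := stretch_congr e5
  refine ⟨stretch v x' y', ?_⟩
  rcases hr with hr | hr <;> rcases hl with hl | hl
  · exact absurd hl (c1 hr)
  · right
    have hr' := hr.resolve_left fun he => c2 (Or.inl he.symm) hl
    have hl' := hl.resolve_left fun he => c1 hr (Or.inl he.symm)
    refine ⟨(mem_cSet_mirror_iff hv.toGeo).2 ⟨x', y', e1, by omega, e3, ?_, ?_, rfl,
      Or.inr hl'.2.2.2.2, Or.inr hr'.2.2.2.1⟩, ?_⟩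
    · exact hv.not_isLeaf (by omega) (by omega)
    · exact hv.not_isLeaf (by omega) (by omega)
    · exact (mem_cSet_iff hw.toGeo).2 ⟨x', y', e2, by omega, e4, hw.not_isLeaf (by omega) (by omega),
        hw.not_isLeaf (by omega) (by omega), hst, Or.inr hl'.2.2.2.1, Or.inr hr'.2.2.2.2⟩
  · left
    have hr' := hr.resolve_left fun he => c1 (Or.inl he.symm) hl
    have hl' := hl.resolve_left fun he => c2 hr (Or.inl he.symm)
    refine ⟨(mem_cSet_iff hv.toGeo).2 ⟨x', y', e1, by omega, e3, ?_, ?_, rfl,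
      Or.inr hl'.2.2.2.1, Or.inr hr'.2.2.2.2⟩, ?_⟩
    · exact hv.not_isLeaf (by omega) (by omega)
    · exact hv.not_isLeaf (by omega) (by omega)
    · exact (mem_cSet_mirror_iff hw.toGeo).2 ⟨x', y', e2, by omega, e4,
        hw.not_isLeaf (by omega) (by omega), hw.not_isLeaf (by omega) (by omega), hst,
        Or.inr hl'.2.2.2.2, Or.inr hr'.2.2.2.1⟩
  · exact absurd hl (c2 hr)

end Compare

end PlaneTree

namespace PlaneTree

/-! ### Facets of the noncrossing complex -/

section Facets

variable {V : Type*} [Finite V] {T : PlaneTree V} {v w : ℤ → V} {m n a b k : ℤ} {g h : V → ℤ}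

omit [Finite V] in
theorem ContainsCorner.subset {p : Set V} {c : T.Corner} (h : T.ContainsCorner p c) :
    c.side ∈ p ∧ c.apex ∈ p ∧ c.other ∈ p := by
  obtain ⟨l, -, rfl, hl⟩ := h
  exact ⟨hl.subset (by simp), hl.subset (by simp), hl.subset (by simp)⟩

/-- An arc through a corner that fits `X` stays to the left of the arc attached to this corner. -/
theorem EtaRule.exists_common {X : Set (Set V)} (hE : T.EtaRule X v m n k)
    (hv : T.GatedArc v m n g) (hw : T.GatedArc w a b h) (hmk : m < k) (hkn : k < n)
    (hL : T.TurnL v k) (ha : a ≤ k - 1) (hb : k + 1 ≤ b)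
    (heq : ∀ i, k - 1 ≤ i → i ≤ k + 1 → w i = v i) (hf : T.Fits X (stretch w a b)) :
    ∃ x y, x < k ∧ k < y ∧ m ≤ x ∧ a ≤ x ∧ y ≤ n ∧ y ≤ b ∧ (∀ i, x ≤ i → i ≤ y → v i = w i) ∧
      T.PartsAfter v n w b y ∧ T.PartsBefore v m w a x := by
  obtain ⟨x, y, hx, hy, e1, e2, e3, e4, e5, hr, hl⟩ := hv.exists_common hw (k := k - 1) (by omega)
    (by omega) ha (by omega) (heq _ le_rfl (by omega)).symm (heq _ (by omega) (by omega)).symm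
  obtain ⟨x', y', hx', hy', e1', e2', e3', e4', e5', hr', hl'⟩ := hv.exists_common hw (k := k)
    (by omega) (by omega) (by omega) (by omega) (heq _ (by omega) (by omega)).symm
    (heq _ (by omega) (by omega)).symm
  have hLw : T.TurnL w k := by
    rwa [turnL_congr (heq _ (by omega) (by omega)) (heq _ (by omega) (by omega))
      (heq _ (by omega) (by omega))]
  have e6 : ∀ i, x ≤ i → i ≤ y' → v i = w i := fun i i1 i2 => by
    rcases le_total k i with hi | hi
    · exact e5' i (by omega) i2
    · exact e5 i i1 (by omega)
  have hkl := hv.not_isLeaf hmk hkn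
  refine ⟨x, y', by omega, hy', e1, e2, e3', e4', e6, ?_, ?_⟩
  · rcases hr' with hr' | hr'
    · exact hr'
    rcases hr' with hr' | ⟨q1, q2, q3, q4, q5⟩
    · exact Or.inl hr'.symm
    exfalso
    -- If v turned left and w right at the parting vertex, the rule for v would put the stretch from
    -- k into X. But w turns left at k and right at y', so the stretch is in K of w, which X must
    -- avoid.
    have hs := ((hE y' (by omega) q2).1 hy').1 q5
    rw [stretch_congr fun i i1 i2 => e6 i (by omega) i2] at hs
    exact hf.2 _ ((mem_cSet_mirror_iff hw.toGeo).2 ⟨k, y', by omega, hy', e4',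
      hw.not_isLeaf (by omega) (by omega), hw.not_isLeaf (by omega) q1, rfl, Or.inr hLw,
      Or.inr q4⟩) hs
  · rcases hl with hl | hl
    · exact hl
    rcases hl with hl | ⟨q1, q2, q3, q4, q5⟩
    · exact Or.inl hl.symm
    exfalso
    have hs : stretch v x k ∈ X := by
      rw [stretch_congr fun i i1 i2 => e6 i i1 (by omega)]
      exact hf.1 ((mem_cSet_iff hw.toGeo).2 ⟨x, k, e2, by omega, by omega,
        hw.not_isLeaf q1 (by omega), hw.not_isLeaf (by omega) (by omega), rfl, Or.inr q4,
        Or.inr hLw⟩)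
    exact hv.not_turnR q2 (by omega) q5 (((hE x q2 (by omega)).2 (by omega)).2 hs)

theorem GatedArc.not_reg_subset (hv : T.GatedArc v m n g) (hw : T.GatedArc w a b h)
    {d e : T.graph.Dart} (hd : T.LeftOf v g d) (hd' : T.LeftOf w h d) (he : T.LeftOf v g e)
    (he' : ¬ T.LeftOf w h e) :
    ¬ T.Reg (stretch v m n) (T.leftFace d) ⊆ T.Reg (stretch w a b) (T.leftFace d) := by
  intro hsub
  have he'' : T.leftFace e ∈ T.Reg (stretch v m n) (T.leftFace d) := hv.mem_reg_iff.2 (by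
    rw [hv.onLeft_leftFace, hv.onLeft_leftFace]
    exact ⟨fun _ => he, fun _ => hd⟩)
  have := hsub he''
  rw [hw.mem_reg_iff, hw.onLeft_leftFace, hw.onLeft_leftFace] at this
  exact he' (this.1 hd')

omit [Finite V] in
theorem GatedArc.not_mem_of_partsAfter (hw : T.GatedArc w a b h) (hv : T.GatedArc v m n g) {y : ℤ}
    (hm : m < y) (ha : a < y) (hy : y < n) (hb : y < b) (h1 : v (y - 1) = w (y - 1))
    (h0 : v y = w y) (hne : v (y + 1) ≠ w (y + 1)) : v (y + 1) ∉ stretch w a b := by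
  refine Gate.not_mem_of_ne hw.toLine (by omega) hb.le (h0 ▸ hv.adj y hm.le hy) (fun _ he => ?_)
    fun _ => hne
  rw [← h1] at he
  have := hv.inj _ _ (by omega) (by omega) (by omega) (by omega) he
  omega

/-- By `EtaRule.exists_common`, q can part from p only to the left, the side of the corner. If the
arcs differ, an edge of p beyond a parting vertex shows strictness, and the right turn of p there,
together with its left turn at the corner, excludes a boundary arc. -/
theorem reg_subset_of_isEtaArc {X : Set (Set V)} {c : T.Corner} {p q : Set V}
    (hp : T.IsEtaArc X c p) (hq : T.IsArc q) (hqc : T.ContainsCorner q c) (hf : T.Fits X q) :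
    T.Reg q c.face ⊆ T.Reg p c.face ∧
      (q ≠ p → ¬ T.Reg p c.face ⊆ T.Reg q c.face ∧ ¬ T.IsBoundaryArc p) := by
  obtain ⟨v, m, n, k, hv, hm, hn, hmk, hkn, v1, v2, v3, rfl, hE⟩ := hp.exists_param
  obtain ⟨g, hv⟩ := hv.exists_gatedArc (by omega) hm hn
  have hL : T.TurnL v k := by
    rw [TurnL, v1, v2, v3]
    exact c.leftTurn
  obtain ⟨s1, s2, s3⟩ := hqc.subset
  obtain ⟨w, a, b, h, hw, rfl, ha, hb, heq⟩ := hq.exists_align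
    (hv.toLine.sub (i := k - 1) (j := k + 1) (by omega) (by omega) (by omega)) (by rwa [v1])
    (by rwa [v3])
  obtain ⟨x, y, hx, hy, e1, e2, e3, e4, e5, hr, hl⟩ := hE.exists_common hv hw hmk hkn hL ha hb heq hf
  have hd := hv.leftOf_pred hmk hkn.le
  have hd' := hw.leftOf_pred (y := k) (by omega) (by omega)
  have hF : ∀ (x y : V) (hxy : T.graph.Adj x y), x = c.side → y = c.apex →
      T.leftFace ⟨(x, y), hxy⟩ = c.face := by
    rintro x y hxy rfl rfl
    rfl
  have hFv := hF _ _ (hv.adj' hmk hkn.le).symm v1 v2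
  have hFw := hF _ _ (hw.adj' (i := k) (by omega) (by omega)).symm
    ((heq _ le_rfl (by omega)).trans v1) ((heq _ (by omega) (by omega)).trans v2)
  have hdw : T.LeftOf w h ⟨(v (k - 1), v k), (hv.adj' hmk hkn.le).symm⟩ := by
    rw [← hw.onLeft_leftFace, hFv, ← hFw, hw.onLeft_leftFace]
    exact hd'.1
  rw [← hFv]
  refine ⟨hv.reg_subset hw (fun d => hv.leftOf_of_common hw e1 e2 (by omega) e3 e4 e5 hr hl) hdw,
    fun hne => ?_⟩
  have key : ∃ i, m < i ∧ i < n ∧ T.TurnR v i ∧ ∃ e, T.LeftOf v g e ∧ ¬ T.LeftOf w h e := by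
    rcases hr with hr | ⟨q1, q2, q3, q4, q5⟩
    · rcases hl with hl | ⟨q1, q2, q3, q4, q5⟩
      · refine absurd ?_ hne
        rw [← hr.1, ← hr.2, ← hl.1, ← hl.2]
        exact (stretch_congr e5).symm
      · refine ⟨x, q1, by omega, q4, _, (hv.leftOf_pred q1 (by omega)).1, ?_⟩
        have hx' := e5 x le_rfl (by omega)
        have hadj := hv.adj' q1 (by omega)
        have := hw.leftOf_parted (y := x) (z := v (x - 1)) (by omega) (by omega)
          (by rw [← hx']; exact hadj) (by
            refine Gate.not_mem_of_ne hw.toLine (by omega) (by omega) (hx' ▸ hadj) (fun _ => q3)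
              fun _ he => ?_
            rw [← e5 (x + 1) (by omega) (by omega)] at he
            have := hv.inj _ _ (by omega) (by omega) (by omega) (by omega) he
            omega)
        simp only [← hx'] at this
        rw [this.2]
        exact hw.not_turnR (by omega) (by omega) q5
    · refine ⟨y, by omega, q1, q4, _, (hv.leftOf_succ (by omega) q1).1, ?_⟩
      have hy' := e5 y (by omega) le_rfl
      have hadj := hv.adj y (by omega) q1
      have := hw.leftOf_parted (y := y) (z := v (y + 1)) (by omega) (by omega)
        (by rw [← hy']; exact hadj) (hw.not_mem_of_partsAfter hv (by omega) (by omega) q1 q2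
          (e5 _ (by omega) (by omega)) hy' q3)
      simp only [← hy'] at this
      rw [this.1]
      exact hw.not_turnR (by omega) (by omega) q5
  obtain ⟨i, i1, i2, iR, e, he, he'⟩ := key
  exact ⟨hv.not_reg_subset hw hd.1 hdw he he', (not_isBoundaryArc_iff hv.lt hv.toGeo hm hn).2
    ⟨⟨k, hmk, hkn, hL⟩, i, i1, i2, iR⟩⟩

/-- The arc attached to c dominates all fitting arcs through c. If another such arc exists, the
attached one is not a boundary arc, so it belongs to η(X) and is strictly larger. -/
theorem isMarked_etaSet_iff {X : T.Bic} {c : T.Corner} {p : Set V} :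
    T.IsMarked (T.etaSet X.1) p c ↔ p ∈ T.etaSet X.1 ∧ T.IsEtaArc X.1 c p := by
  constructor
  · rintro ⟨hp, hpc, hmax⟩
    refine ⟨hp, ?_⟩
    obtain ⟨p', hp', -⟩ := existsUnique_isEtaArc X.1 c
    have hpe := mem_etaSet_iff.1 hp
    obtain ⟨-, h2⟩ := reg_subset_of_isEtaArc hp' hpe.1 hpc hpe.2.2
    by_cases hne : p = p'
    · rwa [hne]
    · obtain ⟨h3, h4⟩ := h2 hne
      exact absurd (hmax p' ⟨h4, c, hp'⟩ hp'.2.1) h3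
  · rintro ⟨hp, hpc⟩
    refine ⟨hp, hpc.2.1, fun q hq hqc => ?_⟩
    have hqe := mem_etaSet_iff.1 hq
    exact (reg_subset_of_isEtaArc hpc hqe.1 hqc hqe.2.2).1

theorem isReducedFace_etaSet (X : T.Bic) : T.IsReducedFace (T.etaSet X.1) := by
  refine ⟨fun p hp => ⟨(mem_etaSet_iff.1 hp).1, (mem_etaSet_iff.1 hp).2.1⟩, fun p hp q hq _ hc => ?_⟩
  obtain ⟨p1, -, p2, p3⟩ := mem_etaSet_iff.1 hp
  obtain ⟨q1, -, q2, q3⟩ := mem_etaSet_iff.1 hq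
  obtain ⟨t, ⟨h1, h2⟩ | ⟨h1, h2⟩⟩ := hc.exists_mem p1 q1
  · exact q3 t h2 (p2 h1)
  · exact p3 t h1 (q2 h2)

/-- For arcs of a noncrossing set no C_q meets any K_p, so generating φ(A) from the C_q never
violates the condition on K_p. -/
theorem IsReducedFace.subset_etaSet {A : Set (Set V)} (hA : T.IsReducedFace A) :
    A ⊆ T.etaSet (phiBic A fun p hp => (hA.1 p hp).1).1 := by
  intro p hp
  refine mem_etaSet_iff.2 ⟨(hA.1 p hp).1, (hA.1 p hp).2, ?_⟩
  refine fits_phiSet hp (hA.1 p hp).1 fun q hq t ht ht' => ?_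
  by_cases hqp : q = p
  · subst hqp
    exact (hA.1 q hq).1.disjoint_cSet_mirror t ht ht'
  · exact hA.2 hq hp hqp (crossing_of_mem (hA.1 q hq).1 (hA.1 p hp).1 ht ht')

/-- A reduced face B containing η(X) lies in η(φ(B)); the inclusion of η(X) in this set is then an
equality by `down_eq_of_etaSet_subset`. -/
theorem maximal_etaSet (X : T.Bic) : Maximal T.IsReducedFace (T.etaSet X.1) := by
  refine ⟨isReducedFace_etaSet X, fun B hB hle => ?_⟩
  have h1 := hB.subset_etaSet
  have h2 := etaSet_eq_of_down_eq (down_eq_of_etaSet_subset (Set.Subset.trans hle h1))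
  rw [h2]
  exact h1

namespace FG

/-- The map `φ`. -/
def phi (A : T.FG) : T.Bic := phiBic A.1 fun p hp => (A.2.1.1 p hp).1

theorem etaSet_phi (A : T.FG) : T.etaSet A.phi.1 = A.1 :=
  (A.2.2 (isReducedFace_etaSet _) A.2.1.subset_etaSet).antisymm A.2.1.subset_etaSet

theorem phi_injective : Function.Injective (phi (T := T)) := fun A B h => Subtype.ext <| by
  rw [← etaSet_phi, ← etaSet_phi, h]

end FG

/-- The map `η`. -/
def Bic.eta (X : T.Bic) : T.FG := ⟨T.etaSet X.1, maximal_etaSet X⟩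

theorem Bic.phi_eta (X : T.Bic) : X.eta.phi = X.down := Subtype.ext (phiSet_etaSet X)

namespace FG

theorem eta_phi (A : T.FG) : A.phi.eta = A := Subtype.ext A.etaSet_phi

theorem down_phi (A : T.FG) : A.phi.down = A.phi := by
  rw [← Bic.phi_eta, eta_phi]

theorem eta_eq_iff {X Y : T.Bic} : X.eta = Y.eta ↔ X.down = Y.down := by
  rw [← Bic.phi_eta, ← Bic.phi_eta]
  exact ⟨fun h => by rw [h], fun h => phi_injective h⟩

end FG

-- The order is pulled back along φ; that it is reachability by flips is shown in
-- `le_iff_reflTransGen_flip`.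
scoped instance instPartialOrderFG : PartialOrder T.FG :=
  PartialOrder.lift FG.phi FG.phi_injective

namespace FG

theorem le_iff {A B : T.FG} : A ≤ B ↔ A.phi ≤ B.phi := Iff.rfl

theorem phi_eta_sup (A B : T.FG) : (A.phi ⊔ B.phi).eta.phi = A.phi ⊔ B.phi := by
  rw [Bic.phi_eta, Bic.down_sup_of_down_eq A.down_phi B.down_phi]

theorem phi_eta_inf (A B : T.FG) : (A.phi ⊓ B.phi).eta.phi = A.phi ⊓ B.phi := by
  rw [Bic.phi_eta, Bic.down_inf_of_down_eq A.down_phi B.down_phi]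

end FG

-- The image of φ consists of the fixed points of π_↓ and is closed under joins and meets of Bic(T),
-- so both can be computed there.
scoped instance instLatticeFG : Lattice T.FG where
  sup A B := (A.phi ⊔ B.phi).eta
  inf A B := (A.phi ⊓ B.phi).eta
  le_sup_left A B := by rw [FG.le_iff, FG.phi_eta_sup]; exact le_sup_left
  le_sup_right A B := by rw [FG.le_iff, FG.phi_eta_sup]; exact le_sup_right
  sup_le A B C h h' := by rw [FG.le_iff, FG.phi_eta_sup]; exact sup_le h h'
  inf_le_left A B := by rw [FG.le_iff, FG.phi_eta_inf]; exact inf_le_left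
  inf_le_right A B := by rw [FG.le_iff, FG.phi_eta_inf]; exact inf_le_right
  le_inf A B C h h' := by rw [FG.le_iff, FG.phi_eta_inf]; exact le_inf h h'

namespace FG

instance : Finite T.FG := inferInstanceAs (Finite {A : Set (Set V) // _})

/-- The lattice map `φ`. -/
def phiHom : LatticeHom T.FG T.Bic where
  toFun := phi
  map_sup' := phi_eta_sup
  map_inf' := phi_eta_inf

/-- The lattice map `η`. -/
def etaHom : LatticeHom T.Bic T.FG where
  toFun := Bic.eta
  map_sup' X Y := phi_injective <| by
    change (X ⊔ Y).eta.phi = (X.eta.phi ⊔ Y.eta.phi).eta.phi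
    rw [phi_eta_sup, Bic.phi_eta, Bic.phi_eta, Bic.phi_eta, Bic.down_sup]
  map_inf' X Y := phi_injective <| by
    change (X ⊓ Y).eta.phi = (X.eta.phi ⊓ Y.eta.phi).eta.phi
    rw [phi_eta_inf, Bic.phi_eta, Bic.phi_eta, Bic.phi_eta, ← Bic.down_inf,
      Bic.down_inf_of_down_eq X.down_down Y.down_down]

theorem etaHom_surjective : Function.Surjective (etaHom (T := T)) := fun A => ⟨A.phi, A.eta_phi⟩

theorem range_phi : Set.range (fun A : T.FG => (phiHom A).1) =
    Set.range (fun X : T.Bic => T.piDown X.1) := by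
  ext S
  constructor
  · rintro ⟨A, rfl⟩
    exact ⟨A.phi, congrArg Subtype.val A.down_phi⟩
  · rintro ⟨X, rfl⟩
    exact ⟨X.eta, phiSet_etaSet X⟩

/-- For the dual half, complementation maps Bic(T) onto its dual, and the dual of the flip lattice
is a quotient of that dual. -/
theorem isCongruenceUniform : IsCongruenceUniform T.FG :=
  isCongruenceUniform_of_separates (Bic.separatesJoinIrreducibles.map etaHom etaHom_surjective)
    ((Bic.separatesJoinIrreducibles.map Bic.complHom Bic.complHom_surjective).map
      (LatticeHom.dual etaHom) etaHom_surjective)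

theorem isPolygonal : IsPolygonal T.FG :=
  isPolygonal_of_upper (Bic.upperPolygonal.map etaHom etaHom_surjective)
    ((Bic.upperPolygonal.map Bic.complHom Bic.complHom_surjective).map
      (LatticeHom.dual etaHom) etaHom_surjective)

end FG

end Facets

end PlaneTree

namespace PlaneTree

/-! ### Flips -/

section Flips

variable {V : Type*} {T : PlaneTree V} {v w : ℤ → V} {m n a b k l : ℤ}

/-- The path `v` traverses the corner `c` at the index `k`. -/
def Corner.At (c : T.Corner) (v : ℤ → V) (k : ℤ) : Prop :=
  v k = c.apex ∧ ((T.TurnL v k ∧ v (k - 1) = c.side ∧ v (k + 1) = c.other) ∨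
    (T.TurnR v k ∧ v (k + 1) = c.side ∧ v (k - 1) = c.other))

theorem Corner.ext' {c d : T.Corner} (h1 : c.apex = d.apex) (h2 : c.side = d.side) : c = d := by
  cases c
  cases d
  cases h1
  cases h2
  rfl

theorem Corner.At.of_turnL {c : T.Corner} (hL : T.TurnL v k) (h : v k = c.apex)
    (h' : v (k + 1) = c.other ∨ v (k - 1) = c.side) : c.At v k := by
  have hL' := hL
  rw [TurnL, h] at hL'
  refine ⟨h, Or.inl ⟨hL, ?_⟩⟩
  rcases h' with h' | h'
  · rw [h'] at hL'
    exact ⟨hL'.left_unique c.leftTurn, h'⟩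
  · rw [h'] at hL'
    exact ⟨h', hL'.right_unique c.leftTurn⟩

theorem Corner.At.of_turnR {c : T.Corner} (hR : T.TurnR v k) (h : v k = c.apex)
    (h' : v (k - 1) = c.other ∨ v (k + 1) = c.side) : c.At v k := by
  have hR' := hR
  rw [TurnR, h] at hR'
  refine ⟨h, Or.inr ⟨hR, ?_⟩⟩
  rcases h' with h' | h'
  · rw [h'] at hR'
    exact ⟨hR'.left_unique c.leftTurn, h'⟩
  · rw [h'] at hR'
    exact ⟨h', hR'.right_unique c.leftTurn⟩

theorem Corner.At.containsCorner {c : T.Corner} (h : c.At v k) (hv : T.Line v m n) (h1 : m < k)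
    (h2 : k < n) : T.ContainsCorner (stretch v m n) c :=
  (containsCorner_iff hv).2 ⟨k, h1, h2, h.1, h.2.imp (fun h => h.2) fun h => h.2⟩

theorem ContainsCorner.exists_at {c : T.Corner} (hv : T.Line v m n)
    (h : T.ContainsCorner (stretch v m n) c) : ∃ k, m < k ∧ k < n ∧ c.At v k := by
  obtain ⟨k, h1, h2, h3, h4⟩ := (containsCorner_iff hv).1 h
  refine ⟨k, h1, h2, h3, ?_⟩
  have := c.leftTurn
  rcases h4 with h4 | h4
  · left
    rw [TurnL, h3, h4.1, h4.2]
    exact ⟨this, rfl, rfl⟩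
  · right
    rw [TurnR, h3, h4.1, h4.2]
    exact ⟨this, rfl, rfl⟩

variable [Finite V]

theorem Corner.At.unique {c d : T.Corner} (hv : T.Geo v m n) (h1 : m < k) (h2 : k < n)
    (hc : c.At v k) (hd : d.At v k) : c = d := by
  refine Corner.ext' (hc.1.symm.trans hd.1) ?_
  obtain ⟨-, ⟨c1, c2, -⟩ | ⟨c1, c2, -⟩⟩ := hc <;> obtain ⟨-, ⟨d1, d2, -⟩ | ⟨d1, d2, -⟩⟩ := hd
  · exact c2.symm.trans d2
  · exact absurd d1 (hv.not_turnR h1 h2 c1)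
  · exact absurd c1 (hv.not_turnR h1 h2 d1)
  · exact c2.symm.trans d2

omit [Finite V] in
theorem IsEtaArc.exists_at {X : Set (Set V)} {c : T.Corner} (hv : T.Geo v m n)
    (hm : T.IsLeaf (v m)) (hn : T.IsLeaf (v n)) (h : T.IsEtaArc X c (stretch v m n)) :
    ∃ k, m < k ∧ k < n ∧ c.At v k ∧ T.EtaRule X v m n k := by
  obtain ⟨k, h1, h2, h3⟩ := h.2.1.exists_at hv.toLine
  exact ⟨k, h1, h2, h3, (isEtaArc_iff hv hm hn h1 h2 h3.1 h.2.1).1 h⟩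

omit [Finite V] in
theorem EtaRule.isEtaArc {X : Set (Set V)} {c : T.Corner} (hE : T.EtaRule X v m n k)
    (hv : T.Geo v m n) (hm : T.IsLeaf (v m)) (hn : T.IsLeaf (v n)) (h1 : m < k) (h2 : k < n)
    (hc : c.At v k) : T.IsEtaArc X c (stretch v m n) :=
  (isEtaArc_iff hv hm hn h1 h2 hc.1 (hc.containsCorner hv.toLine h1 h2)).2 hE

/-- Of two distinct vertices obeying the rule, the earlier one in the order turns left and the later
one right. -/
theorem EtaRule.eq_of_turnL_iff {X : Set (Set V)} (hv : T.Geo v m n) (hk : m < k) (hk' : k < n)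
    (hl : m < l) (hl' : l < n) (h1 : T.EtaRule X v m n k) (h2 : T.EtaRule X v m n l)
    (h : T.TurnL v k ↔ T.TurnL v l) : k = l := by
  by_contra hne
  rw [(etaRule_iff hv).1 h1 l hl hl' (Ne.symm hne), (etaRule_iff hv).1 h2 k hk hk' hne] at h
  rcases Before.total (X := X) (v := v) hne with h' | h'
  · exact (h.1 h').asymm h'
  · exact (h.2 h').asymm h'

/-- An arc is attached to at most two corners. -/
theorem IsEtaArc.eq_or_eq {X : Set (Set V)} {c d e : T.Corner} {p : Set V}
    (hc : T.IsEtaArc X c p) (hd : T.IsEtaArc X d p) (he : T.IsEtaArc X e p) (hcd : c ≠ d) :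
    e = c ∨ e = d := by
  obtain ⟨v, m, n, -, hv, hm, hn, rfl⟩ := isArc_iff.1 hc.1
  obtain ⟨k, k1, k2, k3, k4⟩ := hc.exists_at hv hm hn
  obtain ⟨l, l1, l2, l3, l4⟩ := hd.exists_at hv hm hn
  obtain ⟨r, r1, r2, r3, r4⟩ := he.exists_at hv hm hn
  have h1 : ¬ (T.TurnL v k ↔ T.TurnL v l) := fun h => by
    obtain rfl := k4.eq_of_turnL_iff hv k1 k2 l1 l2 l4 h
    exact hcd (k3.unique hv k1 k2 l3)
  by_cases h2 : T.TurnL v r ↔ T.TurnL v k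
  · obtain rfl := r4.eq_of_turnL_iff hv r1 r2 k1 k2 k4 h2
    exact Or.inl (r3.unique hv r1 r2 k3)
  · have h3 : T.TurnL v r ↔ T.TurnL v l := by tauto
    obtain rfl := r4.eq_of_turnL_iff hv r1 r2 l1 l2 l4 h3
    exact Or.inr (r3.unique hv r1 r2 l3)

omit [Finite V] in
theorem IsArc.exists_align_of_mem_cSet {q : Set V} (hq : T.IsArc q) {x y : ℤ}
    (hv : T.Line v x y) (hxy : x < y) (h : stretch v x y ∈ T.CSet q) :
    ∃ w a b, T.Geo w a b ∧ T.IsLeaf (w a) ∧ T.IsLeaf (w b) ∧ stretch w a b = q ∧ a < x ∧ y < b ∧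
      (∀ k, x ≤ k → k ≤ y → w k = v k) ∧ T.TurnR w x ∧ T.TurnL w y := by
  have hsub : stretch v x y ⊆ q := by
    obtain ⟨w, a, b, _, hw, _, _, rfl⟩ := isArc_iff.1 hq
    obtain ⟨i, j, i1, _, j1, _, _, he, _, _⟩ := (mem_cSet_iff hw).1 h
    rw [he]
    exact stretch_subset i1 j1
  obtain ⟨w, a, b, h', hw, rfl, hax, hyb, heq⟩ := hq.exists_align hv
    (hsub (left_mem_stretch v hxy.le)) (hsub (right_mem_stretch v hxy.le))
  rw [stretch_congr fun k k1 k2 => (heq k k1 k2).symm] at h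
  obtain ⟨i, j, i1, hij, j1, hi, hj, he, iL, jR⟩ := (mem_cSet_iff hw.toGeo).1 h
  obtain ⟨rfl, rfl⟩ := hw.toLine.stretch_inj hax hxy.le hyb i1 hij.le j1 he
  have h1 : x ≠ a := by rintro rfl; exact hi hw.leaf_left
  have h2 : y ≠ b := by rintro rfl; exact hj hw.leaf_right
  exact ⟨w, a, b, hw.toGeo, hw.leaf_left, hw.leaf_right, rfl, by omega, by omega, heq,
    iL.resolve_left h1, jR.resolve_left h2⟩

theorem IsArc.exists_align_of_mem_cSet_mirror {q : Set V} (hq : T.IsArc q) {x y : ℤ}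
    (hv : T.Line v x y) (hxy : x < y) (h : stretch v x y ∈ T.mirror.CSet q) :
    ∃ w a b, T.Geo w a b ∧ T.IsLeaf (w a) ∧ T.IsLeaf (w b) ∧ stretch w a b = q ∧ a < x ∧ y < b ∧
      (∀ k, x ≤ k → k ≤ y → w k = v k) ∧ T.TurnL w x ∧ T.TurnR w y := by
  obtain ⟨w, a, b, h1, h2⟩ :=
    (isArc_mirror.2 hq).exists_align_of_mem_cSet (line_mirror.2 hv) hxy h
  simp only [turnL_mirror, turnR_mirror] at h2
  exact ⟨w, a, b, geo_mirror.1 h1, h2⟩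

omit [Finite V] in
theorem before_insert {X Y : T.Bic} {s : Set V} (hY : Y.1 = insert s X.1) (hw : T.Line w a b)
    {x y : ℤ} (hx : a ≤ x) (hxy : x < y) (hy : y ≤ b) (hs : stretch w x y = s) {i j : ℤ}
    (hi : a ≤ i) (hi' : i ≤ b) (hj : a ≤ j) (hj' : j ≤ b) (h1 : ¬ (i = x ∧ j = y))
    (h2 : ¬ (i = y ∧ j = x)) : Before X.1 w i j ↔ Before Y.1 w i j := by
  have key : ∀ i j, a ≤ i → i < j → j ≤ b → ¬ (i = x ∧ j = y) →
      (stretch w i j ∈ X.1 ↔ stretch w i j ∈ Y.1) := by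
    intro i j e1 e2 e3 e4
    rw [hY, Set.mem_insert_iff, or_iff_right]
    rw [← hs]
    exact fun he => e4 (hw.stretch_inj e1 e2.le e3 hx hxy.le hy he)
  refine or_congr (and_congr_right fun hij => not_congr (key i j hi hij hj' h1))
    (and_congr_right fun hij => key j i hj hij hi' fun h => h2 ⟨h.2, h.1⟩)

-- Inserting s changes the order of the path only by swapping x and y. A vertex between them would
-- keep its position relative to both, and transitivity would forbid the swap.
omit [Finite V] in
theorem not_between_of_insert {X Y : T.Bic} {s : Set V} (hsX : s ∉ X.1) (hY : Y.1 = insert s X.1)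
    (hw : T.Geo w a b) {x y : ℤ} (hx : a ≤ x) (hxy : x < y) (hy : y ≤ b)
    (hs : stretch w x y = s) {k : ℤ} (hk : a ≤ k) (hk' : k ≤ b) :
    ¬ (Before X.1 w x k ∧ Before X.1 w k y) ∧ ¬ (Before Y.1 w y k ∧ Before Y.1 w k x) := by
  have hbX : Before X.1 w x y := (before_iff_of_lt hxy).2 (by rwa [hs])
  have hbY : Before Y.1 w y x := (before_iff_of_gt hxy).2 (by rw [hs, hY]; exact Set.mem_insert _ _)
  have cong : ∀ i j, a ≤ i → i ≤ b → a ≤ j → j ≤ b → ¬ (i = x ∧ j = y) → ¬ (i = y ∧ j = x) →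
      (Before X.1 w i j ↔ Before Y.1 w i j) := fun i j e1 e2 e3 e4 e5 e6 =>
    before_insert hY hw.toLine hx hxy hy hs e1 e2 e3 e4 e5 e6
  constructor
  · rintro ⟨h1, h2⟩
    have n1 := h1.ne
    have n2 := h2.ne
    rw [cong x k hx (by omega) hk hk' (by omega) (by omega)] at h1
    rw [cong k y hk hk' (by omega) hy (by omega) (by omega)] at h2
    exact (Before.trans Y hw hx (by omega) hk hk' (by omega) hy h1 h2).asymm hbY
  · rintro ⟨h1, h2⟩
    have n1 := h1.ne
    have n2 := h2.ne
    rw [← cong y k (by omega) hy hk hk' (by omega) (by omega)] at h1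
    rw [← cong k x hk hk' hx (by omega) (by omega) (by omega)] at h2
    exact (Before.trans X hw (by omega) hy hk hk' hx (by omega) h1 h2).asymm hbX

/-- In a fitting arc a left turn i immediately followed in the order by a right turn j must be the
last left turn, and j the first right turn. -/
theorem Fits.etaRule_of_not_between {X : Set (Set V)} (h : T.Fits X (stretch v m n))
    (hv : T.Geo v m n) (hm : T.IsLeaf (v m)) (hn : T.IsLeaf (v n)) {i j : ℤ} (hi : m < i)
    (hi' : i < n) (hj : m < j) (hj' : j < n) (hL : T.TurnL v i) (hR : T.TurnR v j)
    (hb : ∀ k, m ≤ k → k ≤ n → ¬ (Before X v i k ∧ Before X v k j)) :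
    T.EtaRule X v m n i ∧ T.EtaRule X v m n j := by
  constructor
  · refine h.etaRule_last hv hm hn hi hi' hL fun r r1 r2 r3 hri => ?_
    refine (Before.total hri).resolve_right fun h' => hb r r1.le r2.le ⟨h', ?_⟩
    exact (fits_iff hv hm hn).1 h r j r1 r2 hj hj' r3 hR
  · refine h.etaRule_first hv hm hn hj hj' hR fun r r1 r2 r3 hrj => ?_
    refine (Before.total hrj).resolve_left fun h' => hb r r1.le r2.le ⟨?_, h'⟩
    exact (fits_iff hv hm hn).1 h i r hi hi' r1 r2 hL r3

/-- If `Y` is obtained from `X` by inserting the segment `s`, then an arc of `η(X)` with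
`s ∈ K_r` is attached to corners at the ends of `s`. -/
theorem isEtaArc_of_insert {X Y : T.Bic} {x y : ℤ} (hsX : stretch v x y ∉ X.1)
    (hY : Y.1 = insert (stretch v x y) X.1) (hv : T.Line v x y) (hxy : x < y) {c d : T.Corner}
    (hc : c.apex = v x) (hc' : c.other = v (x + 1)) (hd : d.apex = v y)
    (hd' : d.other = v (y - 1)) {r : Set V} (hr : T.IsArc r) (hf : T.Fits X.1 r)
    (hs : stretch v x y ∈ T.mirror.CSet r) : T.IsEtaArc X.1 c r ∧ T.IsEtaArc X.1 d r := by
  obtain ⟨w, a, b, hw, ha, hb, rfl, hax, hyb, heq, hL, hR⟩ :=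
    hr.exists_align_of_mem_cSet_mirror hv hxy hs
  have hse : stretch w x y = stretch v x y := stretch_congr heq
  obtain ⟨h1, h2⟩ := hf.etaRule_of_not_between hw ha hb hax (by omega) (by omega) hyb hL hR
    fun k k1 k2 => (not_between_of_insert hsX hY hw hax.le hxy hyb.le hse k1 k2).1
  refine ⟨h1.isEtaArc hw ha hb hax (by omega) (Corner.At.of_turnL hL ?_ (Or.inl ?_)),
    h2.isEtaArc hw ha hb (by omega) hyb (Corner.At.of_turnR hR ?_ (Or.inl ?_))⟩
  · rw [hc, heq x le_rfl hxy.le]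
  · rw [hc', heq _ (by omega) (by omega)]
  · rw [hd, heq y hxy.le le_rfl]
  · rw [hd', heq _ (by omega) (by omega)]

/-- After the swap y immediately precedes x. An arc with s in C_r turns right at x and left at y, so
the same edges of s now bound its corners from the other side, which moves both corners one step
clockwise. -/
theorem isEtaArc_next_of_insert {X Y : T.Bic} {x y : ℤ} (hsX : stretch v x y ∉ X.1)
    (hY : Y.1 = insert (stretch v x y) X.1) (hv : T.Line v x y) (hxy : x < y) {c d : T.Corner}
    (hc : c.apex = v x) (hc' : c.other = v (x + 1)) (hd : d.apex = v y)
    (hd' : d.other = v (y - 1)) {r : Set V} (hr : T.IsArc r) (hf : T.Fits Y.1 r)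
    (hs : stretch v x y ∈ T.CSet r) : T.IsEtaArc Y.1 c.next r ∧ T.IsEtaArc Y.1 d.next r := by
  obtain ⟨w, a, b, hw, ha, hb, rfl, hax, hyb, heq, hR, hL⟩ :=
    hr.exists_align_of_mem_cSet hv hxy hs
  have hse : stretch w x y = stretch v x y := stretch_congr heq
  obtain ⟨h1, h2⟩ := hf.etaRule_of_not_between hw ha hb (by omega) hyb hax (by omega) hL hR
    fun k k1 k2 => (not_between_of_insert hsX hY hw hax.le hxy hyb.le hse k1 k2).2
  refine ⟨h2.isEtaArc hw ha hb hax (by omega) (Corner.At.of_turnR hR ?_ (Or.inr ?_)),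
    h1.isEtaArc hw ha hb (by omega) hyb (Corner.At.of_turnL hL ?_ (Or.inr ?_))⟩
  · rw [heq x le_rfl hxy.le]
    exact hc.symm
  · rw [heq _ (by omega) (by omega)]
    exact hc'.symm
  · rw [heq y hxy.le le_rfl]
    exact hd.symm
  · rw [heq _ (by omega) (by omega)]
    exact hd'.symm

/-- In a path obeying the rule defining `η`, both ends of an inserted segment obey it. -/
theorem Bic.turnL_iff_of_insert {X Y : T.Bic} {x y : ℤ} (hsX : stretch v x y ∉ X.1)
    (hY : Y.1 = insert (stretch v x y) X.1) (hv : T.Geo v x y)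
    (hC : T.CSet (stretch v x y) ⊆ Y.1) {u : ℤ} (h1 : x < u) (h2 : u < y) :
    (T.TurnL v u ↔ stretch v x u ∈ X.1) ∧ (T.TurnL v u ↔ stretch v x u ∈ Y.1) := by
  have hs : stretch v x y ∈ Y.1 := hY ▸ Set.mem_insert _ _
  have nl := fun z hz => not_isLeaf_of_mem_seg (Y.subset hs) (x := z) hz
  have hx := nl _ (left_mem_stretch v (by omega))
  have hy := nl _ (right_mem_stretch v (by omega))
  have hu := hv.not_isLeaf h1 h2
  have mem_iff : ∀ i j, x ≤ i → i < j → j ≤ y → ¬ (i = x ∧ j = y) →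
      (stretch v i j ∈ Y.1 ↔ stretch v i j ∈ X.1) := by
    intro i j e1 e2 e3 e4
    rw [hY, Set.mem_insert_iff, or_iff_right]
    exact fun he => e4 (hv.toLine.stretch_inj e1 e2.le e3 le_rfl (by omega) le_rfl he)
  have key : T.TurnL v u ↔ stretch v x u ∈ X.1 := by
    constructor
    · intro hL
      rw [← mem_iff x u le_rfl h1 h2.le (by omega)]
      exact hC ((mem_cSet_iff hv).2 ⟨x, u, le_rfl, h1, h2.le, hx, hu, rfl, Or.inl rfl, Or.inr hL⟩)
    · intro h
      by_contra hL
      have hR := (hv.not_turnL_iff h1 h2).1 hL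
      refine hsX (X.isClosedSet.comp hv le_rfl h1 h2 le_rfl h ?_)
      rw [← mem_iff u y h1.le h2 le_rfl (by omega)]
      exact hC ((mem_cSet_iff hv).2 ⟨u, y, h1.le, h2, le_rfl, hu, hy, rfl, Or.inr hR, Or.inl rfl⟩)
  exact ⟨key, key.trans (mem_iff x u le_rfl h1 h2.le (by omega)).symm⟩

omit [Finite V] in
theorem exists_corner_other {x y : V} (hx : ¬ T.IsLeaf x) (h : T.graph.Adj x y) :
    ∃ c : T.Corner, c.apex = x ∧ c.other = y := by
  obtain ⟨z, hz⟩ := exists_leftTurn' h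
  exact ⟨⟨x, z, hx, hz.adj_left⟩, rfl, (hz.right_unique ⟨hz.adj_left, rfl⟩).symm⟩

namespace FG

/-- Let Y = φ(B) and let X arise from Y by removing one segment s while staying above φ(A). Then
η(X) is A, since it lies between A and B and its projection misses s. The fitting conditions for X
and Y differ only at s: arcs with s in K_p are lost and arcs with s in C_q are gained. Either kind
is attached to corners at the ends of s, hence unique. -/
theorem flip_of_covBy {A B : T.FG} (hAB : A ⋖ B) : T.Flip A B := by
  have hlt : A.phi < B.phi := lt_of_le_of_ne hAB.le fun h => hAB.ne (phi_injective h)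
  obtain ⟨s, hsY, -, X, hAX, hsX, hY⟩ := Bic.exists_remove hlt
  set Y := B.phi with hYB
  have hXY : X ≤ Y := fun t ht => by
    rw [hY]
    exact Set.mem_insert_of_mem _ ht
  have hXA : X.eta = A := by
    have h1 : A ≤ X.eta := by
      rw [le_iff, Bic.phi_eta, ← A.down_phi]
      exact Bic.down_mono hAX
    have h2 : X.eta ≤ B := by
      rw [le_iff, Bic.phi_eta]
      exact X.down_le.trans hXY
    refine (hAB.eq_or_eq h1 h2).resolve_right fun h => hsX ?_
    have := congrArg phi h
    rw [Bic.phi_eta] at this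
    exact X.down_le (this ▸ hsY)
  have hA : A.1 = T.etaSet X.1 := by rw [← hXA]; rfl
  have hB : B.1 = T.etaSet Y.1 := B.etaSet_phi.symm
  have hC : T.CSet s ⊆ Y.1 := by
    have : s ∈ Y.down.1 := by rwa [hYB, B.down_phi]
    exact this.2
  obtain ⟨v, x, y, hxy, hv, hx, hy, rfl⟩ := mem_seg_iff.1 (Y.subset hsY)
  obtain ⟨c, hc, hc'⟩ := exists_corner_other hx (hv.adj x le_rfl hxy)
  obtain ⟨d, hd, hd'⟩ := exists_corner_other hy (hv.toLine.adj' hxy le_rfl)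
  have rule := fun u (h1 : x < u) (h2 : u < y) => Bic.turnL_iff_of_insert hsX hY hv hC h1 h2
  have hcL := c.leftTurn
  have hcR := c.next.leftTurn
  rw [hc, hc'] at hcL
  rw [show c.next.side = v (x + 1) from hc', show c.next.apex = v x from hc] at hcR
  -- The segment s obeys the rule for X. It is extended so that the arc turns left at v x; at v y
  -- the rule demands a right turn because s is not in X, so s lies in K_p.
  obtain ⟨p, hp, hpf, hsp⟩ : ∃ p, p ∈ T.etaSet X.1 ∧ T.Fits X.1 p ∧
      stretch v x y ∈ T.mirror.CSet p := by
    obtain ⟨w, a, b, ha, hb, hw, hwv, hwx, hwa, hwb, hE, hL⟩ := exists_arc_through X.1 hv hxy hx hy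
      (fun u h1 h2 => (rule u h1 h2).1) (Or.inl hcL)
    have hL := (hw.not_turnL_iff (by omega) hb).1 (mt hL.1 hsX)
    have hL' : T.TurnL w x := by
      rw [TurnL, hwx, hwv x le_rfl (by omega), hwv (x + 1) (by omega) (by omega)]
      exact hcL
    have hf := hE.fits hw hwa hwb ha (by omega)
    refine ⟨_, mem_etaSet_iff.2 ⟨isArc_iff.2 ⟨w, a, b, by omega, hw, hwa, hwb, rfl⟩,
      (not_isBoundaryArc_iff (by omega) hw hwa hwb).2 ⟨⟨x, ha, by omega, hL'⟩, y, by omega, hb, hL⟩,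
      hf⟩, hf, ?_⟩
    refine (mem_cSet_mirror_iff hw).2 ⟨x, y, ha.le, hxy, hb.le, ?_, ?_, (stretch_congr hwv).symm,
      Or.inr hL', Or.inr hL⟩
    · rwa [hwv x le_rfl hxy.le]
    · rwa [hwv y hxy.le le_rfl]
  obtain ⟨q, hq, hqf, hsq⟩ : ∃ q, q ∈ T.etaSet Y.1 ∧ T.Fits Y.1 q ∧
      stretch v x y ∈ T.CSet q := by
    obtain ⟨w, a, b, ha, hb, hw, hwv, hwx, hwa, hwb, hE, hL⟩ := exists_arc_through Y.1 hv hxy hx hy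
      (fun u h1 h2 => (rule u h1 h2).2) (Or.inr hcR)
    have hL := hL.2 hsY
    have hL' : T.TurnR w x := by
      rw [TurnR, hwx, hwv x le_rfl (by omega), hwv (x + 1) (by omega) (by omega)]
      exact hcR
    have hf := hE.fits hw hwa hwb ha (by omega)
    refine ⟨_, mem_etaSet_iff.2 ⟨isArc_iff.2 ⟨w, a, b, by omega, hw, hwa, hwb, rfl⟩,
      (not_isBoundaryArc_iff (by omega) hw hwa hwb).2 ⟨⟨y, by omega, hb, hL⟩, x, ha, by omega, hL'⟩,
      hf⟩, hf, ?_⟩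
    refine (mem_cSet_iff hw).2 ⟨x, y, ha.le, hxy, hb.le, ?_, ?_, (stretch_congr hwv).symm,
      Or.inr hL', Or.inr hL⟩
    · rwa [hwv x le_rfl hxy.le]
    · rwa [hwv y hxy.le le_rfl]
  have etaX := fun r (hr : T.IsArc r) hf hs =>
    isEtaArc_of_insert hsX hY hv.toLine hxy hc hc' hd hd' (r := r) hr hf hs
  have etaY := fun r (hr : T.IsArc r) hf hs =>
    isEtaArc_next_of_insert hsX hY hv.toLine hxy hc hc' hd hd' (r := r) hr hf hs
  have hpX := etaX p (mem_etaSet_iff.1 hp).1 hpf hsp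
  have hqY := etaY q (mem_etaSet_iff.1 hq).1 hqf hsq
  have hqA : q ∉ A.1 := by
    rw [hA, mem_etaSet_iff]
    exact fun h => hsX (h.2.2.1 hsq)
  refine ⟨p, q, hA ▸ hp, hqA, ?_, c, d, ?_, ?_, ?_, ?_, ?_⟩
  · rw [hA, hB]
    ext r
    constructor
    · intro hr
      obtain ⟨r1, r2, r3⟩ := mem_etaSet_iff.1 hr
      by_cases hrs : stretch v x y ∈ T.CSet r
      · exact Or.inr ((existsUnique_isEtaArc Y.1 c.next).unique (etaY r r1 r3 hrs).1 hqY.1)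
      · refine Or.inl ⟨mem_etaSet_iff.2 ⟨r1, r2, fun t ht => ?_, fun t ht h => r3.2 t ht (hXY h)⟩, ?_⟩
        · have := r3.1 ht
          rw [hY] at this
          refine this.resolve_left ?_
          rintro rfl
          exact hrs ht
        · rintro rfl
          exact r3.2 _ hsp hsY
    · rintro (⟨hr, hrp⟩ | rfl)
      · obtain ⟨r1, r2, r3⟩ := mem_etaSet_iff.1 hr
        refine mem_etaSet_iff.2 ⟨r1, r2, r3.1.trans hXY, fun t ht h => ?_⟩
        rw [hY] at h
        rcases h with rfl | h
        · exact hrp ((existsUnique_isEtaArc X.1 c).unique (etaX r r1 r3 ht).1 hpX.1)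
        · exact r3.2 t ht h
      · exact hq
  · rintro rfl
    have := hv.inj x y le_rfl hxy.le hxy.le le_rfl (hc.symm.trans hd)
    omega
  · rw [hA]
    exact isMarked_etaSet_iff.2 ⟨hp, hpX.1⟩
  · rw [hA]
    exact isMarked_etaSet_iff.2 ⟨hp, hpX.2⟩
  · rw [hB]
    exact isMarked_etaSet_iff.2 ⟨hq, hqY.1⟩
  · rw [hB]
    exact isMarked_etaSet_iff.2 ⟨hq, hqY.2⟩

end FG

end Flips

end PlaneTree

namespace PlaneTree

/-! ### Flips are exactly the covers of the flip order. -/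

section FlipCover

variable {V : Type*} {T : PlaneTree V} [Finite V]

/-- At a vertex of degree at least three, two clockwise steps do not lead back to the start. -/
theorem Corner.side_ne_next_other (c : T.Corner) : c.side ≠ c.next.other := by
  intro h
  refine c.leftTurn.not_rev c.interior ?_
  have := c.next.leftTurn
  rwa [← h] at this

/-- The shape of two arcs `p` and `q` that are attached to two corners and to the corners clockwise
from these: they share the path between the two corners, and part at its ends. -/
theorem exists_shape {X : T.Bic} {Y : Set (Set V)} {p q : Set V} {c d : T.Corner} (hcd : c ≠ d)
    (hpc : T.IsEtaArc X.1 c p) (hpd : T.IsEtaArc X.1 d p) (hqc : T.IsEtaArc Y c.next q)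
    (hqd : T.IsEtaArc Y d.next q) : ∃ (v : ℤ → V) (m n k l : ℤ) (g : V → ℤ),
      T.GatedArc v m n g ∧ p = stretch v m n ∧ m < k ∧ k < l ∧ l < n ∧ v k = c.apex ∧
      v (k + 1) = c.other ∧ v l = d.apex ∧ v (l - 1) = d.other ∧ T.TurnL v k ∧ T.TurnR v l ∧
      stretch v k l ∉ X.1 ∧ ∃ (w : ℤ → V) (a b : ℤ) (h : V → ℤ), T.GatedArc w a b h ∧
        q = stretch w a b ∧ a < k ∧ l < b ∧ (∀ i, k ≤ i → i ≤ l → w i = v i) ∧ T.TurnR w k ∧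
        T.TurnL w l ∧ v (k - 1) ≠ w (k - 1) ∧ v (l + 1) ≠ w (l + 1) := by
  obtain ⟨v, m, n, k, hv, hm, hn, hmk, hkn, v1, v2, v3, rfl, hE⟩ := hpc.exists_param
  obtain ⟨l, hml, hln, hd, hE'⟩ := hpd.exists_at hv hm hn
  obtain ⟨g, hv⟩ := hv.exists_gatedArc (by omega) hm hn
  have hL : T.TurnL v k := by
    rw [TurnL, v1, v2, v3]
    exact c.leftTurn
  have hc : c.At v k := Corner.At.of_turnL hL v2 (Or.inl v3)
  have hkl : k ≠ l := by
    rintro rfl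
    exact hcd (hc.unique hv.toGeo hmk hkn hd)
  have hb := ((etaRule_iff hv.toGeo).1 hE' k hmk hkn hkl).1 hL
  have hR : T.TurnR v l := (hE.turnR_iff hv.toGeo hml hln hkl.symm).2 hb
  obtain ⟨d1, d2⟩ := hd
  obtain ⟨-, d3, d4⟩ := d2.resolve_left fun h => hv.not_turnR hml hln h.1 hR
  have sc := hqc.2.1.subset
  have sd := hqd.2.1.subset
  rcases lt_or_gt_of_ne hkl with hkl | hkl
  · obtain ⟨w, a, b, h, hw, rfl, hak, hlb, heq⟩ := hqc.1.exists_align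
      (hv.toLine.sub hmk.le hkl.le hln.le) (by rw [v2]; exact sc.2.1) (by rw [d1]; exact sd.2.1)
    refine ⟨v, m, n, k, l, g, hv, rfl, hmk, hkl, hln, v2, v3, d1, d4, hL, hR,
      (before_iff_of_lt hkl).1 hb, w, a, b, h, hw, rfl, ?_⟩
    obtain ⟨k', k1, k2, k3, k4⟩ := hqc.2.1.exists_at hw.toLine
    obtain rfl : k' = k := hw.inj _ _ k1.le k2.le hak (by omega)
      (k3.trans (v2.symm.trans (heq k le_rfl hkl.le).symm))
    obtain ⟨l', l1, l2, l3, l4⟩ := hqd.2.1.exists_at hw.toLine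
    obtain rfl : l' = l := hw.inj _ _ l1.le l2.le (by omega) hlb
      (l3.trans (d1.symm.trans (heq l hkl.le le_rfl).symm))
    have hk := k4.resolve_left fun h => by
      have e1 : w (k' - 1) = w (k' + 1) :=
        h.2.1.trans (v3.symm.trans (heq _ (by omega) (by omega)).symm)
      have := hw.inj _ _ (by omega) (by omega) (by omega) (by omega) e1
      omega
    have hl := l4.resolve_right fun h => by
      have e1 : w (l' + 1) = w (l' - 1) :=
        h.2.1.trans (d4.symm.trans (heq _ (by omega) (by omega)).symm)
      have := hw.inj _ _ (by omega) (by omega) (by omega) (by omega) e1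
      omega
    refine ⟨k1, l2, heq, hk.1, hl.1, ?_, ?_⟩
    · rw [v1, hk.2.2]
      exact c.side_ne_next_other
    · rw [d3, hl.2.2]
      exact d.side_ne_next_other
  -- If d came before c on p, then q, containing the outer neighbours `d.other` and `c.other`, would
  -- follow p between them and traverse c instead of `c.next` at its apex.
  · exfalso
    obtain ⟨w, a, b, h, hw, rfl, hak, hlb, heq⟩ := hqc.1.exists_align
      (hv.toLine.sub (i := l - 1) (j := k + 1) (by omega) (by omega) (by omega))
      (by rw [d4]; exact sd.1) (by rw [v3]; exact sc.1)
    obtain ⟨k', k1, k2, k3, k4⟩ := hqc.2.1.exists_at hw.toLine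
    obtain rfl : k' = k := hw.inj _ _ k1.le k2.le (by omega) (by omega)
      (k3.trans (v2.symm.trans (heq k (by omega) (by omega)).symm))
    rcases k4 with h | h
    · have e1 : w (k' - 1) = w (k' + 1) :=
        h.2.1.trans (v3.symm.trans (heq _ (by omega) (by omega)).symm)
      have := hw.inj _ _ (by omega) (by omega) (by omega) (by omega) e1
      omega
    · exact c.side_ne_next_other (v1.symm.trans ((heq _ (by omega) (by omega)).symm.trans h.2.2))

omit [Finite V] in
theorem GatedArc.notMem_of_parted {v w : ℤ → V} {m n a b k l : ℤ} {g h : V → ℤ}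
    (hv : T.GatedArc v m n g) (hw : T.GatedArc w a b h) (hmk : m < k) (hkl : k < l) (hln : l < n)
    (hak : a < k) (hlb : l < b) (heq : ∀ i, k ≤ i → i ≤ l → w i = v i)
    (hne : v (l + 1) ≠ w (l + 1)) {i : ℤ} (h1 : l < i) (h2 : i ≤ n) : v i ∉ stretch w a b := by
  intro hi
  have hgi := hv.apply i (by omega) h2
  have := hw.eq_of_parted hv (x := k) (y := l) (z := v i) hak.le hmk.le hkl hlb hln heq hne.symm
    (by omega)
  have h3 := hw.eq_apply hi
  rw [this, heq l hkl.le le_rfl] at h3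
  have := hv.inj _ _ (by omega) h2 (by omega) hln.le h3
  omega

/-- The segments in `C_p` and `K_q` for arcs `p` and `q` as in `exists_shape`. -/
theorem GatedArc.disjoint_of_parted {v w : ℤ → V} {m n a b k l : ℤ} {g h : V → ℤ}
    (hv : T.GatedArc v m n g) (hw : T.GatedArc w a b h) (hmk : m < k) (hkl : k < l) (hln : l < n)
    (hak : a < k) (hlb : l < b) (heq : ∀ i, k ≤ i → i ≤ l → w i = v i)
    (hne : v (k - 1) ≠ w (k - 1)) (hne' : v (l + 1) ≠ w (l + 1)) (hL : T.TurnL v k) {t : Set V} (ht : t ∈ T.CSet (stretch v m n)) :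
    t ∉ T.mirror.CSet (stretch w a b) := by
  intro ht'
  obtain ⟨i, j, i1, hij, j1, hi, hj, rfl, iR, -⟩ := (mem_cSet_iff hv.toGeo).1 ht
  obtain ⟨i', j', i1', hij', j1', hi', hj', he, iL, -⟩ := (mem_cSet_mirror_iff hw.toGeo).1 ht'
  have hsub : stretch v i j ⊆ stretch w a b := by
    rw [he]
    exact stretch_subset i1' j1'
  have hjl : j ≤ l := by
    by_contra hjl
    exact hv.notMem_of_parted hw hmk hkl hln hak hlb heq hne' (by omega) j1
      (hsub (right_mem_stretch v hij.le))
  have hki : k ≤ i := by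
    by_contra hki
    refine hv.rev.notMem_of_parted hw.rev (k := -l) (l := -k) (i := -i) (by omega) (by omega)
      (by omega) (by omega) (by omega) (fun r r1 r2 => heq (-r) (by omega) (by omega)) ?_
      (by omega) (by omega) ?_
    · simp only [PlaneTree.rev, show -(-k + 1) = k - 1 by ring]
      exact hne
    · rw [stretch_rev, neg_neg, neg_neg]
      simp only [PlaneTree.rev, neg_neg]
      exact hsub (left_mem_stretch v hij.le)
  have iR := iR.resolve_left (by omega)
  have hki : k < i := hki.lt_of_ne (by
    rintro rfl
    exact hv.not_turnR hmk (by omega) hL iR)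
  rw [stretch_congr fun r r1 r2 => (heq r (by omega) (by omega)).symm] at he
  obtain ⟨rfl, rfl⟩ := hw.toLine.stretch_inj (by omega) hij.le (by omega) i1' hij'.le j1' he
  have iL := iL.resolve_left (by omega)
  rw [turnL_congr (heq _ (by omega) (by omega)) (heq _ (by omega) (by omega))
    (heq _ (by omega) (by omega))] at iL
  exact hv.not_turnR (by omega) (by omega) iL iR

namespace FG

omit [Finite V] in
theorem isArc_of_mem {A : T.FG} {p : Set V} (hp : p ∈ A.1) : T.IsArc p := (A.2.1.1 p hp).1

theorem disjoint_of_mem {A : T.FG} {p q t : Set V} (hp : p ∈ A.1) (hq : q ∈ A.1)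
    (ht : t ∈ T.CSet p) : t ∉ T.mirror.CSet q := by
  intro ht'
  by_cases hpq : p = q
  · subst hpq
    exact (isArc_of_mem hp).disjoint_cSet_mirror t ht ht'
  · exact A.2.1.2 hp hq hpq (crossing_of_mem (isArc_of_mem hp) (isArc_of_mem hq) ht ht')

/-- The set U is the mirror φ of B, generated by the K_q with q in B. As in `notMem_phiSet`, U
avoids every C_p with p in A, so φ(A) lies in the complement of U, which is closed. Passing back
through the mirror turns this into the inequality. -/
theorem le_of_disjoint {A B : T.FG}
    (h : ∀ p ∈ A.1, ∀ q ∈ B.1, ∀ t ∈ T.CSet p, t ∉ T.mirror.CSet q) : A ≤ B := by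
  set U : T.mirror.Bic := B.phi.mir.down with hU
  have hUv : U.1 = T.mirror.phiSet B.1 := by
    rw [← B.etaSet_phi, ← etaSet_mirror, phiSet_etaSet]
    rfl
  obtain ⟨hUs, hUc, -⟩ := Bic.isClosedSet_of_mirror U.2
  have hA : A.phi.1 ⊆ T.Seg \ U.1 := by
    refine closureSet_subset hUc (Set.iUnion₂_subset fun p hp t ht => ⟨cSet_subset_seg _ ht, ?_⟩)
    rw [hUv]
    exact notMem_phiSet (isArc_mirror.2 (isArc_of_mem hp))
      (fun q hq t ht ht' => h p hp q hq t (by rwa [mirror_mirror] at ht') ht)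
      (by rwa [mirror_mirror])
  have hle : U ≤ A.phi.mir := fun t ht => ⟨hUs ht, fun h => (hA h).2 ht⟩
  have hdown := Bic.down_mono hle
  rw [hU, Bic.down_down, Bic.mir_down_le_iff, down_phi, down_phi] at hdown
  exact hdown

/-- Of the two conditions for fitting φ(C), the one on C_p is inherited from below and the one on
K_p from above. -/
theorem mem_of_le_of_le {A B C : T.FG} (h1 : A ≤ C) (h2 : C ≤ B) {p : Set V} (hp : p ∈ A.1)
    (hp' : p ∈ B.1) : p ∈ C.1 := by
  rw [← etaSet_phi, mem_etaSet_iff] at hp hp' ⊢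
  exact ⟨hp.1, hp.2.1, hp.2.2.1.trans h1, fun t ht h => hp'.2.2.2 t ht (h2 h)⟩

theorem isMarked_iff {A : T.FG} {p : Set V} {c : T.Corner} :
    T.IsMarked A.1 p c ↔ p ∈ A.1 ∧ T.IsEtaArc A.phi.1 c p := by
  have := isMarked_etaSet_iff (X := A.phi) (c := c) (p := p)
  rwa [etaSet_phi] at this

/-- Any arc of A and any arc of B lie in a common facet, except for the pair p, q; for this pair the
shape of the two arcs decides (`disjoint_of_parted`). -/
theorem lt_of_flip {A B : T.FG} (h : T.Flip A B) : A < B := by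
  obtain ⟨p, q, hp, hq, hAB, c, d, hcd, m1, m2, m3, m4⟩ := h
  rw [isMarked_iff] at m1 m2 m3 m4
  refine lt_of_le_of_ne (le_of_disjoint fun r hr r' hr' t ht => ?_) fun h => hq (h ▸ m3.1)
  have hB : ∀ r ∈ A.1, r ≠ p → r ∈ B.1 := fun r hr hrp => by
    rw [hAB]
    exact Or.inl ⟨hr, hrp⟩
  by_cases hrp : r = p
  · subst hrp
    have hr'' := hr'
    rw [hAB] at hr''
    rcases hr'' with ⟨hr'', -⟩ | hr''
    · exact disjoint_of_mem hr hr'' ht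
    · obtain rfl : r' = q := hr''
      obtain ⟨v, m, n, k, l, g, hv, rfl, h1, h2, h3, -, -, -, -, hL, hR, -, w, a, b, h, hw, rfl, h4,
        h5, heq, -, -, h6, h7⟩ := exists_shape hcd m1.2 m2.2 m3.2 m4.2
      exact hv.disjoint_of_parted hw h1 h2 h3 h4 h5 heq h6 h7 hL ht
  · exact disjoint_of_mem (hB r hr hrp) hr' ht

/-- The path between the corners of a flip. -/
theorem exists_path_of_flip {A B : T.FG} {p q : Set V} {c d : T.Corner} (hcd : c ≠ d)
    (m1 : T.IsMarked A.1 p c) (m2 : T.IsMarked A.1 p d) (m3 : T.IsMarked B.1 q c.next)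
    (m4 : T.IsMarked B.1 q d.next) : ∃ (v : ℤ → V) (k l : ℤ), T.Line v k l ∧ k < l ∧
      v k = c.apex ∧ v (k + 1) = c.other ∧ v l = d.apex ∧ v (l - 1) = d.other := by
  rw [isMarked_iff] at m1 m2 m3 m4
  obtain ⟨v, m, n, k, l, g, hv, rfl, h1, h2, h3, h4, h5, h6, h7, -⟩ :=
    exists_shape hcd m1.2 m2.2 m3.2 m4.2
  exact ⟨v, k, l, hv.toLine.sub h1.le h2.le h3.le, h2, h4, h5, h6, h7⟩

/-- Otherwise there are covers A ⋖ C ⋖ D ≤ B, and both are flips. Arcs common to A and B persist in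
between, so the first flip removes p and the second removes the arc just added. That arc is attached
to at most two corners, so the second flip starts at the corners where the first one ended. Both
flips then describe the same path between the two apices, but with different first edges at one end.
-/
theorem covBy_of_flip {A B : T.FG} (h : T.Flip A B) : A ⋖ B := by
  have hlt := lt_of_flip h
  obtain ⟨p, q, hp, hq, hAB, -⟩ := h
  obtain ⟨C, hAC, hCB⟩ := exists_covBy_le_of_lt hlt
  rcases hCB.eq_or_lt with rfl | hCB
  · exact hAC
  exfalso
  obtain ⟨D, hCD, hDB⟩ := exists_covBy_le_of_lt hCB
  obtain ⟨p₁, q₁, hp₁, hq₁, hAC', c, d, hcd, m1, m2, m3, m4⟩ := flip_of_covBy hAC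
  obtain ⟨p₂, q₂, hp₂, hq₂, hCD', c', d', hcd', n1, n2, n3, n4⟩ := flip_of_covBy hCD
  have hp₁C : p₁ ∉ C.1 := by
    rw [hAC']
    rintro (h | h)
    · exact h.2 rfl
    · exact hq₁ (Set.mem_singleton_iff.1 h ▸ hp₁)
  have hp₂D : p₂ ∉ D.1 := by
    rw [hCD']
    rintro (h | h)
    · exact h.2 rfl
    · exact hq₂ (Set.mem_singleton_iff.1 h ▸ hp₂)
  obtain rfl : p₁ = p := by
    by_contra hne
    refine hp₁C (mem_of_le_of_le hAC.le hCB.le hp₁ ?_)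
    rw [hAB]
    exact Or.inl ⟨hp₁, hne⟩
  obtain rfl : p₂ = q₁ := by
    by_contra hne
    refine hp₂D (mem_of_le_of_le hCD.le hDB hp₂ ?_)
    rw [hAC'] at hp₂
    rw [hAB]
    exact Or.inl (hp₂.resolve_right hne)
  obtain ⟨v, k, l, hv, hkl, v1, v2, v3, v4⟩ := exists_path_of_flip hcd m1 m2 m3 m4
  obtain ⟨w, i, j, hw, hij, w1, w2, w3, w4⟩ := exists_path_of_flip hcd' n1 n2 n3 n4
  have hne : c.next ≠ d.next := fun h => by
    have h1 : v k = v l := v1.trans ((congrArg Corner.apex h).trans v3.symm)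
    have := hv.inj _ _ le_rfl hkl.le hkl.le le_rfl h1
    omega
  rw [isMarked_iff] at m3 m4 n1 n2
  have hc' := m3.2.eq_or_eq m4.2 n1.2 hne
  have hd' := m3.2.eq_or_eq m4.2 n2.2 hne
  have other_ne : ∀ c : T.Corner, c.other ≠ c.next.other := fun c =>
    c.next.leftTurn.ne c.next.interior
  rcases hc' with rfl | rfl
  · obtain rfl := hd'.resolve_left hcd'.symm
    obtain ⟨e1, e2⟩ := hv.unique hw (v1.trans w1.symm) (v3.trans w3.symm)
    have := e2 1 (by omega) (by omega)
    rw [v2, w2] at this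
    exact other_ne c this
  · obtain rfl := hd'.resolve_right hcd'.symm
    obtain ⟨e1, e2⟩ := hv.unique hw.rev (by simpa [PlaneTree.rev] using v1.trans w3.symm)
      (by simpa [PlaneTree.rev] using v3.trans w1.symm)
    have := e2 (l - k - 1) (by omega) (by omega)
    simp only [PlaneTree.rev] at this
    rw [show k + (l - k - 1) = l - 1 by ring, show -(-j + (l - k - 1)) = i + 1 by omega, v4, w2] at this
    exact other_ne d this

theorem covBy_iff_flip {A B : T.FG} : A ⋖ B ↔ T.Flip A B := ⟨flip_of_covBy, covBy_of_flip⟩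

theorem le_iff_reflTransGen_flip {A B : T.FG} : A ≤ B ↔ Relation.ReflTransGen T.Flip A B := by
  have : Fintype T.FG := Fintype.ofFinite _
  classical
  have : LocallyFiniteOrder T.FG := Fintype.toLocallyFiniteOrder
  rw [le_iff_reflTransGen_covBy]
  have h : (fun A B : T.FG => A ⋖ B) = T.Flip := by
    ext A B
    exact covBy_iff_flip
  exact iff_of_eq (congrArg (fun r => Relation.ReflTransGen r A B) h)

end FG

theorem Bic.isCongruenceUniform : IsCongruenceUniform T.Bic :=
  isCongruenceUniform_of_separates separatesJoinIrreducibles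
    (separatesJoinIrreducibles.map complHom complHom_surjective)

theorem Bic.isPolygonal : IsPolygonal T.Bic :=
  isPolygonal_of_upper upperPolygonal (upperPolygonal.map complHom complHom_surjective)

end FlipCover

end PlaneTree

theorem theorem4p10 {V : Type*} [Finite V] (T : PlaneTree V) :
    -- the arcs defining `η(X)` exist and are unique
    (∀ (X : T.Bic) (c : T.Corner), ∃! p : Set V, T.IsEtaArc X.1 c p) ∧
    -- biclosed sets under inclusion form a lattice
    ∃ instBic : Lattice T.Bic, (∀ X Y : T.Bic, X ≤ Y ↔ X.1 ⊆ Y.1) ∧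
    -- the oriented flip graph is the Hasse diagram of a lattice
    ∃ instFG : Lattice T.FG,
      (∀ A B : T.FG, A ≤ B ↔ Relation.ReflTransGen T.Flip A B) ∧
      (∀ A B : T.FG, A ⋖ B ↔ T.Flip A B) ∧
    -- `Θ` is a lattice congruence
    ∃ Θ : LatticeCon T.Bic, (∀ X Y : T.Bic, Θ.r X Y ↔ T.piDown X.1 = T.piDown Y.1) ∧
    -- `η` is a surjective lattice map whose fibers are the classes of `Θ`
    (∃ η : LatticeHom T.Bic T.FG, (∀ X : T.Bic, (η X).1 = T.etaSet X.1) ∧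
      Function.Surjective η ∧ ∀ X Y : T.Bic, η X = η Y ↔ Θ.r X Y) ∧
    -- `φ` is an injective lattice map whose image is the image of `π_↓`
    (∃ φ : LatticeHom T.FG T.Bic, (∀ A : T.FG, (φ A).1 = T.phiSet A.1) ∧
      Function.Injective φ ∧
      Set.range (fun A : T.FG => (φ A).1) = Set.range (fun X : T.Bic => T.piDown X.1)) ∧
    -- both lattices are congruence-uniform and polygonal
    IsCongruenceUniform T.Bic ∧ IsPolygonal T.Bic ∧
    IsCongruenceUniform T.FG ∧ IsPolygonal T.FG := by
  refine ⟨fun X c => PlaneTree.existsUnique_isEtaArc X.1 c, PlaneTree.instLatticeBic, fun X Y => Iff.rfl,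
    PlaneTree.instLatticeFG, fun A B => PlaneTree.FG.le_iff_reflTransGen_flip,
    fun A B => PlaneTree.FG.covBy_iff_flip, PlaneTree.Bic.theta T, fun X Y => Subtype.ext_iff,
    ⟨PlaneTree.FG.etaHom, fun _ => rfl, PlaneTree.FG.etaHom_surjective,
      fun X Y => PlaneTree.FG.eta_eq_iff⟩,
    ⟨PlaneTree.FG.phiHom, fun _ => rfl, PlaneTree.FG.phi_injective, PlaneTree.FG.range_phi⟩,
    PlaneTree.Bic.isCongruenceUniform, PlaneTree.Bic.isPolygonal,
    PlaneTree.FG.isCongruenceUniform, PlaneTree.FG.isPolygonal⟩
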